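/- Let $(\mathcal M,g)$ be a spacetime, i.e. a connected, Hausdorff, paracompact, orientable four-dimensional $C^3$ manifold with a $C^2$ Lorentzian metric $g$ of signature $(-1,1,1,1)$ and volume form $\eta$, satisfying the vacuum equations $R_{\alpha\beta}=0$, and let $\vec\xi$ be a Killing vector field on it, of class $C^2$. Put $\lambda=-\xi^\alpha\xi_\alpha$, $\mathcal M^+=\{\lambda>0\}$, $\omega_\alpha=\eta_{\alpha\beta\gamma\delta}\xi^\beta\nabla^\gamma\xi^\delta$, $F_{\alpha\beta}=\nabla_\alpha\xi_\beta$, $\mathcal F_{\alpha\beta}=F_{\alpha\beta}+\frac i2\eta_{\alpha\beta\gamma\delta}F^{\gamma\delta}$, $\mathcal F^2=\mathcal F_{\alpha\beta}\mathcal F^{\alpha\beta}$, $\sigma_\mu=2\xi^\alpha\mathcal F_{\alpha\mu}$, $\mathcal C_{\alpha\beta\gamma\delta}=C_{\alpha\beta\gamma\delta}+\frac i2\eta_{\gamma\delta\rho\sigma}C_{\alpha\beta}{}^{\rho\sigma}$ with $C$ the Weyl tensor, $Y_{\mu\nu}=2\xi^\alpha\xi^\beta\mathcal C_{\alpha\mu\beta\nu}$,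 $\gamma_{\mu\nu}=\lambda g_{\mu\nu}+\xi_\mu\xi_\nu$ and, where $\lambda\neq0$, $h_{\mu\nu}=g_{\mu\nu}+\lambda^{-1}\xi_\mu\xi_\nu$. At a point of $\mathcal M^+$ let $U$ be the map that sends a complex symmetric tensor $Z_{\alpha\beta}$ completely orthogonal to $\vec\xi$ to $$U(Z)_{\alpha\beta\gamma}=Z_{\alpha\beta}\sigma_\gamma-Z_{\alpha\gamma}\sigma_\beta-\tfrac12h_{\alpha\beta}\left(Z\sigma_\gamma-\sigma^\mu Z_{\mu\gamma}\right)+\tfrac12h_{\alpha\gamma}\left(Z\sigma_\beta-\sigma^\mu Z_{\mu\beta}\right),\qquad Z=g^{\mu\nu}Z_{\mu\nu}.$$ (a) At every point of $\mathcal M^+$ the tensors $h$, $\sigma\otimes\sigma$, $Y$ and $-\frac12\mathcal F^2h-\frac1{2\lambda}\sigma\otimes\sigma$ are symmetric and completely orthogonal to $\vec\xi$, $Y$ is trace-free, and $U(Z+s_1h+s_2\,\sigma\otimes\sigma)=U(Z)$ for all $Z$ in the domain of $U$ and $s_1,s_2\in\mathbb C$. In particular $-\frac12\mathcal F^2h-\frac1{2\lambda}\sigma\otimes\sigma$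 lies in the kernel of $U$ and $U\left(Y-\frac12\mathcal F^2h-\frac1{2\lambda}\sigma\otimes\sigma\right)=U(Y)$. Moreover $U(Y)$ equals on $\mathcal M^+$ the spacetime Simon tensor $$S_{\alpha\beta\nu}=Y_{\alpha\beta}\sigma_\nu-Y_{\alpha\nu}\sigma_\beta-\tfrac12\gamma_{\alpha\beta}\,\xi^\mu\mathcal C_{\mu\nu\rho\delta}\mathcal F^{\rho\delta}+\tfrac12\gamma_{\alpha\nu}\,\xi^\mu\mathcal C_{\mu\beta\rho\delta}\mathcal F^{\rho\delta}.$$ (b) $S$ is a continuous tensor field on all of $\mathcal M$, whatever the sign of $\lambda$. (c) Suppose that the set $\mathcal N^+$ of the orbits of $\vec\xi$ in $\mathcal M^+$ is a three-dimensional $C^3$ manifold such that the canonical projection $\pi:\mathcal M^+\to\mathcal N^+$ is a $C^3$ submersion. A covariant tensor on $\mathcal M^+$ is the spacetime counterpart of a tensor on $\mathcal N^+$ if it is its pull-back by $\pi$. Then there are a unique function $\lambda$, a unique one-form $\omega_i$ and a unique tensor $\gamma_{ij}$ on $\mathcal N^+$ whose counterparts are $\lambda$, $\omega_\alpha$ and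 $\gamma_{\alpha\beta}$. Let $D$ be the Levi-Civita covariant derivative of $(\mathcal N^+,\gamma)$, $\sigma_j=D_j\lambda-i\omega_j$ and $\hat Z_{ij}=D_j\sigma_i$. The spacetime counterpart of $\hat Z_{ij}$ is $$\hat Z_{\mu\nu}=2\xi^\alpha\xi^\beta\mathcal C_{\alpha\mu\beta\nu}-\tfrac12\mathcal F^2h_{\mu\nu}-\tfrac1{2\lambda}\sigma_\mu\sigma_\nu ,$$ and $S$ is on $\mathcal M^+$ the spacetime counterpart of Simon's tensor $$S_{ijk}=2\left(\sigma_{[k}D_{j]}\sigma_i-u_{[k}\gamma_{j]i}\right),\qquad u_k=\gamma^{ij}\sigma_{[k}D_{j]}\sigma_i .$$ Here the Riemann tensor is $R^\alpha{}_{\beta\gamma\delta}=\partial_\gamma\Gamma^\alpha_{\beta\delta}-\partial_\delta\Gamma^\alpha_{\beta\gamma}+\Gamma^\epsilon_{\beta\delta}\Gamma^\alpha_{\epsilon\gamma}-\Gamma^\epsilon_{\beta\gamma}\Gamma^\alpha_{\epsilon\delta}$ and $R_{\alpha\beta}=R^\gamma{}_{\alpha\gamma\beta}$. -/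

import Mathlib

open scoped Manifold Topology

noncomputable section

namespace KillingSpacetime

/-! ## Tangent vectors, coordinate fields and components -/

/-- The tangent space at `p` of an `n`-manifold (modelled on `ℝⁿ`). Mathlib identifies it with `ℝⁿ` by
means of the preferred chart at `p`. -/
abbrev Tan (n : ℕ) {M : Type*} [TopologicalSpace M] [ChartedSpace (EuclideanSpace ℝ (Fin n)) M]
    (p : M) : Type :=
  TangentSpace 𝓘(ℝ, EuclideanSpace ℝ (Fin n)) p

/-- Covariant tensors of rank two at every point (no regularity is implied). -/
abbrev BilinField (n : ℕ) (M : Type*) [TopologicalSpace M]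
    [ChartedSpace (EuclideanSpace ℝ (Fin n)) M] : Type _ :=
  (p : M) → Tan n p →L[ℝ] Tan n p →L[ℝ] ℝ

section General

variable {n : ℕ} {M : Type*} [TopologicalSpace M] [ChartedSpace (EuclideanSpace ℝ (Fin n)) M]

/-- The `a`-th standard basis vector of `ℝⁿ`. -/
def stdVec (n : ℕ) (a : Fin n) : EuclideanSpace ℝ (Fin n) := EuclideanSpace.single a 1

/-- The coordinate vector `∂_a` at `p` of the preferred chart at `p`. -/
def frame (p : M) (a : Fin n) : Tan n p := stdVec n a

/-- The component `v^a` of a tangent vector `v` at `p` in the basis `frame p`. -/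
def comp {p : M} (v : Tan n p) (a : Fin n) : ℝ := (show EuclideanSpace ℝ (Fin n) from v) a

/-- The coordinate vector field `∂_a` of the preferred chart at `p₀`, as a function of the
coordinates `y` of that chart. -/
def coordVec (p₀ : M) (y : EuclideanSpace ℝ (Fin n)) (a : Fin n) :
    Tan n ((extChartAt 𝓘(ℝ, EuclideanSpace ℝ (Fin n)) p₀).symm y) :=
  mfderiv 𝓘(ℝ, EuclideanSpace ℝ (Fin n)) 𝓘(ℝ, EuclideanSpace ℝ (Fin n))
    (extChartAt 𝓘(ℝ, EuclideanSpace ℝ (Fin n)) p₀).symm y (stdVec n a)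

/-- The coordinates of `p` in the preferred chart at `p`. -/
def coord (p : M) : EuclideanSpace ℝ (Fin n) := extChartAt 𝓘(ℝ, EuclideanSpace ℝ (Fin n)) p p

/-- The partial derivative `∂_a f` at `y`. -/
def pd {F : Type*} [NormedAddCommGroup F] [NormedSpace ℝ F] (a : Fin n)
    (f : EuclideanSpace ℝ (Fin n) → F) (y : EuclideanSpace ℝ (Fin n)) : F :=
  fderiv ℝ f y (stdVec n a)

/-! ## Levi-Civita connection and curvature in charts -/

/-- The matrix `g_{ab}` of a metric in the preferred chart at `p₀`, as a function of the coordinates. -/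
def localMetric (g : BilinField n M) (p₀ : M) (y : EuclideanSpace ℝ (Fin n)) :
    Matrix (Fin n) (Fin n) ℝ :=
  Matrix.of fun a b => g _ (coordVec p₀ y a) (coordVec p₀ y b)

/-- The Christoffel symbols `Γ^c_{ab}` of `g` in the preferred chart at `p₀`. -/
def christoffel (g : BilinField n M) (p₀ : M) (c a b : Fin n) (y : EuclideanSpace ℝ (Fin n)) : ℝ :=
  (1 / 2) * ∑ d, (localMetric g p₀ y)⁻¹ c d *
    (pd a (fun z => localMetric g p₀ z d b) y + pd b (fun z => localMetric g p₀ z d a) y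
      - pd d (fun z => localMetric g p₀ z a b) y)

/-- The components `∇_a θ_b` at `p` (derivative index first) of the Levi-Civita covariant derivative
of a real, complex or vector valued one-form `θ`. -/
def covDeriv {F : Type*} [NormedAddCommGroup F] [NormedSpace ℝ F] (g : BilinField n M)
    (θ : (p : M) → Tan n p →L[ℝ] F) (p : M) (a b : Fin n) : F :=
  pd a (fun y => θ _ (coordVec p y b)) (coord p)
    - ∑ c, christoffel g p c a b (coord p) • θ p (frame p c)

/-- The matrix `g_{ab}` at `p`. -/
def gdn (g : BilinField n M) (p : M) : Matrix (Fin n) (Fin n) ℝ :=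
  Matrix.of fun a b => g p (frame p a) (frame p b)

/-- The inverse matrix `g^{ab}` at `p`. -/
def gup (g : BilinField n M) (p : M) : Matrix (Fin n) (Fin n) ℝ := (gdn g p)⁻¹

/-- The Riemann tensor `R^a_{bcd}` at `p`. -/
def riemannUp (g : BilinField n M) (p : M) (a b c d : Fin n) : ℝ :=
  pd c (christoffel g p a b d) (coord p) - pd d (christoffel g p a b c) (coord p)
    + ∑ e, (christoffel g p e b d (coord p) * christoffel g p a e c (coord p)
      - christoffel g p e b c (coord p) * christoffel g p a e d (coord p))

/-- The Riemann tensor `R_{abcd} = g_{ae} R^e_{bcd}` at `p`. -/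
def riemann (g : BilinField n M) (p : M) (a b c d : Fin n) : ℝ :=
  ∑ e, gdn g p a e * riemannUp g p e b c d

/-- The Ricci tensor `R_{ab} = R^c_{acb}` at `p`. -/
def ricci (g : BilinField n M) (p : M) (a b : Fin n) : ℝ := ∑ c, riemannUp g p c a c b

/-- The curvature scalar at `p`. -/
def scalarCurv (g : BilinField n M) (p : M) : ℝ := ∑ a, ∑ b, gup g p a b * ricci g p a b

/-- `p` and `q` lie on one integral line of the vector field `ξ` (whose integral curves need not be
complete). -/
def SameOrbit (ξ : (p : M) → Tan n p) (p q : M) : Prop :=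
  ∃ (c : ℝ → M) (J : Set ℝ), IsOpen J ∧ J.OrdConnected ∧
    IsMIntegralCurveOn (I := 𝓘(ℝ, EuclideanSpace ℝ (Fin n))) c ξ J ∧
    (∃ s ∈ J, c s = p) ∧ ∃ t ∈ J, c t = q

end General

/-! ## Spacetimes with a Killing vector -/

section Spacetime

variable {M : Type*} [TopologicalSpace M] [ChartedSpace (EuclideanSpace ℝ (Fin 4)) M]

/-- `e` is an orthonormal frame at `p` for a metric of signature `(-1, 1, 1, 1)`. -/
def IsOrthonormalFrame (g : BilinField 4 M) (p : M) (e : Fin 4 → Tan 4 p) : Prop :=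
  ∀ a b, g p (e a) (e b) = if a = b then (if a = 0 then -1 else 1) else 0

/-- `g` is a Lorentzian metric of class `C²`, of signature `(-1, 1, 1, 1)`. -/
structure IsLorentzMetric [IsManifold 𝓘(ℝ, EuclideanSpace ℝ (Fin 4)) 3 M] (g : BilinField 4 M) :
    Prop where
  symm : ∀ (p : M) (u v : Tan 4 p), g p u v = g p v u
  signature : ∀ p : M, ∃ e : Fin 4 → Tan 4 p, IsOrthonormalFrame g p e
  contMDiff : ContMDiff 𝓘(ℝ, EuclideanSpace ℝ (Fin 4))
    (𝓘(ℝ, EuclideanSpace ℝ (Fin 4)).prod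
      𝓘(ℝ, EuclideanSpace ℝ (Fin 4) →L[ℝ] EuclideanSpace ℝ (Fin 4) →L[ℝ] ℝ)) 2
    (fun p => Bundle.TotalSpace.mk'
      (EuclideanSpace ℝ (Fin 4) →L[ℝ] EuclideanSpace ℝ (Fin 4) →L[ℝ] ℝ)
      (E := fun p : M => Tan 4 p →L[ℝ] Tan 4 p →L[ℝ] ℝ) p (g p))

/-- `X` is continuous at `p` as a vector field. -/
def VecContinuousAt [IsManifold 𝓘(ℝ, EuclideanSpace ℝ (Fin 4)) 3 M]
    (X : (p : M) → Tan 4 p) (p : M) : Prop :=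
  ContinuousAt (fun q => (⟨q, X q⟩ : TangentBundle 𝓘(ℝ, EuclideanSpace ℝ (Fin 4)) M)) p

/-- `η` is the volume form of `g` for one of the orientations of the spacetime: a continuous four-form
with values `±1` on orthonormal frames. -/
structure IsVolumeForm [IsManifold 𝓘(ℝ, EuclideanSpace ℝ (Fin 4)) 3 M]
    (g : BilinField 4 M) (η : (p : M) → Tan 4 p [⋀^Fin 4]→ₗ[ℝ] ℝ) : Prop where
  normalized : ∀ (p : M) (e : Fin 4 → Tan 4 p), IsOrthonormalFrame g p e → |η p e| = 1
  continuous : ∀ (p : M) (X : Fin 4 → (q : M) → Tan 4 q), (∀ i, VecContinuousAt (X i) p) →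
    ContinuousAt (fun q => η q (fun i => X i q)) p

/-- The one-form `ξ_α`. -/
def flat (g : BilinField 4 M) (ξ : (p : M) → Tan 4 p) (p : M) : Tan 4 p →L[ℝ] ℝ := g p (ξ p)

/-- The vector field `ξ` is a Killing vector of `g`: `∇_α ξ_β + ∇_β ξ_α = 0`. It is of class `C²`. -/
structure IsKilling [IsManifold 𝓘(ℝ, EuclideanSpace ℝ (Fin 4)) 3 M] (g : BilinField 4 M)
    (ξ : (p : M) → Tan 4 p) : Prop where
  contMDiff : ContMDiff 𝓘(ℝ, EuclideanSpace ℝ (Fin 4)) 𝓘(ℝ, EuclideanSpace ℝ (Fin 4)).tangent 2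
    (fun p => (⟨p, ξ p⟩ : TangentBundle 𝓘(ℝ, EuclideanSpace ℝ (Fin 4)) M))
  killing : ∀ (p : M) (a b : Fin 4), covDeriv g (flat g ξ) p a b + covDeriv g (flat g ξ) p b a = 0

variable (g : BilinField 4 M) (η : (p : M) → Tan 4 p [⋀^Fin 4]→ₗ[ℝ] ℝ) (ξ : (p : M) → Tan 4 p)

/-- The components `ξ_a`. -/
def xiDn (p : M) (a : Fin 4) : ℝ := flat g ξ p (frame p a)

/-- The norm `λ = - ξ^a ξ_a`. -/
def lam (p : M) : ℝ := - g p (ξ p) (ξ p)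

/-- The region `M⁺` in which `ξ` is timelike. -/
def timelikeRegion : Set M := {p | 0 < lam g ξ p}

/-- The components `η_{abcd}` of the volume form. -/
def vol (p : M) (a b c d : Fin 4) : ℝ := η p ![frame p a, frame p b, frame p c, frame p d]

/-- The two-form `F_{ab} = ∇_a ξ_b`. -/
def killF (p : M) (a b : Fin 4) : ℝ := covDeriv g (flat g ξ) p a b

/-- Both indices of a rank-two tensor raised: `T^{ab} = g^{ac} g^{bd} T_{cd}`. -/
def raise₂ {𝕜 : Type*} [NormedField 𝕜] [NormedAlgebra ℝ 𝕜] (p : M) (T : Fin 4 → Fin 4 → 𝕜)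
    (a b : Fin 4) : 𝕜 :=
  ∑ c, ∑ d, (gup g p a c * gup g p b d) • T c d

/-- The Hodge dual of a two-form, `B^⋆_{ab} = ½ η_{abcd} B^{cd}`. -/
def hodge (p : M) (B : Fin 4 → Fin 4 → ℝ) (a b : Fin 4) : ℝ :=
  (1 / 2) * ∑ c, ∑ d, vol η p a b c d * raise₂ g p B c d

/-- The Killing form `𝓕_{ab} = F_{ab} + i F^⋆_{ab}`. -/
def killingForm (p : M) (a b : Fin 4) : ℂ :=
  (killF g ξ p a b : ℂ) + Complex.I * (hodge g η p (killF g ξ p) a b : ℂ)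

/-- The square `𝓕² = 𝓕_{ab} 𝓕^{ab}`. -/
def formSq (p : M) : ℂ :=
  ∑ a, ∑ b, killingForm g η ξ p a b * raise₂ g p (killingForm g η ξ p) a b

/-- The twist `ω_a = η_{abcd} ξ^b ∇^c ξ^d`. -/
def twist (p : M) (a : Fin 4) : ℝ :=
  ∑ b, ∑ c, ∑ d, vol η p a b c d * comp (ξ p) b * raise₂ g p (killF g ξ p) c d

/-- The Ernst one-form `σ_a = 2 ξ^b 𝓕_{ba}`. -/
def ernst (p : M) (a : Fin 4) : ℂ := 2 * ∑ b, (comp (ξ p) b : ℂ) * killingForm g η ξ p b a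

/-- The Weyl tensor `C_{abcd}`. -/
def weyl (p : M) (a b c d : Fin 4) : ℝ :=
  riemann g p a b c d
    - (1 / 2) * (gdn g p a c * ricci g p b d - gdn g p a d * ricci g p b c
      - gdn g p b c * ricci g p a d + gdn g p b d * ricci g p a c)
    + (scalarCurv g p / 6) * (gdn g p a c * gdn g p b d - gdn g p a d * gdn g p b c)

/-- The right self-dual Weyl tensor `𝓒_{abcd} = C_{abcd} + (i/2) η_{cdrs} C_{ab}^{rs}`. -/
def sdWeyl (p : M) (a b c d : Fin 4) : ℂ :=
  (weyl g p a b c d : ℂ) + Complex.I * (hodge g η p (weyl g p a b) c d : ℂ)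

/-- The tensor `h_{ab} = g_{ab} + λ⁻¹ ξ_a ξ_b` (meaningful where `λ ≠ 0`). -/
def projMetric (p : M) (a b : Fin 4) : ℝ :=
  gdn g p a b + (lam g ξ p)⁻¹ * xiDn g ξ p a * xiDn g ξ p b

/-- The tensor `γ_{ab} = λ g_{ab} + ξ_a ξ_b`, which is `λ h_{ab}` where `λ ≠ 0`. -/
def gammaMetric (p : M) (a b : Fin 4) : ℝ :=
  lam g ξ p * gdn g p a b + xiDn g ξ p a * xiDn g ξ p b

/-- The tensor `Y_{ab} = 2 ξ^c ξ^d 𝓒_{cadb}`. -/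
def tensorY (p : M) (a b : Fin 4) : ℂ :=
  2 * ∑ c, ∑ d, (comp (ξ p) c : ℂ) * (comp (ξ p) d : ℂ) * sdWeyl g η p c a d b

/-- The part `- ½ 𝓕² h_{ab} - (1 / (2 λ)) σ_a σ_b`, singular where `λ` tends to zero. -/
def singularPart (p : M) (a b : Fin 4) : ℂ :=
  - (1 / 2) * formSq g η ξ p * (projMetric g ξ p a b : ℂ)
    - 1 / (2 * (lam g ξ p : ℂ)) * ernst g η ξ p a * ernst g η ξ p b

/-- The trace `g^{ab} Z_{ab}`. -/
def trace (p : M) (Z : Fin 4 → Fin 4 → ℂ) : ℂ := ∑ a, ∑ b, (gup g p a b : ℂ) * Z a b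

/-- The contraction `σ^m Z_{mc}`. -/
def sigmaContr (p : M) (Z : Fin 4 → Fin 4 → ℂ) (c : Fin 4) : ℂ :=
  ∑ m, ∑ k, (gup g p m k : ℂ) * ernst g η ξ p k * Z m c

/-- The domain of the map `U` at `p`: complex symmetric tensors `Z_{ab}` that are completely orthogonal
to `ξ`. -/
def SymOrth (p : M) (Z : Fin 4 → Fin 4 → ℂ) : Prop :=
  (∀ a b, Z a b = Z b a) ∧ ∀ b, ∑ a, (comp (ξ p) a : ℂ) * Z a b = 0

/-- The linear map
`U(Z)_{abc} = Z_{ab} σ_c - Z_{ac} σ_b - ½ h_{ab} (Z σ_c - σ^m Z_{mc}) + ½ h_{ac} (Z σ_b - σ^m Z_{mb})`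
at a point where `λ > 0`. -/
def mapU (p : M) (Z : Fin 4 → Fin 4 → ℂ) (a b c : Fin 4) : ℂ :=
  Z a b * ernst g η ξ p c - Z a c * ernst g η ξ p b
    - (1 / 2) * (projMetric g ξ p a b : ℂ)
      * (trace g p Z * ernst g η ξ p c - sigmaContr g η ξ p Z c)
    + (1 / 2) * (projMetric g ξ p a c : ℂ)
      * (trace g p Z * ernst g η ξ p b - sigmaContr g η ξ p Z b)

/-- The one-form `ξ^m 𝓒_{mcrd} 𝓕^{rd}`. -/
def weylContr (p : M) (c : Fin 4) : ℂ :=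
  ∑ m, ∑ r, ∑ d, (comp (ξ p) m : ℂ) * sdWeyl g η p m c r d
    * raise₂ g p (killingForm g η ξ p) r d

/-- The spacetime Simon tensor, defined at every point of the spacetime whatever the sign of `λ`:
`S_{abc} = Y_{ab} σ_c - Y_{ac} σ_b - ½ γ_{ab} ξ^m 𝓒_{mcrd} 𝓕^{rd} + ½ γ_{ac} ξ^m 𝓒_{mbrd} 𝓕^{rd}`. -/
def spacetimeSimon (p : M) (a b c : Fin 4) : ℂ :=
  tensorY g η ξ p a b * ernst g η ξ p c - tensorY g η ξ p a c * ernst g η ξ p b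
    - (1 / 2) * (gammaMetric g ξ p a b : ℂ) * weylContr g η ξ p c
    + (1 / 2) * (gammaMetric g ξ p a c : ℂ) * weylContr g η ξ p b

/-- A rank-three tensor field, given at every point by its components in the basis `frame p`, is a
continuous tensor field: it takes vector fields that are continuous at a point to functions that are
continuous there. -/
def IsContinuousTensor₃ [IsManifold 𝓘(ℝ, EuclideanSpace ℝ (Fin 4)) 3 M]
    (S : M → Fin 4 → Fin 4 → Fin 4 → ℂ) : Prop :=
  ∀ (p : M) (X Y Z : (q : M) → Tan 4 q),
    VecContinuousAt X p → VecContinuousAt Y p → VecContinuousAt Z p →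
    ContinuousAt (fun q => ∑ a, ∑ b, ∑ c,
      S q a b c * (comp (X q) a : ℂ) * (comp (Y q) b : ℂ) * (comp (Z q) c : ℂ)) p

/-! ## The manifold of trajectories -/

variable {N : Type*} [TopologicalSpace N] [ChartedSpace (EuclideanSpace ℝ (Fin 3)) N]

/-- The differential of `π : M → N` at `p`. -/
def dproj (π : M → N) (p : M) : Tan 4 p →L[ℝ] Tan 3 (π p) :=
  mfderiv 𝓘(ℝ, EuclideanSpace ℝ (Fin 4)) 𝓘(ℝ, EuclideanSpace ℝ (Fin 3)) π p

/-- The three-manifold `N`, together with `π`, is the manifold of trajectories `M⁺/≈` of `ξ` in the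
timelike region: `π` maps `M⁺` onto `N` as a submersion of class `C³`, and its fibres are the orbits.
Only the values of `π` on `M⁺` matter. -/
structure IsTrajectoryManifold (π : M → N) : Prop where
  contMDiffOn : ContMDiffOn 𝓘(ℝ, EuclideanSpace ℝ (Fin 4)) 𝓘(ℝ, EuclideanSpace ℝ (Fin 3)) 3 π
    (timelikeRegion g ξ)
  surjective : ∀ x : N, ∃ p ∈ timelikeRegion g ξ, π p = x
  submersion : ∀ p ∈ timelikeRegion g ξ, Function.Surjective (dproj π p)
  fibre : ∀ p ∈ timelikeRegion g ξ, ∀ q ∈ timelikeRegion g ξ, π p = π q ↔ SameOrbit ξ p q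

/-- The function `f` on `N` corresponds to the function `T` on `M⁺`. -/
def Corr₀ (π : M → N) (f : N → ℝ) (T : M → ℝ) : Prop :=
  ∀ p ∈ timelikeRegion g ξ, f (π p) = T p

/-- The one-form `ω` on `N` corresponds to the one-form on `M⁺` with components `T_a`. -/
def Corr₁ (π : M → N) (ω : (x : N) → Tan 3 x →L[ℝ] ℝ) (T : M → Fin 4 → ℝ) : Prop :=
  ∀ p ∈ timelikeRegion g ξ, ∀ a, ω (π p) (dproj π p (frame p a)) = T p a

/-- The tensor `t` on `N` corresponds to the tensor on `M⁺` with components `T_{ab}`. -/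
def Corr₂ (π : M → N) (t : BilinField 3 N) (T : M → Fin 4 → Fin 4 → ℝ) : Prop :=
  ∀ p ∈ timelikeRegion g ξ, ∀ a b,
    t (π p) (dproj π p (frame p a)) (dproj π p (frame p b)) = T p a b

/-- The entries `∂π^i/∂x^a` of the Jacobian matrix of `π` at `p`. -/
def jac (π : M → N) (p : M) (i : Fin 3) (a : Fin 4) : ℝ := comp (dproj π p (frame p a)) i

/-- The spacetime counterpart (pull-back by `π`) of a complex rank-two tensor on `N` that is given by
its components. -/
def counterpart₂ (π : M → N) (t : N → Fin 3 → Fin 3 → ℂ) (p : M) (a b : Fin 4) : ℂ :=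
  ∑ i, ∑ j, t (π p) i j * (jac π p i a : ℂ) * (jac π p j b : ℂ)

/-- The spacetime counterpart (pull-back by `π`) of a complex rank-three tensor on `N` that is given by
its components. -/
def counterpart₃ (π : M → N) (t : N → Fin 3 → Fin 3 → Fin 3 → ℂ) (p : M) (a b c : Fin 4) : ℂ :=
  ∑ i, ∑ j, ∑ k, t (π p) i j k * (jac π p i a : ℂ) * (jac π p j b : ℂ) * (jac π p k c : ℂ)

end Spacetime

/-! ## Simon's tensor -/

section Simon

variable {N : Type*} [TopologicalSpace N] [ChartedSpace (EuclideanSpace ℝ (Fin 3)) N]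
  (γ : BilinField 3 N) (l : N → ℝ) (ω : (x : N) → Tan 3 x →L[ℝ] ℝ)

/-- The complex one-form `σ_j = D_j λ - i ω_j`. -/
def sigmaN (x : N) : Tan 3 x →L[ℝ] ℂ :=
  Complex.ofRealCLM.comp (mvfderiv 𝓘(ℝ, EuclideanSpace ℝ (Fin 3)) l x)
    - Complex.I • Complex.ofRealCLM.comp (ω x)

/-- The tensor `Ẑ_{ij} = D_j σ_i`, where `D` is the Levi-Civita derivative of `γ`. -/
def zHat (x : N) (i j : Fin 3) : ℂ := covDeriv γ (sigmaN l ω) x j i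

/-- The antisymmetrized product `σ_{[k} D_{j]} σ_i`. -/
def sigmaD (x : N) (i j k : Fin 3) : ℂ :=
  (1 / 2) * (sigmaN l ω x (frame x k) * covDeriv γ (sigmaN l ω) x j i
    - sigmaN l ω x (frame x j) * covDeriv γ (sigmaN l ω) x k i)

/-- The one-form `u_k = γ^{ij} σ_{[k} D_{j]} σ_i`. -/
def simonU (x : N) (k : Fin 3) : ℂ := ∑ i, ∑ j, (gup γ x i j : ℂ) * sigmaD γ l ω x i j k

/-- Simon's tensor `S_{ijk} = 2 (σ_{[k} D_{j]} σ_i - u_{[k} γ_{j]i})`. -/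
def simon (x : N) (i j k : Fin 3) : ℂ :=
  2 * (sigmaD γ l ω x i j k
    - (1 / 2) * (simonU γ l ω x k * (gdn γ x j i : ℂ) - simonU γ l ω x j * (gdn γ x k i : ℂ)))

end Simon

end KillingSpacetime

end

open KillingSpacetime

/-! Pointwise algebra where λ > 0. In vacuum the Weyl tensor is the Riemann tensor, so `Y` and the
contraction `ξ^m 𝓒_{mcrd} 𝓕^{rd}` depend on the curvature only through `P_{bcd} = ξ^a R_{abcd}`. In
an orthonormal frame with ξ = √λ e₀ a self-dual two-form is determined by its electric three-vector
(`sdF_levi`). If f is the vector of 𝓕 and k^c that of the self-dual part of P_c, then σ = 2√λ f,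
Y_{cm} = 2√λ k^c_m, and the contraction is −4 k^c·f (`pairing_sdTable`). The symmetries of the
Riemann tensor and Ricci = 0 make Y symmetric, trace-free and orthogonal to ξ, and comparison of the
two expressions gives λ ξ^m 𝓒_{mcrd} 𝓕^{rd} = −σ^m Y_{mc} (`lam_mul_weylContr`). Since tr h = 3 and
σ^m h_{mc} = σ_c, the map U annihilates h and σ ⊗ σ (`mapU_add`). With γ = λh this yields U(Y) = S
(`mapU_tensorY`).

Regularity. The formula for S contains no negative power of λ. In a coordinate frame its ingredients
are polynomials in g, g⁻¹, η, ξ, F = ∇ξ and ∇F. The last of these is the curvature contraction,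
because a Killing field satisfies ∇_w F(u, v) = ⟨ξ, R(u, v) w⟩ (`nabla2_killing`). All are
continuous for a C² metric and a C² Killing field (`isContinuousTensor₃_spacetimeSimon`).

Descent to the orbits. The form σ = dλ − iω and the tensor γ vanish on ξ and have zero Lie
derivative along ξ (`lie_ernstForm`, `lie_gammaForm`). For σ this rests on ∇_b σ_a = 2 (∇_b ξ^c)
𝓕_{ca} + Y_{ba} (`nablaForm_ernstForm`), which uses that g and η are parallel, and on the fact that
F commutes with its dual. Evaluated on lifts of a fixed vector of N, such tensors are constant along
an orbit, so they come from unique tensors on N (`IsTrajectoryManifold.apply_eq_of_invariant`).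
Local sections of π show that the quotient metric is C² and that σ is differentiable on N.

The Hessian. Christoffel symbols of the first kind can be pulled back along a submersion, not only
along a diffeomorphism (`chris1_pullback`). Hence the counterpart of Dσ is ∇σ minus σ applied to the
difference X of the two connections. The vector X is determined modulo ξ by γ(X, ·), which is the
Koszul combination of ∇γ, and the ambiguity is harmless as σ(ξ) = 0
(`IsTrajectoryManifold.exists_nablaForm_sigmaN`). In the adapted frame X is quadratic in ξ and F,
and the formula for Ẑ becomes a polynomial identity between electric and magnetic parts
(`hessian_frame`). So Ẑ is Y plus the singular part.

Simon's tensor. The inverse of the quotient metric is λ⁻¹ times the push-forward of g⁻¹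
(`IsTrajectoryManifold.gup_eq`). Therefore the pull-back of Simon's tensor is U(Ẑ), and U(Ẑ) = U(Y)
= S because the singular part lies in the kernel. -/

noncomputable section

set_option maxSynthPendingDepth 3
set_option linter.unusedSectionVars false

namespace KillingSpacetime

/-! ### Connections, curvature and Killing forms on open sets of a normed space -/

section Calculus

open Filter

variable {E E' F : Type*} [NormedAddCommGroup E] [NormedSpace ℝ E] [NormedAddCommGroup E']
  [NormedSpace ℝ E'] [NormedAddCommGroup F] [NormedSpace ℝ F]

theorem symm_snd_fderiv {f : E → F} {y : E} (hf : ContDiffAt ℝ 2 f y) (u v : E) :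
    fderiv ℝ (fderiv ℝ f) y u v = fderiv ℝ (fderiv ℝ f) y v u :=
  (hf.isSymmSndFDerivAt (by simp)).eq u v

theorem differentiableAt_fderiv {f : E → F} {y : E} (hf : ContDiffAt ℝ 2 f y) :
    DifferentiableAt ℝ (fderiv ℝ f) y :=
  (hf.fderiv_right (m := 1) (by norm_num)).differentiableAt (by norm_num)

/-- The derivative of a pulled back one-form. -/
theorem fderiv_pullback_one {θ : E → E →L[ℝ] F} {θ' : E' → E' →L[ℝ] F} {φ : E → E'} {y : E}
    (hφ : ContDiffAt ℝ 2 φ y) (hθ' : DifferentiableAt ℝ θ' (φ y))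
    (h : ∀ᶠ z in 𝓝 y, θ z = (θ' (φ z)).comp (fderiv ℝ φ z)) (u v : E) :
    fderiv ℝ θ y u v = fderiv ℝ θ' (φ y) (fderiv ℝ φ y u) (fderiv ℝ φ y v)
      + θ' (φ y) (fderiv ℝ (fderiv ℝ φ) y u v) := by
  have hd : HasFDerivAt φ (fderiv ℝ φ y) y := (hφ.differentiableAt (by norm_num)).hasFDerivAt
  have h2 := (differentiableAt_fderiv hφ).hasFDerivAt
  have h1 := (hθ'.hasFDerivAt.comp y hd).clm_comp h2
  have h3 : θ =ᶠ[𝓝 y] fun z => ((θ' ∘ φ) z).comp (fderiv ℝ φ z) := h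
  rw [h3.fderiv_eq, h1.fderiv]
  simp [add_comm]

/-- The derivative of a pulled back bilinear form. -/
theorem fderiv_pullback_two {G : E → E →L[ℝ] E →L[ℝ] F} {G' : E' → E' →L[ℝ] E' →L[ℝ] F}
    {φ : E → E'} {y : E}
    (hφ : ContDiffAt ℝ 2 φ y) (hG' : DifferentiableAt ℝ G' (φ y)) (hG : DifferentiableAt ℝ G y)
    (h : ∀ᶠ z in 𝓝 y, ∀ v w, G z v w = G' (φ z) (fderiv ℝ φ z v) (fderiv ℝ φ z w)) (u v w : E) :
    fderiv ℝ G y u v w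
      = fderiv ℝ G' (φ y) (fderiv ℝ φ y u) (fderiv ℝ φ y v) (fderiv ℝ φ y w)
      + G' (φ y) (fderiv ℝ (fderiv ℝ φ) y u v) (fderiv ℝ φ y w)
      + G' (φ y) (fderiv ℝ φ y v) (fderiv ℝ (fderiv ℝ φ) y u w) := by
  have hd : HasFDerivAt φ (fderiv ℝ φ y) y := (hφ.differentiableAt (by norm_num)).hasFDerivAt
  have h2 := (differentiableAt_fderiv hφ).hasFDerivAt
  have hv : ∀ v, HasFDerivAt (fun z => fderiv ℝ φ z v)
      ((fderiv ℝ (fderiv ℝ φ) y).flip v) y := fun v => by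
    simpa using! h2.clm_apply (hasFDerivAt_const v y)
  have h0 : HasFDerivAt (fun z => G' (φ z)) ((fderiv ℝ G' (φ y)).comp (fderiv ℝ φ y)) y :=
    hG'.hasFDerivAt.comp y hd
  have h1 := (h0.clm_apply (hv v)).clm_apply (hv w)
  have h3 : (fun z => G z v w) =ᶠ[𝓝 y]
      fun z => G' (φ z) (fderiv ℝ φ z v) (fderiv ℝ φ z w) := h.mono fun z hz => hz v w
  have h4 : HasFDerivAt (fun z => G z v w) (((fderiv ℝ G y).flip v).flip w) y := by
    simpa using! (hG.hasFDerivAt.clm_apply (hasFDerivAt_const v y)).clm_apply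
      (hasFDerivAt_const w y)
  have h5 := congrArg (fun L => L u) (h4.unique (h1.congr_of_eventuallyEq h3))
  simp only [ContinuousLinearMap.flip_apply] at h5
  rw [h5]
  simp
  abel

/-- The Christoffel symbols of the first kind, `½ (∂_u G(v,w) + ∂_v G(u,w) - ∂_w G(u,v))`. -/
def chris1 (G : E → E →L[ℝ] E →L[ℝ] ℝ) (y u v w : E) : ℝ :=
  (1 / 2) * (fderiv ℝ G y u v w + fderiv ℝ G y v u w - fderiv ℝ G y w u v)

/-- Six terms contain a second derivative of `φ`; by the symmetry of `D²φ` and of `G'` four of them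
cancel and the other two coincide. Injectivity of `Dφ` plays no role, so the formula serves chart
transitions and also the projection to the space of orbits, where the pulled back form is
degenerate. -/
theorem chris1_pullback {G : E → E →L[ℝ] E →L[ℝ] ℝ} {G' : E' → E' →L[ℝ] E' →L[ℝ] ℝ}
    {φ : E → E'} {y : E}
    (hφ : ContDiffAt ℝ 2 φ y) (hG' : DifferentiableAt ℝ G' (φ y)) (hG : DifferentiableAt ℝ G y)
    (hs : ∀ v w, G' (φ y) v w = G' (φ y) w v)
    (h : ∀ᶠ z in 𝓝 y, ∀ v w, G z v w = G' (φ z) (fderiv ℝ φ z v) (fderiv ℝ φ z w)) (u v w : E) :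
    chris1 G y u v w = chris1 G' (φ y) (fderiv ℝ φ y u) (fderiv ℝ φ y v) (fderiv ℝ φ y w)
      + G' (φ y) (fderiv ℝ (fderiv ℝ φ) y u v) (fderiv ℝ φ y w) := by
  simp only [chris1, fderiv_pullback_two hφ hG' hG h]
  rw [symm_snd_fderiv hφ v u, symm_snd_fderiv hφ w u, symm_snd_fderiv hφ w v,
    hs (fderiv ℝ φ y u) (fderiv ℝ (fderiv ℝ φ) y v w),
    hs (fderiv ℝ φ y v) (fderiv ℝ (fderiv ℝ φ) y u w)]
  ring

/-- `Γ` is the Levi-Civita connection of `G` at `y`. -/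
def IsConn (G : E → E →L[ℝ] E →L[ℝ] ℝ) (Γ : E → E →L[ℝ] E →L[ℝ] E) (y : E) : Prop :=
  ∀ u v w, G y (Γ y u v) w = chris1 G y u v w

/-- Both sides are tested against `Dφ w`; these are all vectors because `Dφ` is onto, and `G'` is
nondegenerate. This is the inhomogeneous transformation law that makes covariant derivatives
tensorial. -/
theorem IsConn.pullback {G : E → E →L[ℝ] E →L[ℝ] ℝ} {G' : E' → E' →L[ℝ] E' →L[ℝ] ℝ}
    {Γ : E → E →L[ℝ] E →L[ℝ] E} {Γ' : E' → E' →L[ℝ] E' →L[ℝ] E'}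
    {φ : E → E'} {y : E} (hΓ : IsConn G Γ y) (hΓ' : IsConn G' Γ' (φ y))
    (hφ : ContDiffAt ℝ 2 φ y) (hG' : DifferentiableAt ℝ G' (φ y)) (hG : DifferentiableAt ℝ G y)
    (hs : ∀ v w, G' (φ y) v w = G' (φ y) w v) (hnd : ∀ v, (∀ w, G' (φ y) v w = 0) → v = 0)
    (hsurj : Function.Surjective (fderiv ℝ φ y))
    (h : ∀ᶠ z in 𝓝 y, ∀ v w, G z v w = G' (φ z) (fderiv ℝ φ z v) (fderiv ℝ φ z w)) (u v : E) :
    fderiv ℝ φ y (Γ y u v)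
      = fderiv ℝ (fderiv ℝ φ) y u v + Γ' (φ y) (fderiv ℝ φ y u) (fderiv ℝ φ y v) := by
  rw [← sub_eq_zero]
  refine hnd _ fun w => ?_
  obtain ⟨w, rfl⟩ := hsurj w
  simp only [map_sub, map_add, sub_apply, add_apply]
  rw [hΓ', ← h.self_of_nhds, hΓ, chris1_pullback hφ hG' hG hs h]
  ring

/-- The covariant derivative `(∇_u θ)(v)` of a one-form. -/
def nabla1 (Γ : E → E →L[ℝ] E →L[ℝ] E) (θ : E → E →L[ℝ] F) (y u v : E) : F :=
  fderiv ℝ θ y u v - θ y (Γ y u v)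

/-- The covariant derivative `(∇_u B)(v, w)` of a bilinear form. -/
def nabla2 (Γ : E → E →L[ℝ] E →L[ℝ] E) (B : E → E →L[ℝ] E →L[ℝ] F) (y u v w : E) : F :=
  fderiv ℝ B y u v w - B y (Γ y u v) w - B y v (Γ y u w)

/-- The term with `D²φ` that comes from differentiating the pull-back cancels the inhomogeneous term
in the transformation law of the connection. -/
theorem nabla1_pullback {Γ : E → E →L[ℝ] E →L[ℝ] E} {Γ' : E' → E' →L[ℝ] E' →L[ℝ] E'}
    {θ : E → E →L[ℝ] F} {θ' : E' → E' →L[ℝ] F} {φ : E → E'} {y : E}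
    (hφ : ContDiffAt ℝ 2 φ y)
    (hΓ : ∀ u v, fderiv ℝ φ y (Γ y u v)
      = fderiv ℝ (fderiv ℝ φ) y u v + Γ' (φ y) (fderiv ℝ φ y u) (fderiv ℝ φ y v))
    (hθ' : DifferentiableAt ℝ θ' (φ y))
    (h : ∀ᶠ z in 𝓝 y, θ z = (θ' (φ z)).comp (fderiv ℝ φ z)) (u v : E) :
    nabla1 Γ θ y u v = nabla1 Γ' θ' (φ y) (fderiv ℝ φ y u) (fderiv ℝ φ y v) := by
  simp only [nabla1, fderiv_pullback_one hφ hθ' h, h.self_of_nhds, ContinuousLinearMap.comp_apply,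
    hΓ, map_add]
  abel

theorem nabla2_pullback {Γ : E → E →L[ℝ] E →L[ℝ] E} {Γ' : E' → E' →L[ℝ] E' →L[ℝ] E'}
    {B : E → E →L[ℝ] E →L[ℝ] F} {B' : E' → E' →L[ℝ] E' →L[ℝ] F} {φ : E → E'} {y : E}
    (hφ : ContDiffAt ℝ 2 φ y)
    (hΓ : ∀ u v, fderiv ℝ φ y (Γ y u v)
      = fderiv ℝ (fderiv ℝ φ) y u v + Γ' (φ y) (fderiv ℝ φ y u) (fderiv ℝ φ y v))
    (hB' : DifferentiableAt ℝ B' (φ y)) (hB : DifferentiableAt ℝ B y)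
    (h : ∀ᶠ z in 𝓝 y, ∀ v w, B z v w = B' (φ z) (fderiv ℝ φ z v) (fderiv ℝ φ z w)) (u v w : E) :
    nabla2 Γ B y u v w
      = nabla2 Γ' B' (φ y) (fderiv ℝ φ y u) (fderiv ℝ φ y v) (fderiv ℝ φ y w) := by
  simp only [nabla2, fderiv_pullback_two hφ hB' hB h, h.self_of_nhds,
    hΓ, map_add, add_apply]
  abel

/-- The curvature operator `R(u, v) w` of a connection. -/
def curv (Γ : E → E →L[ℝ] E →L[ℝ] E) (y u v w : E) : E :=
  fderiv ℝ Γ y u v w - fderiv ℝ Γ y v u w + Γ y u (Γ y v w) - Γ y v (Γ y u w)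

theorem chris1_add_swap {G : E → E →L[ℝ] E →L[ℝ] ℝ} {y : E}
    (hs : ∀ u v w, fderiv ℝ G y u v w = fderiv ℝ G y u w v) (u v w : E) :
    chris1 G y u v w + chris1 G y u w v = fderiv ℝ G y u v w := by
  simp only [chris1]
  linarith [hs w v u, hs u w v, hs v w u]

theorem fderiv_symm {G : E → E →L[ℝ] E →L[ℝ] ℝ} {y : E}
    (hs : ∀ᶠ z in 𝓝 y, ∀ v w, G z v w = G z w v) (hG : DifferentiableAt ℝ G y) (u v w : E) :
    fderiv ℝ G y u v w = fderiv ℝ G y u w v := by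
  have h4 : ∀ v w, HasFDerivAt (fun z => G z v w) (((fderiv ℝ G y).flip v).flip w) y :=
    fun v w => by
    simpa using! (hG.hasFDerivAt.clm_apply (hasFDerivAt_const v y)).clm_apply
      (hasFDerivAt_const w y)
  have h : (fun z => G z v w) =ᶠ[𝓝 y] fun z => G z w v := hs.mono fun z hz => hz v w
  have := congrArg (fun L => L u) ((h4 v w).unique ((h4 w v).congr_of_eventuallyEq h))
  simpa using this

variable {G : E → E →L[ℝ] E →L[ℝ] ℝ} {Γ : E → E →L[ℝ] E →L[ℝ] E} {y : E}

/-- Metricity: in the sum of the two Koszul expressions with the last arguments exchanged, only the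
derivative in the direction `u` survives. -/
theorem IsConn.compat (hΓ : IsConn G Γ y) (hs : ∀ᶠ z in 𝓝 y, ∀ v w, G z v w = G z w v)
    (hG : DifferentiableAt ℝ G y) (u v w : E) :
    fderiv ℝ G y u v w = G y (Γ y u v) w + G y v (Γ y u w) := by
  rw [hs.self_of_nhds v, hΓ, hΓ, chris1_add_swap (fderiv_symm hs hG)]

/-- Differentiating the metricity identity once more expresses `D²G` through the connection. The
antisymmetric part of this expression is the asserted sum, and it vanishes since second derivatives
of the C² form `G` commute. -/
theorem curv_antisymm (hG : ContDiffAt ℝ 2 G y) (hΓd : DifferentiableAt ℝ Γ y)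
    (hs : ∀ᶠ z in 𝓝 y, ∀ v w, G z v w = G z w v) (hΓ : ∀ᶠ z in 𝓝 y, IsConn G Γ z)
    (u v a b : E) : G y (curv Γ y u v a) b + G y a (curv Γ y u v b) = 0 := by
  have hGd : DifferentiableAt ℝ G y := hG.differentiableAt (by norm_num)
  have hGe : ∀ᶠ z in 𝓝 y, DifferentiableAt ℝ G z :=
    (hG.eventually (by simp)).mono fun z hz => hz.differentiableAt (by norm_num)
  have hcompat : ∀ᶠ z in 𝓝 y, ∀ u v w, fderiv ℝ G z u v w = G z (Γ z u v) w + G z v (Γ z u w) := by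
    filter_upwards [hGe, hs.eventually_nhds, hΓ] with z h1 h2 h3 using h3.compat h2 h1
  have hΓv : ∀ u v, HasFDerivAt (fun z => Γ z u v) (((fderiv ℝ Γ y).flip u).flip v) y :=
    fun u v => by
    simpa using! (hΓd.hasFDerivAt.clm_apply (hasFDerivAt_const u y)).clm_apply
      (hasFDerivAt_const v y)
  have h2 := (differentiableAt_fderiv hG).hasFDerivAt
  have hL : ∀ u v w, HasFDerivAt (fun z => fderiv ℝ G z u v w)
      ((((fderiv ℝ (fderiv ℝ G) y).flip u).flip v).flip w) y := fun u v w => by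
    simpa using! ((h2.clm_apply (hasFDerivAt_const u y)).clm_apply
      (hasFDerivAt_const v y)).clm_apply (hasFDerivAt_const w y)
  have key : ∀ c d, fderiv ℝ (fderiv ℝ G) y c d a b
      = fderiv ℝ G y c (Γ y d a) b + G y (fderiv ℝ Γ y c d a) b
      + fderiv ℝ G y c a (Γ y d b) + G y a (fderiv ℝ Γ y c d b) := by
    intro c d
    have hR := ((hGd.hasFDerivAt.clm_apply (hΓv d a)).clm_apply (hasFDerivAt_const b y)).add
      ((hGd.hasFDerivAt.clm_apply (hasFDerivAt_const a y)).clm_apply (hΓv d b))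
    have he : (fun z => fderiv ℝ G z d a b) =ᶠ[𝓝 y]
        fun z => G z (Γ z d a) b + G z a (Γ z d b) := hcompat.mono fun z hz => hz d a b
    have := congrArg (fun L => L c) ((hL d a b).unique (hR.congr_of_eventuallyEq he))
    simp at this
    rw [this]
    abel
  have h := symm_snd_fderiv hG u v
  have h' : fderiv ℝ (fderiv ℝ G) y u v a b = fderiv ℝ (fderiv ℝ G) y v u a b := by rw [h]
  rw [key, key] at h'
  simp only [hcompat.self_of_nhds] at h'
  simp only [curv, map_sub, map_add, sub_apply, add_apply]
  linarith

/-- First Bianchi identity: absence of torsion near `y` passes to the derivative of `Γ`, after which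
the terms of the cyclic sum cancel in pairs. -/
theorem curv_bianchi (hΓd : DifferentiableAt ℝ Γ y)
    (hsym : ∀ᶠ z in 𝓝 y, ∀ u v, Γ z u v = Γ z v u) (u v w : E) :
    curv Γ y u v w + curv Γ y v w u + curv Γ y w u v = 0 := by
  have hΓv : ∀ u v, HasFDerivAt (fun z => Γ z u v) (((fderiv ℝ Γ y).flip u).flip v) y :=
    fun u v => by
    simpa using! (hΓd.hasFDerivAt.clm_apply (hasFDerivAt_const u y)).clm_apply
      (hasFDerivAt_const v y)
  have hd : ∀ c u v, fderiv ℝ Γ y c u v = fderiv ℝ Γ y c v u := by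
    intro c u v
    have h : (fun z => Γ z u v) =ᶠ[𝓝 y] fun z => Γ z v u := hsym.mono fun z hz => hz u v
    have := congrArg (fun L => L c) ((hΓv u v).unique ((hΓv v u).congr_of_eventuallyEq h))
    simpa using this
  have h0 := hsym.self_of_nhds
  simp only [curv]
  rw [hd u w v, hd v u w, hd w v u, h0 w v, h0 u w, h0 v u]
  abel

/-- The identity `∇_w ∇_u θ_v = R(u, v)` for a Killing one-form. -/
theorem nabla2_killing {θ : E → E →L[ℝ] ℝ} {B : E → E →L[ℝ] E →L[ℝ] ℝ}
    (hθ : ContDiffAt ℝ 2 θ y) (hΓd : DifferentiableAt ℝ Γ y) (hBd : DifferentiableAt ℝ B y)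
    (hsym : ∀ᶠ z in 𝓝 y, ∀ u v, Γ z u v = Γ z v u)
    (hB : ∀ᶠ z in 𝓝 y, ∀ u v, B z u v = nabla1 Γ θ z u v)
    (hanti : ∀ᶠ z in 𝓝 y, ∀ u v, B z u v = - B z v u) (u v w : E) :
    nabla2 Γ B y w u v = θ y (curv Γ y u v w) := by
  have hΓv : ∀ u v, HasFDerivAt (fun z => Γ z u v) (((fderiv ℝ Γ y).flip u).flip v) y :=
    fun u v => by
    simpa using! (hΓd.hasFDerivAt.clm_apply (hasFDerivAt_const u y)).clm_apply
      (hasFDerivAt_const v y)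
  have hBv : ∀ u v, HasFDerivAt (fun z => B z u v) (((fderiv ℝ B y).flip u).flip v) y :=
    fun u v => by
    simpa using! (hBd.hasFDerivAt.clm_apply (hasFDerivAt_const u y)).clm_apply
      (hasFDerivAt_const v y)
  have h2 := (differentiableAt_fderiv hθ).hasFDerivAt
  have hθd := (hθ.differentiableAt (by norm_num)).hasFDerivAt
  have hL : ∀ u v, HasFDerivAt (fun z => fderiv ℝ θ z u v)
      (((fderiv ℝ (fderiv ℝ θ) y).flip u).flip v) y := fun u v => by
    simpa using! (h2.clm_apply (hasFDerivAt_const u y)).clm_apply (hasFDerivAt_const v y)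
  have hs := hsym.self_of_nhds
  have ha := hanti.self_of_nhds
  have key : ∀ c a b, fderiv ℝ B y c a b = fderiv ℝ (fderiv ℝ θ) y c a b
      - fderiv ℝ θ y c (Γ y a b) - θ y (fderiv ℝ Γ y c a b) := by
    intro c a b
    have hR := (hL a b).sub (hθd.clm_apply (hΓv a b))
    have he : (fun z => B z a b) =ᶠ[𝓝 y] fun z => fderiv ℝ θ z a b - θ z (Γ z a b) :=
      hB.mono fun z hz => hz a b
    have := congrArg (fun L => L c) ((hBv a b).unique (hR.congr_of_eventuallyEq he))
    simp at this
    rw [this]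
    abel
  have hda : ∀ c a b, fderiv ℝ B y c a b = - fderiv ℝ B y c b a := by
    intro c a b
    have h : (fun z => B z a b) =ᶠ[𝓝 y] fun z => - B z b a := hanti.mono fun z hz => hz a b
    have := congrArg (fun L => L c) ((hBv a b).unique ((hBv b a).neg.congr_of_eventuallyEq h))
    simpa using this
  have hna : ∀ c a b, nabla2 Γ B y c a b = - nabla2 Γ B y c b a := by
    intro c a b
    simp only [nabla2]
    rw [hda c a b, ha (Γ y c a) b, ha a (Γ y c b)]
    ring
  -- The Ricci identity for the one-form `θ`: its commuted second covariant derivatives differ by a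
  -- curvature term, as `Γ` has no torsion.
  have hricci : ∀ c a b, nabla2 Γ B y c a b - nabla2 Γ B y a c b = - θ y (curv Γ y c a b) := by
    intro c a b
    simp only [nabla2, key, curv, map_sub, map_add]
    rw [hB.self_of_nhds a, hB.self_of_nhds c, hs c a, symm_snd_fderiv hθ c a]
    simp only [nabla1]
    ring
  -- The exact form `B`, half of `dθ`, is closed. In the cyclic sum of the Ricci identities the
  -- curvature drops out by Bianchi, and antisymmetry of `B` turns what remains into twice this sum.
  have hcyc : nabla2 Γ B y w u v + nabla2 Γ B y u v w + nabla2 Γ B y v w u = 0 := by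
    have hb := curv_bianchi hΓd hsym u v w
    have h1 := hricci w u v
    have h2 := hricci u v w
    have h3 := hricci v w u
    have e1 := hna u w v
    have e2 := hna v u w
    have e3 := hna w v u
    have e := congrArg (θ y) hb
    simp only [map_add, map_zero] at e
    linarith
  have h1 := hricci u v w
  have e2 := hna v u w
  linarith

end Calculus

/-! ### Tensor fields in preferred charts and change of chart -/

section Charts

open Filter

/-- The model space `ℝⁿ`. -/
abbrev Coords (n : ℕ) : Type := EuclideanSpace ℝ (Fin n)

variable {n m : ℕ} {M : Type*} [TopologicalSpace M] [ChartedSpace (EuclideanSpace ℝ (Fin n)) M]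
  {M' : Type*} [TopologicalSpace M'] [ChartedSpace (EuclideanSpace ℝ (Fin m)) M']
  {F : Type*} [NormedAddCommGroup F] [NormedSpace ℝ F]

/-- The preferred chart at `p`, with values in `ℝⁿ`. -/
abbrev chartC (n : ℕ) {M : Type*} [TopologicalSpace M]
    [ChartedSpace (EuclideanSpace ℝ (Fin n)) M] (p : M) : PartialEquiv M (Coords n) :=
  extChartAt 𝓘(ℝ, EuclideanSpace ℝ (Fin n)) p

/-- The derivative of the inverse of the preferred chart at `p`. -/
def dchart (p : M) (y : Coords n) : Coords n →L[ℝ] Coords n :=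
  mfderiv 𝓘(ℝ, EuclideanSpace ℝ (Fin n)) 𝓘(ℝ, EuclideanSpace ℝ (Fin n)) (chartC n p).symm y

/-- A map between manifolds in the preferred charts at `p` and `x`. -/
def inCharts (n m : ℕ) {M : Type*} [TopologicalSpace M]
    [ChartedSpace (EuclideanSpace ℝ (Fin n)) M] {M' : Type*} [TopologicalSpace M']
    [ChartedSpace (EuclideanSpace ℝ (Fin m)) M'] (p : M) (x : M') (f : M → M') : Coords n → Coords m :=
  fun y => chartC m x (f ((chartC n p).symm y))

/-- A one-form in the preferred chart at `p`. -/
def pull1 (θ : M → Coords n →L[ℝ] F) (p : M) (y : Coords n) : Coords n →L[ℝ] F :=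
  (θ ((chartC n p).symm y)).comp (dchart p y)

/-- A bilinear form in the preferred chart at `p`. -/
def pull2 (B : M → Coords n →L[ℝ] Coords n →L[ℝ] F) (p : M) (y : Coords n) :
    Coords n →L[ℝ] Coords n →L[ℝ] F :=
  (B ((chartC n p).symm y)).bilinearComp (dchart p y) (dchart p y)

theorem pull1_apply (θ : M → Coords n →L[ℝ] F) (p : M) (y v : Coords n) :
    pull1 θ p y v = θ ((chartC n p).symm y) (dchart p y v) := rfl

theorem pull2_apply (B : M → Coords n →L[ℝ] Coords n →L[ℝ] F) (p : M) (y v w : Coords n) :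
    pull2 B p y v w = B ((chartC n p).symm y) (dchart p y v) (dchart p y w) := rfl

theorem target_mem_nhds {p : M} {y : Coords n} (hy : y ∈ (chartC n p).target) :
    (chartC n p).target ∈ 𝓝 y := (isOpen_extChartAt_target p).mem_nhds hy

theorem coord_mem_target (p : M) : coord p ∈ (chartC n p).target := mem_extChartAt_target p

theorem symm_coord (p : M) : (chartC n p).symm (coord p) = p := extChartAt_to_inv p

theorem continuousAt_chart_symm {p : M} {y : Coords n} (hy : y ∈ (chartC n p).target) :
    ContinuousAt (chartC n p).symm y := continuousAt_extChartAt_symm'' hy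

section

variable [IsManifold 𝓘(ℝ, EuclideanSpace ℝ (Fin n)) 3 M]
  [IsManifold 𝓘(ℝ, EuclideanSpace ℝ (Fin m)) 3 M']

instance isManifold_one_of_three : IsManifold 𝓘(ℝ, EuclideanSpace ℝ (Fin n)) 1 M :=
  IsManifold.of_le (n := 3) (by norm_num)

instance contMDiffVectorBundle_tangent : ContMDiffVectorBundle 2 (EuclideanSpace ℝ (Fin n))
    (TangentSpace 𝓘(ℝ, EuclideanSpace ℝ (Fin n)) : M → Type _)
    𝓘(ℝ, EuclideanSpace ℝ (Fin n)) := by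
  have : IsManifold 𝓘(ℝ, EuclideanSpace ℝ (Fin n)) (2 + 1) M := by
    have : (2 + 1 : WithTop ℕ∞) = 3 := by norm_num
    rw [this]; infer_instance
  exact TangentBundle.contMDiffVectorBundle

theorem contMDiffAt_chart_symm {p : M} {y : Coords n} (hy : y ∈ (chartC n p).target) :
    ContMDiffAt 𝓘(ℝ, EuclideanSpace ℝ (Fin n)) 𝓘(ℝ, EuclideanSpace ℝ (Fin n)) 3
      (chartC n p).symm y :=
  (contMDiffOn_extChartAt_symm p).contMDiffAt (target_mem_nhds hy)

theorem contMDiffAt_chart {p q : M} (hq : q ∈ (chartC n p).source) :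
    ContMDiffAt 𝓘(ℝ, EuclideanSpace ℝ (Fin n)) 𝓘(ℝ, EuclideanSpace ℝ (Fin n)) 3
      (chartC n p) q :=
  contMDiffAt_extChartAt' (by simpa using hq)

theorem mdifferentiableAt_chart_symm {p : M} {y : Coords n} (hy : y ∈ (chartC n p).target) :
    MDifferentiableAt 𝓘(ℝ, EuclideanSpace ℝ (Fin n)) 𝓘(ℝ, EuclideanSpace ℝ (Fin n))
      (chartC n p).symm y :=
  (contMDiffAt_chart_symm hy).mdifferentiableAt (by norm_num)

/-- The tangent space at `p` is identified with `ℝⁿ` by the very chart whose inverse is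
differentiated. Hence components in `frame p` are coordinate components at the centre of the chart.
-/
theorem dchart_center (p : M) : dchart p (coord p) = ContinuousLinearMap.id ℝ (Coords n) := by
  have h := mfderivWithin_range_extChartAt_symm (I := 𝓘(ℝ, EuclideanSpace ℝ (Fin n))) (x := p)
  simp only [modelWithCornersSelf_coe, Set.range_id, mfderivWithin_univ] at h
  exact h

theorem contDiffAt_inCharts {p : M} {x : M'} {f : M → M'} {y : Coords n} {k : WithTop ℕ∞}
    (hk : k ≤ 3) (hy : y ∈ (chartC n p).target)
    (hf : ContMDiffAt 𝓘(ℝ, EuclideanSpace ℝ (Fin n)) 𝓘(ℝ, EuclideanSpace ℝ (Fin m)) k f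
      ((chartC n p).symm y))
    (hx : f ((chartC n p).symm y) ∈ (chartC m x).source) : ContDiffAt ℝ k (inCharts n m p x f) y := by
  rw [← contMDiffAt_iff_contDiffAt]
  exact ((contMDiffAt_chart hx).of_le hk).comp y (hf.comp y ((contMDiffAt_chart_symm hy).of_le hk))

/-- The map `f ∘ chart⁻¹` agrees near `y` with `chart⁻¹` of the target composed with `f` read in
charts; the chain rule is applied to both factorizations. -/
theorem mfderiv_comp_dchart {p : M} {x : M'} {f : M → M'} {y : Coords n}
    (hy : y ∈ (chartC n p).target)
    (hf : MDifferentiableAt 𝓘(ℝ, EuclideanSpace ℝ (Fin n)) 𝓘(ℝ, EuclideanSpace ℝ (Fin m)) f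
      ((chartC n p).symm y))
    (hx : f ((chartC n p).symm y) ∈ (chartC m x).source) :
    ContinuousLinearMap.comp (mfderiv 𝓘(ℝ, EuclideanSpace ℝ (Fin n))
      𝓘(ℝ, EuclideanSpace ℝ (Fin m)) f ((chartC n p).symm y) : Coords n →L[ℝ] Coords m) (dchart p y)
      = (dchart x (inCharts n m p x f y)).comp (fderiv ℝ (inCharts n m p x f) y) := by
  have h1 := mfderiv_comp y hf (mdifferentiableAt_chart_symm hy)
  have hfs : MDifferentiableAt 𝓘(ℝ, EuclideanSpace ℝ (Fin n)) 𝓘(ℝ, EuclideanSpace ℝ (Fin m))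
      (f ∘ (chartC n p).symm) y := hf.comp y (mdifferentiableAt_chart_symm hy)
  have hin : MDifferentiableAt 𝓘(ℝ, EuclideanSpace ℝ (Fin n)) 𝓘(ℝ, EuclideanSpace ℝ (Fin m))
      (inCharts n m p x f) y :=
    ((contMDiffAt_chart hx).mdifferentiableAt (by norm_num)).comp y hfs
  have hxt : inCharts n m p x f y ∈ (chartC m x).target := (chartC m x).map_source hx
  have h2 := mfderiv_comp y (mdifferentiableAt_chart_symm hxt) hin
  rw [mfderiv_eq_fderiv] at h2
  have h3 : (f ∘ (chartC n p).symm) =ᶠ[𝓝 y] ((chartC m x).symm ∘ inCharts n m p x f) := by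
    have : ∀ᶠ z in 𝓝 y, f ((chartC n p).symm z) ∈ (chartC m x).source :=
      hfs.continuousAt.eventually ((isOpen_extChartAt_source x).mem_nhds hx)
    filter_upwards [this] with z hz
    exact ((chartC m x).left_inv hz).symm
  have h4 := h3.mfderiv_eq (I := 𝓘(ℝ, EuclideanSpace ℝ (Fin n)))
    (I' := 𝓘(ℝ, EuclideanSpace ℝ (Fin m)))
  have h5 : (mfderiv 𝓘(ℝ, EuclideanSpace ℝ (Fin n)) 𝓘(ℝ, EuclideanSpace ℝ (Fin m))
      (f ∘ (chartC n p).symm) y : Coords n →L[ℝ] Coords m)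
    = mfderiv 𝓘(ℝ, EuclideanSpace ℝ (Fin n)) 𝓘(ℝ, EuclideanSpace ℝ (Fin m))
      ((chartC m x).symm ∘ inCharts n m p x f) y := h4
  exact (h1.symm.trans h5).trans h2

theorem dchart_trans {p q : M} {y : Coords n} (hy : y ∈ (chartC n p).target)
    (hq : (chartC n p).symm y ∈ (chartC n q).source) :
    dchart p y = (dchart q (inCharts n n p q id y)).comp (fderiv ℝ (inCharts n n p q id) y) := by
  have h := mfderiv_comp_dchart (f := (id : M → M)) (x := q) hy mdifferentiableAt_id hq
  rw [← h, mfderiv_id]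
  exact (ContinuousLinearMap.id_comp _).symm

theorem contDiffAt_trans {p q : M} {y : Coords n} (hy : y ∈ (chartC n p).target)
    (hq : (chartC n p).symm y ∈ (chartC n q).source) : ContDiffAt ℝ 3 (inCharts n n p q (id : M → M)) y :=
  contDiffAt_inCharts le_rfl hy contMDiffAt_id hq

omit [IsManifold 𝓘(ℝ, EuclideanSpace ℝ (Fin n)) 3 M] in
theorem symm_inCharts_id {p q : M} {y : Coords n} (hq : (chartC n p).symm y ∈ (chartC n q).source) :
    (chartC n q).symm (inCharts n n p q id y) = (chartC n p).symm y := (chartC n q).left_inv hq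

/-- The derivative of the transition map into the chart at `p`, at the centre of the chart
at `q`, is a right inverse of the derivative of the inverse of the chart at `p`. -/
theorem dchart_comp_fderiv {p q : M} (hq : q ∈ (chartC n p).source) :
    (dchart p (chartC n p q)).comp (fderiv ℝ (inCharts n n q p id) (coord q))
      = ContinuousLinearMap.id ℝ (Coords n) := by
  have h := dchart_trans (p := q) (q := p) (coord_mem_target (n := n) q) (by rw [symm_coord (n := n)]; exact hq)
  rw [dchart_center] at h
  have e : inCharts n n q p (id : M → M) (coord q) = chartC n p q := by
    simp only [inCharts, symm_coord (n := n), id]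
  rw [e] at h
  exact h.symm

/-- In finite dimension a one-sided inverse is two-sided: the transition derivative is injective,
hence surjective, so the opposite composition can be cancelled. -/
theorem fderiv_comp_dchart {p q : M} (hq : q ∈ (chartC n p).source) :
    (fderiv ℝ (inCharts n n q p id) (coord q)).comp (dchart p (chartC n p q))
      = ContinuousLinearMap.id ℝ (Coords n) := by
  have h := dchart_comp_fderiv hq
  ext1 v
  have h' : Function.LeftInverse (dchart p (chartC n p q))
      (fderiv ℝ (inCharts n n q p id) (coord q)) := fun v => congrArg (fun L => L v) h
  have hi : Function.Injective ((fderiv ℝ (inCharts n n q p id) (coord q) : Coords n →L[ℝ] Coords n) :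
      Coords n →ₗ[ℝ] Coords n) := h'.injective
  obtain ⟨w, rfl⟩ := (LinearMap.injective_iff_surjective.mp hi) v
  exact congrArg _ (h' w)

/-- The derivative of the inverse of a chart is injective. -/
theorem dchart_injective {p : M} {y : Coords n} (hy : y ∈ (chartC n p).target) :
    Function.Injective (dchart p y) := by
  have h := fderiv_comp_dchart ((chartC n p).map_target hy)
  rw [(chartC n p).right_inv hy] at h
  exact Function.LeftInverse.injective (g := fderiv ℝ (inCharts n n ((chartC n p).symm y) p id) (coord ((chartC n p).symm y)))
    fun v => congrArg (fun L => L v) h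

theorem dchart_surjective {p : M} {y : Coords n} (hy : y ∈ (chartC n p).target) :
    Function.Surjective (dchart p y) :=
  LinearMap.surjective_of_injective (f := (dchart p y : Coords n →ₗ[ℝ] Coords n))
    (dchart_injective hy)

theorem pull1_trans {θ : M → Coords n →L[ℝ] F} {p q : M} {y : Coords n}
    (hy : y ∈ (chartC n p).target) (hq : (chartC n p).symm y ∈ (chartC n q).source) :
    pull1 θ p y = (pull1 θ q (inCharts n n p q id y)).comp (fderiv ℝ (inCharts n n p q id) y) := by
  simp only [pull1, symm_inCharts_id hq, dchart_trans hy hq]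
  rfl

theorem pull2_trans {B : M → Coords n →L[ℝ] Coords n →L[ℝ] F} {p q : M} {y : Coords n}
    (hy : y ∈ (chartC n p).target) (hq : (chartC n p).symm y ∈ (chartC n q).source) (v w : Coords n) :
    pull2 B p y v w = pull2 B q (inCharts n n p q id y) (fderiv ℝ (inCharts n n p q id) y v)
      (fderiv ℝ (inCharts n n p q id) y w) := by
  simp only [pull2_apply, symm_inCharts_id hq, dchart_trans hy hq, ContinuousLinearMap.comp_apply]

omit [IsManifold 𝓘(ℝ, EuclideanSpace ℝ (Fin n)) 3 M] in
theorem eventually_mem_source {p q : M} {y : Coords n} (hy : y ∈ (chartC n p).target)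
    (hq : (chartC n p).symm y ∈ (chartC n q).source) :
    ∀ᶠ z in 𝓝 y, z ∈ (chartC n p).target ∧ (chartC n p).symm z ∈ (chartC n q).source :=
  Filter.Eventually.and (target_mem_nhds hy)
    ((continuousAt_chart_symm hy).eventually ((isOpen_extChartAt_source q).mem_nhds hq))

/-! ### Smoothness in charts -/

/-- A coordinate field is a constant section in the tangent bundle trivialization at `p`. The bundle
of a C³ manifold is C², which is the regularity obtained. -/
theorem contMDiffOn_coordField (p : M) (v : Coords n) :
    ContMDiffOn 𝓘(ℝ, EuclideanSpace ℝ (Fin n)) 𝓘(ℝ, EuclideanSpace ℝ (Fin n)).tangent 2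
      (fun q => (⟨q, (dchart p (chartC n p q) v : Coords n)⟩ :
        TangentBundle 𝓘(ℝ, EuclideanSpace ℝ (Fin n)) M)) (chartC n p).source := by
  intro q hq
  have hq' : q ∈ (chartAt (EuclideanSpace ℝ (Fin n)) p).source := by simpa using hq
  have hs : ContMDiffOn 𝓘(ℝ, EuclideanSpace ℝ (Fin n))
      𝓘(ℝ, EuclideanSpace ℝ (Fin n)).tangent 2
      (fun q => (⟨q, (trivializationAt (EuclideanSpace ℝ (Fin n))
        (TangentSpace 𝓘(ℝ, EuclideanSpace ℝ (Fin n)) : M → Type _) p).symmL ℝ q v⟩ :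
        TangentBundle 𝓘(ℝ, EuclideanSpace ℝ (Fin n)) M))
      (trivializationAt (EuclideanSpace ℝ (Fin n))
        (TangentSpace 𝓘(ℝ, EuclideanSpace ℝ (Fin n)) : M → Type _) p).baseSet := by
    refine (Bundle.Trivialization.contMDiffOn_section_baseSet_iff _).2 ?_
    refine (contMDiffOn_const (c := v)).congr fun x hx => ?_
    rw [Bundle.Trivialization.symmL_apply _ hx, Bundle.Trivialization.apply_mk_symm _ hx]
  rw [TangentBundle.trivializationAt_baseSet] at hs
  refine ((hs q hq').mono (by intro x; simp)).congr_of_mem (fun x hx => ?_) hq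
  have hx' : x ∈ (chartAt (EuclideanSpace ℝ (Fin n)) p).source := by simpa using hx
  rw [TangentBundle.symmL_trivializationAt hx']
  simp only [modelWithCornersSelf_coe, Set.range_id, mfderivWithin_univ]
  rfl

end

end Charts

/-! ### Multilinear maps and their values on the standard basis -/

section Linear

variable {n : ℕ} {F : Type*} [NormedAddCommGroup F] [NormedSpace ℝ F]

theorem stdVec_apply (a b : Fin n) : stdVec n a b = if b = a then 1 else 0 := by
  simp [stdVec, PiLp.single_apply]

theorem sum_stdVec (u : Coords n) : ∑ a, u a • stdVec n a = u := by
  ext b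
  simp [stdVec_apply]

theorem eq_of_stdVec {f h : Coords n → ℝ} (hf : IsLinearMap ℝ f) (hh : IsLinearMap ℝ h)
    (H : ∀ a, f (stdVec n a) = h (stdVec n a)) (v : Coords n) : f v = h v := by
  have e1 : f v = hf.mk' f v := rfl
  have e2 : h v = hh.mk' h v := rfl
  rw [e1, e2, ← sum_stdVec v, map_sum, map_sum]
  refine Finset.sum_congr rfl fun a _ => ?_
  rw [map_smul, map_smul]
  exact congrArg _ (H a)

theorem apply_eq_sum (L : Coords n →L[ℝ] F) (u : Coords n) : L u = ∑ a, u a • L (stdVec n a) := by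
  conv_lhs => rw [← sum_stdVec u]
  simp

theorem contDiffAt_of_stdVec {E : Type*} [NormedAddCommGroup E] [NormedSpace ℝ E]
    {f : E → Coords n →L[ℝ] F} {y : E} {k : WithTop ℕ∞}
    (h : ∀ a, ContDiffAt ℝ k (fun z => f z (stdVec n a)) y) : ContDiffAt ℝ k f y := by
  have e : f = fun z => ∑ a, (ContinuousLinearMap.smulRightL ℝ (Coords n) F
      (EuclideanSpace.proj a)) (f z (stdVec n a)) := by
    funext z
    ext u
    rw [apply_eq_sum]
    simp
  rw [e]
  refine ContDiffAt.sum fun a _ => ?_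
  exact (ContinuousLinearMap.contDiff _).contDiffAt.comp y (h a)

theorem contDiffAt_of_stdVec₂ {E : Type*} [NormedAddCommGroup E] [NormedSpace ℝ E]
    {f : E → Coords n →L[ℝ] Coords n →L[ℝ] F} {y : E} {k : WithTop ℕ∞}
    (h : ∀ a b, ContDiffAt ℝ k (fun z => f z (stdVec n a) (stdVec n b)) y) : ContDiffAt ℝ k f y :=
  contDiffAt_of_stdVec fun a => contDiffAt_of_stdVec fun b => h a b

theorem fderiv_apply_const {E : Type*} [NormedAddCommGroup E] [NormedSpace ℝ E]
    {f : E → Coords n →L[ℝ] F} {y : E} (hf : DifferentiableAt ℝ f y) (v : Coords n) (u : E) :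
    fderiv ℝ (fun z => f z v) y u = fderiv ℝ f y u v := by
  rw [(hf.hasFDerivAt.clm_apply (hasFDerivAt_const v y)).fderiv]
  simp

theorem fderiv_apply_const₂ {E : Type*} [NormedAddCommGroup E] [NormedSpace ℝ E]
    {f : E → Coords n →L[ℝ] Coords n →L[ℝ] F} {y : E} (hf : DifferentiableAt ℝ f y)
    (v w : Coords n) (u : E) :
    fderiv ℝ (fun z => f z v w) y u = fderiv ℝ f y u v w := by
  rw [((hf.hasFDerivAt.clm_apply (hasFDerivAt_const v y)).clm_apply (hasFDerivAt_const w y)).fderiv]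
  simp

end Linear

/-! ### Smooth dependence of determinants and inverse matrices -/

section MatrixSmooth

variable {E ι : Type*} [NormedAddCommGroup E] [NormedSpace ℝ E] [Fintype ι] [DecidableEq ι]

theorem contDiffAt_det {A : E → Matrix ι ι ℝ} {y : E} {k : WithTop ℕ∞}
    (h : ∀ i j, ContDiffAt ℝ k (fun z => A z i j) y) : ContDiffAt ℝ k (fun z => (A z).det) y := by
  simp only [Matrix.det_apply]
  refine ContDiffAt.sum fun σ _ => ?_
  exact (contDiffAt_prod fun i _ => h _ _).const_smul _

theorem contDiffAt_inv_matrix {A : E → Matrix ι ι ℝ} {y : E} {k : WithTop ℕ∞}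
    (h : ∀ i j, ContDiffAt ℝ k (fun z => A z i j) y) (hdet : (A y).det ≠ 0) (i j : ι) :
    ContDiffAt ℝ k (fun z => (A z)⁻¹ i j) y := by
  simp only [Matrix.inv_def, Matrix.smul_apply, Ring.inverse_eq_inv', smul_eq_mul]
  refine ((contDiffAt_det h).inv hdet).mul ?_
  simp only [Matrix.adjugate_apply]
  refine contDiffAt_det fun a b => ?_
  by_cases hab : a = j
  · subst hab
    simpa using! contDiffAt_const
  · simpa [Matrix.updateRow_ne hab] using h a b

end MatrixSmooth

/-! ### The Levi-Civita connection and curvature of a C² metric in a chart -/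

section Connection

open Filter

variable {n : ℕ} {M : Type*} [TopologicalSpace M] [ChartedSpace (EuclideanSpace ℝ (Fin n)) M]
  {F : Type*} [NormedAddCommGroup F] [NormedSpace ℝ F]

/-- The Levi-Civita connection of `g` in the preferred chart at `p`. -/
def conn (g : BilinField n M) (p : M) (y : Coords n) : Coords n →L[ℝ] Coords n →L[ℝ] Coords n :=
  ∑ a, ∑ b, ∑ c, christoffel g p c a b y •
    (EuclideanSpace.proj a : Coords n →L[ℝ] ℝ).smulRight
      ((EuclideanSpace.proj b : Coords n →L[ℝ] ℝ).smulRight (stdVec n c))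

theorem conn_stdVec (g : BilinField n M) (p : M) (y : Coords n) (a b : Fin n) :
    conn g p y (stdVec n a) (stdVec n b) = ∑ c, christoffel g p c a b y • stdVec n c := by
  simp [conn, stdVec_apply]

theorem conn_stdVec_apply (g : BilinField n M) (p : M) (y : Coords n) (a b c : Fin n) :
    conn g p y (stdVec n a) (stdVec n b) c = christoffel g p c a b y := by
  simp [conn_stdVec, stdVec_apply]

/-- A non-degenerate metric of class `C²`. -/
structure IsMetric (g : BilinField n M) : Prop where
  symm : ∀ (p : M) (u v : Coords n), g p u v = g p v u
  nondeg : ∀ (p : M) (v : Coords n), (∀ w : Coords n, g p v w = 0) → v = 0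
  contDiffAt : ∀ (p : M) (y : Coords n), y ∈ (chartC n p).target → ContDiffAt ℝ 2 (pull2 g p) y

variable [IsManifold 𝓘(ℝ, EuclideanSpace ℝ (Fin n)) 3 M] {g : BilinField n M}

theorem localMetric_apply (g : BilinField n M) (p : M) (y : Coords n) (a b : Fin n) :
    localMetric g p y a b = pull2 g p y (stdVec n a) (stdVec n b) := rfl

theorem IsMetric.pull_symm (hg : IsMetric g) (p : M) (y u v : Coords n) :
    pull2 g p y u v = pull2 g p y v u := hg.symm _ _ _

theorem IsMetric.pull_nondeg (hg : IsMetric g) {p : M} {y : Coords n}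
    (hy : y ∈ (chartC n p).target) (v : Coords n) (h : ∀ w, pull2 g p y v w = 0) : v = 0 := by
  refine dchart_injective hy ?_
  rw [map_zero]
  refine hg.nondeg ((chartC n p).symm y) _ fun w => ?_
  obtain ⟨w, rfl⟩ := dchart_surjective hy w
  exact h w

theorem det_ne_zero_of_nondeg {B : Coords n →L[ℝ] Coords n →L[ℝ] ℝ}
    (h : ∀ v, (∀ w, B v w = 0) → v = 0) :
    (Matrix.of fun a b => B (stdVec n a) (stdVec n b)).det ≠ 0 := by
  intro hdet
  obtain ⟨v, hv, hv0⟩ := Matrix.exists_vecMul_eq_zero_iff.2 hdet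
  apply hv
  have : (∑ a, v a • stdVec n a : Coords n) = 0 := by
    refine h _ fun w => ?_
    refine eq_of_stdVec (f := fun w => B (∑ a, v a • stdVec n a) w) (h := fun _ => 0)
      ⟨fun _ _ => map_add _ _ _, fun _ _ => map_smul _ _ _⟩ ⟨by simp, by simp⟩ (fun b => ?_) w
    have := congrFun hv0 b
    simpa [Matrix.vecMul, dotProduct, sum_apply] using this
  funext b
  have := congrArg (fun x : Coords n => x b) this
  simpa [stdVec_apply] using this

theorem IsMetric.localMetric_det (hg : IsMetric g) {p : M} {y : Coords n}
    (hy : y ∈ (chartC n p).target) : (localMetric g p y).det ≠ 0 :=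
  det_ne_zero_of_nondeg (B := pull2 g p y) (hg.pull_nondeg hy)

theorem IsMetric.differentiableAt (hg : IsMetric g) {p : M} {y : Coords n}
    (hy : y ∈ (chartC n p).target) : DifferentiableAt ℝ (pull2 g p) y :=
  (hg.contDiffAt p y hy).differentiableAt (by norm_num)

theorem pd_localMetric (hg : IsMetric g) {p : M} {y : Coords n}
    (hy : y ∈ (chartC n p).target) (a b c : Fin n) :
    pd a (fun z => localMetric g p z b c) y
      = fderiv ℝ (pull2 g p) y (stdVec n a) (stdVec n b) (stdVec n c) :=
  fderiv_apply_const₂ (hg.differentiableAt hy) _ _ _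

theorem IsMetric.fderiv_symm (hg : IsMetric g) {p : M} {y : Coords n}
    (hy : y ∈ (chartC n p).target) (u v w : Coords n) :
    fderiv ℝ (pull2 g p) y u v w = fderiv ℝ (pull2 g p) y u w v :=
  KillingSpacetime.fderiv_symm (Eventually.of_forall fun z => hg.pull_symm p z)
    (hg.differentiableAt hy) u v w

theorem christoffel_eq (hg : IsMetric g) {p : M} {y : Coords n}
    (hy : y ∈ (chartC n p).target) (c a b : Fin n) :
    christoffel g p c a b y = ∑ d, (localMetric g p y)⁻¹ c d *
      chris1 (pull2 g p) y (stdVec n a) (stdVec n b) (stdVec n d) := by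
  simp only [christoffel, chris1, pd_localMetric hg hy, Finset.mul_sum]
  refine Finset.sum_congr rfl fun d _ => ?_
  rw [hg.fderiv_symm hy _ (stdVec n d) (stdVec n b), hg.fderiv_symm hy _ (stdVec n d) (stdVec n a)]
  ring

/-- Both sides are linear in each argument, so basis vectors suffice; there, lowering the upper
index of the Christoffel symbol cancels the inverse metric in its definition. -/
theorem IsMetric.isConn (hg : IsMetric g) {p : M} {y : Coords n}
    (hy : y ∈ (chartC n p).target) : IsConn (pull2 g p) (conn g p) y := by
  intro u v w
  refine eq_of_stdVec (f := fun w => pull2 g p y (conn g p y u v) w)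
    (h := fun w => chris1 (pull2 g p) y u v w) ⟨by simp, by simp⟩
    ⟨by intros; simp [chris1]; ring, by intros; simp [chris1]; ring⟩ (fun d => ?_) w
  refine eq_of_stdVec (f := fun v => pull2 g p y (conn g p y u v) (stdVec n d))
    (h := fun v => chris1 (pull2 g p) y u v (stdVec n d)) ⟨by simp, by simp⟩
    ⟨by intros; simp [chris1]; ring, by intros; simp [chris1]; ring⟩ (fun b => ?_) v
  refine eq_of_stdVec (f := fun u => pull2 g p y (conn g p y u (stdVec n b)) (stdVec n d))
    (h := fun u => chris1 (pull2 g p) y u (stdVec n b) (stdVec n d)) ⟨by simp, by simp⟩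
    ⟨by intros; simp [chris1]; ring, by intros; simp [chris1]; ring⟩ (fun a => ?_) u
  have hinv : (localMetric g p y) * (localMetric g p y)⁻¹ = 1 :=
    Matrix.mul_nonsing_inv _ (isUnit_iff_ne_zero.2 (hg.localMetric_det hy))
  simp only [conn_stdVec, map_sum, map_smul, sum_apply, smul_apply,
    smul_eq_mul, christoffel_eq hg hy, Finset.sum_mul]
  rw [Finset.sum_comm]
  have key : ∀ e, ∑ c, (localMetric g p y)⁻¹ c e *
      chris1 (pull2 g p) y (stdVec n a) (stdVec n b) (stdVec n e)
        * pull2 g p y (stdVec n c) (stdVec n d)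
      = (if d = e then 1 else 0) *
        chris1 (pull2 g p) y (stdVec n a) (stdVec n b) (stdVec n e) := by
    intro e
    rw [← Matrix.one_apply, ← hinv, Matrix.mul_apply, Finset.sum_mul]
    refine Finset.sum_congr rfl fun c _ => ?_
    rw [localMetric_apply, hg.pull_symm p y (stdVec n d)]
    ring
  simp only [key]
  simp

theorem IsMetric.conn_symm (hg : IsMetric g) {p : M} {y : Coords n}
    (hy : y ∈ (chartC n p).target) (u v : Coords n) : conn g p y u v = conn g p y v u := by
  rw [← sub_eq_zero]
  refine hg.pull_nondeg hy _ fun w => ?_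
  rw [map_sub, sub_apply, hg.isConn hy, hg.isConn hy]
  simp only [chris1]
  rw [hg.fderiv_symm hy w u v]
  ring

theorem IsMetric.contDiffAt_conn (hg : IsMetric g) {p : M} {y : Coords n}
    (hy : y ∈ (chartC n p).target) : ContDiffAt ℝ 1 (conn g p) y := by
  have hG := hg.contDiffAt p y hy
  have hev : ∀ᶠ z in 𝓝 y, z ∈ (chartC n p).target := target_mem_nhds hy
  have h1 : ∀ a b, ContDiffAt ℝ 1 (fun z => localMetric g p z a b) y := fun a b =>
    ((hG.of_le (by norm_num)).clm_apply contDiffAt_const).clm_apply contDiffAt_const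
  have h2 : ContDiffAt ℝ 1 (fderiv ℝ (pull2 g p)) y := hG.fderiv_right (by norm_num)
  have h3 : ∀ u v w : Coords n, ContDiffAt ℝ 1 (fun z => fderiv ℝ (pull2 g p) z u v w) y :=
    fun u v w => ((h2.clm_apply contDiffAt_const).clm_apply contDiffAt_const).clm_apply
      contDiffAt_const
  refine contDiffAt_of_stdVec₂ fun a b => ?_
  simp only [conn_stdVec]
  refine ContDiffAt.sum fun c _ => ContDiffAt.fun_smul ?_ contDiffAt_const
  have h4 : (christoffel g p c a b) =ᶠ[𝓝 y] fun y => ∑ d, (localMetric g p y)⁻¹ c d *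
      chris1 (pull2 g p) y (stdVec n a) (stdVec n b) (stdVec n d) := by
    filter_upwards [hev] with z hz using christoffel_eq hg hz c a b
  refine ContDiffAt.congr_of_eventuallyEq ?_ h4
  refine ContDiffAt.sum fun d _ => ?_
  refine (contDiffAt_inv_matrix h1 (hg.localMetric_det hy) c d).mul ?_
  simp only [chris1]
  exact contDiffAt_const.mul (((h3 _ _ _).add (h3 _ _ _)).sub (h3 _ _ _))

omit [IsManifold 𝓘(ℝ, EuclideanSpace ℝ (Fin n)) 3 M] in
theorem gdn_eq (g : BilinField n M) (p : M) (a b : Fin n) :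
    gdn g p a b = g p (stdVec n a) (stdVec n b) := rfl

theorem pull1_center (θ : M → Coords n →L[ℝ] F) (p : M) : pull1 θ p (coord p) = θ p := by
  rw [pull1, dchart_center, symm_coord (n := n)]
  exact ContinuousLinearMap.comp_id _

theorem pull2_center (B : M → Coords n →L[ℝ] Coords n →L[ℝ] F) (p : M) :
    pull2 B p (coord p) = B p := by
  ext v w
  rw [pull2_apply, dchart_center, symm_coord (n := n)]
  rfl

/-- The definition differentiates components of `θ` one by one, whereas `nabla1` differentiates the
form as a whole; the two agree once the form is differentiable in the chart. -/
theorem covDeriv_eq {θ : (p : M) → Tan n p →L[ℝ] F} {p : M}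
    (hθ : DifferentiableAt ℝ (pull1 θ p) (coord p)) (a b : Fin n) :
    covDeriv g θ p a b = nabla1 (conn g p) (pull1 θ p) (coord p) (stdVec n a) (stdVec n b) := by
  have h1 : pd a (fun y => θ _ (coordVec p y b)) (coord p)
      = fderiv ℝ (pull1 θ p) (coord p) (stdVec n a) (stdVec n b) :=
    fderiv_apply_const hθ _ _
  have h2 : pull1 θ p (coord p) = (θ p : Coords n →L[ℝ] F) := pull1_center θ p
  rw [covDeriv, h1, nabla1, h2, conn_stdVec]
  refine congrArg _ ?_
  have : ∀ L : Coords n →L[ℝ] F, ∑ c, christoffel g p c a b (coord p) • L (stdVec n c)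
      = L (∑ c, christoffel g p c a b (coord p) • stdVec n c) := fun L => by simp
  exact this _

/-- The classical formula and the curvature operator order the lower indices of the Christoffel
symbols differently; the symmetry of the connection and of its derivative reconciles them. -/
theorem riemannUp_eq (hg : IsMetric g) (p : M) (a b c d : Fin n) :
    riemannUp g p a b c d
      = curv (conn g p) (coord p) (stdVec n c) (stdVec n d) (stdVec n b) a := by
  have hy := coord_mem_target (n := n) p
  have hd : DifferentiableAt ℝ (conn g p) (coord p) :=
    (hg.contDiffAt_conn hy).differentiableAt (by norm_num)
  have hpd : ∀ e a b c, pd e (christoffel g p a b c) (coord p)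
      = fderiv ℝ (conn g p) (coord p) (stdVec n e) (stdVec n b) (stdVec n c) a := by
    intro e a b c
    have h1 : christoffel g p a b c
        = fun y => (EuclideanSpace.proj a : Coords n →L[ℝ] ℝ)
          (conn g p y (stdVec n b) (stdVec n c)) := by
      funext y
      simp [conn_stdVec_apply]
    have h2 : HasFDerivAt (fun y => conn g p y (stdVec n b) (stdVec n c))
        (((fderiv ℝ (conn g p) (coord p)).flip (stdVec n b)).flip (stdVec n c)) (coord p) := by
      simpa using! (hd.hasFDerivAt.clm_apply (hasFDerivAt_const (stdVec n b) _)).clm_apply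
        (hasFDerivAt_const (stdVec n c) _)
    have h3 : HasFDerivAt (fun y => (EuclideanSpace.proj a : Coords n →L[ℝ] ℝ)
        (conn g p y (stdVec n b) (stdVec n c))) _ (coord p) :=
      (EuclideanSpace.proj a : Coords n →L[ℝ] ℝ).hasFDerivAt.comp _ h2
    rw [pd, h1, h3.fderiv]
    simp
  have hsym : ∀ e a b c : Fin n,
      fderiv ℝ (conn g p) (coord p) (stdVec n e) (stdVec n b) (stdVec n c) a
      = fderiv ℝ (conn g p) (coord p) (stdVec n e) (stdVec n c) (stdVec n b) a := by
    intro e a b c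
    rw [← fderiv_apply_const₂ hd, ← fderiv_apply_const₂ hd]
    have : (fun z => conn g p z (stdVec n b) (stdVec n c)) =ᶠ[𝓝 (coord p)]
        fun z => conn g p z (stdVec n c) (stdVec n b) := by
      filter_upwards [target_mem_nhds hy] with z hz using hg.conn_symm hz _ _
    rw [this.fderiv_eq]
  have hs := hg.conn_symm hy
  rw [riemannUp, hpd, hpd, hsym c, hsym d, Finset.sum_sub_distrib]
  simp only [curv]
  rw [hs (stdVec n c) (conn g p (coord p) _ _), hs (stdVec n d) (conn g p (coord p) _ _),
    hs (stdVec n d) (stdVec n b), hs (stdVec n c) (stdVec n b)]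
  simp only [conn_stdVec g p (coord p) b, map_sum, map_smul, sum_apply,
    smul_apply]
  simp [conn_stdVec_apply]
  ring

end Connection

/-! ### Chart independence of covariant derivatives and curvature identities -/

section Tensoriality

open Filter

variable {n : ℕ} {M : Type*} [TopologicalSpace M] [ChartedSpace (EuclideanSpace ℝ (Fin n)) M]
  {F : Type*} [NormedAddCommGroup F] [NormedSpace ℝ F]
  [IsManifold 𝓘(ℝ, EuclideanSpace ℝ (Fin n)) 3 M] {g : BilinField n M}

/-- The bilinear form of a metric in the basis `frame p`. -/
def bil (g : BilinField n M) (p : M) : Coords n →L[ℝ] Coords n →L[ℝ] ℝ := g p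

theorem bil_center (g : BilinField n M) (p : M) : pull2 g p (coord p) = bil g p :=
  pull2_center (bil g) p

theorem fderiv_trans_surjective {p q : M} {y : Coords n} (hy : y ∈ (chartC n q).target)
    (hq : (chartC n q).symm y ∈ (chartC n p).source) :
    Function.Surjective (fderiv ℝ (inCharts n n q p (id : M → M)) y) := by
  have h := dchart_trans hy hq
  have hinj : Function.Injective (fderiv ℝ (inCharts n n q p (id : M → M)) y) := by
    intro u v huv
    refine dchart_injective hy ?_
    rw [h, ContinuousLinearMap.comp_apply, ContinuousLinearMap.comp_apply, huv]
  exact LinearMap.surjective_of_injective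
    (f := (fderiv ℝ (inCharts n n q p (id : M → M)) y : Coords n →ₗ[ℝ] Coords n)) hinj

theorem trans_mem_target {p q : M} {y : Coords n}
    (hq : (chartC n q).symm y ∈ (chartC n p).source) :
    inCharts n n q p (id : M → M) y ∈ (chartC n p).target := (chartC n p).map_source hq

theorem IsMetric.conn_trans (hg : IsMetric g) {p q : M} {y : Coords n}
    (hy : y ∈ (chartC n q).target) (hq : (chartC n q).symm y ∈ (chartC n p).source)
    (u v : Coords n) :
    fderiv ℝ (inCharts n n q p id) y (conn g q y u v)
      = fderiv ℝ (fderiv ℝ (inCharts n n q p id)) y u v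
        + conn g p (inCharts n n q p id y) (fderiv ℝ (inCharts n n q p id) y u)
          (fderiv ℝ (inCharts n n q p id) y v) := by
  have ht := trans_mem_target hq
  refine (hg.isConn hy).pullback (hg.isConn ht) ((contDiffAt_trans hy hq).of_le (by norm_num))
    (hg.differentiableAt ht) (hg.differentiableAt hy) (hg.pull_symm p _)
    (hg.pull_nondeg ht) (fderiv_trans_surjective hy hq) ?_ u v
  filter_upwards [eventually_mem_source hy hq] with z hz v w
  exact pull2_trans hz.1 hz.2 v w

theorem IsMetric.nabla1_trans (hg : IsMetric g) {θ : M → Coords n →L[ℝ] F} {p q : M} {y : Coords n}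
    (hy : y ∈ (chartC n q).target) (hq : (chartC n q).symm y ∈ (chartC n p).source)
    (hθ : DifferentiableAt ℝ (pull1 θ p) (inCharts n n q p id y)) (u v : Coords n) :
    nabla1 (conn g q) (pull1 θ q) y u v
      = nabla1 (conn g p) (pull1 θ p) (inCharts n n q p id y)
        (fderiv ℝ (inCharts n n q p id) y u) (fderiv ℝ (inCharts n n q p id) y v) := by
  refine nabla1_pullback ((contDiffAt_trans hy hq).of_le (by norm_num)) (hg.conn_trans hy hq) hθ ?_
    u v
  filter_upwards [eventually_mem_source hy hq] with z hz
  exact pull1_trans hz.1 hz.2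

theorem IsMetric.nabla2_trans (hg : IsMetric g) {B : M → Coords n →L[ℝ] Coords n →L[ℝ] F} {p q : M}
    {y : Coords n}
    (hy : y ∈ (chartC n q).target) (hq : (chartC n q).symm y ∈ (chartC n p).source)
    (hB : DifferentiableAt ℝ (pull2 B p) (inCharts n n q p id y))
    (hB' : DifferentiableAt ℝ (pull2 B q) y) (u v w : Coords n) :
    nabla2 (conn g q) (pull2 B q) y u v w
      = nabla2 (conn g p) (pull2 B p) (inCharts n n q p id y)
        (fderiv ℝ (inCharts n n q p id) y u) (fderiv ℝ (inCharts n n q p id) y v)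
        (fderiv ℝ (inCharts n n q p id) y w) := by
  refine nabla2_pullback ((contDiffAt_trans hy hq).of_le (by norm_num)) (hg.conn_trans hy hq) hB
    hB' ?_ u v w
  filter_upwards [eventually_mem_source hy hq] with z hz v w
  exact pull2_trans hz.1 hz.2 v w

/-- The covariant derivative of a one-form as a bilinear form. -/
def nabla1L {E : Type*} [NormedAddCommGroup E] [NormedSpace ℝ E]
    (Γ : E → E →L[ℝ] E →L[ℝ] E) (θ : E → E →L[ℝ] F) (y : E) : E →L[ℝ] E →L[ℝ] F :=
  fderiv ℝ θ y - (ContinuousLinearMap.compL ℝ E E F (θ y)).comp (Γ y)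

theorem nabla1L_apply {E : Type*} [NormedAddCommGroup E] [NormedSpace ℝ E]
    (Γ : E → E →L[ℝ] E →L[ℝ] E) (θ : E → E →L[ℝ] F) (y u v : E) :
    nabla1L Γ θ y u v = nabla1 Γ θ y u v := rfl

/-- The covariant derivative of a one-form on a manifold. -/
def nablaForm (g : BilinField n M) (θ : M → Coords n →L[ℝ] F) (p : M) :
    Coords n →L[ℝ] Coords n →L[ℝ] F :=
  nabla1L (conn g p) (pull1 θ p) (coord p)

theorem inCharts_coord (p q : M) :
    inCharts n n q p (id : M → M) (coord q) = chartC n p q := by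
  simp only [inCharts, symm_coord (n := n), id]

theorem fderiv_trans_dchart {p : M} {y : Coords n} (hy : y ∈ (chartC n p).target) (u : Coords n) :
    fderiv ℝ (inCharts n n ((chartC n p).symm y) p (id : M → M)) (coord ((chartC n p).symm y))
      (dchart p y u) = u := by
  have h := fderiv_comp_dchart (n := n) ((chartC n p).map_target hy)
  rw [(chartC n p).right_inv hy] at h
  exact congrArg (fun L => L u) h

/-- At each point `nablaForm` is computed in the chart centred there, a chart that moves with the
point. Tensoriality replaces it by a fixed chart, without which the result could not be
differentiated again. -/
theorem IsMetric.pull2_nablaForm (hg : IsMetric g) {θ : M → Coords n →L[ℝ] F} {p : M}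
    {y : Coords n} (hy : y ∈ (chartC n p).target) (hθ : DifferentiableAt ℝ (pull1 θ p) y) :
    pull2 (nablaForm g θ) p y = nabla1L (conn g p) (pull1 θ p) y := by
  have hs : (chartC n ((chartC n p).symm y)).symm (coord ((chartC n p).symm y))
      ∈ (chartC n p).source := by
    rw [symm_coord (n := n)]; exact (chartC n p).map_target hy
  have he : inCharts n n ((chartC n p).symm y) p (id : M → M) (coord ((chartC n p).symm y)) = y := by
    rw [inCharts_coord, (chartC n p).right_inv hy]
  ext u v
  rw [pull2_apply, nablaForm, nabla1L_apply, nabla1L_apply,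
    hg.nabla1_trans (p := p) (coord_mem_target (n := n) _) hs (by rw [he]; exact hθ), he,
    fderiv_trans_dchart hy, fderiv_trans_dchart hy]

/-- The covariant derivative of a bilinear form on a manifold. -/
def nablaForm₂ (g : BilinField n M) (B : M → Coords n →L[ℝ] Coords n →L[ℝ] F) (p : M)
    (u v w : Coords n) : F :=
  nabla2 (conn g p) (pull2 B p) (coord p) u v w

theorem IsMetric.nablaForm₂_dchart (hg : IsMetric g)
    {B : M → Coords n →L[ℝ] Coords n →L[ℝ] F} {p : M} {y : Coords n}
    (hy : y ∈ (chartC n p).target)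
    (hB : ∀ (p : M) (y : Coords n), y ∈ (chartC n p).target → DifferentiableAt ℝ (pull2 B p) y)
    (u v w : Coords n) :
    nablaForm₂ g B ((chartC n p).symm y) (dchart p y u) (dchart p y v) (dchart p y w)
      = nabla2 (conn g p) (pull2 B p) y u v w := by
  have hs : (chartC n ((chartC n p).symm y)).symm (coord ((chartC n p).symm y))
      ∈ (chartC n p).source := by
    rw [symm_coord (n := n)]; exact (chartC n p).map_target hy
  have he : inCharts n n ((chartC n p).symm y) p (id : M → M) (coord ((chartC n p).symm y)) = y := by
    rw [inCharts_coord, (chartC n p).right_inv hy]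
  rw [nablaForm₂, hg.nabla2_trans (p := p) (coord_mem_target (n := n) _) hs (by rw [he]; exact hB p y hy)
    (hB _ _ (coord_mem_target (n := n) _)), he,
    fderiv_trans_dchart hy, fderiv_trans_dchart hy, fderiv_trans_dchart hy]

theorem contDiffAt_nabla1L {E : Type*} [NormedAddCommGroup E] [NormedSpace ℝ E]
    {Γ : E → E →L[ℝ] E →L[ℝ] E} {θ : E → E →L[ℝ] F} {y : E}
    (hΓ : ContDiffAt ℝ 1 Γ y) (hθ : ContDiffAt ℝ 2 θ y) : ContDiffAt ℝ 1 (nabla1L Γ θ) y := by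
  refine ContDiffAt.sub (hθ.fderiv_right (by norm_num)) ?_
  exact ((ContinuousLinearMap.contDiff _).contDiffAt.comp y
    (hθ.of_le (by norm_num))).clm_comp hΓ

/-- The second covariant derivative of a Killing one-form. -/
theorem IsMetric.nablaForm₂_killing (hg : IsMetric g) {θ : M → Coords n →L[ℝ] ℝ}
    (hθ : ∀ (p : M) (y : Coords n), y ∈ (chartC n p).target → ContDiffAt ℝ 2 (pull1 θ p) y)
    (hk : ∀ (p : M) (u v : Coords n), nablaForm g θ p u v = - nablaForm g θ p v u)
    (p : M) (u v w : Coords n) :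
    nablaForm₂ g (nablaForm g θ) p w u v = θ p (curv (conn g p) (coord p) u v w) := by
  have hy := coord_mem_target (n := n) p
  have hev : ∀ᶠ z in 𝓝 (coord p), z ∈ (chartC n p).target := target_mem_nhds hy
  have hpull : pull2 (nablaForm g θ) p =ᶠ[𝓝 (coord p)] nabla1L (conn g p) (pull1 θ p) := by
    filter_upwards [hev] with z hz
    exact hg.pull2_nablaForm hz ((hθ p z hz).differentiableAt (by norm_num))
  have hd : DifferentiableAt ℝ (pull2 (nablaForm g θ) p) (coord p) :=
    (((contDiffAt_nabla1L (hg.contDiffAt_conn hy) (hθ p _ hy)).congr_of_eventuallyEq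
      hpull)).differentiableAt (by norm_num)
  rw [nablaForm₂, nabla2_killing (hθ p _ hy)
    ((hg.contDiffAt_conn hy).differentiableAt (by norm_num)) hd, pull1_center]
  · filter_upwards [hev] with z hz using hg.conn_symm hz
  · filter_upwards [hpull] with z hz u v
    rw [hz, nabla1L_apply]
  · filter_upwards [hev] with z hz u v
    exact hk _ _ _

theorem IsMetric.contDiffAt_nablaForm (hg : IsMetric g) {θ : M → Coords n →L[ℝ] ℝ}
    (hθ : ∀ (p : M) (y : Coords n), y ∈ (chartC n p).target → ContDiffAt ℝ 2 (pull1 θ p) y)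
    (p : M) (y : Coords n) (hy : y ∈ (chartC n p).target) :
    ContDiffAt ℝ 1 (pull2 (nablaForm g θ) p) y := by
  refine (contDiffAt_nabla1L (hg.contDiffAt_conn hy) (hθ p _ hy)).congr_of_eventuallyEq ?_
  filter_upwards [target_mem_nhds hy] with z hz
  exact hg.pull2_nablaForm hz ((hθ p z hz).differentiableAt (by norm_num))

theorem IsMetric.riemann_eq (hg : IsMetric g) (p : M) (a b c d : Fin n) :
    riemann g p a b c d = bil g p (stdVec n a)
      (curv (conn g p) (coord p) (stdVec n c) (stdVec n d) (stdVec n b)) := by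
  rw [riemann, apply_eq_sum]
  refine Finset.sum_congr rfl fun e _ => ?_
  rw [riemannUp_eq hg, gdn_eq, smul_eq_mul, mul_comm]
  rfl

theorem IsMetric.curv_antisymm (hg : IsMetric g) (p : M) (u v a b : Coords n) :
    bil g p (curv (conn g p) (coord p) u v a) b
      + bil g p a (curv (conn g p) (coord p) u v b) = 0 := by
  have hy := coord_mem_target (n := n) p
  have h := KillingSpacetime.curv_antisymm (hg.contDiffAt p _ hy)
    ((hg.contDiffAt_conn hy).differentiableAt (by norm_num))
    (Eventually.of_forall fun z => hg.pull_symm p z)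
    (by filter_upwards [target_mem_nhds hy] with z hz using hg.isConn hz) u v a b
  rwa [bil_center] at h

theorem IsMetric.curv_bianchi (hg : IsMetric g) (p : M) (u v w : Coords n) :
    curv (conn g p) (coord p) u v w + curv (conn g p) (coord p) v w u
      + curv (conn g p) (coord p) w u v = 0 := by
  have hy := coord_mem_target (n := n) p
  exact KillingSpacetime.curv_bianchi ((hg.contDiffAt_conn hy).differentiableAt (by norm_num))
    (by filter_upwards [target_mem_nhds hy] with z hz using hg.conn_symm hz) u v w

end Tensoriality

/-! ### Regularity of tensor fields evaluated in charts -/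

section Smoothness

open Filter

variable {n : ℕ} {M : Type*} [TopologicalSpace M] [ChartedSpace (EuclideanSpace ℝ (Fin n)) M]
  [IsManifold 𝓘(ℝ, EuclideanSpace ℝ (Fin n)) 3 M]

theorem contMDiffAt_coordField {p : M} {y : Coords n} (hy : y ∈ (chartC n p).target)
    (v : Coords n) :
    ContMDiffAt 𝓘(ℝ, EuclideanSpace ℝ (Fin n)) 𝓘(ℝ, EuclideanSpace ℝ (Fin n)).tangent 2
      (fun q => (⟨q, (dchart p (chartC n p q) v : Coords n)⟩ :
        TangentBundle 𝓘(ℝ, EuclideanSpace ℝ (Fin n)) M)) ((chartC n p).symm y) :=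
  (contMDiffOn_coordField p v).contMDiffAt
    ((isOpen_extChartAt_source p).mem_nhds ((chartC n p).map_target hy))

theorem contDiffAt_of_contMDiffAt {F : Type*} [NormedAddCommGroup F] [NormedSpace ℝ F]
    {f : M → F} {h : Coords n → F} {p : M} {y : Coords n}
    (hy : y ∈ (chartC n p).target)
    (hf : ContMDiffAt 𝓘(ℝ, EuclideanSpace ℝ (Fin n)) 𝓘(ℝ, F) 2 f ((chartC n p).symm y))
    (he : ∀ z ∈ (chartC n p).target, h z = f ((chartC n p).symm z)) : ContDiffAt ℝ 2 h y := by
  rw [← contMDiffAt_iff_contDiffAt]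
  refine (hf.comp y ((contMDiffAt_chart_symm hy).of_le (by norm_num))).congr_of_eventuallyEq ?_
  filter_upwards [target_mem_nhds hy] with z hz using he z hz

theorem contMDiffAt_bilin {B : BilinField n M} {X Y : (p : M) → Tan n p} {q : M}
    (hB : ContMDiffAt 𝓘(ℝ, EuclideanSpace ℝ (Fin n))
      (𝓘(ℝ, EuclideanSpace ℝ (Fin n)).prod
        𝓘(ℝ, EuclideanSpace ℝ (Fin n) →L[ℝ] EuclideanSpace ℝ (Fin n) →L[ℝ] ℝ)) 2
      (fun p => Bundle.TotalSpace.mk'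
        (EuclideanSpace ℝ (Fin n) →L[ℝ] EuclideanSpace ℝ (Fin n) →L[ℝ] ℝ)
        (E := fun p : M => Tan n p →L[ℝ] Tan n p →L[ℝ] ℝ) p (B p)) q)
    (hX : ContMDiffAt 𝓘(ℝ, EuclideanSpace ℝ (Fin n)) 𝓘(ℝ, EuclideanSpace ℝ (Fin n)).tangent 2
      (fun p => (⟨p, X p⟩ : TangentBundle 𝓘(ℝ, EuclideanSpace ℝ (Fin n)) M)) q)
    (hY : ContMDiffAt 𝓘(ℝ, EuclideanSpace ℝ (Fin n)) 𝓘(ℝ, EuclideanSpace ℝ (Fin n)).tangent 2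
      (fun p => (⟨p, Y p⟩ : TangentBundle 𝓘(ℝ, EuclideanSpace ℝ (Fin n)) M)) q) :
    ContMDiffAt 𝓘(ℝ, EuclideanSpace ℝ (Fin n)) 𝓘(ℝ, ℝ) 2 (fun p => B p (X p) (Y p)) q := by
  have h : ContMDiffAt 𝓘(ℝ, EuclideanSpace ℝ (Fin n)) (𝓘(ℝ, EuclideanSpace ℝ (Fin n)).prod 𝓘(ℝ, ℝ))
      2 (fun m ↦ Bundle.TotalSpace.mk' ℝ (E := Bundle.Trivial M ℝ) m (B m (X m) (Y m))) q := by
    apply ContMDiffAt.clm_bundle_apply₂ (F₁ := EuclideanSpace ℝ (Fin n))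
      (F₂ := EuclideanSpace ℝ (Fin n))
    · exact hB
    · exact hX
    · exact hY
  simp only [Bundle.contMDiffAt_totalSpace] at h
  exact h.2

end Smoothness

/-! ### Self-dual two-forms and the algebra of `σ` and `Y` in an orthonormal frame -/

section PointwiseAlgebra

/-- The contraction `S_{ab} H^{ac} H^{bd} T_{cd}`. -/
def pairing (H S T : Fin 4 → Fin 4 → ℂ) : ℂ :=
  ∑ a, ∑ b, S a b * ∑ c, ∑ d, H a c * H b d * T c d

/-- The Hodge dual for the inverse metric `H` and the volume form `V`. -/
def dualF (H : Fin 4 → Fin 4 → ℂ) (V : Fin 4 → Fin 4 → Fin 4 → Fin 4 → ℂ)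
    (B : Fin 4 → Fin 4 → ℂ) (a b : Fin 4) : ℂ := (1 / 2) * pairing H (V a b) B

/-- The self-dual part `B + i B^⋆`. -/
def sdF (H : Fin 4 → Fin 4 → ℂ) (V : Fin 4 → Fin 4 → Fin 4 → Fin 4 → ℂ)
    (B : Fin 4 → Fin 4 → ℂ) (a b : Fin 4) : ℂ := B a b + Complex.I * dualF H V B a b

/-- The Ernst one-form of a two-form `F`. -/
def ernstF (H : Fin 4 → Fin 4 → ℂ) (V : Fin 4 → Fin 4 → Fin 4 → Fin 4 → ℂ)
    (x : Fin 4 → ℂ) (F : Fin 4 → Fin 4 → ℂ) (a : Fin 4) : ℂ := 2 * ∑ b, x b * sdF H V F b a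

/-- The tensor `Y` of a curvature `P_{bcd} = ξ^a C_{abcd}`. -/
def yF (H : Fin 4 → Fin 4 → ℂ) (V : Fin 4 → Fin 4 → Fin 4 → Fin 4 → ℂ)
    (x : Fin 4 → ℂ) (P : Fin 4 → Fin 4 → Fin 4 → ℂ) (a b : Fin 4) : ℂ :=
  2 * ∑ d, x d * sdF H V (P a) d b

/-- The contraction of the self-dual curvature with the self-dual two-form. -/
def contrF (H : Fin 4 → Fin 4 → ℂ) (V : Fin 4 → Fin 4 → Fin 4 → Fin 4 → ℂ)
    (P : Fin 4 → Fin 4 → Fin 4 → ℂ) (F : Fin 4 → Fin 4 → ℂ) (c : Fin 4) : ℂ :=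
  pairing H (sdF H V (P c)) (sdF H V F)

/-- Components of a covector in the frame `A`. -/
def tr1 (A : Fin 4 → Fin 4 → ℂ) (w : Fin 4 → ℂ) (i : Fin 4) : ℂ := ∑ a, A i a * w a

/-- Components of a rank-two tensor in the frame `A`. -/
def tr2 (A T : Fin 4 → Fin 4 → ℂ) (i j : Fin 4) : ℂ := ∑ a, ∑ b, A i a * A j b * T a b

/-- Components of a rank-three tensor in the frame `A`. -/
def tr3 (A : Fin 4 → Fin 4 → ℂ) (T : Fin 4 → Fin 4 → Fin 4 → ℂ) (i j k : Fin 4) : ℂ :=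
  ∑ a, A i a * tr2 A (T a) j k

/-- Components of a rank-four tensor in the frame `A`. -/
def tr4 (A : Fin 4 → Fin 4 → ℂ) (V : Fin 4 → Fin 4 → Fin 4 → Fin 4 → ℂ) (i j k l : Fin 4) : ℂ :=
  ∑ a, ∑ b, A i a * A j b * tr2 A (V a b) k l

theorem tr2_eq_matrix (A T : Fin 4 → Fin 4 → ℂ) :
    Matrix.of (tr2 A T) = Matrix.of A * Matrix.of T * (Matrix.of A).transpose := by
  ext i j
  simp only [Matrix.of_apply, tr2, Matrix.mul_apply, Matrix.transpose_apply, Finset.sum_mul]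
  rw [Finset.sum_comm]
  refine Finset.sum_congr rfl fun a _ => Finset.sum_congr rfl fun b _ => ?_
  ring

theorem pairing_eq_trace (H S T : Fin 4 → Fin 4 → ℂ) :
    pairing H S T = ((Matrix.of S).transpose *
      (Matrix.of H * Matrix.of T * (Matrix.of H).transpose)).trace := by
  have h : ∀ a b, ∑ c, ∑ d, H a c * H b d * T c d
      = (Matrix.of H * Matrix.of T * (Matrix.of H).transpose) a b := by
    intro a b
    rw [← tr2_eq_matrix]
    rfl
  simp only [pairing, h, Matrix.trace, Matrix.diag]
  rw [Finset.sum_comm]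
  rfl

/-- With `H = Aᵀ H' A` both contractions are traces of the same product of matrices, up to cyclic
order. Invertibility of `A` is not needed. -/
theorem pairing_change {A H H' : Fin 4 → Fin 4 → ℂ}
    (hH : ∀ a b, H a b = ∑ i, ∑ j, A i a * A j b * H' i j) (S T : Fin 4 → Fin 4 → ℂ) :
    pairing H S T = pairing H' (tr2 A S) (tr2 A T) := by
  have h : Matrix.of H = (Matrix.of A).transpose * Matrix.of H' * Matrix.of A := by
    have h1 := tr2_eq_matrix (fun a i => A i a) H'
    have h2 : Matrix.of H = Matrix.of (tr2 (fun a i => A i a) H') := by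
      ext a b
      exact hH a b
    rw [h2, h1]
    rfl
  rw [pairing_eq_trace, pairing_eq_trace, tr2_eq_matrix, tr2_eq_matrix, h]
  simp only [Matrix.transpose_mul, Matrix.transpose_transpose, Matrix.mul_assoc]
  rw [Matrix.trace_mul_comm (Matrix.of A)]
  simp only [Matrix.mul_assoc]

theorem pairing_sum_left (H T : Fin 4 → Fin 4 → ℂ) (c : Fin 4 → Fin 4 → ℂ)
    (S : Fin 4 → Fin 4 → Fin 4 → Fin 4 → ℂ) :
    pairing H (fun k l => ∑ a, ∑ b, c a b * S a b k l) T = ∑ a, ∑ b, c a b * pairing H (S a b) T := by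
  simp only [pairing, Finset.sum_mul, Finset.mul_sum]
  have : ∀ f : Fin 4 → Fin 4 → Fin 4 → Fin 4 → ℂ,
      ∑ k, ∑ l, ∑ a, ∑ b, f a b k l = ∑ a, ∑ b, ∑ k, ∑ l, f a b k l := by
    intro f
    calc ∑ k, ∑ l, ∑ a, ∑ b, f a b k l = ∑ k, ∑ a, ∑ l, ∑ b, f a b k l :=
          Finset.sum_congr rfl fun _ _ => Finset.sum_comm
      _ = ∑ a, ∑ k, ∑ l, ∑ b, f a b k l := Finset.sum_comm
      _ = ∑ a, ∑ k, ∑ b, ∑ l, f a b k l := Finset.sum_congr rfl fun _ _ =>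
          Finset.sum_congr rfl fun _ _ => Finset.sum_comm
      _ = ∑ a, ∑ b, ∑ k, ∑ l, f a b k l := Finset.sum_congr rfl fun _ _ => Finset.sum_comm
  have h2 : ∀ k l, (∑ c', ∑ d, ∑ a, ∑ b, c a b * S a b k l * (H k c' * H l d * T c' d))
      = ∑ a, ∑ b, ∑ c', ∑ d, c a b * (S a b k l * (H k c' * H l d * T c' d)) := by
    intro k l
    rw [this (fun a b c' d => c a b * S a b k l * (H k c' * H l d * T c' d))]
    simp only [mul_assoc]
  simp only [h2]
  rw [this (fun a b k l => ∑ c', ∑ d, c a b * (S a b k l * (H k c' * H l d * T c' d)))]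

/-- The summed pair of indices is contracted frame-independently by `pairing_change`, and the free
pair of `V` is carried along by linearity. -/
theorem dualF_change {A H H' : Fin 4 → Fin 4 → ℂ}
    (hH : ∀ a b, H a b = ∑ i, ∑ j, A i a * A j b * H' i j)
    (V : Fin 4 → Fin 4 → Fin 4 → Fin 4 → ℂ) (B : Fin 4 → Fin 4 → ℂ) :
    dualF H' (tr4 A V) (tr2 A B) = tr2 A (dualF H V B) := by
  funext i j
  have h : tr4 A V i j = fun k l => ∑ a, ∑ b, (A i a * A j b) * tr2 A (V a b) k l := rfl
  rw [dualF, h, pairing_sum_left H' (tr2 A B) (fun a b => A i a * A j b)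
    (fun a b => tr2 A (V a b))]
  simp only [← pairing_change hH]
  simp only [tr2, dualF, Finset.mul_sum]
  refine Finset.sum_congr rfl fun a _ => Finset.sum_congr rfl fun b _ => ?_
  ring

theorem sdF_change {A H H' : Fin 4 → Fin 4 → ℂ}
    (hH : ∀ a b, H a b = ∑ i, ∑ j, A i a * A j b * H' i j)
    (V : Fin 4 → Fin 4 → Fin 4 → Fin 4 → ℂ) (B : Fin 4 → Fin 4 → ℂ) :
    sdF H' (tr4 A V) (tr2 A B) = tr2 A (sdF H V B) := by
  funext i j
  rw [sdF, dualF_change hH]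
  simp only [tr2, sdF, Finset.mul_sum, ← Finset.sum_add_distrib]
  refine Finset.sum_congr rfl fun a _ => Finset.sum_congr rfl fun b _ => ?_
  ring

theorem tr2_contr {A : Fin 4 → Fin 4 → ℂ} {x x' : Fin 4 → ℂ}
    (hx : ∀ a, x a = ∑ i, A i a * x' i) (T : Fin 4 → Fin 4 → ℂ) (j : Fin 4) :
    ∑ i, x' i * tr2 A T i j = tr1 A (fun b => ∑ a, x a * T a b) j := by
  simp only [tr1, tr2, hx, Finset.mul_sum, Finset.sum_mul]
  rw [Finset.sum_comm]
  rw [Finset.sum_comm (s := Finset.univ) (t := Finset.univ) (f := fun b a => ∑ i, A j b * (A i a * x' i * T a b))]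
  refine Finset.sum_congr rfl fun a _ => ?_
  rw [Finset.sum_comm]
  refine Finset.sum_congr rfl fun b _ => Finset.sum_congr rfl fun i _ => ?_
  ring

theorem ernstF_change {A H H' : Fin 4 → Fin 4 → ℂ} {x x' : Fin 4 → ℂ}
    (hH : ∀ a b, H a b = ∑ i, ∑ j, A i a * A j b * H' i j) (hx : ∀ a, x a = ∑ i, A i a * x' i)
    (V : Fin 4 → Fin 4 → Fin 4 → Fin 4 → ℂ) (F : Fin 4 → Fin 4 → ℂ) :
    ernstF H' (tr4 A V) x' (tr2 A F) = tr1 A (ernstF H V x F) := by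
  funext i
  rw [ernstF, sdF_change hH, tr2_contr hx]
  simp only [tr1, ernstF, Finset.mul_sum]
  refine Finset.sum_congr rfl fun a _ => Finset.sum_congr rfl fun b _ => ?_
  ring

theorem sdF_sum (H : Fin 4 → Fin 4 → ℂ) (V : Fin 4 → Fin 4 → Fin 4 → Fin 4 → ℂ) (c : Fin 4 → ℂ)
    (B : Fin 4 → Fin 4 → Fin 4 → ℂ) :
    sdF H V (fun k l => ∑ a, c a * B a k l) = fun k l => ∑ a, c a * sdF H V (B a) k l := by
  funext k l
  have h : pairing H (V k l) (fun k l => ∑ a, c a * B a k l)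
      = ∑ a, c a * pairing H (V k l) (B a) := by
    rw [pairing_eq_trace]
    have e : (Matrix.of fun k l => ∑ a, c a * B a k l) = ∑ a, c a • Matrix.of (B a) := by
      ext i j
      simp [Matrix.sum_apply]
    rw [e]
    simp only [Matrix.mul_sum, Matrix.sum_mul, Matrix.trace_sum, Matrix.mul_smul, Matrix.smul_mul,
      Matrix.trace_smul, pairing_eq_trace, smul_eq_mul]
  simp only [sdF, dualF, h, Finset.mul_sum, ← Finset.sum_add_distrib]
  refine Finset.sum_congr rfl fun a _ => ?_
  ring

theorem sdF_tr3 {A H H' : Fin 4 → Fin 4 → ℂ}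
    (hH : ∀ a b, H a b = ∑ i, ∑ j, A i a * A j b * H' i j)
    (V : Fin 4 → Fin 4 → Fin 4 → Fin 4 → ℂ) (P : Fin 4 → Fin 4 → Fin 4 → ℂ) (i : Fin 4) :
    sdF H' (tr4 A V) (tr3 A P i) = fun k l => ∑ a, A i a * tr2 A (sdF H V (P a)) k l := by
  have h : tr3 A P i = fun k l => ∑ a, A i a * tr2 A (P a) k l := rfl
  rw [h, sdF_sum]
  simp only [sdF_change hH]

theorem yF_change {A H H' : Fin 4 → Fin 4 → ℂ} {x x' : Fin 4 → ℂ}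
    (hH : ∀ a b, H a b = ∑ i, ∑ j, A i a * A j b * H' i j) (hx : ∀ a, x a = ∑ i, A i a * x' i)
    (V : Fin 4 → Fin 4 → Fin 4 → Fin 4 → ℂ) (P : Fin 4 → Fin 4 → Fin 4 → ℂ) :
    yF H' (tr4 A V) x' (tr3 A P) = tr2 A (yF H V x P) := by
  funext i j
  rw [yF, sdF_tr3 hH]
  have h : ∀ a, ∑ d, x' d * tr2 A (sdF H V (P a)) d j
      = tr1 A (fun b => ∑ d, x d * sdF H V (P a) d b) j := fun a => tr2_contr hx _ _
  have h2 : ∑ d, x' d * ∑ a, A i a * tr2 A (sdF H V (P a)) d j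
      = ∑ a, A i a * ∑ d, x' d * tr2 A (sdF H V (P a)) d j := by
    simp only [Finset.mul_sum]
    rw [Finset.sum_comm]
    refine Finset.sum_congr rfl fun a _ => Finset.sum_congr rfl fun b _ => ?_
    ring
  rw [h2]
  simp only [h]
  simp only [tr1, tr2, yF, Finset.mul_sum]
  refine Finset.sum_congr rfl fun a _ => Finset.sum_congr rfl fun b _ =>
    Finset.sum_congr rfl fun d _ => ?_
  ring

theorem contrF_change {A H H' : Fin 4 → Fin 4 → ℂ}
    (hH : ∀ a b, H a b = ∑ i, ∑ j, A i a * A j b * H' i j)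
    (V : Fin 4 → Fin 4 → Fin 4 → Fin 4 → ℂ) (P : Fin 4 → Fin 4 → Fin 4 → ℂ)
    (F : Fin 4 → Fin 4 → ℂ) :
    contrF H' (tr4 A V) (tr3 A P) (tr2 A F) = tr1 A (contrF H V P F) := by
  funext i
  rw [contrF, sdF_tr3 hH, sdF_change hH]
  have h := pairing_sum_left H' (tr2 A (sdF H V F)) (fun a b => if b = 0 then A i a else 0)
    (fun a _ => tr2 A (sdF H V (P a)))
  simp only [ite_mul, zero_mul, Finset.sum_ite_eq', Finset.mem_univ, if_true] at h
  rw [h]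
  simp only [← pairing_change hH, tr1, contrF]

/-- The standard Minkowski metric `diag(-1, 1, 1, 1)`. -/
def minkS (i : Fin 4) : ℂ := if i = 0 then -1 else 1

/-- The inverse of the standard Minkowski metric. -/
def mink (i j : Fin 4) : ℂ := if i = j then minkS i else 0

/-- The Levi-Civita symbol. -/
def leviZ (a b c d : Fin 4) : ℤ :=
  (((b : ℤ) - a) * ((c : ℤ) - a) * ((d : ℤ) - a) * ((c : ℤ) - b) * ((d : ℤ) - b)
    * ((d : ℤ) - c)) / 12

/-- The Levi-Civita symbol as a complex number. -/
def levi (a b c d : Fin 4) : ℂ := (leviZ a b c d : ℂ)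

theorem pairing_mink (S T : Fin 4 → Fin 4 → ℂ) :
    pairing mink S T = ∑ a, ∑ b, S a b * (minkS a * minkS b * T a b) := by
  simp [pairing, mink, mul_assoc]

variable {ε : ℂ} {B : Fin 4 → Fin 4 → ℂ}

theorem dualF_levi (hB : ∀ a b, B a b = - B b a) :
    dualF mink (fun a b c d => ε * levi a b c d) B =
      ![![0, ε * B 2 3, ε * B 3 1, ε * B 1 2],
        ![- (ε * B 2 3), 0, - (ε * B 0 3), ε * B 0 2],
        ![- (ε * B 3 1), ε * B 0 3, 0, - (ε * B 0 1)],
        ![- (ε * B 1 2), - (ε * B 0 2), ε * B 0 1, 0]] := by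
  have h10 := hB 1 0
  have h20 := hB 2 0
  have h30 := hB 3 0
  have h21 := hB 2 1
  have h32 := hB 3 2
  have h13 := hB 1 3
  funext a b
  rw [dualF, pairing_mink]
  fin_cases a <;> fin_cases b <;>
    simp [Fin.sum_univ_four, levi, leviZ, minkS, h10, h20, h30, h21, h32, h13] <;> ring

/-- The self-dual two-form with electric part `f`. -/
def sdTable (ε f₁ f₂ f₃ : ℂ) : Fin 4 → Fin 4 → ℂ :=
  ![![0, f₁, f₂, f₃],
    ![-f₁, 0, -(Complex.I * ε * f₃), Complex.I * ε * f₂],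
    ![-f₂, Complex.I * ε * f₃, 0, -(Complex.I * ε * f₁)],
    ![-f₃, -(Complex.I * ε * f₂), Complex.I * ε * f₁, 0]]

/-- Duality exchanges electric and magnetic parts, and `(iε)² = −1` in Lorentzian signature. A
self-dual two-form is therefore fixed by the three numbers `B_{0i} + iε B_{jk}`, and later
identities reduce to the algebra of three-vectors. -/
theorem sdF_levi (hε : ε ^ 2 = 1) (hB : ∀ a b, B a b = - B b a) :
    sdF mink (fun a b c d => ε * levi a b c d) B =
      sdTable ε (B 0 1 + Complex.I * ε * B 2 3) (B 0 2 + Complex.I * ε * B 3 1)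
        (B 0 3 + Complex.I * ε * B 1 2) := by
  have hd : ∀ a, B a a = 0 := fun a => self_eq_neg.1 (hB a a)
  have h10 := hB 1 0
  have h20 := hB 2 0
  have h30 := hB 3 0
  have h21 := hB 2 1
  have h32 := hB 3 2
  have h13 := hB 1 3
  have hI := Complex.I_sq
  have hIε : ∀ z : ℂ, Complex.I * ε * (Complex.I * ε * z) = - z := fun z => by
    linear_combination ε ^ 2 * z * hI - z * hε
  funext a b
  rw [sdF, dualF_levi hB]
  fin_cases a <;> fin_cases b <;>
    simp [sdTable, hd, h10, h20, h30, h21, h32, h13, mul_add, hIε] <;> ring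

/-- The electric entries contribute −2 per direction because one raised index is the time index; the
magnetic entries contribute −2 because of `(iε)² = −1`. -/
theorem pairing_sdTable (hε : ε ^ 2 = 1) (f₁ f₂ f₃ k₁ k₂ k₃ : ℂ) :
    pairing mink (sdTable ε f₁ f₂ f₃) (sdTable ε k₁ k₂ k₃)
      = -4 * (f₁ * k₁ + f₂ * k₂ + f₃ * k₃) := by
  have hI := Complex.I_sq
  rw [pairing_mink]
  simp [Fin.sum_univ_four, sdTable, minkS]
  linear_combination (2 * ε ^ 2 * (f₁ * k₁ + f₂ * k₂ + f₃ * k₃)) * hI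
    - 2 * (f₁ * k₁ + f₂ * k₂ + f₃ * k₃) * hε

/-- The components of a vector along the time axis. -/
def timeVec (r : ℂ) (i : Fin 4) : ℂ := if i = 0 then r else 0

/-- The algebraic properties of `P_{bcd} = ξ^a C_{abcd}` in an orthonormal frame adapted to `ξ`. -/
structure IsFrameCurv (P : Fin 4 → Fin 4 → Fin 4 → ℂ) : Prop where
  anti : ∀ b c d, P b c d = - P b d c
  time : ∀ c d, P 0 c d = 0
  cyclic : ∀ b c d, P b c d + P c d b + P d b c = 0
  trace : ∀ c, P 1 c 1 + P 2 c 2 + P 3 c 3 = 0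

variable {P : Fin 4 → Fin 4 → Fin 4 → ℂ} {F : Fin 4 → Fin 4 → ℂ} {r : ℂ}

theorem ernstF_frame (hε : ε ^ 2 = 1) (hB : ∀ a b, B a b = - B b a) :
    ernstF mink (fun a b c d => ε * levi a b c d) (timeVec r) B =
      ![0, 2 * r * (B 0 1 + Complex.I * ε * B 2 3), 2 * r * (B 0 2 + Complex.I * ε * B 3 1),
        2 * r * (B 0 3 + Complex.I * ε * B 1 2)] := by
  funext a
  rw [ernstF, sdF_levi hε hB]
  fin_cases a <;> simp [timeVec, sdTable] <;> ring

theorem yF_eq_ernstF (H : Fin 4 → Fin 4 → ℂ) (V : Fin 4 → Fin 4 → Fin 4 → Fin 4 → ℂ)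
    (x : Fin 4 → ℂ) (P : Fin 4 → Fin 4 → Fin 4 → ℂ) (a b : Fin 4) :
    yF H V x P a b = ernstF H V x (P a) b := rfl

/-- The electric part `P_{i0j}` is symmetric by the cyclic identity together with `P_{0cd} = 0`. The
magnetic part is symmetric by the three spatial trace identities, which is where the vacuum
equations enter. -/
theorem yF_frame_symm (hε : ε ^ 2 = 1) (hP : IsFrameCurv P) (a b : Fin 4) :
    yF mink (fun a b c d => ε * levi a b c d) (timeVec r) P a b
      = yF mink (fun a b c d => ε * levi a b c d) (timeVec r) P b a := by
  simp only [yF_eq_ernstF, ernstF_frame hε (hP.anti _)]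
  have hs : ∀ i j, P i 0 j = P j 0 i := fun i j => by
    have h1 := hP.cyclic i 0 j
    rw [hP.time, hP.anti j i 0] at h1
    linear_combination h1
  have t1 := hP.trace 1
  have t2 := hP.trace 2
  have t3 := hP.trace 3
  have hd : ∀ a b, P a b b = 0 := fun a b => self_eq_neg.1 (hP.anti a b b)
  have a1 : P 1 3 1 = P 2 2 3 := by
    linear_combination t3 - hd 3 3 - hP.anti 2 2 3
  have a3 : P 1 1 2 = P 3 2 3 := by
    linear_combination hP.anti 1 1 2 - t2 + hd 2 2
  have a4 : P 2 1 2 = P 3 3 1 := by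
    linear_combination t1 - hd 1 1 - hP.anti 3 3 1
  fin_cases a <;> fin_cases b <;>
    simp [hP.time, hs 2 1, hs 3 1, hs 3 2, a1, a3, a4]

end PointwiseAlgebra

/-! ### Trace, contraction, Hessian and invariance identities in the adapted frame -/

section PointwiseIdentities

variable {ε : ℂ} {B : Fin 4 → Fin 4 → ℂ}
variable {P : Fin 4 → Fin 4 → Fin 4 → ℂ} {F : Fin 4 → Fin 4 → ℂ} {r : ℂ}

/-- The electric half of the trace vanishes by the trace condition with time index, the magnetic
half by the cyclic identity for the three spatial indices. -/
theorem yF_frame_trace (hε : ε ^ 2 = 1) (hP : IsFrameCurv P) :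
    ∑ a, ∑ b, mink a b * yF mink (fun a b c d => ε * levi a b c d) (timeVec r) P a b = 0 := by
  have t0 := hP.trace 0
  have c := hP.cyclic 1 2 3
  have a1 := hP.anti 1 1 0
  have a2 := hP.anti 2 2 0
  have a3 := hP.anti 3 3 0
  have b1 := hP.anti 1 0 1
  have b2 := hP.anti 2 0 2
  have b3 := hP.anti 3 0 3
  simp [yF_eq_ernstF, ernstF_frame hε (hP.anti _), mink, minkS, Fin.sum_univ_four]
  linear_combination (2 * r) * t0 + (2 * r * Complex.I * ε) * c

/-- Both sides equal `−4 r² Σ f_i k_i`, with `f` and `k` the electric parts of `F` and `P c`.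
Symmetry of `Y` puts its contracted index in the slot in which `k` is read off. -/
theorem contrF_frame (hε : ε ^ 2 = 1) (hP : IsFrameCurv P) (hF : ∀ a b, F a b = - F b a)
    (c : Fin 4) :
    r ^ 2 * contrF mink (fun a b c d => ε * levi a b c d) P F c
      = - ∑ m, ∑ k, mink m k * ernstF mink (fun a b c d => ε * levi a b c d) (timeVec r) F k
        * yF mink (fun a b c d => ε * levi a b c d) (timeVec r) P m c := by
  have hs : ∀ m, yF mink (fun a b c d => ε * levi a b c d) (timeVec r) P m c
      = yF mink (fun a b c d => ε * levi a b c d) (timeVec r) P c m := fun m =>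
    yF_frame_symm hε hP m c
  simp only [hs, contrF, sdF_levi hε (hP.anti _), sdF_levi hε hF, pairing_sdTable hε,
    yF_eq_ernstF, ernstF_frame hε (hP.anti _), ernstF_frame hε hF]
  simp [mink, minkS, Fin.sum_univ_four]
  ring

/-- The derivative `(∇_b σ)_a` of the Ernst one-form. -/
def dErnstF (H : Fin 4 → Fin 4 → ℂ) (V : Fin 4 → Fin 4 → Fin 4 → Fin 4 → ℂ)
    (x : Fin 4 → ℂ) (P : Fin 4 → Fin 4 → Fin 4 → ℂ) (F : Fin 4 → Fin 4 → ℂ) (b a : Fin 4) : ℂ :=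
  ernstF H V (fun c => ∑ d, H c d * F b d) F a + yF H V x P b a

/-- The correction to the Hessian due to the change of connection. -/
def connShiftF (dl : Fin 4 → ℂ) (F : Fin 4 → Fin 4 → ℂ) (xl : Fin 4 → ℂ) (b a i : Fin 4) : ℂ :=
  (1 / 2) * (dl b * mink a i + dl a * mink b i - dl i * mink b a) + F b i * xl a + F a i * xl b

/-- The curvature term `Y` occurs on both sides and cancels, so `P` is arbitrary. What remains is
quadratic in `F`, and each of the sixteen entries is a polynomial identity modulo `i² = −1` and `ε²
= 1`. -/
theorem hessian_frame (hε : ε ^ 2 = 1) (hr : r ≠ 0) (hF : ∀ a b, F a b = - F b a)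
    (P : Fin 4 → Fin 4 → Fin 4 → ℂ) {σ dl : Fin 4 → ℂ}
    (hσ : σ = ernstF mink (fun a b c d => ε * levi a b c d) (timeVec r) F)
    (hdl : ∀ a, dl a = 2 * r * F 0 a) (b a : Fin 4) :
    dErnstF mink (fun a b c d => ε * levi a b c d) (timeVec r) P F b a
      - (r ^ 2)⁻¹ * (σ 1 * connShiftF dl F (timeVec (-r)) b a 1
        + σ 2 * connShiftF dl F (timeVec (-r)) b a 2
        + σ 3 * connShiftF dl F (timeVec (-r)) b a 3)
    = yF mink (fun a b c d => ε * levi a b c d) (timeVec r) P b a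
      - (1 / 2) * pairing mink (sdF mink (fun a b c d => ε * levi a b c d) F)
          (sdF mink (fun a b c d => ε * levi a b c d) F)
        * (mink b a + (r ^ 2)⁻¹ * timeVec (-r) b * timeVec (-r) a)
      - 1 / (2 * r ^ 2) * σ b * σ a := by
  have hd : ∀ a, F a a = 0 := fun a => self_eq_neg.1 (hF a a)
  have h10 := hF 1 0
  have h20 := hF 2 0
  have h30 := hF 3 0
  have h21 := hF 2 1
  have h32 := hF 3 2
  have h13 := hF 1 3
  have hI := Complex.I_sq
  subst hσ
  simp only [ernstF_frame hε hF, dErnstF, sdF_levi hε hF, pairing_sdTable hε, connShiftF, hdl]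
  simp only [ernstF, sdF_levi hε hF]
  generalize hk1 : F 0 1 = e1
  generalize hk2 : F 0 2 = e2
  generalize hk3 : F 0 3 = e3
  fin_cases b <;> fin_cases a <;>
  · simp [Fin.sum_univ_four, sdTable, mink, minkS, timeVec, hd, h10, h20, h30, h21, h32, h13, hk1, hk2, hk3]
    field_simp
    ring_nf
    try simp only [hI, hε]
    try ring_nf

/-- The curvature contribution vanishes since `P_{0cd} = 0`. The rest is proportional to the
antisymmetric part of the product `F_a{}^c 𝓕_{cb}`, which is zero because a two-form commutes with
its dual. -/
theorem lie_frame (hε : ε ^ 2 = 1) (hF : ∀ a b, F a b = - F b a) (hP : IsFrameCurv P)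
    (a : Fin 4) :
    r * dErnstF mink (fun a b c d => ε * levi a b c d) (timeVec r) P F 0 a
      + ∑ c, minkS c * F a c * ernstF mink (fun a b c d => ε * levi a b c d) (timeVec r) F c
      = 0 := by
  have hd : ∀ a, F a a = 0 := fun a => self_eq_neg.1 (hF a a)
  have h10 := hF 1 0
  have h20 := hF 2 0
  have h30 := hF 3 0
  have h21 := hF 2 1
  have h32 := hF 3 2
  have h13 := hF 1 3
  have hI := Complex.I_sq
  simp only [dErnstF, yF_eq_ernstF, ernstF_frame hε (hP.anti _), ernstF_frame hε hF]
  simp only [ernstF, sdF_levi hε hF]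
  fin_cases a <;>
  · simp [Fin.sum_univ_four, sdTable, mink, minkS, hd, h10, h20, h30, h21, h32, h13,
      hP.time]
    ring_nf
    try simp only [hI, hε]
    try ring_nf

end PointwiseIdentities

/-! ### Four-forms on frames and the Gram determinant -/

section VolumeOnFrames

variable {V : Type*} [AddCommGroup V] [Module ℝ V]

/-- The product of differences of `0, 1, 2, 3` in increasing order is 12, so division by 12 leaves
exactly the sign of the permutation. -/
theorem leviZ_perm : ∀ σ : Equiv.Perm (Fin 4),
    leviZ (σ 0) (σ 1) (σ 2) (σ 3) = (Equiv.Perm.sign σ : ℤ) := by decide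

theorem leviZ_eq_zero : ∀ a b c d : Fin 4,
    (a = b ∨ a = c ∨ a = d ∨ b = c ∨ b = d ∨ c = d) → leviZ a b c d = 0 := by decide

/-- Four distinct indices form a permutation and produce its sign; with a repeated index both sides
vanish. -/
theorem alternating_comp (η : V [⋀^Fin 4]→ₗ[ℝ] ℝ) (u : Fin 4 → V) (a b c d : Fin 4) :
    η ![u a, u b, u c, u d] = (leviZ a b c d : ℝ) * η u := by
  have h0 : ![u a, u b, u c, u d] = u ∘ ![a, b, c, d] := by
    funext i; fin_cases i <;> rfl
  rw [h0]
  by_cases hi : Function.Injective ![a, b, c, d]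
  · have hb := Finite.injective_iff_bijective.1 hi
    have h1 : u ∘ ![a, b, c, d] = fun i => u ((Equiv.ofBijective _ hb) i) := rfl
    have h2 := leviZ_perm (Equiv.ofBijective _ hb)
    have h3 : leviZ a b c d = (Equiv.Perm.sign (Equiv.ofBijective _ hb) : ℤ) := h2
    have h4 := η.map_perm u (Equiv.ofBijective _ hb)
    rw [h3]
    refine h4.trans ?_
    rw [Units.smul_def, zsmul_eq_mul]
  · have h1 : η (u ∘ ![a, b, c, d]) = 0 := by
      refine η.map_eq_zero_of_not_injective _ fun h => hi (Function.Injective.of_comp h)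
    rw [h1, leviZ_eq_zero, Int.cast_zero, zero_mul]
    by_contra hcon
    push Not at hcon
    obtain ⟨h1, h2, h3, h4, h5, h6⟩ := hcon
    refine hi ?_
    intro i j hij
    fin_cases i <;> fin_cases j <;> simp_all

theorem vecCons_sum (η : V [⋀^Fin 4]→ₗ[ℝ] ℝ) (i : Fin 4) (w : Fin 4 → V) (c : Fin 4 → ℝ)
    (u : Fin 4 → V) :
    η (Function.update w i (∑ a, c a • u a)) = ∑ a, c a * η (Function.update w i (u a)) := by
  have h := map_sum (η.toMultilinearMap.toLinearMap w i) (fun a => c a • u a) Finset.univ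
  simp only [map_smul] at h
  exact h

theorem alternating_expand (η : V [⋀^Fin 4]→ₗ[ℝ] ℝ) (u : Fin 4 → V) (A : Fin 4 → Fin 4 → ℝ)
    (i j k l : Fin 4) :
    η ![∑ a, A i a • u a, ∑ a, A j a • u a, ∑ a, A k a • u a, ∑ a, A l a • u a]
      = ∑ a, ∑ b, A i a * A j b * ∑ c, ∑ d, A k c * A l d * η ![u a, u b, u c, u d] := by
  have e0 : ∀ x y z w x' : V, Function.update ![x, y, z, w] 0 x' = ![x', y, z, w] := by
    intros; funext m; fin_cases m <;> rfl
  have e1 : ∀ x y z w x' : V, Function.update ![x, y, z, w] 1 x' = ![x, x', z, w] := by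
    intros; funext m; fin_cases m <;> rfl
  have e2 : ∀ x y z w x' : V, Function.update ![x, y, z, w] 2 x' = ![x, y, x', w] := by
    intros; funext m; fin_cases m <;> rfl
  have e3 : ∀ x y z w x' : V, Function.update ![x, y, z, w] 3 x' = ![x, y, z, x'] := by
    intros; funext m; fin_cases m <;> rfl
  have s0 : ∀ y z w : V, ∀ c : Fin 4 → ℝ, η ![∑ a, c a • u a, y, z, w]
      = ∑ a, c a * η ![u a, y, z, w] := fun y z w c => by
    simpa only [e0] using vecCons_sum η 0 ![0, y, z, w] c u
  have s1 : ∀ y z w : V, ∀ c : Fin 4 → ℝ, η ![y, ∑ a, c a • u a, z, w]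
      = ∑ a, c a * η ![y, u a, z, w] := fun y z w c => by
    simpa only [e1] using vecCons_sum η 1 ![y, 0, z, w] c u
  have s2 : ∀ y z w : V, ∀ c : Fin 4 → ℝ, η ![y, z, ∑ a, c a • u a, w]
      = ∑ a, c a * η ![y, z, u a, w] := fun y z w c => by
    simpa only [e2] using vecCons_sum η 2 ![y, z, 0, w] c u
  have s3 : ∀ y z w : V, ∀ c : Fin 4 → ℝ, η ![y, z, w, ∑ a, c a • u a]
      = ∑ a, c a * η ![y, z, w, u a] := fun y z w c => by
    simpa only [e3] using vecCons_sum η 3 ![y, z, w, 0] c u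
  simp only [s0, s1, s2, s3, Finset.mul_sum]
  refine Finset.sum_congr rfl fun a _ => Finset.sum_congr rfl fun b _ =>
    Finset.sum_congr rfl fun c _ => Finset.sum_congr rfl fun d _ => ?_
  ring

theorem alternating_det (η : V [⋀^Fin 4]→ₗ[ℝ] ℝ) (e : Fin 4 → V)
    (A : Matrix (Fin 4) (Fin 4) ℝ) (u : Fin 4 → V) (hu : ∀ i, u i = ∑ a, A i a • e a) :
    η u = A.det * η e := by
  have h : u = Fintype.linearCombination ℝ e ∘ A := by
    funext i
    rw [hu]
    rfl
  have h2 := DFunLike.congr_fun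
    ((η.compLinearMap (Fintype.linearCombination ℝ e)).eq_smul_basis_det (Pi.basisFun ℝ (Fin 4))) A
  have hd : (Pi.basisFun ℝ (Fin 4)).det A = A.det := Pi.basisFun_det_apply A
  have h3 : (η.compLinearMap (Fintype.linearCombination ℝ e)) (Pi.basisFun ℝ (Fin 4)) = η e := by
    refine congrArg η (funext fun i => ?_)
    simp
  rw [h, mul_comm, ← hd, ← h3]
  exact h2

/-- The square of a four-form on four vectors in terms of their Gram matrix. -/
theorem alternating_sq (η : V [⋀^Fin 4]→ₗ[ℝ] ℝ) (e : Fin 4 → V) (hη : |η e| = 1)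
    (A G : Matrix (Fin 4) (Fin 4) ℝ) (u : Fin 4 → V) (hu : ∀ i, u i = ∑ a, A i a • e a)
    (hG : ∀ i j, G i j = ∑ a, A i a * (if a = 0 then -1 else 1) * A j a) :
    η u ^ 2 = - G.det := by
  have h1 := alternating_det η e A u hu
  have h2 : G = A * (Matrix.diagonal fun i => if i = 0 then (-1 : ℝ) else 1) * A.transpose := by
    ext i j
    rw [Matrix.mul_apply, hG]
    simp only [Matrix.mul_diagonal, Matrix.transpose_apply]
  have h3 : η e ^ 2 = 1 := by rw [← sq_abs, hη, one_pow]
  rw [h2, Matrix.det_mul, Matrix.det_mul, Matrix.det_transpose, Matrix.det_diagonal, h1, mul_pow,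
    h3]
  simp
  ring

end VolumeOnFrames

/-! ### Gram matrices, orthonormal frames and frames adapted to a timelike vector -/

section LorentzFrames

variable {M : Type*} [TopologicalSpace M] [ChartedSpace (EuclideanSpace ℝ (Fin 4)) M]
  {g : BilinField 4 M} {p : M}

/-- The real Minkowski matrix. -/
def minkR (i j : Fin 4) : ℝ := if i = j then (if i = 0 then -1 else 1) else 0

theorem minkR_cast (i j : Fin 4) : ((minkR i j : ℝ) : ℂ) = mink i j := by
  fin_cases i <;> fin_cases j <;> simp [minkR, mink, minkS]

/-- The matrix of the components of a frame. -/
def frameMat (e : Fin 4 → Coords 4) : Matrix (Fin 4) (Fin 4) ℝ := Matrix.of fun i a => e i a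

/-- The Gram matrix of a frame. -/
def gram (g : BilinField 4 M) (p : M) (e : Fin 4 → Coords 4) : Matrix (Fin 4) (Fin 4) ℝ :=
  Matrix.of fun i j => bil g p (e i) (e j)

theorem bil_eq_sum (u v : Coords 4) :
    bil g p u v = ∑ a, ∑ b, u a * v b * gdn g p a b := by
  rw [apply_eq_sum (bil g p) u]
  simp only [sum_apply, smul_apply, smul_eq_mul]
  refine Finset.sum_congr rfl fun a _ => ?_
  rw [apply_eq_sum (bil g p (stdVec 4 a)) v, Finset.mul_sum]
  refine Finset.sum_congr rfl fun b _ => ?_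
  rw [smul_eq_mul, gdn_eq, mul_assoc]
  rfl

theorem gram_eq (e : Fin 4 → Coords 4) :
    gram g p e = frameMat e * gdn g p * (frameMat e).transpose := by
  ext i j
  simp only [gram, Matrix.of_apply, bil_eq_sum, Matrix.mul_apply, Matrix.transpose_apply,
    frameMat, Finset.sum_mul]
  rw [Finset.sum_comm]
  refine Finset.sum_congr rfl fun a _ => Finset.sum_congr rfl fun b _ => ?_
  ring

theorem frameMat_det_ne_zero {e : Fin 4 → Coords 4} (h : (gram g p e).det ≠ 0) :
    (frameMat e).det ≠ 0 ∧ (gdn g p).det ≠ 0 := by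
  rw [gram_eq, Matrix.det_mul, Matrix.det_mul] at h
  exact ⟨fun h0 => h (by rw [h0]; ring), fun h0 => h (by rw [h0]; ring)⟩

theorem gup_frame {e : Fin 4 → Coords 4} (h : (gram g p e).det ≠ 0) :
    gup g p = (frameMat e).transpose * (gram g p e)⁻¹ * frameMat e := by
  obtain ⟨h1, h2⟩ := frameMat_det_ne_zero h
  have hA : IsUnit (frameMat e).det := isUnit_iff_ne_zero.2 h1
  have hAt : IsUnit (frameMat e).transpose.det := by rwa [Matrix.det_transpose]
  rw [gup, gram_eq, Matrix.mul_inv_rev, Matrix.mul_inv_rev]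
  rw [← Matrix.mul_assoc, ← Matrix.mul_assoc, Matrix.mul_nonsing_inv _ hAt, Matrix.one_mul,
    Matrix.mul_assoc, Matrix.nonsing_inv_mul _ hA, Matrix.mul_one]

theorem gup_frame_apply {e : Fin 4 → Coords 4} (h : (gram g p e).det ≠ 0) (a b : Fin 4) :
    gup g p a b = ∑ i, ∑ j, e i a * e j b * (gram g p e)⁻¹ i j := by
  rw [gup_frame h, Matrix.mul_apply]
  simp only [Matrix.mul_apply, Matrix.transpose_apply, frameMat, Matrix.of_apply, Finset.sum_mul]
  rw [Finset.sum_comm]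
  refine Finset.sum_congr rfl fun i _ => Finset.sum_congr rfl fun j _ => ?_
  ring

/-- The expansion of a vector in a frame. -/
theorem vec_frame {e : Fin 4 → Coords 4} (h : (gram g p e).det ≠ 0) (v : Coords 4) :
    v = ∑ i, (∑ j, (gram g p e)⁻¹ i j * bil g p (e j) v) • e i := by
  obtain ⟨h1, h2⟩ := frameMat_det_ne_zero h
  have hG : gup g p * gdn g p = 1 := Matrix.nonsing_inv_mul _ (isUnit_iff_ne_zero.2 h2)
  have hv : ∀ j, bil g p (e j) v = ((frameMat e * gdn g p).mulVec v) j := by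
    intro j
    simp only [bil_eq_sum, Matrix.mulVec, dotProduct, Matrix.mul_apply, frameMat, Matrix.of_apply,
      Finset.sum_mul]
    rw [Finset.sum_comm]
    refine Finset.sum_congr rfl fun a _ => Finset.sum_congr rfl fun b _ => ?_
    ring
  have key : (frameMat e).transpose.mulVec ((gram g p e)⁻¹.mulVec
      ((frameMat e * gdn g p).mulVec v)) = v := by
    rw [Matrix.mulVec_mulVec, Matrix.mulVec_mulVec, ← Matrix.mul_assoc,
      ← gup_frame h, hG, Matrix.one_mulVec]
  ext a
  have := congrFun key a
  rw [← this]
  simp only [Matrix.mulVec, dotProduct, hv]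
  simp [frameMat, mul_comm]

theorem gram_orthonormal {e : Fin 4 → Coords 4} (he : IsOrthonormalFrame g p e) :
    gram g p e = Matrix.of minkR := by
  ext i j
  exact he i j

theorem minkR_mul_self : (Matrix.of minkR) * (Matrix.of minkR) = 1 := by
  ext i j
  rw [Matrix.mul_apply]
  fin_cases i <;> fin_cases j <;> simp [minkR]

theorem minkR_det : (Matrix.of minkR).det ≠ 0 := by
  intro h
  have := congrArg Matrix.det minkR_mul_self
  rw [Matrix.det_mul, h] at this
  simp at this

theorem gram_orthonormal_det {e : Fin 4 → Coords 4} (he : IsOrthonormalFrame g p e) :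
    (gram g p e).det ≠ 0 := by rw [gram_orthonormal he]; exact minkR_det

theorem gram_orthonormal_inv {e : Fin 4 → Coords 4} (he : IsOrthonormalFrame g p e) :
    (gram g p e)⁻¹ = Matrix.of minkR := by
  rw [gram_orthonormal he]
  exact Matrix.inv_eq_right_inv minkR_mul_self

theorem vec_orthonormal {e : Fin 4 → Coords 4} (he : IsOrthonormalFrame g p e) (v : Coords 4) :
    v = ∑ i, ((if i = 0 then -1 else 1) * bil g p (e i) v) • e i := by
  conv_lhs => rw [vec_frame (gram_orthonormal_det he) v, gram_orthonormal_inv he]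
  refine Finset.sum_congr rfl fun i _ => ?_
  simp [minkR]

/-- An orthonormal frame whose time axis is along a given timelike vector. -/
theorem exists_adapted_frame (hs : ∀ u v : Coords 4, bil g p u v = bil g p v u)
    {f : Fin 4 → Coords 4} (hf : IsOrthonormalFrame g p f)
    (x : Coords 4) (hx : 0 < - bil g p x x) :
    ∃ e : Fin 4 → Coords 4, IsOrthonormalFrame g p e ∧ x = Real.sqrt (- bil g p x x) • e 0 := by
  set r := Real.sqrt (- bil g p x x) with hr
  have hr0 : 0 < r := Real.sqrt_pos.2 hx
  have hr2 : r ^ 2 = - bil g p x x := Real.sq_sqrt hx.le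
  set t : Coords 4 := r⁻¹ • x with ht
  have htt : bil g p t t = -1 := by
    simp only [ht, map_smul, smul_apply, smul_eq_mul]
    field_simp
    linarith
  have hf' : ∀ a b, bil g p (f a) (f b) = if a = b then (if a = 0 then -1 else 1) else 0 := hf
  -- choose the sign of `f 0` so that it points in the same direction as `t`
  obtain ⟨s, hs1, hs2⟩ : ∃ s : ℝ, s ^ 2 = 1 ∧ s * bil g p (f 0) t ≤ 0 := by
    rcases le_total (bil g p (f 0) t) 0 with h | h
    · exact ⟨1, by norm_num, by linarith⟩
    · exact ⟨-1, by norm_num, by linarith⟩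
  set b0 := s * bil g p (f 0) t with hb0
  -- Reflection in the hyperplane orthogonal to `n` maps `s f₀` to `−t`, hence maps the spatial
  -- vectors `f_i` to an orthonormal triple orthogonal to `t`. The sign `s` makes `b0 ≤ 0`, so that
  -- `⟨n, n⟩ = 2 (b0 − 1)` is not zero; the coefficients `c i` below are those of this reflection.
  set n : Coords 4 := s • f 0 + t with hn
  have ht' := hs t
  have hD : 1 - b0 ≠ 0 := by linarith
  have hcomp : bil g p t t = - (bil g p (f 0) t) ^ 2 + (bil g p (f 1) t) ^ 2
      + (bil g p (f 2) t) ^ 2 + (bil g p (f 3) t) ^ 2 := by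
    conv_lhs => rw [vec_orthonormal hf t]
    simp only [map_sum, map_smul, sum_apply, smul_apply, smul_eq_mul]
    simp only [Fin.sum_univ_four, hf']
    simp
    ring
  let c : Fin 4 → ℝ := fun i => bil g p (f i) t / (1 - b0)
  refine ⟨fun i => if i = 0 then t else f i + c i • n, ?_, ?_⟩
  · have hnt : bil g p n t = b0 - 1 := by
      simp only [hn, map_add, add_apply, map_smul, smul_apply, smul_eq_mul, htt, hb0]
      ring
    have hfn : ∀ i, i ≠ 0 → bil g p (f i) n = bil g p (f i) t := by
      intro i hi
      simp only [hn, map_add, map_smul, smul_eq_mul, hf', hi, if_false]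
      ring
    have hnn : bil g p n n = 2 * (b0 - 1) := by
      simp only [hn, map_add, add_apply, map_smul, smul_apply, smul_eq_mul, htt, hf', ht' (f 0)]
      simp only [if_true]
      rw [hb0]
      linear_combination - hs1
    intro i j
    change bil g p _ _ = _
    by_cases hi : i = 0 <;> by_cases hj : j = 0
    · simp [hi, hj, htt]
    · have h0j : ¬ (0 = j) := fun h => hj h.symm
      simp only [hi, hj, if_true, if_false, map_add, map_smul, smul_eq_mul, h0j]
      rw [hs t (f j), hs t n, hnt]
      simp only [c]
      field_simp
      ring
    · simp only [hi, hj, if_true, if_false, map_add, map_smul, smul_eq_mul, add_apply,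
        smul_apply, hnt]
      simp only [c]
      field_simp
      ring
    · simp only [hi, hj, if_false, map_add, map_smul, smul_eq_mul, add_apply,
        smul_apply, hnn, hfn i hi, hs n (f j), hfn j hj, hf']
      simp only [c]
      have : bil g p (f i) t / (1 - b0) * bil g p (f j) t + bil g p (f j) t / (1 - b0) * (bil g p (f i) t
        + bil g p (f i) t / (1 - b0) * (2 * (b0 - 1))) = 0 := by
        field_simp
        ring
      linarith
  · simp only [if_true, ht, smul_smul, mul_inv_cancel₀ hr0.ne', one_smul]

end LorentzFrames

/-! ### The Killing two-form, its derivative and the tensors of the statement in a frame -/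

section SpacetimeGeometry

variable {M : Type*} [TopologicalSpace M] [ChartedSpace (EuclideanSpace ℝ (Fin 4)) M]
  [IsManifold 𝓘(ℝ, EuclideanSpace ℝ (Fin 4)) 3 M]
  {g : BilinField 4 M} {η : (p : M) → Tan 4 p [⋀^Fin 4]→ₗ[ℝ] ℝ} {ξ : (p : M) → Tan 4 p} {p : M}

theorem IsLorentzMetric.isMetric (hg : IsLorentzMetric g) : IsMetric g where
  symm := hg.symm
  nondeg p v h := by
    obtain ⟨e, he⟩ := hg.signature p
    have hs : ∀ u, bil g p (e u) v = 0 := fun u => (hg.symm p _ _).trans (h (e u))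
    rw [vec_orthonormal he v]
    refine Finset.sum_eq_zero fun i _ => ?_
    rw [hs, mul_zero]
    exact zero_smul ℝ (show Coords 4 from e i)
  contDiffAt p y hy := by
    refine contDiffAt_of_stdVec₂ fun a b => ?_
    refine contDiffAt_of_contMDiffAt hy (contMDiffAt_bilin (hg.contMDiff _)
      (contMDiffAt_coordField hy (stdVec 4 a)) (contMDiffAt_coordField hy (stdVec 4 b)))
      fun z hz => ?_
    rw [(chartC 4 p).right_inv hz]
    rfl

/-- The vector field `ξ` in the basis `frame p`. -/
def vecC (ξ : (p : M) → Tan 4 p) (p : M) : Coords 4 := ξ p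

/-- The one-form `ξ_α` in the basis `frame p`. -/
def flatC (g : BilinField 4 M) (ξ : (p : M) → Tan 4 p) (p : M) : Coords 4 →L[ℝ] ℝ := flat g ξ p

theorem flatC_apply (g : BilinField 4 M) (ξ : (p : M) → Tan 4 p) (p : M) (v : Coords 4) :
    flatC g ξ p v = bil g p (vecC ξ p) v := rfl

theorem IsKilling.contDiffAt_flat (hξ : IsKilling g ξ) (hg : IsLorentzMetric g) (p : M)
    (y : Coords 4) (hy : y ∈ (chartC 4 p).target) : ContDiffAt ℝ 2 (pull1 (flatC g ξ) p) y := by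
  refine contDiffAt_of_stdVec fun a => ?_
  refine contDiffAt_of_contMDiffAt hy (contMDiffAt_bilin (hg.contMDiff _)
    (hξ.contMDiff _) (contMDiffAt_coordField hy (stdVec 4 a))) fun z hz => ?_
  rw [(chartC 4 p).right_inv hz]
  rfl

/-- The two-form `F = ∇ξ`. -/
def kF (g : BilinField 4 M) (ξ : (p : M) → Tan 4 p) (p : M) : Coords 4 →L[ℝ] Coords 4 →L[ℝ] ℝ :=
  nablaForm g (flatC g ξ) p

/-- The second covariant derivative `∇∇ξ`. -/
def kP (g : BilinField 4 M) (ξ : (p : M) → Tan 4 p) (p : M) (u v w : Coords 4) : ℝ :=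
  nablaForm₂ g (kF g ξ) p u v w

theorem IsKilling.killF_eq (hξ : IsKilling g ξ) (hg : IsLorentzMetric g) (p : M) (a b : Fin 4) :
    killF g ξ p a b = kF g ξ p (stdVec 4 a) (stdVec 4 b) :=
  covDeriv_eq (θ := flat g ξ) ((hξ.contDiffAt_flat hg p _
    (coord_mem_target (n := 4) p)).differentiableAt (by norm_num)) a b

theorem bilin_ext {B C : Coords 4 →L[ℝ] Coords 4 →L[ℝ] ℝ}
    (h : ∀ a b, B (stdVec 4 a) (stdVec 4 b) = C (stdVec 4 a) (stdVec 4 b)) : B = C := by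
  ext u v
  rw [apply_eq_sum B u, apply_eq_sum C u]
  simp only [sum_apply, smul_apply]
  refine Finset.sum_congr rfl fun a _ => congrArg _ ?_
  rw [apply_eq_sum _ v, apply_eq_sum (C _) v]
  exact Finset.sum_congr rfl fun b _ => congrArg _ (h a b)

theorem IsKilling.kF_anti (hξ : IsKilling g ξ) (hg : IsLorentzMetric g) (p : M) (u v : Coords 4) :
    kF g ξ p u v = - kF g ξ p v u := by
  have h : kF g ξ p = - (kF g ξ p).flip := by
    refine bilin_ext fun a b => ?_
    have := hξ.killing p a b
    change killF g ξ p a b + killF g ξ p b a = 0 at this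
    rw [hξ.killF_eq hg, hξ.killF_eq hg] at this
    simp only [neg_apply, ContinuousLinearMap.flip_apply]
    linarith
  have := congrArg (fun L => L u v) h
  simpa using this

theorem IsKilling.contDiffAt_kF (hξ : IsKilling g ξ) (hg : IsLorentzMetric g) (p : M)
    (y : Coords 4) (hy : y ∈ (chartC 4 p).target) : ContDiffAt ℝ 1 (pull2 (kF g ξ) p) y :=
  hg.isMetric.contDiffAt_nablaForm (hξ.contDiffAt_flat hg) p y hy

theorem IsKilling.kP_eq (hξ : IsKilling g ξ) (hg : IsLorentzMetric g) (p : M) (u v w : Coords 4) :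
    kP g ξ p w u v = bil g p (vecC ξ p) (curv (conn g p) (coord p) u v w) :=
  hg.isMetric.nablaForm₂_killing (hξ.contDiffAt_flat hg) (hξ.kF_anti hg) p u v w

theorem IsKilling.kP_anti (hξ : IsKilling g ξ) (hg : IsLorentzMetric g) (p : M) (w u v : Coords 4) :
    kP g ξ p w u v = - kP g ξ p w v u := by
  rw [hξ.kP_eq hg, hξ.kP_eq hg, ← map_neg]
  simp only [curv]
  congr 1
  abel

/-- This is `⟨ξ, R(u, v) ξ⟩`, which vanishes since `R(u, v)` is antisymmetric for the metric. -/
theorem IsKilling.kP_time (hξ : IsKilling g ξ) (hg : IsLorentzMetric g) (p : M) (u v : Coords 4) :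
    kP g ξ p (vecC ξ p) u v = 0 := by
  rw [hξ.kP_eq hg]
  have h := hg.isMetric.curv_antisymm p u v (vecC ξ p) (vecC ξ p)
  have hs : bil g p (curv (conn g p) (coord p) u v (vecC ξ p)) (vecC ξ p)
      = bil g p (vecC ξ p) (curv (conn g p) (coord p) u v (vecC ξ p)) := hg.symm p _ _
  linarith

theorem IsKilling.kP_cyclic (hξ : IsKilling g ξ) (hg : IsLorentzMetric g) (p : M)
    (u v w : Coords 4) : kP g ξ p u v w + kP g ξ p v w u + kP g ξ p w u v = 0 := by
  rw [hξ.kP_eq hg, hξ.kP_eq hg, hξ.kP_eq hg, ← map_add, ← map_add,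
    hg.isMetric.curv_bianchi p v w u, map_zero]

theorem IsKilling.kP_stdVec (hξ : IsKilling g ξ) (hg : IsLorentzMetric g) (p : M)
    (b c d : Fin 4) :
    kP g ξ p (stdVec 4 b) (stdVec 4 c) (stdVec 4 d) = ∑ a, comp (ξ p) a * riemann g p a b c d := by
  rw [hξ.kP_eq hg, apply_eq_sum (bil g p)]
  simp only [sum_apply, smul_apply, smul_eq_mul, hg.isMetric.riemann_eq]
  rfl

theorem gdn_mul_gup (hg : IsLorentzMetric g) (p : M) : gdn g p * gup g p = 1 := by
  obtain ⟨e, he⟩ := hg.signature p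
  exact Matrix.mul_nonsing_inv _
    (isUnit_iff_ne_zero.2 (frameMat_det_ne_zero (gram_orthonormal_det he)).2)

theorem gup_mul_gdn (hg : IsLorentzMetric g) (p : M) : gup g p * gdn g p = 1 :=
  mul_eq_one_comm.1 (gdn_mul_gup hg p)

theorem gdn_symm (hg : IsLorentzMetric g) (p : M) (a b : Fin 4) : gdn g p a b = gdn g p b a :=
  hg.symm p _ _

theorem gup_symm (hg : IsLorentzMetric g) (p : M) (a b : Fin 4) : gup g p a b = gup g p b a := by
  have h : (gdn g p).transpose = gdn g p := by
    ext a b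
    exact gdn_symm hg p b a
  have h2 : (gup g p).transpose = gup g p := by rw [gup, Matrix.transpose_nonsing_inv, h]
  exact congrFun (congrFun h2 b) a

/-- Antisymmetry in the first and in the last pair turns the contraction over the second and fourth
index of `R_{abcd}` into the Ricci contraction, which is zero in vacuum. -/
theorem IsKilling.kP_trace (hξ : IsKilling g ξ) (hg : IsLorentzMetric g)
    (hvac : ∀ (p : M) (a b : Fin 4), ricci g p a b = 0) (p : M) (c : Fin 4) :
    ∑ b, ∑ d, gup g p b d * kP g ξ p (stdVec 4 b) (stdVec 4 c) (stdVec 4 d) = 0 := by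
  have hanti : ∀ a b c d, riemann g p a b c d = - riemann g p b a c d := by
    intro a b c d
    rw [hg.isMetric.riemann_eq, hg.isMetric.riemann_eq]
    have h := hg.isMetric.curv_antisymm p (stdVec 4 c) (stdVec 4 d) (stdVec 4 b) (stdVec 4 a)
    have hs : bil g p (curv (conn g p) (coord p) (stdVec 4 c) (stdVec 4 d) (stdVec 4 b))
      (stdVec 4 a) = bil g p (stdVec 4 a)
        (curv (conn g p) (coord p) (stdVec 4 c) (stdVec 4 d) (stdVec 4 b)) := hg.symm p _ _
    linarith
  have hup : ∀ a b c d, ∑ e, gup g p a e * riemann g p e b c d = riemannUp g p a b c d := by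
    intro a b c d
    have h1 : ∀ e, riemann g p e b c d = (gdn g p).mulVec (fun f => riemannUp g p f b c d) e :=
      fun e => rfl
    simp only [h1]
    have := congrFun (Matrix.mulVec_mulVec (fun f => riemannUp g p f b c d) (gup g p) (gdn g p)) a
    rw [gup_mul_gdn hg, Matrix.one_mulVec] at this
    exact this
  have hcd : ∀ a b c d, riemannUp g p a b c d = - riemannUp g p a b d c := by
    intro a b c d
    simp only [riemannUp, Finset.sum_sub_distrib]
    ring
  simp only [hξ.kP_stdVec hg]
  have key : ∀ a, ∑ b, ∑ d, gup g p b d * riemann g p a b c d = 0 := by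
    intro a
    have : ∀ b d, gup g p b d * riemann g p a b c d = - (gup g p d b * riemann g p b a c d) := by
      intro b d
      rw [hanti a b, gup_symm hg]
      ring
    simp only [this, Finset.sum_neg_distrib]
    rw [Finset.sum_comm]
    simp only [hup]
    have h := hvac p a c
    rw [ricci] at h
    simp only [hcd _ a c, Finset.sum_neg_distrib, h, neg_zero]
  calc ∑ b, ∑ d, gup g p b d * ∑ a, comp (ξ p) a * riemann g p a b c d
      = ∑ a, comp (ξ p) a * ∑ b, ∑ d, gup g p b d * riemann g p a b c d := by
        simp only [Finset.mul_sum]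
        rw [Finset.sum_congr rfl fun b _ => Finset.sum_comm, Finset.sum_comm]
        refine Finset.sum_congr rfl fun a _ => Finset.sum_congr rfl fun b _ =>
          Finset.sum_congr rfl fun d _ => ?_
        ring
    _ = 0 := by simp only [key, mul_zero, Finset.sum_const_zero]

/-! ### The tensors of the statement in complex components -/

/-- The inverse metric. -/
def Hc (g : BilinField 4 M) (p : M) (a b : Fin 4) : ℂ := (gup g p a b : ℂ)

/-- The volume form. -/
def Vc (η : (p : M) → Tan 4 p [⋀^Fin 4]→ₗ[ℝ] ℝ) (p : M) (a b c d : Fin 4) : ℂ :=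
  (vol η p a b c d : ℂ)

/-- The Killing vector. -/
def xc (ξ : (p : M) → Tan 4 p) (p : M) (a : Fin 4) : ℂ := (comp (ξ p) a : ℂ)

/-- The two-form `F`. -/
def Fc (g : BilinField 4 M) (ξ : (p : M) → Tan 4 p) (p : M) (a b : Fin 4) : ℂ :=
  (killF g ξ p a b : ℂ)

/-- The curvature `ξ^a R_{abcd}`. -/
def Pc (g : BilinField 4 M) (ξ : (p : M) → Tan 4 p) (p : M) (b c d : Fin 4) : ℂ :=
  ∑ a, (comp (ξ p) a : ℂ) * (riemann g p a b c d : ℂ)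

theorem hodge_cast (B : Fin 4 → Fin 4 → ℝ) (a b : Fin 4) :
    ((hodge g η p B a b : ℝ) : ℂ) = dualF (Hc g p) (Vc η p) (fun c d => (B c d : ℂ)) a b := by
  simp only [hodge, dualF, pairing, raise₂, Hc, Vc, smul_eq_mul]
  push_cast
  rfl

theorem killingForm_eq (a b : Fin 4) :
    killingForm g η ξ p a b = sdF (Hc g p) (Vc η p) (Fc g ξ p) a b := by
  rw [killingForm, hodge_cast]
  rfl

theorem killingForm_eq' : killingForm g η ξ p = sdF (Hc g p) (Vc η p) (Fc g ξ p) := by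
  funext a b
  exact killingForm_eq a b

theorem ernst_eq : ernst g η ξ p = ernstF (Hc g p) (Vc η p) (xc ξ p) (Fc g ξ p) := by
  funext a
  simp only [ernst, ernstF, killingForm_eq, xc]

theorem raise₂_eq (T : Fin 4 → Fin 4 → ℂ) (a b : Fin 4) :
    raise₂ g p T a b = ∑ c, ∑ d, Hc g p a c * Hc g p b d * T c d := by
  simp [raise₂, Hc]

theorem formSq_eq : formSq g η ξ p = pairing (Hc g p) (sdF (Hc g p) (Vc η p) (Fc g ξ p))
    (sdF (Hc g p) (Vc η p) (Fc g ξ p)) := by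
  simp only [formSq, raise₂_eq, killingForm_eq, pairing]

theorem weyl_eq (hvac : ∀ (p : M) (a b : Fin 4), ricci g p a b = 0) (a b c d : Fin 4) :
    weyl g p a b c d = riemann g p a b c d := by
  simp [weyl, scalarCurv, hvac]

/-- Duality acts on the last pair of indices only, hence commutes with the contraction of the first
index with ξ; vacuum replaces the Weyl by the Riemann tensor. -/
theorem sum_sdWeyl (hvac : ∀ (p : M) (a b : Fin 4), ricci g p a b = 0) (b c d : Fin 4) :
    ∑ a, (comp (ξ p) a : ℂ) * sdWeyl g η p a b c d
      = sdF (Hc g p) (Vc η p) (Pc g ξ p b) c d := by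
  have h : Pc g ξ p b = fun k l => ∑ a, (comp (ξ p) a : ℂ)
      * (fun a k l => (riemann g p a b k l : ℂ)) a k l := rfl
  rw [h, sdF_sum]
  refine Finset.sum_congr rfl fun a _ => congrArg _ ?_
  rw [sdWeyl, hodge_cast, sdF]
  simp only [weyl_eq hvac]

theorem tensorY_eq (hvac : ∀ (p : M) (a b : Fin 4), ricci g p a b = 0) :
    tensorY g η ξ p = yF (Hc g p) (Vc η p) (xc ξ p) (Pc g ξ p) := by
  funext a b
  simp only [tensorY, yF, ← sum_sdWeyl hvac, xc]
  rw [Finset.sum_comm]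
  simp only [Finset.mul_sum]
  refine Finset.sum_congr rfl fun d _ => Finset.sum_congr rfl fun c _ => ?_
  ring

theorem weylContr_eq (hvac : ∀ (p : M) (a b : Fin 4), ricci g p a b = 0) :
    weylContr g η ξ p = contrF (Hc g p) (Vc η p) (Pc g ξ p) (Fc g ξ p) := by
  funext c
  simp only [weylContr, contrF, pairing, ← sum_sdWeyl hvac, raise₂_eq, killingForm_eq',
    Finset.sum_mul]
  rw [Finset.sum_comm]
  refine Finset.sum_congr rfl fun r _ => ?_
  rw [Finset.sum_comm]

/-! ### Frames -/

/-- The components of a frame as complex numbers. -/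
def frameC (e : Fin 4 → Coords 4) (i a : Fin 4) : ℂ := (e i a : ℂ)

variable {e : Fin 4 → Coords 4}

theorem Hc_frame (h : (gram g p e).det ≠ 0) (a b : Fin 4) :
    Hc g p a b = ∑ i, ∑ j, frameC e i a * frameC e j b * (((gram g p e)⁻¹ i j : ℝ) : ℂ) := by
  rw [Hc, gup_frame_apply h]
  push_cast
  rfl

theorem xc_frame (h : (gram g p e).det ≠ 0) (a : Fin 4) :
    xc ξ p a = ∑ i, frameC e i a
      * ((∑ j, (gram g p e)⁻¹ i j * bil g p (e j) (vecC ξ p) : ℝ) : ℂ) := by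
  have h1 : comp (ξ p) a = (vecC ξ p) a := rfl
  rw [xc, h1]
  conv_lhs => rw [vec_frame h (vecC ξ p)]
  simp [frameC, mul_comm]

theorem Vc_frame (η : (p : M) → Tan 4 p [⋀^Fin 4]→ₗ[ℝ] ℝ) (p : M) (e : Fin 4 → Coords 4)
    (i j k l : Fin 4) :
    tr4 (frameC e) (Vc η p) i j k l = ((η p ![e i, e j, e k, e l] : ℝ) : ℂ) := by
  have he : ∀ i, e i = ∑ a, e i a • frame p a := fun i => (sum_stdVec (e i)).symm
  have h := alternating_expand (η p) (frame p) (fun i a => e i a) i j k l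
  have h2 : η p ![e i, e j, e k, e l] = η p ![∑ a, e i a • frame p a, ∑ a, e j a • frame p a,
      ∑ a, e k a • frame p a, ∑ a, e l a • frame p a] := by
    rw [← he, ← he, ← he, ← he]
  rw [h2, h]
  push_cast
  rfl

theorem tr2_bilin (B : Coords 4 →L[ℝ] Coords 4 →L[ℝ] ℝ) (i j : Fin 4) :
    tr2 (frameC e) (fun a b => ((B (stdVec 4 a) (stdVec 4 b) : ℝ) : ℂ)) i j
      = ((B (e i) (e j) : ℝ) : ℂ) := by
  rw [apply_eq_sum B (e i)]
  simp only [sum_apply, smul_apply, smul_eq_mul]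
  have h : ∀ a, B (stdVec 4 a) (e j) = ∑ b, e j b * B (stdVec 4 a) (stdVec 4 b) := fun a =>
    apply_eq_sum _ _
  simp only [h]
  push_cast
  simp only [tr2, frameC, Finset.mul_sum, mul_assoc]

theorem Fc_eq (hξ : IsKilling g ξ) (hg : IsLorentzMetric g) (p : M) :
    Fc g ξ p = fun a b => ((kF g ξ p (stdVec 4 a) (stdVec 4 b) : ℝ) : ℂ) := by
  funext a b
  rw [Fc, hξ.killF_eq hg]

theorem Fc_frame (hξ : IsKilling g ξ) (hg : IsLorentzMetric g) (p : M) :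
    tr2 (frameC e) (Fc g ξ p) = fun i j => ((kF g ξ p (e i) (e j) : ℝ) : ℂ) := by
  funext i j
  rw [Fc_eq hξ hg, tr2_bilin]

theorem Pc_eq (hξ : IsKilling g ξ) (hg : IsLorentzMetric g) (p : M) (b c d : Fin 4) :
    Pc g ξ p b c d = ((kP g ξ p (stdVec 4 b) (stdVec 4 c) (stdVec 4 d) : ℝ) : ℂ) := by
  rw [hξ.kP_stdVec hg, Pc]
  push_cast
  rfl

theorem kP_first_sum (g : BilinField 4 M) (ξ : (p : M) → Tan 4 p) (p : M) (u v w : Coords 4) :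
    kP g ξ p u v w = ∑ a, u a * kP g ξ p (stdVec 4 a) v w := by
  refine eq_of_stdVec (f := fun u => kP g ξ p u v w)
    (h := fun u => ∑ a, u a * kP g ξ p (stdVec 4 a) v w) ⟨?_, ?_⟩ ⟨?_, ?_⟩ (fun a => ?_) u
  · intro x y
    simp [kP, nablaForm₂, nabla2]
    ring
  · intro c x
    simp [kP, nablaForm₂, nabla2]
    ring
  · intro x y
    simp [add_mul, Finset.sum_add_distrib]
  · intro c x
    simp [mul_assoc, Finset.mul_sum]
  · simp [stdVec_apply]

/-- `kP` as a bilinear form in its last two arguments. -/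
def kPB (g : BilinField 4 M) (ξ : (p : M) → Tan 4 p) (p : M) (u : Coords 4) :
    Coords 4 →L[ℝ] Coords 4 →L[ℝ] ℝ :=
  fderiv ℝ (pull2 (kF g ξ) p) (coord p) u
    - (pull2 (kF g ξ) p (coord p)).bilinearComp (conn g p (coord p) u) (.id ℝ _)
    - (pull2 (kF g ξ) p (coord p)).bilinearComp (.id ℝ _) (conn g p (coord p) u)

theorem kPB_apply (u v w : Coords 4) : kPB g ξ p u v w = kP g ξ p u v w := by
  simp [kPB, kP, nablaForm₂, nabla2]

theorem Pc_frame (hξ : IsKilling g ξ) (hg : IsLorentzMetric g) (p : M) :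
    tr3 (frameC e) (Pc g ξ p) = fun i j k => ((kP g ξ p (e i) (e j) (e k) : ℝ) : ℂ) := by
  funext i j k
  have h : ∀ a, Pc g ξ p a
      = fun b c => ((kPB g ξ p (stdVec 4 a) (stdVec 4 b) (stdVec 4 c) : ℝ) : ℂ) := by
    intro a
    funext b c
    rw [kPB_apply, Pc_eq hξ hg]
  simp only [tr3, h, tr2_bilin]
  simp only [kPB_apply]
  rw [kP_first_sum g ξ p (e i)]
  push_cast
  rfl

end SpacetimeGeometry

/-! ### Contractions and identities under a change of frame -/

section ChangeOfFrame

variable {A H H' : Fin 4 → Fin 4 → ℂ}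

theorem tr2_eq_tr1 (A T : Fin 4 → Fin 4 → ℂ) (i j : Fin 4) :
    tr2 A T i j = tr1 A (fun a => tr1 A (T a) j) i := by
  simp only [tr2, tr1, Finset.mul_sum, mul_assoc]

theorem tr1_sum_contr {x x' : Fin 4 → ℂ} (hx : ∀ a, x a = ∑ i, A i a * x' i) (w : Fin 4 → ℂ) :
    ∑ i, x' i * tr1 A w i = ∑ a, x a * w a := by
  simp only [tr1, hx, Finset.mul_sum, Finset.sum_mul]
  rw [Finset.sum_comm]
  refine Finset.sum_congr rfl fun a _ => Finset.sum_congr rfl fun i _ => ?_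
  ring

theorem sum_trace_change (hH : ∀ a b, H a b = ∑ i, ∑ j, A i a * A j b * H' i j)
    (Z : Fin 4 → Fin 4 → ℂ) :
    ∑ i, ∑ j, H' i j * tr2 A Z i j = ∑ a, ∑ b, H a b * Z a b := by
  have h1 : ∀ i, ∑ j, H' i j * tr2 A Z i j
      = ∑ a, ∑ b, ∑ j, A i a * A j b * H' i j * Z a b := by
    intro i
    simp only [tr2, Finset.mul_sum]
    rw [Finset.sum_comm]
    refine Finset.sum_congr rfl fun a _ => ?_
    rw [Finset.sum_comm]
    refine Finset.sum_congr rfl fun b _ => Finset.sum_congr rfl fun j _ => ?_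
    ring
  simp only [h1, hH, Finset.sum_mul]
  rw [Finset.sum_comm]
  refine Finset.sum_congr rfl fun a _ => ?_
  rw [Finset.sum_comm]

theorem sum_contr_change (hH : ∀ a b, H a b = ∑ i, ∑ j, A i a * A j b * H' i j)
    (w : Fin 4 → ℂ) (Z : Fin 4 → Fin 4 → ℂ) (c : Fin 4) :
    ∑ i, ∑ j, H' i j * tr1 A w j * tr2 A Z i c
      = tr1 A (fun b => ∑ m, ∑ k, H m k * w k * Z m b) c := by
  have h := sum_trace_change hH (fun m k => w k * tr1 A (Z m) c)
  have h1 : ∀ i j, tr2 A (fun m k => w k * tr1 A (Z m) c) i j = tr1 A w j * tr2 A Z i c := by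
    intro i j
    rw [tr2_eq_tr1 A Z]
    simp only [tr2, tr1, Finset.mul_sum, Finset.sum_mul]
    refine Finset.sum_congr rfl fun a _ => ?_
    rw [Finset.sum_comm]
    refine Finset.sum_congr rfl fun b _ => Finset.sum_congr rfl fun d _ => ?_
    ring
  simp only [h1, ← mul_assoc] at h
  rw [h]
  simp only [tr1, Finset.mul_sum]
  have : ∀ f : Fin 4 → Fin 4 → Fin 4 → ℂ,
      ∑ a, ∑ b, ∑ i, f a b i = ∑ i, ∑ a, ∑ b, f a b i := by
    intro f
    rw [Finset.sum_congr rfl fun _ _ => Finset.sum_comm, Finset.sum_comm]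
  rw [this]
  refine Finset.sum_congr rfl fun a _ => Finset.sum_congr rfl fun b _ =>
    Finset.sum_congr rfl fun d _ => ?_
  ring

/-- Components in an invertible frame determine the tensor; this transfers identities checked in the
adapted frame back to the coordinate basis. -/
theorem tr1_injective (hA : (Matrix.of A).det ≠ 0) {w w' : Fin 4 → ℂ} (h : tr1 A w = tr1 A w') :
    w = w' := by
  have h1 : (Matrix.of A).mulVec (w - w') = 0 := by
    rw [Matrix.mulVec_sub, sub_eq_zero]
    exact h
  exact sub_eq_zero.1 (Matrix.eq_zero_of_mulVec_eq_zero hA h1)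

theorem tr2_injective (hA : (Matrix.of A).det ≠ 0) {T T' : Fin 4 → Fin 4 → ℂ}
    (h : tr2 A T = tr2 A T') : T = T' := by
  have h1 : ∀ j, (fun a => tr1 A (T a) j) = fun a => tr1 A (T' a) j := fun j =>
    tr1_injective hA (funext fun i => by
      rw [← tr2_eq_tr1, ← tr2_eq_tr1, h])
  funext a
  exact tr1_injective hA (funext fun j => congrFun (h1 j) a)

theorem tr2_transpose (A T : Fin 4 → Fin 4 → ℂ) (i j : Fin 4) :
    tr2 A (fun a b => T b a) i j = tr2 A T j i := by
  rw [tr2, Finset.sum_comm]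
  refine Finset.sum_congr rfl fun a _ => Finset.sum_congr rfl fun b _ => ?_
  ring

end ChangeOfFrame

/-! ### Algebraic properties of `σ` and `Y` on the timelike region -/

section AdaptedFrame

variable {M : Type*} [TopologicalSpace M] [ChartedSpace (EuclideanSpace ℝ (Fin 4)) M]
  {g : BilinField 4 M} {η : (p : M) → Tan 4 p [⋀^Fin 4]→ₗ[ℝ] ℝ} {ξ : (p : M) → Tan 4 p} {p : M}
  [IsManifold 𝓘(ℝ, EuclideanSpace ℝ (Fin 4)) 3 M] {e : Fin 4 → Coords 4} {r : ℝ}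

/-- An orthonormal frame at `p` with `ξ = r e₀`, `r = √λ`. -/
structure IsAdaptedFrame (g : BilinField 4 M) (ξ : (p : M) → Tan 4 p) (p : M)
    (e : Fin 4 → Coords 4) (r : ℝ) : Prop where
  orthonormal : IsOrthonormalFrame g p e
  vec_eq : vecC ξ p = r • e 0
  pos : 0 < r
  sq_eq : r ^ 2 = lam g ξ p

/-- The volume form in the frame `e`. -/
def frameVol (ε : ℂ) (a b c d : Fin 4) : ℂ := ε * levi a b c d

theorem IsAdaptedFrame.Hc_eq (h : IsAdaptedFrame g ξ p e r) (a b : Fin 4) :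
    Hc g p a b = ∑ i, ∑ j, frameC e i a * frameC e j b * mink i j := by
  rw [Hc_frame (gram_orthonormal_det h.orthonormal), gram_orthonormal_inv h.orthonormal]
  simp only [Matrix.of_apply, minkR_cast]

theorem IsAdaptedFrame.xc_eq (h : IsAdaptedFrame g ξ p e r) (a : Fin 4) :
    xc ξ p a = ∑ i, frameC e i a * timeVec r i := by
  have h1 : comp (ξ p) a = (vecC ξ p) a := rfl
  rw [xc, h1, h.vec_eq]
  simp [timeVec, frameC, mul_comm]

theorem IsAdaptedFrame.Vc_eq (η : (p : M) → Tan 4 p [⋀^Fin 4]→ₗ[ℝ] ℝ) (p : M)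
    (e : Fin 4 → Coords 4) :
    tr4 (frameC e) (Vc η p) = frameVol ((η p e : ℝ) : ℂ) := by
  funext i j k l
  rw [Vc_frame, frameVol]
  have := alternating_comp (η p) e i j k l
  rw [this, levi]
  push_cast
  ring

theorem IsAdaptedFrame.det_ne_zero (h : IsAdaptedFrame g ξ p e r) :
    (Matrix.of (frameC e)).det ≠ 0 := by
  have h1 := (frameMat_det_ne_zero (gram_orthonormal_det h.orthonormal)).1
  have h2 : Matrix.of (frameC e) = (frameMat e).map Complex.ofRealHom := rfl
  rw [h2, ← RingHom.mapMatrix_apply, ← RingHom.map_det]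
  simpa using h1

theorem exists_isAdaptedFrame (hg : IsLorentzMetric g) (hp : p ∈ timelikeRegion g ξ) :
    ∃ e r, IsAdaptedFrame g ξ p e r := by
  obtain ⟨f, hf⟩ := hg.signature p
  have hp' : 0 < - bil g p (vecC ξ p) (vecC ξ p) := hp
  obtain ⟨e, he, hx⟩ := exists_adapted_frame (fun u v => hg.symm p u v) hf (vecC ξ p) hp'
  exact ⟨e, _, he, hx, Real.sqrt_pos.2 hp', Real.sq_sqrt hp'.le⟩

theorem IsAdaptedFrame.vol_sq (h : IsAdaptedFrame g ξ p e r) (hη : IsVolumeForm g η) :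
    ((η p e : ℝ) : ℂ) ^ 2 = 1 := by
  have h1 := hη.normalized p e h.orthonormal
  have h2 : (η p e) ^ 2 = 1 := by rw [← sq_abs, h1, one_pow]
  exact_mod_cast h2

theorem IsKilling.frame_anti (hξ : IsKilling g ξ) (hg : IsLorentzMetric g) (p : M)
    (e : Fin 4 → Coords 4) (a b : Fin 4) :
    tr2 (frameC e) (Fc g ξ p) a b = - tr2 (frameC e) (Fc g ξ p) b a := by
  rw [Fc_frame hξ hg]
  beta_reduce
  rw [hξ.kF_anti hg]
  push_cast
  rfl

/-- The time components vanish because ξ is a nonzero multiple of `e 0`; the other properties are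
the symmetries of the curvature and the vacuum equations, expressed in the frame. -/
theorem IsAdaptedFrame.isFrameCurv (h : IsAdaptedFrame g ξ p e r) (hξ : IsKilling g ξ)
    (hg : IsLorentzMetric g) (hvac : ∀ (p : M) (a b : Fin 4), ricci g p a b = 0) :
    IsFrameCurv (tr3 (frameC e) (Pc g ξ p)) := by
  have ht : ∀ u v, kP g ξ p (e 0) u v = 0 := by
    intro u v
    have h1 := hξ.kP_time hg p u v
    rw [h.vec_eq, kP_first_sum] at h1
    simp only [PiLp.smul_apply, smul_eq_mul, mul_assoc, ← Finset.mul_sum] at h1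
    rw [← kP_first_sum] at h1
    exact (mul_eq_zero.1 h1).resolve_left h.pos.ne'
  have hanti : ∀ u v w, kP g ξ p u v w = - kP g ξ p u w v := fun u v w => hξ.kP_anti hg p u v w
  rw [Pc_frame hξ hg]
  refine ⟨fun b c d => ?_, fun c d => ?_, fun b c d => ?_, fun c => ?_⟩
  · rw [hanti]
    push_cast
    rfl
  · rw [ht, Complex.ofReal_zero]
  · have := hξ.kP_cyclic hg p (e b) (e c) (e d)
    exact_mod_cast this
  · have h1 : ∀ u, ∑ i, ∑ j, minkR i j * kP g ξ p (e i) u (e j) = 0 := by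
      intro u
      have h2 : ∀ u, ∑ b, ∑ d, gup g p b d * kP g ξ p (stdVec 4 b) u (stdVec 4 d) = 0 := by
        intro u
        have h3 : ∀ u v w, kP g ξ p u v w = ∑ c, v c * kP g ξ p u (stdVec 4 c) w := by
          intro u v w
          simp only [← kPB_apply]
          conv_lhs => rw [apply_eq_sum (kPB g ξ p u) v]
          simp
        simp only [h3 _ u, Finset.mul_sum]
        rw [Finset.sum_congr rfl fun _ _ => Finset.sum_comm, Finset.sum_comm]
        refine Finset.sum_eq_zero fun c _ => ?_
        have := hξ.kP_trace hg hvac p c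
        calc _ = u c * ∑ b, ∑ d, gup g p b d * kP g ξ p (stdVec 4 b) (stdVec 4 c) (stdVec 4 d) := by
              simp only [Finset.mul_sum]
              refine Finset.sum_congr rfl fun a _ => Finset.sum_congr rfl fun b _ => ?_
              ring
          _ = 0 := by rw [this, mul_zero]
      have h4 : ∀ i j, kP g ξ p (e i) u (e j)
          = ∑ a, ∑ b, e i a * e j b * kP g ξ p (stdVec 4 a) u (stdVec 4 b) := by
        intro i j
        rw [kP_first_sum]
        refine Finset.sum_congr rfl fun a _ => ?_
        rw [← kPB_apply, apply_eq_sum _ (e j), Finset.mul_sum]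
        simp only [kPB_apply, smul_eq_mul, mul_assoc]
      rw [← h2 u]
      have h5 : ∀ a b, gup g p a b = ∑ i, ∑ j, e i a * e j b * minkR i j := by
        intro a b
        rw [gup_frame_apply (gram_orthonormal_det h.orthonormal),
          gram_orthonormal_inv h.orthonormal]
        rfl
      simp only [h4, h5, Finset.mul_sum, Finset.sum_mul]
      have hs : ∀ f : Fin 4 → Fin 4 → Fin 4 → Fin 4 → ℝ,
          ∑ i, ∑ j, ∑ a, ∑ b, f i j a b = ∑ a, ∑ b, ∑ i, ∑ j, f i j a b := by
        intro f
        calc ∑ i, ∑ j, ∑ a, ∑ b, f i j a b = ∑ i, ∑ a, ∑ b, ∑ j, f i j a b := by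
              refine Finset.sum_congr rfl fun i _ => ?_
              rw [Finset.sum_comm]
              exact Finset.sum_congr rfl fun a _ => Finset.sum_comm
          _ = _ := by
              rw [Finset.sum_comm]
              exact Finset.sum_congr rfl fun a _ => Finset.sum_comm
      rw [hs]
      refine Finset.sum_congr rfl fun a _ => Finset.sum_congr rfl fun b _ =>
        Finset.sum_congr rfl fun i _ => Finset.sum_congr rfl fun j _ => ?_
      ring
    -- The Minkowski trace reduces to the spatial trace, because the term with `e 0` in the first
    -- slot is zero.
    have h6 := h1 (e c)
    simp [minkR, Fin.sum_univ_four, ht] at h6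
    exact_mod_cast h6

variable (hη : IsVolumeForm g η) (hξ : IsKilling g ξ) (hg : IsLorentzMetric g)
  (hvac : ∀ (p : M) (a b : Fin 4), ricci g p a b = 0)

theorem IsAdaptedFrame.ernst_frame (h : IsAdaptedFrame g ξ p e r) :
    tr1 (frameC e) (ernst g η ξ p)
      = ernstF mink (frameVol ((η p e : ℝ) : ℂ)) (timeVec r) (tr2 (frameC e) (Fc g ξ p)) := by
  rw [ernst_eq, ← ernstF_change h.Hc_eq h.xc_eq, IsAdaptedFrame.Vc_eq]

theorem IsAdaptedFrame.tensorY_frame (h : IsAdaptedFrame g ξ p e r)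
    (hvac : ∀ (p : M) (a b : Fin 4), ricci g p a b = 0) :
    tr2 (frameC e) (tensorY g η ξ p)
      = yF mink (frameVol ((η p e : ℝ) : ℂ)) (timeVec r) (tr3 (frameC e) (Pc g ξ p)) := by
  rw [tensorY_eq hvac, ← yF_change h.Hc_eq h.xc_eq, IsAdaptedFrame.Vc_eq]

theorem IsAdaptedFrame.weylContr_frame (h : IsAdaptedFrame g ξ p e r)
    (hvac : ∀ (p : M) (a b : Fin 4), ricci g p a b = 0) :
    tr1 (frameC e) (weylContr g η ξ p)
      = contrF mink (frameVol ((η p e : ℝ) : ℂ)) (tr3 (frameC e) (Pc g ξ p))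
        (tr2 (frameC e) (Fc g ξ p)) := by
  rw [weylContr_eq hvac, ← contrF_change h.Hc_eq, IsAdaptedFrame.Vc_eq]

theorem IsAdaptedFrame.formSq_frame (h : IsAdaptedFrame g ξ p e r) :
    formSq g η ξ p
      = pairing mink (sdF mink (frameVol ((η p e : ℝ) : ℂ)) (tr2 (frameC e) (Fc g ξ p)))
        (sdF mink (frameVol ((η p e : ℝ) : ℂ)) (tr2 (frameC e) (Fc g ξ p))) := by
  rw [formSq_eq, ← IsAdaptedFrame.Vc_eq, sdF_change h.Hc_eq, pairing_change h.Hc_eq]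

include hη hξ hg

theorem ernst_orth (hp : p ∈ timelikeRegion g ξ) :
    ∑ a, (comp (ξ p) a : ℂ) * ernst g η ξ p a = 0 := by
  obtain ⟨e, r, h⟩ := exists_isAdaptedFrame hg hp
  have h1 := tr1_sum_contr h.xc_eq (ernst g η ξ p)
  refine Eq.trans h1.symm ?_
  rw [h.ernst_frame]
  unfold frameVol
  rw [ernstF_frame (h.vol_sq hη) (hξ.frame_anti hg p e)]
  simp [timeVec]

include hvac

theorem tensorY_symm (hp : p ∈ timelikeRegion g ξ) (a b : Fin 4) :
    tensorY g η ξ p a b = tensorY g η ξ p b a := by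
  obtain ⟨e, r, h⟩ := exists_isAdaptedFrame hg hp
  have h1 : tr2 (frameC e) (tensorY g η ξ p)
      = tr2 (frameC e) (fun a b => tensorY g η ξ p b a) := by
    funext i j
    rw [tr2_transpose _ (tensorY g η ξ p), h.tensorY_frame hvac]
    exact yF_frame_symm (h.vol_sq hη) (h.isFrameCurv hξ hg hvac) i j
  exact congrFun (congrFun (tr2_injective h.det_ne_zero h1) a) b

theorem tensorY_orth (hp : p ∈ timelikeRegion g ξ) (b : Fin 4) :
    ∑ a, (comp (ξ p) a : ℂ) * tensorY g η ξ p a b = 0 := by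
  obtain ⟨e, r, h⟩ := exists_isAdaptedFrame hg hp
  have h1 : tr1 (frameC e) (fun b => ∑ a, (comp (ξ p) a : ℂ) * tensorY g η ξ p a b)
      = tr1 (frameC e) 0 := by
    funext j
    refine (tr2_contr h.xc_eq (tensorY g η ξ p) j).symm.trans ?_
    rw [h.tensorY_frame hvac]
    have hP := h.isFrameCurv hξ hg hvac
    unfold frameVol
    have h0 : yF mink (fun a b c d => ((η p e : ℝ) : ℂ) * levi a b c d) (timeVec r)
        (tr3 (frameC e) (Pc g ξ p)) 0 j = 0 := by
      rw [yF_eq_ernstF, ernstF_frame (h.vol_sq hη) (hP.anti 0)]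
      fin_cases j <;> simp [hP.time]
    simp [timeVec, h0, tr1]
  exact congrFun (tr1_injective h.det_ne_zero h1) b

theorem tensorY_trace (hp : p ∈ timelikeRegion g ξ) : trace g p (tensorY g η ξ p) = 0 := by
  obtain ⟨e, r, h⟩ := exists_isAdaptedFrame hg hp
  refine (sum_trace_change h.Hc_eq (tensorY g η ξ p)).symm.trans ?_
  rw [h.tensorY_frame hvac]
  exact yF_frame_trace (h.vol_sq hη) (h.isFrameCurv hξ hg hvac)

/-- This identity carries the regularity: in `U(Y)` the one-form `σ^m Y_{mc}` is multiplied by `h`,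
singular at λ = 0, and the factor λ extracted here turns `h` into the regular tensor γ. -/
theorem lam_mul_weylContr (hp : p ∈ timelikeRegion g ξ) (c : Fin 4) :
    (lam g ξ p : ℂ) * weylContr g η ξ p c = - sigmaContr g η ξ p (tensorY g η ξ p) c := by
  obtain ⟨e, r, h⟩ := exists_isAdaptedFrame hg hp
  have h1 : tr1 (frameC e) (fun c => (lam g ξ p : ℂ) * weylContr g η ξ p c)
      = tr1 (frameC e) (fun c => - sigmaContr g η ξ p (tensorY g η ξ p) c) := by
    funext j
    have h2 := contrF_frame (r := r) (h.vol_sq hη) (h.isFrameCurv hξ hg hvac)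
      (hξ.frame_anti hg p e) j
    have h3 : tr1 (frameC e) (fun c => (lam g ξ p : ℂ) * weylContr g η ξ p c) j
        = (lam g ξ p : ℂ) * tr1 (frameC e) (weylContr g η ξ p) j := by
      simp only [tr1, Finset.mul_sum]
      exact Finset.sum_congr rfl fun _ _ => by ring
    have h4 : tr1 (frameC e) (fun c => - sigmaContr g η ξ p (tensorY g η ξ p) c) j
        = - tr1 (frameC e) (sigmaContr g η ξ p (tensorY g η ξ p)) j := by
      simp [tr1]
    have h5 := sum_contr_change h.Hc_eq (ernst g η ξ p) (tensorY g η ξ p) j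
    have h6 : sigmaContr g η ξ p (tensorY g η ξ p) = fun b => ∑ m, ∑ k, Hc g p m k
      * ernst g η ξ p k * tensorY g η ξ p m b := rfl
    rw [h3, h4, h6, ← h5, h.weylContr_frame hvac, h.ernst_frame, h.tensorY_frame hvac, ← h.sq_eq]
    push_cast
    exact h2
  exact congrFun (tr1_injective h.det_ne_zero h1) c

end AdaptedFrame

/-! ### The kernel of `U` and the value `U(Y)` -/

section SimonMap

variable {M : Type*} [TopologicalSpace M] [ChartedSpace (EuclideanSpace ℝ (Fin 4)) M]
  [IsManifold 𝓘(ℝ, EuclideanSpace ℝ (Fin 4)) 3 M]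
  {g : BilinField 4 M} {η : (p : M) → Tan 4 p [⋀^Fin 4]→ₗ[ℝ] ℝ} {ξ : (p : M) → Tan 4 p} {p : M}

theorem xiDn_eq (hg : IsLorentzMetric g) (p : M) (a : Fin 4) :
    xiDn g ξ p a = ∑ b, gdn g p a b * comp (ξ p) b := by
  have h : xiDn g ξ p a = bil g p (vecC ξ p) (stdVec 4 a) := rfl
  rw [h, apply_eq_sum (bil g p)]
  simp only [sum_apply, smul_apply, smul_eq_mul]
  refine Finset.sum_congr rfl fun b _ => ?_
  rw [mul_comm, gdn_symm hg]
  rfl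

theorem xiDn_contr (g : BilinField 4 M) (ξ : (p : M) → Tan 4 p) (p : M) :
    ∑ a, comp (ξ p) a * xiDn g ξ p a = - lam g ξ p := by
  have h : lam g ξ p = - bil g p (vecC ξ p) (vecC ξ p) := rfl
  rw [h, apply_eq_sum _ (vecC ξ p), neg_neg]
  rfl

theorem gup_xiDn (hg : IsLorentzMetric g) (p : M) (a : Fin 4) :
    ∑ b, gup g p a b * xiDn g ξ p b = comp (ξ p) a := by
  have h : xiDn g ξ p = (gdn g p).mulVec (comp (ξ p)) := funext fun a => xiDn_eq hg p a
  have h1 := congrFun (Matrix.mulVec_mulVec (comp (ξ p)) (gup g p) (gdn g p)) a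
  rw [gup_mul_gdn hg, Matrix.one_mulVec, ← h] at h1
  exact h1

theorem projMetric_symm (hg : IsLorentzMetric g) (p : M) (a b : Fin 4) :
    projMetric g ξ p a b = projMetric g ξ p b a := by
  rw [projMetric, projMetric, gdn_symm hg]
  ring

theorem projMetric_contr (hg : IsLorentzMetric g) (hp : p ∈ timelikeRegion g ξ) (b : Fin 4) :
    ∑ a, comp (ξ p) a * projMetric g ξ p a b = 0 := by
  have hl : lam g ξ p ≠ 0 := ne_of_gt hp
  have h1 := xiDn_contr g ξ p
  have h2 := xiDn_eq hg (ξ := ξ) p b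
  calc _ = ∑ a, gdn g p b a * comp (ξ p) a
        + (lam g ξ p)⁻¹ * (∑ a, comp (ξ p) a * xiDn g ξ p a) * xiDn g ξ p b := by
        rw [Finset.mul_sum, Finset.sum_mul, ← Finset.sum_add_distrib]
        refine Finset.sum_congr rfl fun a _ => ?_
        rw [projMetric, gdn_symm hg]
        ring
    _ = 0 := by
        rw [← h2, h1]
        field_simp
        ring

theorem trace_projMetric (hg : IsLorentzMetric g) (hp : p ∈ timelikeRegion g ξ) :
    trace g p (fun a b => (projMetric g ξ p a b : ℂ)) = 3 := by
  have hl : lam g ξ p ≠ 0 := ne_of_gt hp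
  have h1 : ∑ a, ∑ b, gup g p a b * projMetric g ξ p a b = 3 := by
    have h2 : ∀ a, ∑ b, gup g p a b * gdn g p b a = 1 := fun a => by
      have := congrFun (congrFun (gup_mul_gdn hg p) a) a
      rwa [Matrix.mul_apply, Matrix.one_apply_eq] at this
    have h3 : ∀ a, ∑ b, gup g p a b * projMetric g ξ p a b
        = 1 + (lam g ξ p)⁻¹ * (comp (ξ p) a * xiDn g ξ p a) := by
      intro a
      rw [← h2 a, ← gup_xiDn hg, Finset.sum_mul, Finset.mul_sum, ← Finset.sum_add_distrib]
      refine Finset.sum_congr rfl fun b _ => ?_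
      rw [projMetric, gdn_symm hg]
      ring
    simp only [h3, Finset.sum_add_distrib, ← Finset.mul_sum, xiDn_contr]
    rw [mul_neg, inv_mul_cancel₀ hl]
    norm_num
  rw [trace]
  exact_mod_cast h1

variable (hη : IsVolumeForm g η) (hξ : IsKilling g ξ) (hg : IsLorentzMetric g)

include hη hξ hg

/-- With one index raised, `h` is the identity plus a multiple of `ξ ⊗ ξ_α`; the second part does
not contribute since `σ(ξ) = 0`. -/
theorem sigmaContr_projMetric (hp : p ∈ timelikeRegion g ξ) (c : Fin 4) :
    sigmaContr g η ξ p (fun a b => (projMetric g ξ p a b : ℂ)) c = ernst g η ξ p c := by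
  have h2 : ∀ k, ∑ m, gup g p m k * projMetric g ξ p m c
      = (if k = c then 1 else 0) + (lam g ξ p)⁻¹ * comp (ξ p) k * xiDn g ξ p c := by
    intro k
    have h3 : ∑ m, gup g p k m * gdn g p m c = if k = c then 1 else 0 := by
      have := congrFun (congrFun (gup_mul_gdn hg p) k) c
      rwa [Matrix.mul_apply, Matrix.one_apply] at this
    rw [← h3, ← gup_xiDn hg, Finset.mul_sum, Finset.sum_mul, ← Finset.sum_add_distrib]
    refine Finset.sum_congr rfl fun m _ => ?_
    rw [projMetric, gup_symm hg p m k]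
    ring
  have h4 : ∀ k, ∑ m, (gup g p m k : ℂ) * ernst g η ξ p k * (projMetric g ξ p m c : ℂ)
      = (if k = c then ernst g η ξ p k else 0)
        + (lam g ξ p : ℂ)⁻¹ * (xiDn g ξ p c : ℂ) * ((comp (ξ p) k : ℂ) * ernst g η ξ p k) := by
    intro k
    have h5 := congrArg (Complex.ofReal) (h2 k)
    push_cast at h5
    calc _ = (∑ m, (gup g p m k : ℂ) * (projMetric g ξ p m c : ℂ)) * ernst g η ξ p k := by
          rw [Finset.sum_mul]
          exact Finset.sum_congr rfl fun _ _ => by ring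
      _ = _ := by
          rw [h5]
          split_ifs <;> push_cast <;> ring
  rw [sigmaContr, Finset.sum_comm]
  simp only [h4, Finset.sum_add_distrib, ← Finset.mul_sum, ernst_orth hη hξ hg hp]
  simp

/-- For `h` the bracket in `U` is `3σ_c − σ_c = 2σ_c`, whose half cancels the leading terms. For `σ
⊗ σ` the leading terms cancel by symmetry and the bracket is `N σ_c − N σ_c = 0`, where `N = σ^m
σ_m`. -/
theorem mapU_add (hp : p ∈ timelikeRegion g ξ) (Z : Fin 4 → Fin 4 → ℂ) (s₁ s₂ : ℂ) :
    mapU g η ξ p (fun a b => Z a b + s₁ * (projMetric g ξ p a b : ℂ)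
      + s₂ * ernst g η ξ p a * ernst g η ξ p b) = mapU g η ξ p Z := by
  set N := ∑ m, ∑ k, (gup g p m k : ℂ) * ernst g η ξ p k * ernst g η ξ p m with hN
  have ht : trace g p (fun a b => Z a b + s₁ * (projMetric g ξ p a b : ℂ)
      + s₂ * ernst g η ξ p a * ernst g η ξ p b) = trace g p Z + 3 * s₁ + s₂ * N := by
    rw [← trace_projMetric hg hp, trace, trace, trace, hN]
    simp only [Finset.mul_sum, Finset.sum_mul, ← Finset.sum_add_distrib]
    refine Finset.sum_congr rfl fun a _ => Finset.sum_congr rfl fun b _ => ?_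
    ring
  have hc : ∀ c, sigmaContr g η ξ p (fun a b => Z a b + s₁ * (projMetric g ξ p a b : ℂ)
      + s₂ * ernst g η ξ p a * ernst g η ξ p b) c
      = sigmaContr g η ξ p Z c + s₁ * ernst g η ξ p c + s₂ * N * ernst g η ξ p c := by
    intro c
    have h := congrArg (fun t => sigmaContr g η ξ p Z c + s₁ * t + s₂ * N * ernst g η ξ p c)
      (sigmaContr_projMetric hη hξ hg hp c)
    refine Eq.trans ?_ h
    rw [sigmaContr, sigmaContr, sigmaContr, hN]
    simp only [Finset.mul_sum, Finset.sum_mul, ← Finset.sum_add_distrib]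
    refine Finset.sum_congr rfl fun a _ => Finset.sum_congr rfl fun b _ => ?_
    ring
  funext a b c
  simp only [mapU, ht, hc]
  ring

theorem mapU_singularPart_aux (hp : p ∈ timelikeRegion g ξ) (Z : Fin 4 → Fin 4 → ℂ) :
    mapU g η ξ p (fun a b => Z a b + singularPart g η ξ p a b) = mapU g η ξ p Z := by
  rw [← mapU_add hη hξ hg hp Z (-(1 / 2) * formSq g η ξ p) (-(1 / (2 * (lam g ξ p : ℂ))))]
  congr 1
  funext a b
  rw [singularPart]
  ring

theorem mapU_singularPart (hp : p ∈ timelikeRegion g ξ) :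
    mapU g η ξ p (singularPart g η ξ p) = 0 := by
  have h := mapU_singularPart_aux hη hξ hg hp 0
  simp only [Pi.zero_apply, zero_add] at h
  refine h.trans ?_
  funext a b c
  simp [mapU, trace, sigmaContr]

theorem symOrth_projMetric (hp : p ∈ timelikeRegion g ξ) :
    SymOrth ξ p (fun a b => (projMetric g ξ p a b : ℂ)) := by
  refine ⟨fun a b => congrArg _ (projMetric_symm hg p a b), fun b => ?_⟩
  beta_reduce
  exact_mod_cast projMetric_contr hg hp b

theorem symOrth_ernst (hp : p ∈ timelikeRegion g ξ) :
    SymOrth ξ p (fun a b => ernst g η ξ p a * ernst g η ξ p b) := by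
  refine ⟨fun a b => mul_comm _ _, fun b => ?_⟩
  simp only [← mul_assoc, ← Finset.sum_mul, ernst_orth hη hξ hg hp, zero_mul]

theorem symOrth_singularPart (hp : p ∈ timelikeRegion g ξ) :
    SymOrth ξ p (singularPart g η ξ p) := by
  obtain ⟨h1, h2⟩ := symOrth_projMetric hη hξ hg hp
  obtain ⟨h3, h4⟩ := symOrth_ernst hη hξ hg hp
  refine ⟨fun a b => ?_, fun b => ?_⟩
  · rw [singularPart, singularPart, projMetric_symm hg]
    ring
  · calc _ = (- (1 / 2) * formSq g η ξ p) * ∑ a, (comp (ξ p) a : ℂ) * (projMetric g ξ p a b : ℂ)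
          - 1 / (2 * (lam g ξ p : ℂ))
            * ∑ a, (comp (ξ p) a : ℂ) * (ernst g η ξ p a * ernst g η ξ p b) := by
          rw [Finset.mul_sum, Finset.mul_sum, ← Finset.sum_sub_distrib]
          refine Finset.sum_congr rfl fun a _ => ?_
          rw [singularPart]
          ring
      _ = 0 := by rw [h2, h4, mul_zero, mul_zero, sub_zero]

theorem gammaMetric_eq_lam_mul (hp : p ∈ timelikeRegion g ξ) (a b : Fin 4) :
    gammaMetric g ξ p a b = lam g ξ p * projMetric g ξ p a b := by
  have hl : lam g ξ p ≠ 0 := ne_of_gt hp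
  rw [gammaMetric, projMetric]
  field_simp

/-- The trace terms of `U` drop out because `Y` is trace-free, and `lam_mul_weylContr` with `γ = λ
h` rewrites the other correction terms. -/
theorem mapU_tensorY (hvac : ∀ (p : M) (a b : Fin 4), ricci g p a b = 0)
    (hp : p ∈ timelikeRegion g ξ) :
    mapU g η ξ p (tensorY g η ξ p) = spacetimeSimon g η ξ p := by
  funext a b c
  have hs : ∀ c, sigmaContr g η ξ p (tensorY g η ξ p) c
      = - ((lam g ξ p : ℂ) * weylContr g η ξ p c) := fun c => by
    rw [lam_mul_weylContr hη hξ hg hvac hp, neg_neg]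
  rw [mapU, spacetimeSimon, tensorY_trace hη hξ hg hvac hp, hs, hs,
    gammaMetric_eq_lam_mul hη hξ hg hp, gammaMetric_eq_lam_mul hη hξ hg hp]
  push_cast
  ring

end SimonMap

/-! ### Continuity of the algebraic constructions -/

section Regularity

variable {α : Type*} [TopologicalSpace α]

theorem continuousAt_pairing {y : α} {H S T : α → Fin 4 → Fin 4 → ℂ}
    (hH : ContinuousAt H y) (hS : ContinuousAt S y) (hT : ContinuousAt T y) :
    ContinuousAt (fun z => pairing (H z) (S z) (T z)) y := by
  have e : ∀ {T : α → Fin 4 → Fin 4 → ℂ}, ContinuousAt T y → ∀ a b,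
      ContinuousAt (fun z => T z a b) y := fun h a b => continuousAt_pi.1 (continuousAt_pi.1 h a) b
  exact tendsto_finsetSum _ fun a _ => tendsto_finsetSum _ fun b _ => (e hS a b).mul
    (tendsto_finsetSum _ fun c _ => tendsto_finsetSum _ fun d _ =>
      ((e hH a c).mul (e hH b d)).mul (e hT c d))

theorem continuousAt_sdF {y : α} {H B : α → Fin 4 → Fin 4 → ℂ}
    {V : α → Fin 4 → Fin 4 → Fin 4 → Fin 4 → ℂ}
    (hH : ContinuousAt H y) (hV : ContinuousAt V y) (hB : ContinuousAt B y) :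
    ContinuousAt (fun z => sdF (H z) (V z) (B z)) y := by
  refine continuousAt_pi.2 fun a => continuousAt_pi.2 fun b => ?_
  refine (continuousAt_pi.1 (continuousAt_pi.1 hB a) b).add (continuousAt_const.mul
    (continuousAt_const.mul (continuousAt_pairing hH ?_ hB)))
  exact continuousAt_pi.1 (continuousAt_pi.1 hV a) b

theorem continuousAt_ernstF {y : α} {H : α → Fin 4 → Fin 4 → ℂ}
    {V : α → Fin 4 → Fin 4 → Fin 4 → Fin 4 → ℂ} {x : α → Fin 4 → ℂ} {F : α → Fin 4 → Fin 4 → ℂ}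
    (hH : ContinuousAt H y) (hV : ContinuousAt V y) (hx : ContinuousAt x y) (hF : ContinuousAt F y)
    (a : Fin 4) : ContinuousAt (fun z => ernstF (H z) (V z) (x z) (F z) a) y :=
  continuousAt_const.mul (tendsto_finsetSum _ fun b _ => (continuousAt_pi.1 hx b).mul
    (continuousAt_pi.1 (continuousAt_pi.1 (continuousAt_sdF hH hV hF) b) a))

theorem continuousAt_contrF {y : α} {H : α → Fin 4 → Fin 4 → ℂ}
    {V : α → Fin 4 → Fin 4 → Fin 4 → Fin 4 → ℂ} {P : α → Fin 4 → Fin 4 → Fin 4 → ℂ}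
    {F : α → Fin 4 → Fin 4 → ℂ}
    (hH : ContinuousAt H y) (hV : ContinuousAt V y) (hP : ContinuousAt P y) (hF : ContinuousAt F y)
    (a : Fin 4) : ContinuousAt (fun z => contrF (H z) (V z) (P z) (F z) a) y :=
  continuousAt_pairing hH (continuousAt_sdF hH hV (continuousAt_pi.1 hP a))
    (continuousAt_sdF hH hV hF)

end Regularity

/-! ### Components in arbitrary frames and continuity of the spacetime Simon tensor -/

section FrameComponents

open Filter

variable {M : Type*} [TopologicalSpace M] [ChartedSpace (EuclideanSpace ℝ (Fin 4)) M]
  [IsManifold 𝓘(ℝ, EuclideanSpace ℝ (Fin 4)) 3 M]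
  {g : BilinField 4 M} {η : (p : M) → Tan 4 p [⋀^Fin 4]→ₗ[ℝ] ℝ} {ξ : (p : M) → Tan 4 p} {p : M}

/-- The components of the inverse of a real matrix, as complex numbers. -/
def invC (G : Matrix (Fin 4) (Fin 4) ℝ) (a b : Fin 4) : ℂ := ((G⁻¹ a b : ℝ) : ℂ)

/-- The components of a vector with covariant components `f`. -/
def upC (G : Matrix (Fin 4) (Fin 4) ℝ) (f : Fin 4 → ℝ) (a : Fin 4) : ℂ :=
  ((∑ b, G⁻¹ a b * f b : ℝ) : ℂ)

/-- The components of a bilinear form in a frame, as complex numbers. -/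
def formC (B : Coords 4 → Coords 4 → ℝ) (u : Fin 4 → Coords 4) (i j : Fin 4) : ℂ :=
  (B (u i) (u j) : ℂ)

/-- The components of `kP` in a frame. -/
def curvC (P : Coords 4 → Coords 4 → Coords 4 → ℝ) (u : Fin 4 → Coords 4) (i j k : Fin 4) : ℂ :=
  (P (u i) (u j) (u k) : ℂ)

variable {u : Fin 4 → Coords 4} {q : M}

theorem tr4_frameVol (η : (p : M) → Tan 4 p [⋀^Fin 4]→ₗ[ℝ] ℝ) (q : M) (u : Fin 4 → Coords 4) :
    tr4 (frameC u) (Vc η q) = frameVol ((η q u : ℝ) : ℂ) := IsAdaptedFrame.Vc_eq η q u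

/-- Only nondegeneracy of the Gram matrix is required, so the formula holds whatever the sign of λ.
It is used for coordinate frames, to prove continuity, and for frames moved along a line, to
differentiate `σ`. -/
theorem ernst_components (hξ : IsKilling g ξ) (hg : IsLorentzMetric g)
    (h : (gram g q u).det ≠ 0) :
    tr1 (frameC u) (ernst g η ξ q)
      = ernstF (invC (gram g q u)) (frameVol ((η q u : ℝ) : ℂ))
        (upC (gram g q u) fun j => bil g q (u j) (vecC ξ q)) (formC (fun v w => kF g ξ q v w) u) := by
  have h1 := ernstF_change (H := Hc g q) (A := frameC u) (Hc_frame h) (xc_frame (ξ := ξ) h)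
    (Vc η q) (Fc g ξ q)
  rw [ernst_eq, ← h1, tr4_frameVol, Fc_frame hξ hg]
  rfl

theorem tensorY_components (hξ : IsKilling g ξ) (hg : IsLorentzMetric g)
    (hvac : ∀ (p : M) (a b : Fin 4), ricci g p a b = 0) (h : (gram g q u).det ≠ 0) :
    tr2 (frameC u) (tensorY g η ξ q)
      = yF (invC (gram g q u)) (frameVol ((η q u : ℝ) : ℂ))
        (upC (gram g q u) fun j => bil g q (u j) (vecC ξ q)) (curvC (kP g ξ q) u) := by
  have h1 := yF_change (H := Hc g q) (A := frameC u) (Hc_frame h) (xc_frame (ξ := ξ) h)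
    (Vc η q) (Pc g ξ q)
  rw [tensorY_eq hvac, ← h1, tr4_frameVol, Pc_frame hξ hg]
  rfl

theorem weylContr_components (hξ : IsKilling g ξ) (hg : IsLorentzMetric g)
    (hvac : ∀ (p : M) (a b : Fin 4), ricci g p a b = 0) (h : (gram g q u).det ≠ 0) :
    tr1 (frameC u) (weylContr g η ξ q)
      = contrF (invC (gram g q u)) (frameVol ((η q u : ℝ) : ℂ)) (curvC (kP g ξ q) u)
        (formC (fun v w => kF g ξ q v w) u) := by
  have h1 := contrF_change (H := Hc g q) (A := frameC u) (Hc_frame h)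
    (Vc η q) (Pc g ξ q) (Fc g ξ q)
  rw [weylContr_eq hvac, ← h1, tr4_frameVol, Fc_frame hξ hg, Pc_frame hξ hg]
  rfl

/-! ### Regularity of the components in a chart -/

/-- The coordinate frame of the chart at `p`. -/
def chartFrame (p : M) (y : Coords 4) (i : Fin 4) : Coords 4 := dchart p y (stdVec 4 i)

theorem gram_chartFrame (g : BilinField 4 M) (p : M) (y : Coords 4) :
    gram g ((chartC 4 p).symm y) (chartFrame p y) = localMetric g p y := rfl

theorem gram_chartFrame_det (hg : IsLorentzMetric g) {y : Coords 4}
    (hy : y ∈ (chartC 4 p).target) :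
    (gram g ((chartC 4 p).symm y) (chartFrame p y)).det ≠ 0 := by
  rw [gram_chartFrame]
  exact hg.isMetric.localMetric_det hy

theorem contDiffAt_localMetric (hg : IsLorentzMetric g) {y : Coords 4}
    (hy : y ∈ (chartC 4 p).target) (i j : Fin 4) :
    ContDiffAt ℝ 2 (fun z => localMetric g p z i j) y :=
  ((hg.isMetric.contDiffAt p y hy).clm_apply contDiffAt_const).clm_apply contDiffAt_const

theorem contDiffAt_localMetric_inv (hg : IsLorentzMetric g) {y : Coords 4}
    (hy : y ∈ (chartC 4 p).target) (i j : Fin 4) :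
    ContDiffAt ℝ 2 (fun z => (localMetric g p z)⁻¹ i j) y :=
  contDiffAt_inv_matrix (contDiffAt_localMetric hg hy) (hg.isMetric.localMetric_det hy) i j

theorem continuousAt_vol_chartFrame (hη : IsVolumeForm g η) {y : Coords 4}
    (hy : y ∈ (chartC 4 p).target) :
    ContinuousAt (fun z => η ((chartC 4 p).symm z) (chartFrame p z)) y := by
  have h := (hη.continuous ((chartC 4 p).symm y)
    (fun i q => (dchart p (chartC 4 p q) (stdVec 4 i) : Coords 4))
    (fun i => (contMDiffAt_coordField hy (stdVec 4 i)).continuousAt))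
  refine (ContinuousAt.comp (f := (chartC 4 p).symm) h (continuousAt_chart_symm hy)).congr ?_
  filter_upwards [target_mem_nhds hy] with z hz
  simp only [Function.comp_apply, (chartC 4 p).right_inv hz]
  rfl

/-- The functions of a chart that determine the Ernst form. -/
theorem continuousAt_components (hη : IsVolumeForm g η) (hξ : IsKilling g ξ)
    (hg : IsLorentzMetric g) {y : Coords 4} (hy : y ∈ (chartC 4 p).target) :
    ContinuousAt (fun z => invC (gram g ((chartC 4 p).symm z) (chartFrame p z))) y ∧
    ContinuousAt (fun z => frameVol ((η ((chartC 4 p).symm z) (chartFrame p z) : ℝ) : ℂ)) y ∧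
    ContinuousAt (fun z => upC (gram g ((chartC 4 p).symm z) (chartFrame p z))
      fun j => bil g ((chartC 4 p).symm z) (chartFrame p z j) (vecC ξ ((chartC 4 p).symm z))) y ∧
    ContinuousAt (fun z => formC (fun v w => kF g ξ ((chartC 4 p).symm z) v w)
      (chartFrame p z)) y ∧
    ContinuousAt (fun z => curvC (kP g ξ ((chartC 4 p).symm z)) (chartFrame p z)) y := by
  have hF := hξ.contDiffAt_kF hg p y hy
  have hinv : ∀ i j, ContinuousAt (fun z => (localMetric g p z)⁻¹ i j) y := fun i j =>
    (contDiffAt_localMetric_inv hg hy i j).continuousAt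
  have hfl : ∀ j, ContinuousAt (fun z => pull1 (flatC g ξ) p z (stdVec 4 j)) y := fun j =>
    ((hξ.contDiffAt_flat hg p y hy).continuousAt.clm_apply continuousAt_const)
  have hfl' : ∀ z j, bil g ((chartC 4 p).symm z) (chartFrame p z j) (vecC ξ ((chartC 4 p).symm z))
      = pull1 (flatC g ξ) p z (stdVec 4 j) := fun z j => hg.symm _ _ _
  refine ⟨?_, ?_, ?_, ?_, ?_⟩
  · refine continuousAt_pi.2 fun i => continuousAt_pi.2 fun j => ?_
    exact Complex.continuous_ofReal.continuousAt.comp (hinv i j)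
  · refine continuousAt_pi.2 fun i => continuousAt_pi.2 fun j => continuousAt_pi.2 fun k =>
      continuousAt_pi.2 fun l => ?_
    exact (Complex.continuous_ofReal.continuousAt.comp
      (continuousAt_vol_chartFrame hη hy)).mul continuousAt_const
  · refine continuousAt_pi.2 fun i => ?_
    refine Complex.continuous_ofReal.continuousAt.comp ?_
    refine tendsto_finsetSum _ fun j _ => ?_
    simp only [hfl']
    exact (hinv i j).mul (hfl j)
  · refine continuousAt_pi.2 fun i => continuousAt_pi.2 fun j => ?_
    refine Complex.continuous_ofReal.continuousAt.comp ?_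
    exact (hF.continuousAt.clm_apply continuousAt_const).clm_apply continuousAt_const
  · refine continuousAt_pi.2 fun i => continuousAt_pi.2 fun j => continuousAt_pi.2 fun k => ?_
    refine Complex.continuous_ofReal.continuousAt.comp ?_
    have hd : ∀ (p : M) (y : Coords 4), y ∈ (chartC 4 p).target →
        DifferentiableAt ℝ (pull2 (kF g ξ) p) y := fun p y hy =>
      (hξ.contDiffAt_kF hg p y hy).differentiableAt (by norm_num)
    -- Written as `∇F`, the curvature contraction involves one derivative of a C¹ form and
    -- undifferentiated Christoffel symbols, hence is continuous.
    have hc : ContinuousAt (fun z => nabla2 (conn g p) (pull2 (kF g ξ) p) z (stdVec 4 i)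
        (stdVec 4 j) (stdVec 4 k)) y := by
      have h1 : ContinuousAt (fderiv ℝ (pull2 (kF g ξ) p)) y :=
        (hF.fderiv_right (m := 0) (by norm_num)).continuousAt
      have h2 : ContinuousAt (conn g p) y := (hg.isMetric.contDiffAt_conn hy).continuousAt
      have h3 : ContinuousAt (pull2 (kF g ξ) p) y := hF.continuousAt
      unfold nabla2
      fun_prop
    refine hc.congr ?_
    filter_upwards [target_mem_nhds hy] with z hz
    exact (hg.isMetric.nablaForm₂_dchart hz hd _ _ _).symm

/-- The components `comp (X q)` refer to the preferred chart at `q`, which may jump with `q`.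
Continuity of the field means continuity of its components in one fixed chart, which the
trivialization at `p` provides. -/
theorem exists_components_of_vecContinuousAt {X : (q : M) → Tan 4 q} (hX : VecContinuousAt X p) :
    ∃ x : Coords 4 → Coords 4, ContinuousAt x (coord p) ∧
      ∀ᶠ y in 𝓝 (coord p), vecC X ((chartC 4 p).symm y) = dchart p y (x y) := by
  have hy := coord_mem_target (n := 4) p
  refine ⟨fun y => fderiv ℝ (inCharts 4 4 ((chartC 4 p).symm y) p (id : M → M))
    (coord ((chartC 4 p).symm y)) (vecC X ((chartC 4 p).symm y)), ?_, ?_⟩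
  · have h1 := ((FiberBundle.continuousAt_totalSpace _ _).1 hX).2
    have h2 : ContinuousAt (fun q => fderiv ℝ (inCharts 4 4 q p (id : M → M)) (coord q)
        (vecC X q)) p := by
      refine h1.congr (Eventually.of_forall fun q => ?_)
      simp only [TangentBundle.trivializationAt_apply, modelWithCornersSelf_coe, Set.range_id,
        fderivWithin_univ]
      rfl
    have h3 : ContinuousAt (fun q => fderiv ℝ (inCharts 4 4 q p (id : M → M)) (coord q)
        (vecC X q)) ((chartC 4 p).symm (coord p)) := by rwa [symm_coord (n := 4)]
    exact ContinuousAt.comp (f := (chartC 4 p).symm) h3 (continuousAt_chart_symm hy)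
  · filter_upwards [target_mem_nhds hy] with y hy
    obtain ⟨v, hv⟩ := dchart_surjective hy (vecC X ((chartC 4 p).symm y))
    rw [← hv, fderiv_trans_dchart hy]

theorem continuousAt_of_chart {β : Type*} [TopologicalSpace β] {f : M → β}
    (h : ContinuousAt (fun y => f ((chartC 4 p).symm y)) (coord p)) : ContinuousAt f p := by
  have h1 : ContinuousAt (chartC 4 p) p := continuousAt_extChartAt p
  refine (ContinuousAt.comp (f := chartC 4 p) h h1).congr ?_
  filter_upwards [(isOpen_extChartAt_source p).mem_nhds
    (mem_extChartAt_source (I := 𝓘(ℝ, EuclideanSpace ℝ (Fin 4))) p)] with q hq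
  exact congrArg f ((chartC 4 p).left_inv hq)

theorem sum_comp_dchart {y x : Coords 4} {X : (q : M) → Tan 4 q}
    (h : vecC X ((chartC 4 p).symm y) = dchart p y x) (a : Fin 4) :
    ((comp (X ((chartC 4 p).symm y)) a : ℝ) : ℂ)
      = ∑ i, frameC (chartFrame p y) i a * ((x i : ℝ) : ℂ) := by
  have h1 : comp (X ((chartC 4 p).symm y)) a = (vecC X ((chartC 4 p).symm y)) a := rfl
  rw [h1, h, apply_eq_sum]
  simp [frameC, chartFrame, mul_comm]

theorem tr1_contr {A : Fin 4 → Fin 4 → ℂ} {x x' : Fin 4 → ℂ}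
    (hx : ∀ a, x a = ∑ i, A i a * x' i) (w : Fin 4 → ℂ) :
    ∑ a, w a * x a = ∑ i, tr1 A w i * x' i := by
  simp only [mul_comm (w _), mul_comm (tr1 A w _)]
  exact (tr1_sum_contr hx w).symm

theorem tr2_contr₂ {A : Fin 4 → Fin 4 → ℂ} {x x' z z' : Fin 4 → ℂ}
    (hx : ∀ a, x a = ∑ i, A i a * x' i) (hz : ∀ a, z a = ∑ i, A i a * z' i)
    (T : Fin 4 → Fin 4 → ℂ) :
    ∑ a, ∑ b, T a b * x a * z b = ∑ i, ∑ j, tr2 A T i j * x' i * z' j := by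
  have h1 : ∑ a, ∑ b, T a b * x a * z b = ∑ b, (∑ a, x a * T a b) * z b := by
    rw [Finset.sum_comm]
    refine Finset.sum_congr rfl fun b _ => ?_
    rw [Finset.sum_mul]
    exact Finset.sum_congr rfl fun a _ => by ring
  have h2 : ∑ i, ∑ j, tr2 A T i j * x' i * z' j = ∑ j, (∑ i, x' i * tr2 A T i j) * z' j := by
    rw [Finset.sum_comm]
    refine Finset.sum_congr rfl fun b _ => ?_
    rw [Finset.sum_mul]
    exact Finset.sum_congr rfl fun a _ => by ring
  rw [h1, h2, tr1_contr hz]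
  exact Finset.sum_congr rfl fun j _ => by rw [tr2_contr hx]

/-- The tensor is a sum of products of `Y`, `σ`, γ and the Weyl contraction, none of which contains
a negative power of λ. Each factor, contracted with continuous vector fields, is continuous. -/
theorem isContinuousTensor₃_spacetimeSimon (hη : IsVolumeForm g η) (hξ : IsKilling g ξ)
    (hg : IsLorentzMetric g) (hvac : ∀ (p : M) (a b : Fin 4), ricci g p a b = 0) :
    IsContinuousTensor₃ (spacetimeSimon g η ξ) := by
  intro p X Y Z hX hY hZ
  have hy := coord_mem_target (n := 4) p
  have hdet : ∀ᶠ y in 𝓝 (coord p),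
      (gram g ((chartC 4 p).symm y) (chartFrame p y)).det ≠ 0 := by
    filter_upwards [target_mem_nhds hy] with y hy using gram_chartFrame_det hg hy
  obtain ⟨hH, hV, hx, hF, hP⟩ := continuousAt_components hη hξ hg hy
  -- A contraction does not depend on the frame, so it may be evaluated in the coordinate frame of
  -- the chart at `p` instead of the frames that vary with `q`.
  have hpair₁ : ∀ {T : M → Fin 4 → ℂ} {T' : Coords 4 → Fin 4 → ℂ},
      (∀ i, ContinuousAt (fun y => T' y i) (coord p)) →
      (∀ᶠ y in 𝓝 (coord p), tr1 (frameC (chartFrame p y)) (T ((chartC 4 p).symm y)) = T' y) →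
      ∀ {X : (q : M) → Tan 4 q}, VecContinuousAt X p →
      ContinuousAt (fun q => ∑ a, T q a * (comp (X q) a : ℂ)) p := by
    intro T T' hT' hT X hX
    obtain ⟨x, hxc, hxe⟩ := exists_components_of_vecContinuousAt hX
    refine continuousAt_of_chart ?_
    have hc : ContinuousAt (fun y => ∑ i, T' y i * ((x y i : ℝ) : ℂ)) (coord p) := by
      refine tendsto_finsetSum _ fun i _ => (hT' i).mul ?_
      exact Complex.continuous_ofReal.continuousAt.comp
        ((EuclideanSpace.proj (𝕜 := ℝ) i).continuous.continuousAt.comp hxc)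
    refine hc.congr ?_
    filter_upwards [hT, hxe] with y h1 h2
    rw [tr1_contr (sum_comp_dchart h2), h1]
  have hpair₂ : ∀ {T : M → Fin 4 → Fin 4 → ℂ} {T' : Coords 4 → Fin 4 → Fin 4 → ℂ},
      (∀ i j, ContinuousAt (fun y => T' y i j) (coord p)) →
      (∀ᶠ y in 𝓝 (coord p), tr2 (frameC (chartFrame p y)) (T ((chartC 4 p).symm y)) = T' y) →
      ∀ {X Y : (q : M) → Tan 4 q}, VecContinuousAt X p → VecContinuousAt Y p →
      ContinuousAt (fun q => ∑ a, ∑ b, T q a b * (comp (X q) a : ℂ) * (comp (Y q) b : ℂ)) p := by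
    intro T T' hT' hT X Y hX hY
    obtain ⟨x, hxc, hxe⟩ := exists_components_of_vecContinuousAt hX
    obtain ⟨z, hzc, hze⟩ := exists_components_of_vecContinuousAt hY
    refine continuousAt_of_chart ?_
    have hc : ContinuousAt (fun y => ∑ i, ∑ j, T' y i j * ((x y i : ℝ) : ℂ) * ((z y j : ℝ) : ℂ))
        (coord p) := by
      refine tendsto_finsetSum _ fun i _ => tendsto_finsetSum _ fun j _ =>
        ((hT' i j).mul ?_).mul ?_
      · exact Complex.continuous_ofReal.continuousAt.comp
          ((EuclideanSpace.proj (𝕜 := ℝ) i).continuous.continuousAt.comp hxc)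
      · exact Complex.continuous_ofReal.continuousAt.comp
          ((EuclideanSpace.proj (𝕜 := ℝ) j).continuous.continuousAt.comp hzc)
    refine hc.congr ?_
    filter_upwards [hT, hxe, hze] with y h1 h2 h3
    rw [tr2_contr₂ (sum_comp_dchart h2) (sum_comp_dchart h3), h1]
  have cσ := fun {X} hX => hpair₁ (T := ernst g η ξ)
    (fun i => continuousAt_ernstF hH hV hx hF i)
    (hdet.mono fun y h => ernst_components hξ hg h) (X := X) hX
  have cw := fun {X} hX => hpair₁ (T := weylContr g η ξ)
    (fun i => continuousAt_contrF hH hV hP hF i)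
    (hdet.mono fun y h => weylContr_components hξ hg hvac h) (X := X) hX
  have cY := fun {X Y} hX hY => hpair₂ (T := tensorY g η ξ)
    (fun i j => continuousAt_ernstF hH hV hx (continuousAt_pi.1 hP i) j)
    (hdet.mono fun y h => tensorY_components hξ hg hvac h) (X := X) (Y := Y) hX hY
  have hbil : ∀ {X Y : (q : M) → Tan 4 q}, VecContinuousAt X p → VecContinuousAt Y p →
      ContinuousAt (fun q => bil g q (vecC X q) (vecC Y q)) p := by
    intro X Y hX hY
    obtain ⟨x, hxc, hxe⟩ := exists_components_of_vecContinuousAt hX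
    obtain ⟨z, hzc, hze⟩ := exists_components_of_vecContinuousAt hY
    refine continuousAt_of_chart ?_
    refine ((((hg.isMetric.contDiffAt p _ hy).continuousAt).clm_apply hxc).clm_apply hzc).congr ?_
    filter_upwards [hxe, hze] with y h1 h2
    rw [h1, h2]
    rfl
  have hξc : VecContinuousAt ξ p := (hξ.contMDiff p).continuousAt
  have cγ : ∀ {X Y : (q : M) → Tan 4 q}, VecContinuousAt X p → VecContinuousAt Y p →
      ContinuousAt (fun q => ∑ a, ∑ b, (gammaMetric g ξ q a b : ℂ) * (comp (X q) a : ℂ)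
        * (comp (Y q) b : ℂ)) p := by
    intro X Y hX hY
    have h : ∀ q, ∑ a, ∑ b, gammaMetric g ξ q a b * comp (X q) a * comp (Y q) b
        = - bil g q (vecC ξ q) (vecC ξ q) * bil g q (vecC X q) (vecC Y q)
          + bil g q (vecC ξ q) (vecC X q) * bil g q (vecC ξ q) (vecC Y q) := by
      intro q
      have e1 : ∀ X : (q : M) → Tan 4 q, bil g q (vecC ξ q) (vecC X q)
          = ∑ a, comp (X q) a * xiDn g ξ q a := fun X => apply_eq_sum _ _
      rw [e1 X, e1 Y, bil_eq_sum (vecC X q), Finset.sum_mul_sum, Finset.mul_sum]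
      rw [← Finset.sum_add_distrib]
      refine Finset.sum_congr rfl fun a _ => ?_
      rw [Finset.mul_sum, ← Finset.sum_add_distrib]
      refine Finset.sum_congr rfl fun b _ => ?_
      have e2 : lam g ξ q = - bil g q (vecC ξ q) (vecC ξ q) := rfl
      have e3 : (vecC X q) a = comp (X q) a := rfl
      have e4 : (vecC Y q) b = comp (Y q) b := rfl
      rw [gammaMetric, e2, e3, e4]
      ring
    have hc := Complex.continuous_ofReal.continuousAt.comp
      (((hbil hξc hξc).neg.mul (hbil hX hY)).add ((hbil hξc hX).mul (hbil hξc hY)))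
    refine hc.congr (Eventually.of_forall fun q => ?_)
    have := congrArg Complex.ofReal (h q)
    push_cast at this
    simp only [Function.comp_apply, this, Pi.add_apply, Pi.mul_apply, Pi.neg_apply]
    push_cast
    rfl
  have hfin := ((((cY hX hY).mul (cσ hZ)).sub ((cY hX hZ).mul (cσ hY))).sub
    ((continuousAt_const (y := (1 / 2 : ℂ))).mul ((cγ hX hY).mul (cw hZ)))).add
    ((continuousAt_const (y := (1 / 2 : ℂ))).mul ((cγ hX hZ).mul (cw hY)))
  refine hfin.congr (Eventually.of_forall fun q => ?_)
  have sw : ∀ (T : Fin 4 → Fin 4 → ℂ) (s x y z : Fin 4 → ℂ),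
      (∑ a, ∑ b, T a b * x a * z b) * ∑ c, s c * y c
        = ∑ a, ∑ b, ∑ c, T a c * s b * x a * y b * z c := by
    intro T s x y z
    rw [Finset.sum_mul]
    refine Finset.sum_congr rfl fun a _ => ?_
    rw [Finset.sum_mul_sum, Finset.sum_comm]
    exact Finset.sum_congr rfl fun b _ => Finset.sum_congr rfl fun c _ => by ring
  have sw' : ∀ (T : Fin 4 → Fin 4 → ℂ) (s x y z : Fin 4 → ℂ),
      (∑ a, ∑ b, T a b * x a * y b) * ∑ c, s c * z c
        = ∑ a, ∑ b, ∑ c, T a b * s c * x a * y b * z c := by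
    intro T s x y z
    rw [Finset.sum_mul]
    refine Finset.sum_congr rfl fun a _ => ?_
    rw [Finset.sum_mul_sum]
    exact Finset.sum_congr rfl fun b _ => Finset.sum_congr rfl fun c _ => by ring
  simp only [Pi.add_apply, Pi.sub_apply, Pi.mul_apply]
  simp only [sw' _ _ (fun a => ((comp (X q) a : ℝ) : ℂ)) (fun a => ((comp (Y q) a : ℝ) : ℂ))
      (fun a => ((comp (Z q) a : ℝ) : ℂ)),
    sw _ _ (fun a => ((comp (X q) a : ℝ) : ℂ)) (fun a => ((comp (Y q) a : ℝ) : ℂ))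
      (fun a => ((comp (Z q) a : ℝ) : ℂ)), Finset.mul_sum, ← Finset.sum_sub_distrib,
    ← Finset.sum_add_distrib]
  refine Finset.sum_congr rfl fun a _ => Finset.sum_congr rfl fun b _ =>
    Finset.sum_congr rfl fun c _ => ?_
  rw [spacetimeSimon]
  ring

end FrameComponents

/-! ### Differentiation along lines in frames that are parallel to first order -/

section Derivatives

/-- A continuous function that does not vanish at `y` keeps its sign nearby, so it is plus or minus
the square root of its square. The volume form is only assumed continuous; its differentiability is
obtained in this way. -/
theorem hasFDerivAt_of_sq {E : Type*} [NormedAddCommGroup E] [NormedSpace ℝ E] {f h : E → ℝ}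
    {h' : E →L[ℝ] ℝ} {y : E} (hf : ContinuousAt f y) (hfy : f y ≠ 0)
    (hsq : ∀ᶠ z in 𝓝 y, f z ^ 2 = h z) (hh : HasFDerivAt h h' y) :
    HasFDerivAt f ((1 / (2 * f y)) • h') y := by
  have hy : h y = f y ^ 2 := hsq.self_of_nhds.symm
  rcases lt_or_gt_of_ne hfy with hneg | hpos
  · have h1 : HasFDerivAt (fun z => - Real.sqrt (h z)) (-((1 / (2 * Real.sqrt (h y))) • h')) y :=
      (hh.sqrt (by rw [hy]; positivity)).neg
    have h2 : Real.sqrt (h y) = - f y := by rw [hy, Real.sqrt_sq_eq_abs, abs_of_neg hneg]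
    have h3 : -((1 / (2 * Real.sqrt (h y))) • h') = (1 / (2 * f y)) • h' := by
      rw [h2, ← neg_smul]
      congr 1
      field_simp
    rw [h3] at h1
    refine h1.congr_of_eventuallyEq ?_
    filter_upwards [hsq, hf.eventually (gt_mem_nhds hneg)] with z hz hz'
    rw [← hz, Real.sqrt_sq_eq_abs, abs_of_neg hz', neg_neg]
  · have h1 := hh.sqrt (x := y) (by rw [hy]; positivity)
    have h2 : Real.sqrt (h y) = f y := by rw [hy, Real.sqrt_sq hpos.le]
    rw [h2] at h1
    refine h1.congr_of_eventuallyEq ?_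
    filter_upwards [hsq, hf.eventually (lt_mem_nhds hpos)] with z hz hz'
    rw [← hz, Real.sqrt_sq hz'.le]

section Curves

variable {H S T B : ℝ → Fin 4 → Fin 4 → ℂ} {V : ℝ → Fin 4 → Fin 4 → Fin 4 → Fin 4 → ℂ}
  {x : ℝ → Fin 4 → ℂ} {S' T' B' : Fin 4 → Fin 4 → ℂ} {x' : Fin 4 → ℂ} {t : ℝ}

theorem hasDerivAt_pairing (hH : ∀ a b, HasDerivAt (fun s => H s a b) 0 t)
    (hS : ∀ a b, HasDerivAt (fun s => S s a b) (S' a b) t)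
    (hT : ∀ a b, HasDerivAt (fun s => T s a b) (T' a b) t) :
    HasDerivAt (fun s => pairing (H s) (S s) (T s))
      (pairing (H t) S' (T t) + pairing (H t) (S t) T') t := by
  have h := HasDerivAt.fun_sum (u := Finset.univ) fun a _ =>
    HasDerivAt.fun_sum (u := Finset.univ) fun b _ => (hS a b).mul
      (HasDerivAt.fun_sum (u := Finset.univ) fun c _ => HasDerivAt.fun_sum (u := Finset.univ)
        fun d _ => ((hH a c).mul (hH b d)).mul (hT c d))
  refine h.congr_deriv ?_
  simp only [pairing, zero_mul, mul_zero, add_zero, zero_add, Finset.sum_add_distrib, Pi.mul_apply]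

theorem hasDerivAt_sdF (hH : ∀ a b, HasDerivAt (fun s => H s a b) 0 t)
    (hV : ∀ a b c d, HasDerivAt (fun s => V s a b c d) 0 t)
    (hB : ∀ a b, HasDerivAt (fun s => B s a b) (B' a b) t) (a b : Fin 4) :
    HasDerivAt (fun s => sdF (H s) (V s) (B s) a b) (sdF (H t) (V t) B' a b) t := by
  have h1 := hasDerivAt_pairing (S' := fun _ _ => 0) hH (fun c d => hV a b c d) hB
  have h2 : pairing (H t) (fun _ _ => 0) (B t) = 0 := by simp [pairing]
  rw [h2, zero_add] at h1
  exact (hB a b).add ((h1.const_mul (1 / 2)).const_mul Complex.I)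

theorem hasDerivAt_ernstF (hH : ∀ a b, HasDerivAt (fun s => H s a b) 0 t)
    (hV : ∀ a b c d, HasDerivAt (fun s => V s a b c d) 0 t)
    (hx : ∀ a, HasDerivAt (fun s => x s a) (x' a) t)
    (hB : ∀ a b, HasDerivAt (fun s => B s a b) (B' a b) t) (a : Fin 4) :
    HasDerivAt (fun s => ernstF (H s) (V s) (x s) (B s) a)
      (ernstF (H t) (V t) x' (B t) a + ernstF (H t) (V t) (x t) B' a) t := by
  have h := (HasDerivAt.fun_sum (u := Finset.univ) fun b _ =>
    (hx b).mul (hasDerivAt_sdF hH hV hB b a)).const_mul 2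
  refine h.congr_deriv ?_
  simp only [ernstF, Finset.sum_add_distrib, mul_add]

end Curves

section Differentiability

variable {E : Type*} [NormedAddCommGroup E] [NormedSpace ℝ E]
  {H S T B : E → Fin 4 → Fin 4 → ℂ} {V : E → Fin 4 → Fin 4 → Fin 4 → Fin 4 → ℂ}
  {x : E → Fin 4 → ℂ} {y : E}

theorem differentiableAt_pairing (hH : ∀ a b, DifferentiableAt ℝ (fun s => H s a b) y)
    (hS : ∀ a b, DifferentiableAt ℝ (fun s => S s a b) y)
    (hT : ∀ a b, DifferentiableAt ℝ (fun s => T s a b) y) :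
    DifferentiableAt ℝ (fun s => pairing (H s) (S s) (T s)) y :=
  DifferentiableAt.fun_sum fun a _ => DifferentiableAt.fun_sum fun b _ => (hS a b).mul
    (DifferentiableAt.fun_sum fun c _ => DifferentiableAt.fun_sum fun d _ =>
      ((hH a c).mul (hH b d)).mul (hT c d))

theorem differentiableAt_ernstF (hH : ∀ a b, DifferentiableAt ℝ (fun s => H s a b) y)
    (hV : ∀ a b c d, DifferentiableAt ℝ (fun s => V s a b c d) y)
    (hx : ∀ a, DifferentiableAt ℝ (fun s => x s a) y)
    (hB : ∀ a b, DifferentiableAt ℝ (fun s => B s a b) y) (a : Fin 4) :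
    DifferentiableAt ℝ (fun s => ernstF (H s) (V s) (x s) (B s) a) y :=
  (DifferentiableAt.fun_sum fun b _ => (hx b).mul ((hB b a).add
    (((differentiableAt_pairing hH (fun c d => hV b a c d) hB).const_mul (1 / 2)).const_mul
      Complex.I))).const_mul 2

end Differentiability

/-- A frame that is parallel at `y` to first order. -/
def movedFrame (Γ : Coords 4 → Coords 4 →L[ℝ] Coords 4 →L[ℝ] Coords 4) (y w : Coords 4)
    (v : Coords 4) (t : ℝ) : Coords 4 := v - t • Γ y w v

theorem hasDerivAt_movedFrame (Γ : Coords 4 → Coords 4 →L[ℝ] Coords 4 →L[ℝ] Coords 4)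
    (y w v : Coords 4) : HasDerivAt (movedFrame Γ y w v) (- Γ y w v) 0 := by
  have h := ((hasDerivAt_id (0 : ℝ)).smul_const (Γ y w v)).const_sub v
  rw [one_smul] at h
  exact h

theorem movedFrame_zero (Γ : Coords 4 → Coords 4 →L[ℝ] Coords 4 →L[ℝ] Coords 4)
    (y w v : Coords 4) : movedFrame Γ y w v 0 = v := by simp [movedFrame]

theorem hasDerivAt_line {F : Type*} [NormedAddCommGroup F] [NormedSpace ℝ F] {f : Coords 4 → F}
    {y : Coords 4} (hf : DifferentiableAt ℝ f y) (w : Coords 4) :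
    HasDerivAt (fun t : ℝ => f (y + t • w)) (fderiv ℝ f y w) 0 := by
  have h1 : HasDerivAt (fun t : ℝ => y + t • w) w 0 := by
    have h := ((hasDerivAt_id (0 : ℝ)).smul_const w).const_add y
    rw [one_smul] at h
    exact h
  have h2 : HasFDerivAt f (fderiv ℝ f y) (y + (0 : ℝ) • w) := by
    simpa using hf.hasFDerivAt
  exact h2.comp_hasDerivAt (0 : ℝ) h1

/-- The first-order correction in `movedFrame` supplies exactly the connection term, so an ordinary
derivative at `t = 0` is the covariant derivative. -/
theorem hasDerivAt_nabla1 {F : Type*} [NormedAddCommGroup F] [NormedSpace ℝ F]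
    {Γ : Coords 4 → Coords 4 →L[ℝ] Coords 4 →L[ℝ] Coords 4} {θ : Coords 4 → Coords 4 →L[ℝ] F}
    {y : Coords 4} (hθ : DifferentiableAt ℝ θ y) (w v : Coords 4) :
    HasDerivAt (fun t : ℝ => θ (y + t • w) (movedFrame Γ y w v t)) (nabla1 Γ θ y w v) 0 := by
  have h := (hasDerivAt_line hθ w).clm_apply (hasDerivAt_movedFrame Γ y w v)
  refine h.congr_deriv ?_
  simp [nabla1, movedFrame_zero, sub_eq_add_neg]

theorem hasDerivAt_nabla2 {F : Type*} [NormedAddCommGroup F] [NormedSpace ℝ F]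
    {Γ : Coords 4 → Coords 4 →L[ℝ] Coords 4 →L[ℝ] Coords 4}
    {B : Coords 4 → Coords 4 →L[ℝ] Coords 4 →L[ℝ] F}
    {y : Coords 4} (hB : DifferentiableAt ℝ B y) (w u v : Coords 4) :
    HasDerivAt (fun t : ℝ => B (y + t • w) (movedFrame Γ y w u t) (movedFrame Γ y w v t))
      (nabla2 Γ B y w u v) 0 := by
  have h := ((hasDerivAt_line hB w).clm_apply (hasDerivAt_movedFrame Γ y w u)).clm_apply
    (hasDerivAt_movedFrame Γ y w v)
  refine h.congr_deriv ?_
  simp [nabla2, movedFrame_zero, sub_eq_add_neg, add_apply]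

theorem hasDerivAt_zero_comp {f : (Fin 4 → Fin 4 → ℝ) → ℝ} {c : ℝ → Fin 4 → Fin 4 → ℝ} {t : ℝ}
    (hf : DifferentiableAt ℝ f (c t)) (hc : ∀ i j, HasDerivAt (fun s => c s i j) 0 t) :
    HasDerivAt (fun s => f (c s)) 0 t := by
  have h : HasDerivAt c 0 t := hasDerivAt_pi.2 fun i => hasDerivAt_pi.2 fun j => hc i j
  exact (hf.hasFDerivAt.comp_hasDerivAt t h).congr_deriv (map_zero _)

end Derivatives

/-! ### The covariant derivative of the Ernst one-form -/

section ErnstDerivative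

open Filter

variable {M : Type*} [TopologicalSpace M] [ChartedSpace (EuclideanSpace ℝ (Fin 4)) M]
  [IsManifold 𝓘(ℝ, EuclideanSpace ℝ (Fin 4)) 3 M]
  {g : BilinField 4 M} {η : (p : M) → Tan 4 p [⋀^Fin 4]→ₗ[ℝ] ℝ} {ξ : (p : M) → Tan 4 p} {p : M}

theorem vol_sq_gram (hη : IsVolumeForm g η) (hg : IsLorentzMetric g) (q : M)
    (u : Fin 4 → Coords 4) : (η q u) ^ 2 = - (gram g q u).det := by
  obtain ⟨e, he⟩ : ∃ e : Fin 4 → Coords 4, IsOrthonormalFrame g q e := hg.signature q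
  have hv := fun i => vec_orthonormal he (u i)
  refine alternating_sq (η q) e (hη.normalized q e he)
    (Matrix.of fun i a => (if a = 0 then -1 else 1) * bil g q (e a) (u i)) (gram g q u) u
    (fun i => hv i) fun i j => ?_
  have h : gram g q u i j = bil g q (u i) (u j) := rfl
  rw [h]
  conv_lhs => rw [hv i]
  rw [map_sum, sum_apply]
  refine Finset.sum_congr rfl fun a _ => ?_
  rw [map_smul, smul_apply, smul_eq_mul, Matrix.of_apply, Matrix.of_apply]
  split_ifs <;> ring

/-- The Ernst one-form. -/
def ernstForm (g : BilinField 4 M) (η : (p : M) → Tan 4 p [⋀^Fin 4]→ₗ[ℝ] ℝ) (ξ : (p : M) → Tan 4 p)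
    (p : M) : Coords 4 →L[ℝ] ℂ :=
  ∑ a, (EuclideanSpace.proj a : Coords 4 →L[ℝ] ℝ).smulRight (ernst g η ξ p a)

theorem ernstForm_apply (p : M) (v : Coords 4) :
    ernstForm g η ξ p v = ∑ a, (v a : ℂ) * ernst g η ξ p a := by
  simp [ernstForm]

theorem ernstForm_stdVec (p : M) (a : Fin 4) :
    ernstForm g η ξ p (stdVec 4 a) = ernst g η ξ p a := by
  simp [ernstForm_apply, stdVec_apply, apply_ite Complex.ofReal]

theorem tr1_ernst (q : M) (u : Fin 4 → Coords 4) (i : Fin 4) :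
    tr1 (frameC u) (ernst g η ξ q) i = ernstForm g η ξ q (u i) := (ernstForm_apply q (u i)).symm

variable (hη : IsVolumeForm g η) (hξ : IsKilling g ξ) (hg : IsLorentzMetric g)

include hη hξ hg

theorem differentiableAt_vol_chartFrame {y : Coords 4} (hy : y ∈ (chartC 4 p).target) :
    DifferentiableAt ℝ (fun z => η ((chartC 4 p).symm z) (chartFrame p z)) y := by
  have hd : DifferentiableAt ℝ (fun z => - (localMetric g p z).det) y :=
    ((contDiffAt_det fun i j => contDiffAt_localMetric hg hy i j).differentiableAt
      (by norm_num)).neg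
  refine (hasFDerivAt_of_sq (continuousAt_vol_chartFrame hη hy) ?_
    (Eventually.of_forall fun z => vol_sq_gram hη hg _ _) hd.hasFDerivAt).differentiableAt
  intro h0
  have h := vol_sq_gram hη hg ((chartC 4 p).symm y) (chartFrame p y)
  rw [h0] at h
  exact gram_chartFrame_det hg hy (by linarith)

/-- In the coordinate frame `σ` is polynomial in the inverse metric, the volume form, ξ and `F`. The
last is C¹, and the volume form is differentiable because its square is minus the Gram determinant.
-/
theorem differentiableAt_ernstForm (p : M) :
    DifferentiableAt ℝ (pull1 (ernstForm g η ξ) p) (coord p) := by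
  have hy := coord_mem_target (n := 4) p
  have e : pull1 (ernstForm g η ξ) p = fun z => ∑ a,
      (ContinuousLinearMap.smulRightL ℝ (Coords 4) ℂ (EuclideanSpace.proj a))
        (pull1 (ernstForm g η ξ) p z (stdVec 4 a)) := by
    funext z
    ext u
    rw [apply_eq_sum]
    simp
  have hF := hξ.contDiffAt_kF hg p _ hy
  have hinv : ∀ i j, DifferentiableAt ℝ (fun z => (localMetric g p z)⁻¹ i j) (coord p) :=
    fun i j => (contDiffAt_localMetric_inv hg hy i j).differentiableAt (by norm_num)
  have hfl : ∀ j, DifferentiableAt ℝ (fun z => pull1 (flatC g ξ) p z (stdVec 4 j)) (coord p) :=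
    fun j => (((hξ.contDiffAt_flat hg p _ hy).differentiableAt (by norm_num)).clm_apply
      (differentiableAt_const _))
  have hfl' : ∀ z j, bil g ((chartC 4 p).symm z) (chartFrame p z j) (vecC ξ ((chartC 4 p).symm z))
      = pull1 (flatC g ξ) p z (stdVec 4 j) := fun z j => hg.symm _ _ _
  have hc : ∀ a, DifferentiableAt ℝ
      (fun z => pull1 (ernstForm g η ξ) p z (stdVec 4 a)) (coord p) := by
    intro a
    have hcomp : DifferentiableAt ℝ (fun z => ernstF
        (invC (gram g ((chartC 4 p).symm z) (chartFrame p z)))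
        (frameVol ((η ((chartC 4 p).symm z) (chartFrame p z) : ℝ) : ℂ))
        (upC (gram g ((chartC 4 p).symm z) (chartFrame p z))
          fun j => bil g ((chartC 4 p).symm z) (chartFrame p z j) (vecC ξ ((chartC 4 p).symm z)))
        (formC (fun v w => kF g ξ ((chartC 4 p).symm z) v w) (chartFrame p z)) a) (coord p) := by
      refine differentiableAt_ernstF (fun i j => ?_) (fun i j k l => ?_) (fun i => ?_)
        (fun i j => ?_) a
      · exact Complex.ofRealCLM.differentiableAt.comp _ (hinv i j)
      · exact (Complex.ofRealCLM.differentiableAt.comp _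
          (differentiableAt_vol_chartFrame hη hξ hg hy)).mul_const _
      · refine Complex.ofRealCLM.differentiableAt.comp _ ?_
        simp only [hfl']
        have h := DifferentiableAt.fun_sum (u := Finset.univ) fun j _ => (hinv i j).mul (hfl j)
        exact h
      · refine Complex.ofRealCLM.differentiableAt.comp _ ?_
        exact ((hF.differentiableAt (by norm_num)).clm_apply (differentiableAt_const _)).clm_apply
          (differentiableAt_const _)
    refine hcomp.congr_of_eventuallyEq ?_
    filter_upwards [target_mem_nhds hy] with z hz
    rw [← ernst_components hξ hg (gram_chartFrame_det hg hz), tr1_ernst]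
    rfl
  rw [e]
  exact DifferentiableAt.fun_sum fun a _ =>
    (ContinuousLinearMap.differentiableAt _).comp _ (hc a)

/-- The components in a frame that is parallel along a line. -/
theorem hasDerivAt_components (v : Fin 4 → Coords 4) (hv : (gram g p v).det ≠ 0) (w : Coords 4) :
    ∃ u : ℝ → Fin 4 → Coords 4, ∃ q : ℝ → M,
      (∀ t, q t = (chartC 4 p).symm (coord p + t • w)) ∧
      (∀ t i, u t i = dchart p (coord p + t • w)
        (movedFrame (conn g p) (coord p) w (v i) t)) ∧
      q 0 = p ∧ u 0 = v ∧
      (∀ᶠ t in 𝓝 (0 : ℝ), (gram g (q t) (u t)).det ≠ 0) ∧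
      (∀ i j, HasDerivAt (fun t => ((gram g (q t) (u t))⁻¹ i j : ℝ)) 0 0) ∧
      HasDerivAt (fun t => η (q t) (u t)) 0 0 ∧
      (∀ i, HasDerivAt (fun t => bil g (q t) (u t i) (vecC ξ (q t))) (kF g ξ p w (v i)) 0) ∧
      (∀ i j, HasDerivAt (fun t => kF g ξ (q t) (u t i) (u t j)) (kP g ξ p w (v i) (v j)) 0) := by
  have hy := coord_mem_target (n := 4) p
  have hline : Tendsto (fun t : ℝ => coord p + t • w) (𝓝 0) (𝓝 (coord p)) := by
    have : ContinuousAt (fun t : ℝ => coord p + t • w) 0 :=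
      (continuous_const.add (continuous_id.smul continuous_const)).continuousAt
    have h := this.tendsto
    rwa [zero_smul, add_zero] at h
  have hev : ∀ᶠ t in 𝓝 (0 : ℝ), coord p + t • w ∈ (chartC 4 p).target :=
    hline.eventually (target_mem_nhds hy)
  set q : ℝ → M := fun t => (chartC 4 p).symm (coord p + t • w) with hq
  set u : ℝ → Fin 4 → Coords 4 := fun t i => dchart p (coord p + t • w)
    (movedFrame (conn g p) (coord p) w (v i) t) with hu
  have hq0 : q 0 = p := by
    simp only [hq, zero_smul, add_zero]
    exact symm_coord (n := 4) p
  have hu0 : u 0 = v := by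
    funext i
    simp only [hu, zero_smul, add_zero, movedFrame_zero, dchart_center]
    rfl
  -- The metric is parallel, so the Gram matrix of the moved frame is stationary; the same then
  -- holds for its determinant and its inverse.
  have hG : ∀ i j, HasDerivAt (fun t => gram g (q t) (u t) i j) 0 0 := by
    intro i j
    have h := hasDerivAt_nabla2 (Γ := conn g p) (hg.isMetric.differentiableAt hy) w (v i) (v j)
    refine h.congr_deriv ?_
    rw [nabla2, (hg.isMetric.isConn hy).compat (Eventually.of_forall fun z =>
      hg.isMetric.pull_symm p z) (hg.isMetric.differentiableAt hy)]
    ring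
  have hG0 : (gram g (q 0) (u 0)).det ≠ 0 := by rw [hq0, hu0]; exact hv
  have hdetd : HasDerivAt (fun t => (gram g (q t) (u t)).det) 0 0 :=
    hasDerivAt_zero_comp (f := fun A => (Matrix.of A).det)
      (c := fun t => gram g (q t) (u t))
      ((contDiffAt_det (k := 1) fun i j => by
        simp only [Matrix.of_apply]
        fun_prop).differentiableAt (by norm_num)) hG
  -- Continuity of `η` on the moved frame is reduced to the coordinate frame, from which it differs
  -- by a continuous determinant.
  have hμc : ContinuousAt (fun t => η (q t) (u t)) 0 := by
    have h1 : ∀ t, η (q t) (u t)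
        = (Matrix.of fun i a => movedFrame (conn g p) (coord p) w (v i) t a).det
          * η (q t) (chartFrame p (coord p + t • w)) := by
      intro t
      refine alternating_det (η (q t)) (chartFrame p (coord p + t • w)) _ (u t) fun i => ?_
      simp only [hu]
      rw [apply_eq_sum]
      rfl
    have h2 : ContinuousAt (fun t : ℝ => η (q t) (chartFrame p (coord p + t • w))) 0 := by
      exact ContinuousAt.comp_of_eq (f := fun t : ℝ => coord p + t • w)
        (continuousAt_vol_chartFrame hη hy) (by fun_prop) (by simp)
    have h4 : ContinuousAt (fun t : ℝ =>
        (Matrix.of fun i a => movedFrame (conn g p) (coord p) w (v i) t a).det) 0 := by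
      have : Continuous fun t : ℝ =>
          (Matrix.of fun i a => movedFrame (conn g p) (coord p) w (v i) t a) := by
        refine continuous_matrix fun i a => ?_
        simp only [movedFrame, Matrix.of_apply, PiLp.sub_apply, PiLp.smul_apply]
        fun_prop
      exact this.matrix_det.continuousAt
    simp only [h1]
    exact h4.mul h2
  refine ⟨u, q, fun _ => rfl, fun _ _ => rfl, hq0, hu0, ?_, ?_, ?_, ?_, ?_⟩
  · exact hdetd.continuousAt.eventually_ne hG0
  · intro i j
    exact hasDerivAt_zero_comp (f := fun A => (Matrix.of A)⁻¹ i j)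
      (c := fun t => gram g (q t) (u t))
      ((contDiffAt_inv_matrix (k := 1) (A := fun A : Fin 4 → Fin 4 → ℝ => Matrix.of A) (fun i j => by
        simp only [Matrix.of_apply]
        fun_prop) hG0 i j).differentiableAt (by norm_num)) hG
  -- The volume form is parallel: on the moved frame it is a continuous nonzero function whose
  -- square, minus the Gram determinant, has derivative zero.
  · have h := (hasFDerivAt_of_sq hμc ?_ (Eventually.of_forall fun t => vol_sq_gram hη hg (q t) (u t))
      hdetd.neg.hasFDerivAt).hasDerivAt
    · refine h.congr_deriv ?_
      simp
    · intro h0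
      have h := vol_sq_gram hη hg (q 0) (u 0)
      rw [h0] at h
      exact hG0 (by linarith)
  · intro i
    have h := hasDerivAt_nabla1 (Γ := conn g p)
      ((hξ.contDiffAt_flat hg p _ hy).differentiableAt (by norm_num)) w (v i)
    refine h.congr_of_eventuallyEq (Eventually.of_forall fun t => ?_)
    exact hg.symm _ _ _
  · intro i j
    exact hasDerivAt_nabla2 (Γ := conn g p)
      ((hξ.contDiffAt_kF hg p _ hy).differentiableAt (by norm_num)) w (v i) (v j)

/-- The Leibniz rule along the moved frame: metric and volume form are stationary, so only the
derivatives of ξ and of `F` contribute. The second one is the curvature `kP` and produces the tensor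
`Y`. -/
theorem nablaForm_ernstForm (v : Fin 4 → Coords 4) (hv : (gram g p v).det ≠ 0) (w : Coords 4)
    (i : Fin 4) :
    nablaForm g (ernstForm g η ξ) p w (v i)
      = ernstF (invC (gram g p v)) (frameVol ((η p v : ℝ) : ℂ))
          (upC (gram g p v) fun j => kF g ξ p w (v j)) (formC (fun a b => kF g ξ p a b) v) i
        + ernstF (invC (gram g p v)) (frameVol ((η p v : ℝ) : ℂ))
          (upC (gram g p v) fun j => bil g p (v j) (vecC ξ p)) (formC (kP g ξ p w) v) i := by
  obtain ⟨u, q, hq, hu, hq0, hu0, hdet, hH, hV, hx, hF⟩ :=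
    hasDerivAt_components hη hξ hg v hv w
  have h1 := hasDerivAt_nabla1 (Γ := conn g p) (differentiableAt_ernstForm hη hξ hg p) w (v i)
  have h2 := hasDerivAt_ernstF (t := 0)
    (H := fun t => invC (gram g (q t) (u t)))
    (V := fun t => frameVol ((η (q t) (u t) : ℝ) : ℂ))
    (x := fun t => upC (gram g (q t) (u t)) fun j => bil g (q t) (u t j) (vecC ξ (q t)))
    (B := fun t => formC (fun a b => kF g ξ (q t) a b) (u t))
    (x' := upC (gram g p v) fun j => kF g ξ p w (v j)) (B' := formC (kP g ξ p w) v)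
    (fun a b => by simpa using! (hH a b).ofReal_comp)
    (fun a b c d => by simpa using! hV.ofReal_comp.mul_const (levi a b c d))
    (fun a => by
      have h := HasDerivAt.fun_sum (u := Finset.univ) fun b _ => (hH a b).mul (hx b)
      refine h.ofReal_comp.congr_deriv ?_
      simp only [zero_mul, zero_add, hq0, hu0, upC])
    (fun a b => (hF a b).ofReal_comp) i
  have hη0 : ∀ q', q' = p → η q' v = η p v := by
    rintro _ rfl
    rfl
  simp only [hq0, hu0, hη0 _ hq0] at h2
  refine h1.unique (h2.congr_of_eventuallyEq ?_)
  filter_upwards [hdet] with t ht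
  rw [← ernst_components hξ hg ht, tr1_ernst, hq, hu]
  rfl

end ErnstDerivative

/-! ### The Killing field in a chart and the invariance of `γ` -/

section LieDerivatives

open Filter

variable {M : Type*} [TopologicalSpace M] [ChartedSpace (EuclideanSpace ℝ (Fin 4)) M]
  [IsManifold 𝓘(ℝ, EuclideanSpace ℝ (Fin 4)) 3 M]
  {g : BilinField 4 M} {η : (p : M) → Tan 4 p [⋀^Fin 4]→ₗ[ℝ] ℝ} {ξ : (p : M) → Tan 4 p} {p : M}

/-- The vector field `ξ` in the preferred chart at `p`. -/
def xiHat (g : BilinField 4 M) (ξ : (p : M) → Tan 4 p) (p : M) (y : Coords 4) : Coords 4 :=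
  ∑ i, (∑ j, (localMetric g p y)⁻¹ i j * pull1 (flatC g ξ) p y (stdVec 4 j)) • stdVec 4 i

theorem dchart_xiHat (hg : IsLorentzMetric g) {y : Coords 4} (hy : y ∈ (chartC 4 p).target) :
    dchart p y (xiHat g ξ p y) = vecC ξ ((chartC 4 p).symm y) := by
  have h := vec_frame (gram_chartFrame_det hg hy) (vecC ξ ((chartC 4 p).symm y))
  rw [h, xiHat, map_sum]
  refine Finset.sum_congr rfl fun i _ => ?_
  rw [map_smul]
  congr 1
  refine Finset.sum_congr rfl fun j _ => ?_
  congr 1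
  exact hg.symm _ _ _

theorem xiHat_center (hg : IsLorentzMetric g) (p : M) : xiHat g ξ p (coord p) = vecC ξ p := by
  have h := dchart_xiHat (ξ := ξ) hg (coord_mem_target (n := 4) p)
  rw [dchart_center] at h
  refine h.trans ?_
  exact congrArg (fun q : M => (ξ q : Coords 4)) (symm_coord (n := 4) p)

theorem pull2_xiHat (hg : IsLorentzMetric g) {y : Coords 4} (hy : y ∈ (chartC 4 p).target)
    (w : Coords 4) : pull2 g p y (xiHat g ξ p y) w = pull1 (flatC g ξ) p y w := by
  refine (pull2_apply (bil g) p y _ w).trans ?_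
  rw [dchart_xiHat hg hy]
  rfl

theorem IsKilling.contDiffAt_xiHat (hξ : IsKilling g ξ) (hg : IsLorentzMetric g) {y : Coords 4}
    (hy : y ∈ (chartC 4 p).target) : ContDiffAt ℝ 2 (xiHat g ξ p) y := by
  refine ContDiffAt.sum fun i _ => ContDiffAt.smul (ContDiffAt.sum fun j _ =>
    (contDiffAt_localMetric_inv hg hy i j).mul ?_) contDiffAt_const
  exact (hξ.contDiffAt_flat hg p y hy).clm_apply contDiffAt_const

/-- The covariant derivative `∇_v ξ`. -/
def nablaXi (g : BilinField 4 M) (ξ : (p : M) → Tan 4 p) (p : M) (v : Coords 4) : Coords 4 :=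
  fderiv ℝ (xiHat g ξ p) (coord p) v + conn g p (coord p) v (vecC ξ p)

variable (hξ : IsKilling g ξ) (hg : IsLorentzMetric g)

include hξ hg

/-- Lowering the index commutes with ∇ because the metric is parallel; the identity comes from
differentiating `g(ξ, w) = ξ_α w^α` in the chart. -/
theorem bil_nablaXi (p : M) (v w : Coords 4) : bil g p (nablaXi g ξ p v) w = kF g ξ p v w := by
  have hy := coord_mem_target (n := 4) p
  have hG := hg.isMetric.differentiableAt hy
  have hX : DifferentiableAt ℝ (xiHat g ξ p) (coord p) :=
    (hξ.contDiffAt_xiHat hg hy).differentiableAt (by norm_num)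
  have hf : DifferentiableAt ℝ (pull1 (flatC g ξ) p) (coord p) :=
    (hξ.contDiffAt_flat hg p _ hy).differentiableAt (by norm_num)
  have h1 : HasFDerivAt (fun y => pull2 g p y (xiHat g ξ p y) w) _ (coord p) :=
    (hG.hasFDerivAt.clm_apply hX.hasFDerivAt).clm_apply (hasFDerivAt_const w _)
  have h2 : HasFDerivAt (fun y => pull1 (flatC g ξ) p y w) _ (coord p) :=
    hf.hasFDerivAt.clm_apply (hasFDerivAt_const w _)
  have h3 := congrArg (fun L => L v) (h1.unique (h2.congr_of_eventuallyEq (by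
    filter_upwards [target_mem_nhds hy] with z hz using pull2_xiHat hg hz w)))
  have hc := (hg.isMetric.isConn hy).compat (Eventually.of_forall fun z =>
    hg.isMetric.pull_symm p z) hG v (vecC ξ p) w
  simp only [ContinuousLinearMap.comp_zero, zero_add, ContinuousLinearMap.flip_apply,
    ContinuousLinearMap.comp_apply, add_apply, xiHat_center hg] at h3
  rw [hc] at h3
  have h4 : kF g ξ p v w = fderiv ℝ (pull1 (flatC g ξ) p) (coord p) v w
      - bil g p (vecC ξ p) (conn g p (coord p) v w) := by
    rw [kF, nablaForm, nabla1L_apply, nabla1, pull1_center]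
    rfl
  rw [h4, nablaXi, map_add, add_apply, ← h3, bil_center]
  ring

theorem flat_nablaXi (p : M) (v : Coords 4) :
    bil g p (vecC ξ p) (nablaXi g ξ p v) = kF g ξ p v (vecC ξ p) :=
  (hg.symm p _ _).trans (bil_nablaXi hξ hg p v _)

/-- The norm of `ξ` in the preferred chart at `p`. -/
theorem hasFDerivAt_lam (p : M) (w : Coords 4) :
    DifferentiableAt ℝ (fun y => lam g ξ ((chartC 4 p).symm y)) (coord p) ∧
      fderiv ℝ (fun y => lam g ξ ((chartC 4 p).symm y)) (coord p) w
        = 2 * kF g ξ p (vecC ξ p) w := by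
  have hy := coord_mem_target (n := 4) p
  have hX : DifferentiableAt ℝ (xiHat g ξ p) (coord p) :=
    (hξ.contDiffAt_xiHat hg hy).differentiableAt (by norm_num)
  have hf : DifferentiableAt ℝ (pull1 (flatC g ξ) p) (coord p) :=
    (hξ.contDiffAt_flat hg p _ hy).differentiableAt (by norm_num)
  have h1 := (hf.hasFDerivAt.clm_apply hX.hasFDerivAt).neg
  have h2 := h1.congr_of_eventuallyEq (f₁ := fun y => lam g ξ ((chartC 4 p).symm y)) (by
    filter_upwards [target_mem_nhds hy] with z hz
    rw [Pi.neg_apply, pull1_apply, dchart_xiHat hg hz]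
    rfl)
  refine ⟨h2.differentiableAt, ?_⟩
  rw [h2.fderiv]
  simp only [neg_apply, add_apply, ContinuousLinearMap.comp_apply,
    ContinuousLinearMap.flip_apply, xiHat_center hg]
  have h4 : kF g ξ p w (vecC ξ p) = fderiv ℝ (pull1 (flatC g ξ) p) (coord p) w (vecC ξ p)
      - bil g p (vecC ξ p) (conn g p (coord p) w (vecC ξ p)) := by
    rw [kF, nablaForm, nabla1L_apply, nabla1, pull1_center]
    rfl
  have h5 := flat_nablaXi hξ hg p w
  rw [nablaXi, map_add] at h5
  have h6 : pull1 (flatC g ξ) p (coord p) = bil g p (vecC ξ p) := pull1_center _ p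
  rw [h6, hξ.kF_anti hg p (vecC ξ p)]
  linarith

theorem contDiffAt_lam (p : M) {y : Coords 4} (hy : y ∈ (chartC 4 p).target) :
    ContDiffAt ℝ 2 (fun y => lam g ξ ((chartC 4 p).symm y)) y := by
  refine contDiffAt_of_contMDiffAt hy (f := lam g ξ) ?_ fun z _ => rfl
  exact (contMDiffAt_bilin (hg.contMDiff _) (hξ.contMDiff _) (hξ.contMDiff _)).neg

/-- The tensor `γ = λ g + ξ ⊗ ξ`. -/
def gammaForm (g : BilinField 4 M) (ξ : (p : M) → Tan 4 p) (p : M) :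
    Coords 4 →L[ℝ] Coords 4 →L[ℝ] ℝ :=
  lam g ξ p • bil g p + (flatC g ξ p).smulRight (flatC g ξ p)

omit [IsManifold 𝓘(ℝ, EuclideanSpace ℝ (Fin 4)) 3 M] hξ hg in
theorem gammaForm_apply (p : M) (u v : Coords 4) :
    gammaForm g ξ p u v = lam g ξ p * bil g p u v + flatC g ξ p u * flatC g ξ p v := by
  simp [gammaForm]

omit [IsManifold 𝓘(ℝ, EuclideanSpace ℝ (Fin 4)) 3 M] hξ hg in
theorem gammaForm_stdVec (p : M) (a b : Fin 4) :
    gammaForm g ξ p (stdVec 4 a) (stdVec 4 b) = gammaMetric g ξ p a b := by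
  rw [gammaForm_apply]
  rfl

theorem contDiffAt_gammaForm (p : M) {y : Coords 4} (hy : y ∈ (chartC 4 p).target) :
    ContDiffAt ℝ 2 (pull2 (gammaForm g ξ) p) y := by
  refine contDiffAt_of_stdVec₂ fun a b => ?_
  have e : (fun z => pull2 (gammaForm g ξ) p z (stdVec 4 a) (stdVec 4 b))
      = fun z => lam g ξ ((chartC 4 p).symm z) * pull2 g p z (stdVec 4 a) (stdVec 4 b)
        + pull1 (flatC g ξ) p z (stdVec 4 a) * pull1 (flatC g ξ) p z (stdVec 4 b) := by
    funext z
    rw [pull2_apply, gammaForm_apply]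
    rfl
  have hf := hξ.contDiffAt_flat hg p y hy
  rw [e]
  exact ((contDiffAt_lam hξ hg p hy).mul (contDiffAt_localMetric hg hy a b)).add
    ((hf.clm_apply contDiffAt_const).mul (hf.clm_apply contDiffAt_const))

/-- The covariant derivative of `γ`. -/
theorem nabla2_gammaForm (p : M) (w u v : Coords 4) :
    nablaForm₂ g (gammaForm g ξ) p w u v
      = 2 * kF g ξ p (vecC ξ p) w * bil g p u v + kF g ξ p w u * flatC g ξ p v
        + flatC g ξ p u * kF g ξ p w v := by
  have hy := coord_mem_target (n := 4) p
  have hG := hg.isMetric.differentiableAt hy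
  have hf : DifferentiableAt ℝ (pull1 (flatC g ξ) p) (coord p) :=
    (hξ.contDiffAt_flat hg p _ hy).differentiableAt (by norm_num)
  have hγ : DifferentiableAt ℝ (pull2 (gammaForm g ξ) p) (coord p) :=
    (contDiffAt_gammaForm hξ hg p hy).differentiableAt (by norm_num)
  obtain ⟨hl, hl'⟩ := hasFDerivAt_lam hξ hg p w
  have e : (fun z => pull2 (gammaForm g ξ) p z u v)
      = fun z => lam g ξ ((chartC 4 p).symm z) * pull2 g p z u v
        + pull1 (flatC g ξ) p z u * pull1 (flatC g ξ) p z v := by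
    funext z
    rw [pull2_apply, gammaForm_apply]
    rfl
  have hGd : ∀ u v, HasFDerivAt (fun z => pull2 g p z u v)
      (((fderiv ℝ (pull2 g p) (coord p)).flip u).flip v) (coord p) := fun u v => by
    simpa using! (hG.hasFDerivAt.clm_apply (hasFDerivAt_const u _)).clm_apply
      (hasFDerivAt_const v _)
  have hfd : ∀ u, HasFDerivAt (fun z => pull1 (flatC g ξ) p z u)
      ((fderiv ℝ (pull1 (flatC g ξ) p) (coord p)).flip u) (coord p) := fun u => by
    simpa using! hf.hasFDerivAt.clm_apply (hasFDerivAt_const u _)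
  have h1 : fderiv ℝ (fun z => pull2 (gammaForm g ξ) p z u v) (coord p) w
      = fderiv ℝ (pull2 (gammaForm g ξ) p) (coord p) w u v := fderiv_apply_const₂ hγ _ _ _
  have h2 := ((hl.hasFDerivAt.mul (hGd u v)).add ((hfd u).mul (hfd v))).fderiv
  have h3 : fderiv ℝ (pull2 (gammaForm g ξ) p) (coord p) w u v
      = lam g ξ p * fderiv ℝ (pull2 g p) (coord p) w u v + bil g p u v * (2 * kF g ξ p (vecC ξ p) w)
        + (flatC g ξ p u * fderiv ℝ (pull1 (flatC g ξ) p) (coord p) w v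
          + flatC g ξ p v * fderiv ℝ (pull1 (flatC g ξ) p) (coord p) w u) := by
    rw [← h1, e]
    refine (congrArg (fun L => L w) h2).trans ?_
    simp only [add_apply, smul_apply, smul_eq_mul, hl', bil_center, pull1_center,
      ContinuousLinearMap.flip_apply, symm_coord (n := 4)]
  have hc := (hg.isMetric.isConn hy).compat (Eventually.of_forall fun z =>
    hg.isMetric.pull_symm p z) hG w u v
  have h4 : ∀ v, kF g ξ p w v = fderiv ℝ (pull1 (flatC g ξ) p) (coord p) w v
      - flatC g ξ p (conn g p (coord p) w v) := fun v => by
    rw [kF, nablaForm, nabla1L_apply, nabla1, pull1_center]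
  rw [nablaForm₂, nabla2, h3, hc, pull2_center, bil_center, h4, h4, gammaForm_apply,
    gammaForm_apply]
  ring

/-- The left side is the Lie derivative of γ along ξ. Since the connection has no torsion, partial
derivatives may be replaced by covariant ones, and the terms then cancel by the antisymmetry of `F`.
-/
theorem lie_gammaForm (p : M) (u v : Coords 4) :
    fderiv ℝ (pull2 (gammaForm g ξ) p) (coord p) (vecC ξ p) u v
      + gammaForm g ξ p (fderiv ℝ (xiHat g ξ p) (coord p) u) v
      + gammaForm g ξ p u (fderiv ℝ (xiHat g ξ p) (coord p) v) = 0 := by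
  have hy := coord_mem_target (n := 4) p
  have h := nabla2_gammaForm hξ hg p (vecC ξ p) u v
  rw [nablaForm₂, nabla2, pull2_center] at h
  have hs : ∀ w, fderiv ℝ (xiHat g ξ p) (coord p) w
      = nablaXi g ξ p w - conn g p (coord p) (vecC ξ p) w := fun w => by
    rw [nablaXi, hg.isMetric.conn_symm hy]
    abel
  have h0 : kF g ξ p (vecC ξ p) (vecC ξ p) = 0 := self_eq_neg.1 (hξ.kF_anti hg p _ _)
  have k1 : ∀ w, gammaForm g ξ p (nablaXi g ξ p w) = lam g ξ p • kF g ξ p w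
      + kF g ξ p w (vecC ξ p) • flatC g ξ p := by
    intro w
    ext z
    rw [gammaForm_apply, bil_nablaXi hξ hg, flatC_apply, flat_nablaXi hξ hg]
    rfl
  have k2 : ∀ u w, gammaForm g ξ p u (nablaXi g ξ p w) = lam g ξ p * kF g ξ p w u
      + flatC g ξ p u * kF g ξ p w (vecC ξ p) := by
    intro u w
    have e : bil g p u (nablaXi g ξ p w) = kF g ξ p w u :=
      (hg.symm p _ _).trans (bil_nablaXi hξ hg p w u)
    rw [gammaForm_apply, e, flatC_apply g ξ p (nablaXi g ξ p w), flat_nablaXi hξ hg]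
  have a1 := hξ.kF_anti hg p u v
  have a2 := hξ.kF_anti hg p u (vecC ξ p)
  have a3 := hξ.kF_anti hg p v (vecC ξ p)
  rw [hs, hs, map_sub, map_sub, sub_apply, k1, k2]
  simp only [add_apply, smul_apply, smul_eq_mul]
  rw [h0] at h
  rw [a1, a2, a3]
  linarith

omit hξ in
theorem gammaForm_vecC (p : M) (v : Coords 4) : gammaForm g ξ p (vecC ξ p) v = 0 := by
  have h : lam g ξ p = - flatC g ξ p (vecC ξ p) := rfl
  rw [gammaForm_apply, h, ← flatC_apply]
  ring

omit hξ in
theorem gammaForm_symm (p : M) (u v : Coords 4) : gammaForm g ξ p u v = gammaForm g ξ p v u := by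
  have h : bil g p u v = bil g p v u := hg.symm p u v
  rw [gammaForm_apply, gammaForm_apply, h]
  ring

end LieDerivatives

/-! ### Invariance of the Ernst one-form under the Killing flow -/

section ErnstLie

variable {M : Type*} [TopologicalSpace M] [ChartedSpace (EuclideanSpace ℝ (Fin 4)) M]
  [IsManifold 𝓘(ℝ, EuclideanSpace ℝ (Fin 4)) 3 M]
  {g : BilinField 4 M} {η : (p : M) → Tan 4 p [⋀^Fin 4]→ₗ[ℝ] ℝ} {ξ : (p : M) → Tan 4 p} {p : M}
  {e : Fin 4 → Coords 4} {r : ℝ}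

theorem IsAdaptedFrame.gram_det (h : IsAdaptedFrame g ξ p e r) : (gram g p e).det ≠ 0 :=
  gram_orthonormal_det h.orthonormal

theorem IsAdaptedFrame.invC_eq (h : IsAdaptedFrame g ξ p e r) : invC (gram g p e) = mink := by
  funext a b
  rw [invC, gram_orthonormal_inv h.orthonormal, ← minkR_cast]
  rfl

theorem IsAdaptedFrame.upC_eq (h : IsAdaptedFrame g ξ p e r) (f : Fin 4 → ℝ) :
    upC (gram g p e) f = fun a => ∑ b, mink a b * (f b : ℂ) := by
  funext a
  rw [upC, gram_orthonormal_inv h.orthonormal]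
  push_cast
  simp only [Matrix.of_apply, minkR_cast]

theorem IsAdaptedFrame.flat_frame (h : IsAdaptedFrame g ξ p e r) (a : Fin 4) :
    bil g p (vecC ξ p) (e a) = if a = 0 then - r else 0 := by
  have h1 : ∀ a b, bil g p (e a) (e b) = if a = b then (if a = 0 then -1 else 1) else 0 :=
    h.orthonormal
  rw [h.vec_eq, map_smul, smul_apply, h1, smul_eq_mul]
  rcases eq_or_ne a 0 with rfl | ha
  · simp
  · simp [ha, ha.symm]

variable (hη : IsVolumeForm g η) (hξ : IsKilling g ξ) (hg : IsLorentzMetric g)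

include hη hξ hg

theorem IsAdaptedFrame.nablaForm_ernstForm (h : IsAdaptedFrame g ξ p e r) (b a : Fin 4) :
    nablaForm g (ernstForm g η ξ) p (e b) (e a)
      = dErnstF mink (frameVol ((η p e : ℝ) : ℂ)) (timeVec r) (tr3 (frameC e) (Pc g ξ p))
        (tr2 (frameC e) (Fc g ξ p)) b a := by
  rw [KillingSpacetime.nablaForm_ernstForm hη hξ hg e h.gram_det, h.invC_eq, h.upC_eq, h.upC_eq,
    Fc_frame hξ hg, Pc_frame hξ hg, dErnstF]
  have h1 : (fun a => ∑ b, mink a b * ((bil g p (e b) (vecC ξ p) : ℝ) : ℂ)) = timeVec r := by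
    funext a
    have h2 : ∀ b, bil g p (e b) (vecC ξ p) = if b = 0 then - r else 0 := fun b =>
      (hg.symm p _ _).trans (h.flat_frame b)
    simp only [h2]
    rcases eq_or_ne a 0 with rfl | ha
    · simp [mink, minkS, timeVec]
    · simp [mink, minkS, timeVec, ha]
  rw [h1]
  rfl

/-- Absence of torsion turns the Lie derivative into `∇_ξ σ + σ(∇ξ)`. This is linear in `v`, so it
suffices to evaluate it on an adapted frame, where it is `lie_frame`. -/
theorem lie_ernstForm (hvac : ∀ (p : M) (a b : Fin 4), ricci g p a b = 0)
    (hp : p ∈ timelikeRegion g ξ) (v : Coords 4) :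
    fderiv ℝ (pull1 (ernstForm g η ξ) p) (coord p) (vecC ξ p) v
      + ernstForm g η ξ p (fderiv ℝ (xiHat g ξ p) (coord p) v) = 0 := by
  have hy := coord_mem_target (n := 4) p
  obtain ⟨e, r, h⟩ := exists_isAdaptedFrame hg hp
  have hs : fderiv ℝ (xiHat g ξ p) (coord p) v
      = nablaXi g ξ p v - conn g p (coord p) (vecC ξ p) v := by
    rw [nablaXi, hg.isMetric.conn_symm hy]
    abel
  have h1 : fderiv ℝ (pull1 (ernstForm g η ξ) p) (coord p) (vecC ξ p) v
      = nablaForm g (ernstForm g η ξ) p (vecC ξ p) v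
        + ernstForm g η ξ p (conn g p (coord p) (vecC ξ p) v) := by
    rw [nablaForm, nabla1L_apply, nabla1, pull1_center]
    abel
  have h2 : nablaXi g ξ p v = ∑ c, ((if c = 0 then -1 else 1) * kF g ξ p v (e c)) • e c := by
    conv_lhs => rw [vec_orthonormal h.orthonormal (nablaXi g ξ p v)]
    refine Finset.sum_congr rfl fun c _ => ?_
    have : bil g p (e c) (nablaXi g ξ p v) = kF g ξ p v (e c) :=
      (hg.symm p _ _).trans (bil_nablaXi hξ hg p v (e c))
    rw [this]
  rw [hs, map_sub, h1]
  have key : nablaForm g (ernstForm g η ξ) p (vecC ξ p) v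
      + ∑ c, (((if c = 0 then -1 else 1) * kF g ξ p v (e c) : ℝ) : ℂ)
        * ernstForm g η ξ p (e c) = 0 := by
    have hlin : ∀ a, nablaForm g (ernstForm g η ξ) p (vecC ξ p) (e a)
        + ∑ c, (((if c = 0 then -1 else 1) * kF g ξ p (e a) (e c) : ℝ) : ℂ)
          * ernstForm g η ξ p (e c) = 0 := by
      intro a
      have hl := lie_frame (r := r) (h.vol_sq hη) (hξ.frame_anti hg p e)
        (h.isFrameCurv hξ hg hvac) a
      rw [h.vec_eq, map_smul, smul_apply, h.nablaForm_ernstForm hη hξ hg]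
      refine Eq.trans ?_ hl
      congr 1
      refine Finset.sum_congr rfl fun c _ => ?_
      have h3 := congrFun (h.ernst_frame (η := η)) c
      rw [tr1_ernst] at h3
      rw [h3, Fc_frame hξ hg, minkS]
      split_ifs <;>
      · push_cast
        rfl
    set L : Coords 4 →L[ℝ] ℂ := nablaForm g (ernstForm g η ξ) p (vecC ξ p)
      + ∑ c, ((if c = 0 then -1 else 1 : ℝ)) •
        ((kF g ξ p).flip (e c)).smulRight (ernstForm g η ξ p (e c)) with hL
    have hLa : ∀ v, L v = nablaForm g (ernstForm g η ξ) p (vecC ξ p) v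
        + ∑ c, (((if c = 0 then -1 else 1) * kF g ξ p v (e c) : ℝ) : ℂ)
          * ernstForm g η ξ p (e c) := by
      intro v
      simp only [hL, add_apply, sum_apply, smul_apply, ContinuousLinearMap.smulRight_apply,
        ContinuousLinearMap.flip_apply, Complex.real_smul, Complex.ofReal_mul, mul_assoc]
    rw [← hLa, vec_orthonormal h.orthonormal v, map_sum]
    refine Finset.sum_eq_zero fun a _ => ?_
    rw [map_smul, hLa, hlin, smul_zero]
  rw [h2, map_sum]
  simp only [map_smul, Complex.real_smul]
  linear_combination key

end ErnstLie

/-! ### The decomposition of the Ernst form into `dλ` and the twist -/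

section RealImaginary

variable {M : Type*} [TopologicalSpace M] [ChartedSpace (EuclideanSpace ℝ (Fin 4)) M]
  [IsManifold 𝓘(ℝ, EuclideanSpace ℝ (Fin 4)) 3 M]
  {g : BilinField 4 M} {η : (p : M) → Tan 4 p [⋀^Fin 4]→ₗ[ℝ] ℝ} {ξ : (p : M) → Tan 4 p} {p : M}

theorem ernst_re (p : M) (a : Fin 4) :
    (ernst g η ξ p a).re = 2 * ∑ b, comp (ξ p) b * killF g ξ p b a := by
  simp [ernst, killingForm]

theorem vol_swap (η : (p : M) → Tan 4 p [⋀^Fin 4]→ₗ[ℝ] ℝ) (p : M) (a b c d : Fin 4) :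
    vol η p b a c d = - vol η p a b c d := by
  have h := (η p).map_swap ![frame p a, frame p b, frame p c, frame p d]
    (i := 0) (j := 1) (by decide)
  rw [vol, vol, ← h]
  congr 1
  funext i
  fin_cases i <;> rfl

/-- The dual contributes `η_{bacd} ξ^b F^{cd}`; the minus sign comes from exchanging the first two
indices to reach `ω_a`. -/
theorem ernst_im (p : M) (a : Fin 4) : (ernst g η ξ p a).im = - twist g η ξ p a := by
  have h1 : (ernst g η ξ p a).im = 2 * ∑ b, comp (ξ p) b * hodge g η p (killF g ξ p) b a := by
    simp [ernst, killingForm]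
  rw [h1, twist, Finset.mul_sum, ← Finset.sum_neg_distrib]
  refine Finset.sum_congr rfl fun b _ => ?_
  rw [hodge]
  simp only [Finset.mul_sum, ← Finset.sum_neg_distrib]
  refine Finset.sum_congr rfl fun c _ => Finset.sum_congr rfl fun d _ => ?_
  rw [vol_swap η p a b]
  ring

theorem ernstForm_re (hξ : IsKilling g ξ) (hg : IsLorentzMetric g) (p : M) (v : Coords 4) :
    (ernstForm g η ξ p v).re = 2 * kF g ξ p (vecC ξ p) v := by
  rw [ernstForm_apply, Complex.re_sum, apply_eq_sum _ v, Finset.mul_sum]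
  refine Finset.sum_congr rfl fun a _ => ?_
  rw [Complex.re_ofReal_mul, ernst_re, apply_eq_sum (kF g ξ p)]
  simp only [sum_apply, smul_apply, smul_eq_mul, hξ.killF_eq hg]
  rw [mul_left_comm]
  rfl

/-- The twist one-form. -/
def twistForm (g : BilinField 4 M) (η : (p : M) → Tan 4 p [⋀^Fin 4]→ₗ[ℝ] ℝ) (ξ : (p : M) → Tan 4 p)
    (p : M) : Coords 4 →L[ℝ] ℝ := - Complex.imCLM.comp (ernstForm g η ξ p)

theorem twistForm_stdVec (p : M) (a : Fin 4) :
    twistForm g η ξ p (stdVec 4 a) = twist g η ξ p a := by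
  have h : twistForm g η ξ p (stdVec 4 a) = - (ernstForm g η ξ p (stdVec 4 a)).im := rfl
  rw [h, ernstForm_stdVec, ernst_im, neg_neg]

/-- The Ernst one-form is `dλ - i ω`. -/
theorem ernstForm_eq (hξ : IsKilling g ξ) (hg : IsLorentzMetric g) (p : M) (v : Coords 4) :
    ernstForm g η ξ p v
      = ((fderiv ℝ (fun y => lam g ξ ((chartC 4 p).symm y)) (coord p) v : ℝ) : ℂ)
        - Complex.I * ((twistForm g η ξ p v : ℝ) : ℂ) := by
  have h : twistForm g η ξ p v = - (ernstForm g η ξ p v).im := rfl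
  rw [(hasFDerivAt_lam hξ hg p v).2, ← ernstForm_re (η := η) hξ hg, h]
  apply Complex.ext <;> simp

theorem ernstForm_vecC (hη : IsVolumeForm g η) (hξ : IsKilling g ξ) (hg : IsLorentzMetric g)
    (hp : p ∈ timelikeRegion g ξ) : ernstForm g η ξ p (vecC ξ p) = 0 := by
  rw [ernstForm_apply]
  exact ernst_orth hη hξ hg hp

end RealImaginary

/-! ### Integral curves of the Killing field -/

section Orbits

open Filter

variable {M : Type*} [TopologicalSpace M] [ChartedSpace (EuclideanSpace ℝ (Fin 4)) M]
  [IsManifold 𝓘(ℝ, EuclideanSpace ℝ (Fin 4)) 3 M]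
  {g : BilinField 4 M} {η : (p : M) → Tan 4 p [⋀^Fin 4]→ₗ[ℝ] ℝ} {ξ : (p : M) → Tan 4 p} {p : M}

/-- An integral curve in the preferred chart at one of its points. -/
theorem hasDerivAt_integralCurve {c : ℝ → M} {J : Set ℝ} (hJ : IsOpen J)
    (hc : IsMIntegralCurveOn (I := 𝓘(ℝ, EuclideanSpace ℝ (Fin 4))) c ξ J) {t : ℝ} (ht : t ∈ J) :
    ContinuousAt c t ∧ HasDerivAt (fun s => chartC 4 (c t) (c s)) (vecC ξ (c t)) t := by
  have h := (hc t ht).hasMFDerivAt (hJ.mem_nhds ht)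
  refine ⟨h.1, ?_⟩
  have h2 := h.2
  simp only [writtenInExtChartAt, extChartAt_model_space_eq_id, PartialEquiv.refl_coe,
    PartialEquiv.refl_symm, Function.comp_id, modelWithCornersSelf_coe, Set.range_id, id] at h2
  have h3 : HasFDerivAt (fun s => chartC 4 (c t) (c s))
      ((1 : ℝ →L[ℝ] ℝ).smulRight (vecC ξ (c t))) t := hasFDerivWithinAt_univ.1 h2
  refine h3.hasDerivAt.congr_deriv ?_
  exact one_smul ℝ (vecC ξ (c t))

theorem eventually_chart_source {c : ℝ → M} {t : ℝ} (hc : ContinuousAt c t) :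
    ∀ᶠ s in 𝓝 t, c s ∈ (chartC 4 (c t)).source :=
  hc.eventually ((isOpen_extChartAt_source (c t)).mem_nhds (mem_extChartAt_source (c t)))

variable (hξ : IsKilling g ξ) (hg : IsLorentzMetric g)

include hξ hg

theorem continuous_lam : Continuous (lam g ξ) := continuous_iff_continuousAt.2 fun p =>
  ((contMDiffAt_bilin (hg.contMDiff p) (hξ.contMDiff p) (hξ.contMDiff p)).neg).continuousAt

theorem isOpen_timelikeRegion : IsOpen (timelikeRegion g ξ) :=
  isOpen_lt continuous_const (continuous_lam hξ hg)

/-- The derivative of λ along ξ is `2 F(ξ, ξ) = 0`, and the parameter set is an interval. In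
particular an orbit that meets `M⁺` stays in it. -/
theorem lam_integralCurve {c : ℝ → M} {J : Set ℝ} (hJ : IsOpen J) (hJ' : J.OrdConnected)
    (hc : IsMIntegralCurveOn (I := 𝓘(ℝ, EuclideanSpace ℝ (Fin 4))) c ξ J) {s t : ℝ}
    (hs : s ∈ J) (ht : t ∈ J) : lam g ξ (c s) = lam g ξ (c t) := by
  have hd : ∀ t ∈ J, HasDerivAt (fun s => lam g ξ (c s)) 0 t := by
    intro t ht
    obtain ⟨hcc, hcd⟩ := hasDerivAt_integralCurve hJ hc ht
    have h1 := (hasFDerivAt_lam hξ hg (c t) (vecC ξ (c t)))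
    have h2 := HasFDerivAt.comp_hasDerivAt (f := fun s => chartC 4 (c t) (c s)) t
      h1.1.hasFDerivAt hcd
    have h0 : kF g ξ (c t) (vecC ξ (c t)) (vecC ξ (c t)) = 0 :=
      self_eq_neg.1 (hξ.kF_anti hg _ _ _)
    refine (h2.congr_of_eventuallyEq ?_).congr_deriv (by rw [h1.2, h0, mul_zero])
    filter_upwards [eventually_chart_source hcc] with s hs
    simp only [Function.comp_apply, (chartC 4 (c t)).left_inv hs]
  exact hJ.is_const_of_deriv_eq_zero hJ'.isPreconnected
    (fun t ht => (hd t ht).differentiableAt.differentiableWithinAt)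
    (fun t ht => (hd t ht).deriv) hs ht

theorem SameOrbit.lam_eq {p q : M} (h : SameOrbit ξ p q) : lam g ξ p = lam g ξ q := by
  obtain ⟨c, J, hJ, hJ', hc, ⟨s, hs, rfl⟩, t, ht, rfl⟩ := h
  exact lam_integralCurve hξ hg hJ hJ' hc hs ht

omit [IsManifold 𝓘(ℝ, EuclideanSpace ℝ (Fin 4)) 3 M] hξ hg in
theorem SameOrbit.of_integralCurve {c : ℝ → M} {J : Set ℝ} (hJ : IsOpen J) (hJ' : J.OrdConnected)
    (hc : IsMIntegralCurveOn (I := 𝓘(ℝ, EuclideanSpace ℝ (Fin 4))) c ξ J) {s t : ℝ}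
    (hs : s ∈ J) (ht : t ∈ J) : SameOrbit ξ (c s) (c t) :=
  ⟨c, J, hJ, hJ', hc, ⟨s, hs, rfl⟩, t, ht, rfl⟩

omit hξ in
theorem vecC_ne_zero (hp : p ∈ timelikeRegion g ξ) : vecC ξ p ≠ 0 := by
  intro h
  have h1 : lam g ξ p = - bil g p (vecC ξ p) (vecC ξ p) := rfl
  have h2 : 0 < lam g ξ p := hp
  rw [h1, h, map_zero] at h2
  simp at h2

/-! ### The projection onto the orbits and lifts of vectors -/

section Projection

variable {N : Type*} [TopologicalSpace N] [ChartedSpace (EuclideanSpace ℝ (Fin 3)) N]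
  [IsManifold 𝓘(ℝ, EuclideanSpace ℝ (Fin 3)) 3 N] {π : M → N}

/-- The differential of `π` in the bases `frame`. -/
def dprojC (π : M → N) (p : M) : Coords 4 →L[ℝ] Coords 3 := dproj π p

omit [IsManifold 𝓘(ℝ, EuclideanSpace ℝ (Fin 4)) 3 M] hξ hg
  [IsManifold 𝓘(ℝ, EuclideanSpace ℝ (Fin 3)) 3 N] in
theorem IsTrajectoryManifold.dprojC_surjective (hπ : IsTrajectoryManifold g ξ π)
    (hp : p ∈ timelikeRegion g ξ) : Function.Surjective (dprojC π p) := hπ.submersion p hp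

omit [IsManifold 𝓘(ℝ, EuclideanSpace ℝ (Fin 3)) 3 N] in
theorem IsTrajectoryManifold.contMDiffAt (hπ : IsTrajectoryManifold g ξ π)
    (hp : p ∈ timelikeRegion g ξ) :
    ContMDiffAt 𝓘(ℝ, EuclideanSpace ℝ (Fin 4)) 𝓘(ℝ, EuclideanSpace ℝ (Fin 3)) 3 π p :=
  hπ.contMDiffOn.contMDiffAt ((isOpen_timelikeRegion hξ hg).mem_nhds hp)

omit [IsManifold 𝓘(ℝ, EuclideanSpace ℝ (Fin 3)) 3 N] in
theorem IsTrajectoryManifold.proj_integralCurve (hπ : IsTrajectoryManifold g ξ π)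
    {c : ℝ → M} {J : Set ℝ} (hJ : IsOpen J) (hJ' : J.OrdConnected)
    (hc : IsMIntegralCurveOn (I := 𝓘(ℝ, EuclideanSpace ℝ (Fin 4))) c ξ J) {s t : ℝ}
    (hs : s ∈ J) (ht : t ∈ J) (hp : c s ∈ timelikeRegion g ξ) :
    c t ∈ timelikeRegion g ξ ∧ π (c t) = π (c s) := by
  have h1 : c t ∈ timelikeRegion g ξ := by
    have h := lam_integralCurve hξ hg hJ hJ' hc hs ht
    have h2 : 0 < lam g ξ (c s) := hp
    change 0 < lam g ξ (c t)
    rw [← h]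
    exact h2
  exact ⟨h1, (hπ.fibre _ h1 _ hp).2 (SameOrbit.of_integralCurve hJ hJ' hc ht hs)⟩

omit [IsManifold 𝓘(ℝ, EuclideanSpace ℝ (Fin 3)) 3 N] in
-- A local integral curve through `p` lies in one fibre, so π is constant along it; differentiation
-- at the initial time gives the claim.
theorem IsTrajectoryManifold.dprojC_vecC (hπ : IsTrajectoryManifold g ξ π)
    (hp : p ∈ timelikeRegion g ξ) : dprojC π p (vecC ξ p) = 0 := by
  obtain ⟨c, hc0, hc⟩ := exists_isMIntegralCurveAt_of_contMDiffAt_boundaryless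
    (I := 𝓘(ℝ, EuclideanSpace ℝ (Fin 4))) (v := ξ) 0 ((hξ.contMDiff p).of_le (by norm_num))
  obtain ⟨ε, hε, hcε⟩ := isMIntegralCurveAt_iff'.1 hc
  have h0 : (0 : ℝ) ∈ Metric.ball (0 : ℝ) ε := Metric.mem_ball_self hε
  have hconst : ∀ t ∈ Metric.ball (0 : ℝ) ε, π (c t) = π p := fun t ht => by
    have := (hπ.proj_integralCurve hξ hg Metric.isOpen_ball
      ((convex_ball _ _).ordConnected) hcε h0 ht (by rw [hc0]; exact hp)).2
    rw [this, hc0]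
  have h1 : HasMFDerivAt 𝓘(ℝ, ℝ) 𝓘(ℝ, EuclideanSpace ℝ (Fin 4)) c 0
      ((1 : ℝ →L[ℝ] ℝ).smulRight (ξ (c 0))) := hc.hasMFDerivAt
  subst hc0
  have h2 := HasMFDerivAt.comp (f := c) (0 : ℝ)
    (((hπ.contMDiffAt hξ hg hp).mdifferentiableAt (by norm_num)).hasMFDerivAt) h1
  have h3 : HasMFDerivAt 𝓘(ℝ, ℝ) 𝓘(ℝ, EuclideanSpace ℝ (Fin 3)) (π ∘ c) 0
      (0 : ℝ →L[ℝ] Coords 3) := by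
    refine (hasMFDerivAt_const (π (c 0)) (0 : ℝ)).congr_of_eventuallyEq ?_
    filter_upwards [Metric.isOpen_ball.mem_nhds h0] with t ht using hconst t ht
  have h4 := hasMFDerivAt_unique h2 h3
  have h5 := congrArg (fun L : ℝ →L[ℝ] Coords 3 => L 1) h4
  refine Eq.trans ?_ h5
  change dprojC π (c 0) (vecC ξ (c 0)) = dprojC π (c 0) ((1 : ℝ) • vecC ξ (c 0))
  rw [one_smul]

omit [IsManifold 𝓘(ℝ, EuclideanSpace ℝ (Fin 3)) 3 N] in
-- The kernel has dimension `4 − 3 = 1` and contains ξ, which is not zero where λ > 0.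
theorem IsTrajectoryManifold.exists_smul_vecC (hπ : IsTrajectoryManifold g ξ π)
    (hp : p ∈ timelikeRegion g ξ) {v : Coords 4} (hv : dprojC π p v = 0) :
    ∃ k : ℝ, v = k • vecC ξ p := by
  have hs := hπ.dprojC_surjective hp
  have hr := LinearMap.finrank_range_add_finrank_ker (dprojC π p : Coords 4 →ₗ[ℝ] Coords 3)
  rw [LinearMap.range_eq_top.2 hs, finrank_top, finrank_euclideanSpace, finrank_euclideanSpace,
    Fintype.card_fin, Fintype.card_fin] at hr
  have h1 : Module.finrank ℝ (LinearMap.ker (dprojC π p : Coords 4 →ₗ[ℝ] Coords 3)) = 1 := by omega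
  have hx : (⟨vecC ξ p, hπ.dprojC_vecC hξ hg hp⟩ :
      LinearMap.ker (dprojC π p : Coords 4 →ₗ[ℝ] Coords 3)) ≠ 0 := by
    intro h
    exact vecC_ne_zero hg hp (congrArg Subtype.val h)
  obtain ⟨k, hk⟩ := (finrank_eq_one_iff_of_nonzero' _ hx).1 h1 ⟨v, hv⟩
  exact ⟨k, (congrArg Subtype.val hk).symm⟩

omit [TopologicalSpace M] [ChartedSpace (EuclideanSpace ℝ (Fin 4)) M]
  [IsManifold 𝓘(ℝ, EuclideanSpace ℝ (Fin 4)) 3 M] hξ hg [TopologicalSpace N]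
  [ChartedSpace (EuclideanSpace ℝ (Fin 3)) N] [IsManifold 𝓘(ℝ, EuclideanSpace ℝ (Fin 3)) 3 N] in
/-- A continuous right inverse of a surjective linear map. -/
theorem exists_rightInverse {A : Coords 4 →L[ℝ] Coords 3} (hA : Function.Surjective A) :
    ∃ R : Coords 3 →L[ℝ] Coords 4, ∀ u, A (R u) = u := by
  obtain ⟨R, hR⟩ := LinearMap.exists_rightInverse_of_surjective (A : Coords 4 →ₗ[ℝ] Coords 3)
    (LinearMap.range_eq_top.2 hA)
  exact ⟨LinearMap.toContinuousLinearMap R, fun u => congrArg (fun L => L u) hR⟩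

/-- The map `π` in charts. -/
theorem IsTrajectoryManifold.dprojC_dchart (hπ : IsTrajectoryManifold g ξ π) {x : N}
    {y : Coords 4} (hy : y ∈ (chartC 4 p).target)
    (hq : (chartC 4 p).symm y ∈ timelikeRegion g ξ)
    (hx : π ((chartC 4 p).symm y) ∈ (chartC 3 x).source) (v : Coords 4) :
    dprojC π ((chartC 4 p).symm y) (dchart p y v)
      = dchart x (inCharts 4 3 p x π y) (fderiv ℝ (inCharts 4 3 p x π) y v) :=
  congrArg (fun L => L v) (mfderiv_comp_dchart (f := π) hy
    ((hπ.contMDiffAt hξ hg hq).mdifferentiableAt (by norm_num)) hx)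

theorem IsTrajectoryManifold.eventually_good (hπ : IsTrajectoryManifold g ξ π) {x : N}
    (hp : p ∈ timelikeRegion g ξ) (hx : π p ∈ (chartC 3 x).source) :
    ∀ᶠ y in 𝓝 (coord p), y ∈ (chartC 4 p).target ∧ (chartC 4 p).symm y ∈ timelikeRegion g ξ ∧
      π ((chartC 4 p).symm y) ∈ (chartC 3 x).source := by
  have hy := coord_mem_target (n := 4) p
  have hc : ContinuousAt (chartC 4 p).symm (coord p) := continuousAt_chart_symm hy
  have h1 : ∀ᶠ q in 𝓝 ((chartC 4 p).symm (coord p)), q ∈ timelikeRegion g ξ := by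
    rw [symm_coord (n := 4)]
    exact (isOpen_timelikeRegion hξ hg).mem_nhds hp
  have h2 : ∀ᶠ q in 𝓝 ((chartC 4 p).symm (coord p)), π q ∈ (chartC 3 x).source := by
    rw [symm_coord (n := 4)]
    exact (hπ.contMDiffAt hξ hg hp).continuousAt.eventually
      ((isOpen_extChartAt_source x).mem_nhds hx)
  exact Filter.Eventually.and (target_mem_nhds hy) ((hc.eventually h1).and (hc.eventually h2))

theorem IsTrajectoryManifold.contDiffAt_inCharts (hπ : IsTrajectoryManifold g ξ π) {x : N}
    (hp : p ∈ timelikeRegion g ξ) (hx : π p ∈ (chartC 3 x).source) :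
    ContDiffAt ℝ 3 (inCharts 4 3 p x π) (coord p) := by
  have h := symm_coord (n := 4) p
  exact KillingSpacetime.contDiffAt_inCharts le_rfl (coord_mem_target (n := 4) p)
    (by rw [h]; exact hπ.contMDiffAt hξ hg hp) (by rw [h]; exact hx)

/-- This is the derivative of the identity `Dφ(y) ξ̂(y) = 0`, valid near the centre of the chart,
combined with the symmetry of `D²φ`. -/
theorem IsTrajectoryManifold.fderiv_xiHat (hπ : IsTrajectoryManifold g ξ π) {x : N}
    (hp : p ∈ timelikeRegion g ξ) (hx : π p ∈ (chartC 3 x).source) (v : Coords 4) :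
    fderiv ℝ (inCharts 4 3 p x π) (coord p) (fderiv ℝ (xiHat g ξ p) (coord p) v)
      = - fderiv ℝ (fderiv ℝ (inCharts 4 3 p x π)) (coord p) (vecC ξ p) v := by
  have hy := coord_mem_target (n := 4) p
  have hφ := hπ.contDiffAt_inCharts hξ hg hp hx
  have hz : ∀ᶠ y in 𝓝 (coord p), fderiv ℝ (inCharts 4 3 p x π) y (xiHat g ξ p y) = 0 := by
    filter_upwards [hπ.eventually_good hξ hg hp hx] with y hy
    have h := hπ.dprojC_dchart hξ hg hy.1 hy.2.1 hy.2.2 (xiHat g ξ p y)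
    rw [dchart_xiHat hg hy.1, hπ.dprojC_vecC hξ hg hy.2.1] at h
    refine dchart_injective (p := x) ((chartC 3 x).map_source hy.2.2) ?_
    rw [map_zero]
    exact h.symm
  have h1 : HasFDerivAt (fun y => fderiv ℝ (inCharts 4 3 p x π) y (xiHat g ξ p y)) _ (coord p) :=
    ((differentiableAt_fderiv (hφ.of_le (by norm_num))).hasFDerivAt).clm_apply
      ((hξ.contDiffAt_xiHat hg hy).differentiableAt (by norm_num)).hasFDerivAt
  have h2 := h1.unique ((hasFDerivAt_const (0 : Coords 3) (coord p)).congr_of_eventuallyEq hz)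
  have h3 := congrArg (fun L => L v) h2
  simp only [add_apply, ContinuousLinearMap.comp_apply, ContinuousLinearMap.flip_apply,
    xiHat_center hg, zero_apply] at h3
  rw [symm_snd_fderiv (hφ.of_le (by norm_num))]
  exact eq_neg_of_add_eq_zero_left h3

/-- The horizontal lift of a vector along an orbit. -/
theorem IsTrajectoryManifold.exists_lift (hπ : IsTrajectoryManifold g ξ π)
    {c : ℝ → M} {t : ℝ} (hct : c t ∈ timelikeRegion g ξ)
    (hcc : ContinuousAt c t) (hcd : HasDerivAt (fun s => chartC 4 (c t) (c s)) (vecC ξ (c t)) t)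
    (hc : ∀ᶠ s in 𝓝 t, c s ∈ timelikeRegion g ξ ∧ π (c s) = π (c t)) (u : Coords 3) :
    ∃ (U : ℝ → Coords 4) (k : ℝ),
      HasDerivAt U (fderiv ℝ (xiHat g ξ (c t)) (coord (c t)) (U t) + k • vecC ξ (c t)) t ∧
      ∀ᶠ s in 𝓝 t, dprojC π (c s) (dchart (c t) (chartC 4 (c t) (c s)) (U s)) = u := by
  set p := c t with hp
  set x := π p with hx
  have hxs : π p ∈ (chartC 3 x).source := mem_extChartAt_source _
  set φ := inCharts 4 3 p x π with hφdef
  have hφ : ContDiffAt ℝ 3 φ (coord p) := hπ.contDiffAt_inCharts hξ hg hct hxs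
  -- Along the orbit π is constant, so the chart of `N` is always used at its centre, where its
  -- derivative is the identity.
  have hctr : ∀ᶠ s in 𝓝 t, ∀ v, dprojC π (c s) (dchart p (chartC 4 p (c s)) v)
      = fderiv ℝ φ (chartC 4 p (c s)) v := by
    have hev := hπ.eventually_good hξ hg hct hxs
    filter_upwards [eventually_chart_source hcc, hc] with s hs hcs v
    have hl : (chartC 4 p).symm (chartC 4 p (c s)) = c s := (chartC 4 p).left_inv hs
    have h := hπ.dprojC_dchart hξ hg (p := p) (x := x) ((chartC 4 p).map_source hs)
      (by rw [hl]; exact hcs.1) (by rw [hl, hcs.2]; exact hxs) v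
    have h2 : inCharts 4 3 p x π (chartC 4 p (c s)) = coord x := by
      simp only [inCharts, hl, hcs.2]
      rfl
    rw [hl, h2, dchart_center] at h
    exact h
  have hA0 : ∀ v, fderiv ℝ φ (coord p) v = dprojC π p v := by
    intro v
    have h := hctr.self_of_nhds v
    have h2 : chartC 4 p (c t) = coord p := rfl
    rw [h2, dchart_center] at h
    exact h.symm
  obtain ⟨L, hL⟩ := exists_rightInverse (hπ.dprojC_surjective hct)
  set A : ℝ → Coords 4 →L[ℝ] Coords 3 := fun s => fderiv ℝ φ (chartC 4 p (c s)) with hA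
  have hAd : HasDerivAt A (fderiv ℝ (fderiv ℝ φ) (coord p) (vecC ξ p)) t :=
    HasFDerivAt.comp_hasDerivAt (f := fun s => chartC 4 p (c s)) t
      (differentiableAt_fderiv (hφ.of_le (by norm_num))).hasFDerivAt hcd
  -- The lift will be `U(s) = L (A(s) L)⁻¹ u`. Since `A(t) L = 1`, the operator `B(s)` is invertible
  -- near `t` and the lift is differentiable there.
  set B : ℝ → Coords 3 →L[ℝ] Coords 3 := fun s => (A s).comp L with hB
  have hBt : B t = 1 := by
    ext1 v
    change fderiv ℝ φ (coord p) (L v) = v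
    rw [hA0, hL]
  have hBd : DifferentiableAt ℝ B t :=
    hAd.differentiableAt.clm_comp (differentiableAt_const L)
  have hBu : ∀ᶠ s in 𝓝 t, IsUnit (B s) := by
    refine hBd.continuousAt.eventually (Units.isOpen.mem_nhds ?_)
    rw [hBt]
    exact isUnit_one
  set U : ℝ → Coords 4 := fun s => L (Ring.inverse (B s) u) with hU
  have hUd : DifferentiableAt ℝ U t := by
    have h1 : DifferentiableAt ℝ (fun s => Ring.inverse (B s)) t :=
      DifferentiableAt.comp (f := B) t
        (differentiableAt_inverse (𝕜 := ℝ) (by rw [hBt]; exact isUnit_one)) hBd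
    exact L.differentiableAt.comp t (h1.clm_apply (differentiableAt_const u))
  have hAU : ∀ᶠ s in 𝓝 t, A s (U s) = u := by
    filter_upwards [hBu] with s hs
    have h := congrArg (fun L : Coords 3 →L[ℝ] Coords 3 => L u) (Ring.mul_inverse_cancel _ hs)
    exact h
  have h1 : HasDerivAt (fun s => A s (U s)) _ t := hAd.clm_apply hUd.hasDerivAt
  have h2 := h1.unique ((hasDerivAt_const t u).congr_of_eventuallyEq hAU)
  -- Differentiating `A(s) U(s) = u` gives `A U' = −A' U`, and by `fderiv_xiHat` the right side is
  -- `A(Dξ̂ U)`. Hence `U' − Dξ̂ U` lies in the kernel, which is spanned by ξ.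
  have h3 : dprojC π p (deriv U t - fderiv ℝ (xiHat g ξ p) (coord p) (U t)) = 0 := by
    rw [map_sub, ← hA0, ← hA0, hπ.fderiv_xiHat hξ hg hct hxs, sub_neg_eq_add, add_comm]
    exact h2
  obtain ⟨k, hk⟩ := hπ.exists_smul_vecC hξ hg hct h3
  refine ⟨U, k, ?_, ?_⟩
  · rw [← hk, add_sub_cancel]
    exact hUd.hasDerivAt
  · filter_upwards [hctr, hAU] with s h1 h2
    rw [h1]
    exact h2

end Projection

end Orbits

/-! ### Invariant horizontal tensors descend to the space of orbits -/

section Descent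

open Filter

variable {M : Type*} [TopologicalSpace M] [ChartedSpace (EuclideanSpace ℝ (Fin 4)) M]
  [IsManifold 𝓘(ℝ, EuclideanSpace ℝ (Fin 4)) 3 M]
  {g : BilinField 4 M} {η : (p : M) → Tan 4 p [⋀^Fin 4]→ₗ[ℝ] ℝ} {ξ : (p : M) → Tan 4 p} {p : M}
  {N : Type*} [TopologicalSpace N] [ChartedSpace (EuclideanSpace ℝ (Fin 3)) N]
  [IsManifold 𝓘(ℝ, EuclideanSpace ℝ (Fin 3)) 3 N] {π : M → N}
  {F : Type*} [NormedAddCommGroup F] [NormedSpace ℝ F]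
  (hξ : IsKilling g ξ) (hg : IsLorentzMetric g)

include hξ hg

omit [IsManifold 𝓘(ℝ, EuclideanSpace ℝ (Fin 3)) 3 N] in
/-- A horizontal one-form has the same value on vectors with the same projection. -/
theorem IsTrajectoryManifold.apply_eq_of_proj (hπ : IsTrajectoryManifold g ξ π)
    (hp : p ∈ timelikeRegion g ξ) {L : Coords 4 →L[ℝ] F} (hL : L (vecC ξ p) = 0) {v w : Coords 4}
    (h : dprojC π p v = dprojC π p w) : L v = L w := by
  obtain ⟨k, hk⟩ := hπ.exists_smul_vecC hξ hg hp (v := v - w) (by rw [map_sub, h, sub_self])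
  rw [← sub_eq_zero, ← map_sub, hk, map_smul, hL, smul_zero]

/-- A horizontal one-form that is invariant under the flow of `ξ` descends to the manifold of
trajectories. -/
theorem IsTrajectoryManifold.apply_eq_of_invariant (hπ : IsTrajectoryManifold g ξ π)
    {θ : M → Coords 4 →L[ℝ] F}
    (hd : ∀ p ∈ timelikeRegion g ξ, DifferentiableAt ℝ (pull1 θ p) (coord p))
    (h0 : ∀ p ∈ timelikeRegion g ξ, θ p (vecC ξ p) = 0)
    (hl : ∀ p ∈ timelikeRegion g ξ, ∀ v, fderiv ℝ (pull1 θ p) (coord p) (vecC ξ p) v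
      + θ p (fderiv ℝ (xiHat g ξ p) (coord p) v) = 0)
    {p q : M} (hp : p ∈ timelikeRegion g ξ) (hq : q ∈ timelikeRegion g ξ) (hpq : π p = π q)
    {v w : Coords 4} (hvw : dprojC π p v = dprojC π q w) : θ p v = θ q w := by
  obtain ⟨c, J, hJ, hJ', hc, ⟨s₀, hs₀, rfl⟩, t₀, ht₀, rfl⟩ := (hπ.fibre p hp q hq).1 hpq
  have hJm : ∀ s ∈ J, ∀ t ∈ J, c s ∈ timelikeRegion g ξ ∧ π (c s) = π (c t) := fun s hs t ht =>
    have h1 := hπ.proj_integralCurve hξ hg hJ hJ' hc hs₀ hs hp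
    ⟨h1.1, h1.2.trans (hπ.proj_integralCurve hξ hg hJ hJ' hc hs₀ ht hp).2.symm⟩
  -- These lifts are chosen without any regularity in `s`. Horizontality makes the value of `θ`
  -- independent of the choice, so near each time they can be replaced by a differentiable lift.
  have hV : ∀ s, ∃ z, s ∈ J → dprojC π (c s) z = dprojC π (c s₀) v := by
    intro s
    by_cases hs : s ∈ J
    · obtain ⟨z, hz⟩ := hπ.dprojC_surjective (hJm s hs s₀ hs₀).1 (dprojC π (c s₀) v)
      exact ⟨z, fun _ => hz⟩
    · exact ⟨0, fun h => absurd h hs⟩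
  choose V hV using hV
  have hder : ∀ t ∈ J, HasDerivAt (fun s => θ (c s) (V s)) 0 t := by
    intro t ht
    obtain ⟨hcc, hcd⟩ := hasDerivAt_integralCurve hJ hc ht
    have hct := (hJm t ht t ht).1
    obtain ⟨U, k, hU, hUe⟩ := hπ.exists_lift hξ hg hct hcc hcd
      (by filter_upwards [hJ.mem_nhds ht] with s hs using hJm s hs t ht) (dprojC π (c s₀) v)
    have h1 : HasDerivAt (fun s => pull1 θ (c t) (chartC 4 (c t) (c s))) _ t :=
      HasFDerivAt.comp_hasDerivAt (f := fun s => chartC 4 (c t) (c s)) t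
        (hd _ hct).hasFDerivAt hcd
    -- The derivative along the differentiable lift is the Lie derivative of `θ` at `U t` plus `k
    -- θ(ξ)`, and both vanish.
    have h2 := (h1.clm_apply hU).congr_deriv (g' := 0) (by
      have e : pull1 θ (c t) (chartC 4 (c t) (c t)) = θ (c t) := pull1_center θ (c t)
      rw [e, map_add, map_smul, h0 _ hct, smul_zero, add_zero]
      exact hl _ hct (U t))
    refine h2.congr_of_eventuallyEq ?_
    filter_upwards [hUe, hJ.mem_nhds ht, eventually_chart_source hcc] with s h3 hs h4
    rw [pull1_apply, (chartC 4 (c t)).left_inv h4]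
    exact hπ.apply_eq_of_proj hξ hg (hJm s hs t ht).1 (h0 _ (hJm s hs t ht).1)
      ((hV s hs).trans h3.symm)
  have hconst := hJ.is_const_of_deriv_eq_zero hJ'.isPreconnected
    (fun t ht => (hder t ht).differentiableAt.differentiableWithinAt)
    (fun t ht => (hder t ht).deriv) hs₀ ht₀
  refine (hπ.apply_eq_of_proj hξ hg hp (h0 _ hp) (hV s₀ hs₀).symm).trans (hconst.trans ?_)
  exact hπ.apply_eq_of_proj hξ hg hq (h0 _ hq) ((hV t₀ ht₀).trans hvw)

/-- A horizontal bilinear form that is invariant under the flow of `ξ` descends to the manifold of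
trajectories. -/
theorem IsTrajectoryManifold.apply₂_eq_of_invariant (hπ : IsTrajectoryManifold g ξ π)
    {B : M → Coords 4 →L[ℝ] Coords 4 →L[ℝ] F}
    (hd : ∀ p ∈ timelikeRegion g ξ, DifferentiableAt ℝ (pull2 B p) (coord p))
    (h0 : ∀ p ∈ timelikeRegion g ξ, B p (vecC ξ p) = 0)
    (h0' : ∀ p ∈ timelikeRegion g ξ, ∀ v, B p v (vecC ξ p) = 0)
    (hl : ∀ p ∈ timelikeRegion g ξ, ∀ u v, fderiv ℝ (pull2 B p) (coord p) (vecC ξ p) u v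
      + B p (fderiv ℝ (xiHat g ξ p) (coord p) u) v
      + B p u (fderiv ℝ (xiHat g ξ p) (coord p) v) = 0)
    {p q : M} (hp : p ∈ timelikeRegion g ξ) (hq : q ∈ timelikeRegion g ξ) (hpq : π p = π q)
    {v w v' w' : Coords 4} (hvw : dprojC π p v = dprojC π q w)
    (hvw' : dprojC π p v' = dprojC π q w') : B p v v' = B q w w' := by
  have hB : ∀ {p : M} {v w v' w' : Coords 4}, p ∈ timelikeRegion g ξ →
      dprojC π p v = dprojC π p w → dprojC π p v' = dprojC π p w' → B p v v' = B p w w' := by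
    intro p v w v' w' hp h1 h2
    rw [hπ.apply_eq_of_proj hξ hg hp (h0 p hp) h1]
    exact hπ.apply_eq_of_proj hξ hg hp (h0' p hp w) h2
  obtain ⟨c, J, hJ, hJ', hc, ⟨s₀, hs₀, rfl⟩, t₀, ht₀, rfl⟩ := (hπ.fibre p hp q hq).1 hpq
  have hJm : ∀ s ∈ J, ∀ t ∈ J, c s ∈ timelikeRegion g ξ ∧ π (c s) = π (c t) := fun s hs t ht =>
    have h1 := hπ.proj_integralCurve hξ hg hJ hJ' hc hs₀ hs hp
    ⟨h1.1, h1.2.trans (hπ.proj_integralCurve hξ hg hJ hJ' hc hs₀ ht hp).2.symm⟩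
  have hV : ∀ u : Coords 3, ∀ s, ∃ z, s ∈ J → dprojC π (c s) z = u := by
    intro u s
    by_cases hs : s ∈ J
    · obtain ⟨z, hz⟩ := hπ.dprojC_surjective (hJm s hs s₀ hs₀).1 u
      exact ⟨z, fun _ => hz⟩
    · exact ⟨0, fun h => absurd h hs⟩
  choose V hV using hV
  set u := dprojC π (c s₀) v
  set u' := dprojC π (c s₀) v'
  have hder : ∀ t ∈ J, HasDerivAt (fun s => B (c s) (V u s) (V u' s)) 0 t := by
    intro t ht
    obtain ⟨hcc, hcd⟩ := hasDerivAt_integralCurve hJ hc ht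
    have hct := (hJm t ht t ht).1
    have hev : ∀ᶠ s in 𝓝 t, c s ∈ timelikeRegion g ξ ∧ π (c s) = π (c t) := by
      filter_upwards [hJ.mem_nhds ht] with s hs using hJm s hs t ht
    obtain ⟨U, k, hU, hUe⟩ := hπ.exists_lift hξ hg hct hcc hcd hev u
    obtain ⟨U', k', hU', hUe'⟩ := hπ.exists_lift hξ hg hct hcc hcd hev u'
    have h1 : HasDerivAt (fun s => pull2 B (c t) (chartC 4 (c t) (c s))) _ t :=
      HasFDerivAt.comp_hasDerivAt (f := fun s => chartC 4 (c t) (c s)) t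
        (hd _ hct).hasFDerivAt hcd
    have h2 := ((h1.clm_apply hU).clm_apply hU').congr_deriv (g' := 0) (by
      have e : pull2 B (c t) (chartC 4 (c t) (c t)) = B (c t) := pull2_center B (c t)
      rw [e, map_add, map_smul, map_add, map_smul, h0 _ hct, h0' _ hct, smul_zero, add_zero,
        smul_zero, add_zero, add_apply]
      exact hl _ hct (U t) (U' t))
    refine h2.congr_of_eventuallyEq ?_
    filter_upwards [hUe, hUe', hJ.mem_nhds ht, eventually_chart_source hcc] with s h3 h3' hs h4
    rw [pull2_apply, (chartC 4 (c t)).left_inv h4]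
    exact hB (hJm s hs t ht).1 ((hV u s hs).trans h3.symm) ((hV u' s hs).trans h3'.symm)
  have hconst := hJ.is_const_of_deriv_eq_zero hJ'.isPreconnected
    (fun t ht => (hder t ht).differentiableAt.differentiableWithinAt)
    (fun t ht => (hder t ht).deriv) hs₀ ht₀
  refine (hB hp (hV u s₀ hs₀).symm (hV u' s₀ hs₀).symm).trans (hconst.trans ?_)
  exact hB hq ((hV u t₀ ht₀).trans hvw) ((hV u' t₀ ht₀).trans hvw')

theorem IsTrajectoryManifold.gammaForm_eq (hπ : IsTrajectoryManifold g ξ π)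
    {p q : M} (hp : p ∈ timelikeRegion g ξ) (hq : q ∈ timelikeRegion g ξ) (hpq : π p = π q)
    {v w v' w' : Coords 4} (hvw : dprojC π p v = dprojC π q w)
    (hvw' : dprojC π p v' = dprojC π q w') :
    gammaForm g ξ p v v' = gammaForm g ξ q w w' :=
  hπ.apply₂_eq_of_invariant hξ hg
    (fun p _ => (contDiffAt_gammaForm hξ hg p (coord_mem_target (n := 4) p)).differentiableAt
      (by norm_num))
    (fun p _ => ContinuousLinearMap.ext fun v => gammaForm_vecC hg p v)
    (fun p _ v => (gammaForm_symm hg p v _).trans (gammaForm_vecC hg p v))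
    (fun p _ => lie_gammaForm hξ hg p) hp hq hpq hvw hvw'

theorem IsTrajectoryManifold.ernstForm_eq (hπ : IsTrajectoryManifold g ξ π)
    (hη : IsVolumeForm g η) (hvac : ∀ (p : M) (a b : Fin 4), ricci g p a b = 0)
    {p q : M} (hp : p ∈ timelikeRegion g ξ) (hq : q ∈ timelikeRegion g ξ) (hpq : π p = π q)
    {v w : Coords 4} (hvw : dprojC π p v = dprojC π q w) :
    ernstForm g η ξ p v = ernstForm g η ξ q w :=
  hπ.apply_eq_of_invariant hξ hg (fun p _ => differentiableAt_ernstForm hη hξ hg p)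
    (fun _ hp => ernstForm_vecC hη hξ hg hp) (fun _ hp => lie_ernstForm hη hξ hg hvac hp)
    hp hq hpq hvw

theorem IsTrajectoryManifold.twistForm_eq (hπ : IsTrajectoryManifold g ξ π)
    (hη : IsVolumeForm g η) (hvac : ∀ (p : M) (a b : Fin 4), ricci g p a b = 0)
    {p q : M} (hp : p ∈ timelikeRegion g ξ) (hq : q ∈ timelikeRegion g ξ) (hpq : π p = π q)
    {v w : Coords 4} (hvw : dprojC π p v = dprojC π q w) :
    twistForm g η ξ p v = twistForm g η ξ q w :=
  congrArg (fun z : ℂ => -z.im) (hπ.ernstForm_eq hξ hg hη hvac hp hq hpq hvw)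

omit [IsManifold 𝓘(ℝ, EuclideanSpace ℝ (Fin 3)) 3 N] in
theorem IsTrajectoryManifold.existsUnique_corr₀ (hπ : IsTrajectoryManifold g ξ π) :
    ∃! l : N → ℝ, Corr₀ g ξ π l (lam g ξ) := by
  choose s hs hs' using hπ.surjective
  refine ⟨fun x => lam g ξ (s x), fun p hp => ?_, fun l hl => ?_⟩
  · exact SameOrbit.lam_eq hξ hg ((hπ.fibre _ (hs _) _ hp).1 (hs' (π p)))
  · funext x
    rw [← hl _ (hs x), hs']

omit [IsManifold 𝓘(ℝ, EuclideanSpace ℝ (Fin 3)) 3 N] hξ hg in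
theorem corr₁_iff {ω : (x : N) → Tan 3 x →L[ℝ] ℝ} :
    Corr₁ g ξ π ω (twist g η ξ) ↔ ∀ p ∈ timelikeRegion g ξ, ∀ v,
      (ω (π p) : Coords 3 →L[ℝ] ℝ) (dprojC π p v) = twistForm g η ξ p v := by
  refine forall₂_congr fun p _ => ⟨fun h v => ?_, fun h a => ?_⟩
  · have e := apply_eq_sum (ContinuousLinearMap.comp (ω (π p) : Coords 3 →L[ℝ] ℝ) (dprojC π p)) v
    refine e.trans ?_
    rw [apply_eq_sum (twistForm g η ξ p)]
    exact Finset.sum_congr rfl fun a _ => congrArg _ ((h a).trans (twistForm_stdVec p a).symm)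
  · exact (h (stdVec 4 a)).trans (twistForm_stdVec p a)

omit [IsManifold 𝓘(ℝ, EuclideanSpace ℝ (Fin 3)) 3 N] hξ hg in
theorem corr₂_iff {γ : BilinField 3 N} :
    Corr₂ g ξ π γ (gammaMetric g ξ) ↔ ∀ p ∈ timelikeRegion g ξ, ∀ u v,
      bil γ (π p) (dprojC π p u) (dprojC π p v) = gammaForm g ξ p u v := by
  refine forall₂_congr fun p _ => ⟨fun h u v => ?_, fun h a b => ?_⟩
  · have e : (bil γ (π p)).bilinearComp (dprojC π p) (dprojC π p) = gammaForm g ξ p := by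
      ext u v
      rw [apply_eq_sum _ u, apply_eq_sum (gammaForm g ξ p) u, sum_apply, sum_apply]
      refine Finset.sum_congr rfl fun a _ => ?_
      rw [smul_apply, smul_apply, apply_eq_sum _ v, apply_eq_sum (gammaForm g ξ p (stdVec 4 a)) v]
      refine congrArg _ (Finset.sum_congr rfl fun b _ => congrArg _ ?_)
      exact (h a b).trans (gammaForm_stdVec p a b).symm
    exact congrArg (fun L => L u v) e
  · exact (h (stdVec 4 a) (stdVec 4 b)).trans (gammaForm_stdVec p a b)

/-- A point of the fibre and a right inverse of the differential are chosen for every `x`;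
invariance shows that the result does not depend on them. Uniqueness holds because every vector of
`N` is the projection of some vector over `M⁺`. -/
theorem IsTrajectoryManifold.existsUnique_corr₁ (hπ : IsTrajectoryManifold g ξ π)
    (hη : IsVolumeForm g η) (hvac : ∀ (p : M) (a b : Fin 4), ricci g p a b = 0) :
    ∃! ω : (x : N) → Tan 3 x →L[ℝ] ℝ, Corr₁ g ξ π ω (twist g η ξ) := by
  choose s hs hs' using hπ.surjective
  choose R hR using fun x => exists_rightInverse (hπ.dprojC_surjective (hs x))
  refine ⟨fun x => ((twistForm g η ξ (s x)).comp (R x) : Coords 3 →L[ℝ] ℝ),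
    corr₁_iff.2 fun p hp v => ?_, fun ω hω => ?_⟩
  · exact hπ.twistForm_eq hξ hg hη hvac (hs _) hp (hs' _) (hR _ _)
  · funext x
    refine ContinuousLinearMap.ext fun u : Coords 3 => ?_
    have h := corr₁_iff.1 hω (s x) (hs x) (R x u)
    exact ((congrArg (fun y => (ω y : Coords 3 →L[ℝ] ℝ) u) (hs' x).symm).trans
      (congrArg (ω (π (s x)) : Coords 3 →L[ℝ] ℝ) (hR x u).symm)).trans h

theorem IsTrajectoryManifold.existsUnique_corr₂ (hπ : IsTrajectoryManifold g ξ π) :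
    ∃! γ : BilinField 3 N, Corr₂ g ξ π γ (gammaMetric g ξ) := by
  choose s hs hs' using hπ.surjective
  choose R hR using fun x => exists_rightInverse (hπ.dprojC_surjective (hs x))
  refine ⟨fun x => ((gammaForm g ξ (s x)).bilinearComp (R x) (R x) :
      Coords 3 →L[ℝ] Coords 3 →L[ℝ] ℝ), corr₂_iff.2 fun p hp u v => ?_, fun γ hγ => ?_⟩
  · exact hπ.gammaForm_eq hξ hg (hs _) hp (hs' _) (hR _ _) (hR _ _)
  · funext x
    refine ContinuousLinearMap.ext fun u : Coords 3 => ContinuousLinearMap.ext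
      fun v : Coords 3 => ?_
    have h := corr₂_iff.1 hγ (s x) (hs x) (R x u) (R x v)
    exact ((congrArg (fun y => bil γ y u v) (hs' x).symm).trans
      (congrArg₂ (fun u v => bil γ (π (s x)) u v) (hR x u).symm (hR x v).symm)).trans h

end Descent

/-! ### Local sections and regularity on the space of orbits -/

section Sections

open Filter

/-- A submersion has local sections. -/
theorem exists_section_of_surjective {φ : Coords 4 → Coords 3} {y : Coords 4}
    (hφ : ContDiffAt ℝ 3 φ y) (hs : Function.Surjective (fderiv ℝ φ y)) :
    ∃ s : Coords 3 → Coords 4, ContDiffAt ℝ 3 s (φ y) ∧ s (φ y) = y ∧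
      ∀ᶠ z in 𝓝 (φ y), φ (s z) = z := by
  obtain ⟨L, hL⟩ := exists_rightInverse hs
  -- Restricted to the affine slice `y + range L`, with `L` a right inverse of `Dφ`, the map `φ` has
  -- derivative the identity and is locally invertible; the section runs inside this slice.
  have h1 : ContDiffAt ℝ 3 (fun z => y + L z) 0 :=
    contDiffAt_const.add L.contDiff.contDiffAt
  have hy : y + L 0 = y := by rw [map_zero, add_zero]
  have h2 : ContDiffAt ℝ 3 (fun z => φ (y + L z)) 0 :=
    ContDiffAt.comp (g := φ) (f := fun z => y + L z) 0 (by rw [hy]; exact hφ) h1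
  have h3 : HasFDerivAt (fun z => φ (y + L z))
      ((ContinuousLinearEquiv.refl ℝ (Coords 3) : Coords 3 →L[ℝ] Coords 3)) 0 := by
    have h4 : HasFDerivAt (fun z => y + L z) L 0 := L.hasFDerivAt.const_add y
    have h5 : HasFDerivAt φ (fderiv ℝ φ y) (y + L 0) := by
      rw [hy]
      exact (hφ.differentiableAt (by norm_num)).hasFDerivAt
    refine (h5.comp 0 h4).congr_fderiv ?_
    ext1 u
    exact hL u
  have hn : (3 : WithTop ℕ∞) ≠ 0 := by norm_num
  have e : φ (y + L 0) = φ y := by rw [hy]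
  refine ⟨fun z => y + L (h2.localInverse h3 hn z), ?_, ?_, ?_⟩
  · refine contDiffAt_const.add (L.contDiff.contDiffAt.comp _ ?_)
    rw [← e]
    exact h2.to_localInverse h3 hn
  · have h := h2.localInverse_apply_image h3 hn
    rw [e] at h
    simp only [h, hy]
  · have h := (h2.hasStrictFDerivAt' h3 hn).eventually_right_inverse
    rw [e] at h
    exact h

variable {M : Type*} [TopologicalSpace M] [ChartedSpace (EuclideanSpace ℝ (Fin 4)) M]
  [IsManifold 𝓘(ℝ, EuclideanSpace ℝ (Fin 4)) 3 M]
  {g : BilinField 4 M} {η : (p : M) → Tan 4 p [⋀^Fin 4]→ₗ[ℝ] ℝ} {ξ : (p : M) → Tan 4 p} {p : M}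
  {N : Type*} [TopologicalSpace N] [ChartedSpace (EuclideanSpace ℝ (Fin 3)) N]
  [IsManifold 𝓘(ℝ, EuclideanSpace ℝ (Fin 3)) 3 N] {π : M → N}
  {l : N → ℝ} {ω : (x : N) → Tan 3 x →L[ℝ] ℝ} {γ : BilinField 3 N}
  (hξ : IsKilling g ξ) (hg : IsLorentzMetric g)

include hξ hg

theorem IsTrajectoryManifold.fderiv_inCharts_center (hπ : IsTrajectoryManifold g ξ π)
    (hp : p ∈ timelikeRegion g ξ) (v : Coords 4) :
    fderiv ℝ (inCharts 4 3 p (π p) π) (coord p) v = dprojC π p v := by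
  have hs := symm_coord (n := 4) p
  have h := hπ.dprojC_dchart hξ hg (p := p) (x := π p) (coord_mem_target (n := 4) p)
    (by rw [hs]; exact hp) (by rw [hs]; exact mem_extChartAt_source _) v
  have h2 : inCharts 4 3 p (π p) π (coord p) = coord (π p) := by
    simp only [inCharts, hs]
    rfl
  rw [hs, h2, dchart_center, dchart_center] at h
  exact h.symm

/-- The manifold of trajectories has local sections. -/
theorem IsTrajectoryManifold.exists_section (hπ : IsTrajectoryManifold g ξ π) {x : N}
    (hp : p ∈ timelikeRegion g ξ) (hx : π p ∈ (chartC 3 x).source) :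
    ∃ s : Coords 3 → Coords 4, ContDiffAt ℝ 3 s (chartC 3 x (π p)) ∧
      s (chartC 3 x (π p)) = coord p ∧ ∀ᶠ z in 𝓝 (chartC 3 x (π p)),
        (chartC 4 p).symm (s z) ∈ timelikeRegion g ξ ∧
        π ((chartC 4 p).symm (s z)) = (chartC 3 x).symm z ∧
        ∀ w, dprojC π ((chartC 4 p).symm (s z)) (dchart p (s z) (fderiv ℝ s z w))
          = dchart x z w := by
  have hs := symm_coord (n := 4) p
  have hφ := hπ.contDiffAt_inCharts hξ hg hp hx
  have e : inCharts 4 3 p x π (coord p) = chartC 3 x (π p) := by simp only [inCharts, hs]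
  have hsurj : Function.Surjective (fderiv ℝ (inCharts 4 3 p x π) (coord p)) := by
    intro w
    obtain ⟨v, hv⟩ := hπ.dprojC_surjective hp (dchart x (chartC 3 x (π p)) w)
    refine ⟨v, dchart_injective ((chartC 3 x).map_source hx) ?_⟩
    have h := hπ.dprojC_dchart hξ hg (p := p) (x := x) (coord_mem_target (n := 4) p)
      (by rw [hs]; exact hp) (by rw [hs]; exact hx) v
    rw [hs, e, dchart_center] at h
    exact h.symm.trans hv
  obtain ⟨s, hs3, hs0, hsr⟩ := exists_section_of_surjective hφ hsurj
  rw [e] at hs3 hs0 hsr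
  refine ⟨s, hs3, hs0, ?_⟩
  have hc : Tendsto s (𝓝 (chartC 3 x (π p))) (𝓝 (coord p)) := by
    rw [← hs0]
    exact hs3.continuousAt
  have hφe : ∀ᶠ y in 𝓝 (coord p), ContDiffAt ℝ 1 (inCharts 4 3 p x π) y :=
    (hφ.of_le (m := 1) (by norm_num)).eventually (by simp)
  have hse : ∀ᶠ z in 𝓝 (chartC 3 x (π p)), ContDiffAt ℝ 1 s z :=
    (hs3.of_le (m := 1) (by norm_num)).eventually (by simp)
  filter_upwards [hc.eventually (hπ.eventually_good hξ hg hp hx), hc.eventually hφe, hse, hsr,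
    hsr.eventually_nhds] with z hz h1 h2 h3 h4
  refine ⟨hz.2.1, ?_, fun w => ?_⟩
  · have h5 : chartC 3 x (π ((chartC 4 p).symm (s z))) = z := h3
    exact ((chartC 3 x).left_inv hz.2.2).symm.trans (congrArg (chartC 3 x).symm h5)
  · rw [hπ.dprojC_dchart hξ hg hz.1 hz.2.1 hz.2.2, h3]
    congr 1
    have h5 : HasFDerivAt (fun z => inCharts 4 3 p x π (s z)) _ z :=
      (h1.differentiableAt (by norm_num)).hasFDerivAt.comp z
        (h2.differentiableAt (by norm_num)).hasFDerivAt
    have h6 := h5.unique ((hasFDerivAt_id z).congr_of_eventuallyEq h4)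
    exact congrArg (fun L => L w) h6

/-- One has `γ(u, ·) = g(λ u + ξ(u) ξ, ·)`. If this vanishes, then `λ u` is a multiple of ξ, which π
annihilates, and λ ≠ 0. -/
theorem gammaForm_nondeg (hπ : IsTrajectoryManifold g ξ π) (hp : p ∈ timelikeRegion g ξ)
    {u : Coords 4} (h : ∀ v, gammaForm g ξ p u v = 0) : dprojC π p u = 0 := by
  have hl : lam g ξ p ≠ 0 := ne_of_gt hp
  have h1 : lam g ξ p • u + flatC g ξ p u • vecC ξ p = 0 := by
    refine hg.isMetric.nondeg p _ fun v => ?_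
    have h2 := h v
    rw [gammaForm_apply] at h2
    have h3 : bil g p (lam g ξ p • u + flatC g ξ p u • vecC ξ p) v
        = lam g ξ p * bil g p u v + flatC g ξ p u * flatC g ξ p v := by
      rw [map_add, map_smul, map_smul, add_apply, smul_apply, smul_apply, smul_eq_mul,
        smul_eq_mul]
      rfl
    exact h3.trans h2
  have h4 := congrArg (dprojC π p) h1
  rw [map_add, map_smul, map_smul, hπ.dprojC_vecC hξ hg hp, smul_zero, add_zero, map_zero] at h4
  exact (smul_eq_zero.1 h4).resolve_left hl

/-- The metric `γ` on the manifold of trajectories. -/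
theorem IsTrajectoryManifold.isMetric (hπ : IsTrajectoryManifold g ξ π)
    (hγ : Corr₂ g ξ π γ (gammaMetric g ξ)) : IsMetric γ := by
  have hγ' := corr₂_iff.1 hγ
  refine ⟨fun x u v => ?_, fun x v h => ?_, fun x y hy => ?_⟩
  · obtain ⟨p, hp, rfl⟩ := hπ.surjective x
    obtain ⟨u, rfl⟩ := hπ.dprojC_surjective hp u
    obtain ⟨v, rfl⟩ := hπ.dprojC_surjective hp v
    exact (hγ' p hp u v).trans ((gammaForm_symm hg p u v).trans (hγ' p hp v u).symm)
  · obtain ⟨p, hp, rfl⟩ := hπ.surjective x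
    obtain ⟨v, rfl⟩ := hπ.dprojC_surjective hp v
    exact gammaForm_nondeg hξ hg hπ hp fun w => (hγ' p hp v w).symm.trans (h _)
  · obtain ⟨p, hp, hpx⟩ := hπ.surjective ((chartC 3 x).symm y)
    have hx : π p ∈ (chartC 3 x).source := by rw [hpx]; exact (chartC 3 x).map_target hy
    have hy' : chartC 3 x (π p) = y := by rw [hpx]; exact (chartC 3 x).right_inv hy
    obtain ⟨s, hs3, hs0, hse⟩ := hπ.exists_section hξ hg hp hx
    rw [hy'] at hs3 hs0 hse
    -- In the chart of `N` the metric is the pull-back of γ by a C³ section. One derivative of the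
    -- section enters, which leaves class C².
    have hD : ContDiffAt ℝ 2 (fderiv ℝ s) y := hs3.fderiv_right (by norm_num)
    have hG : ContDiffAt ℝ 2 (fun z => pull2 (gammaForm g ξ) p (s z)) y := by
      refine ContDiffAt.comp (g := pull2 (gammaForm g ξ) p) y ?_ (hs3.of_le (by norm_num))
      rw [hs0]
      exact contDiffAt_gammaForm hξ hg p (coord_mem_target (n := 4) p)
    refine contDiffAt_of_stdVec₂ fun a b => ?_
    refine ContDiffAt.congr_of_eventuallyEq ((hG.clm_apply (hD.clm_apply
      (contDiffAt_const (c := stdVec 3 a)))).clm_apply (hD.clm_apply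
      (contDiffAt_const (c := stdVec 3 b)))) ?_
    filter_upwards [hse] with z hz
    have h1 := hγ' _ hz.1 (dchart p (s z) (fderiv ℝ s z (stdVec 3 a)))
      (dchart p (s z) (fderiv ℝ s z (stdVec 3 b)))
    rw [hz.2.2, hz.2.2, hz.2.1] at h1
    exact h1

/-- The differential of `λ` on the manifold of trajectories. -/
theorem IsTrajectoryManifold.mvfderiv_lam (hπ : IsTrajectoryManifold g ξ π)
    (hl : Corr₀ g ξ π l (lam g ξ)) (hp : p ∈ timelikeRegion g ξ) (v : Coords 4) :
    (mvfderiv 𝓘(ℝ, EuclideanSpace ℝ (Fin 3)) l (π p) : Coords 3 →L[ℝ] ℝ) (dprojC π p v)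
      = fderiv ℝ (fun y => lam g ξ ((chartC 4 p).symm y)) (coord p) v := by
  have hx : π p ∈ (chartC 3 (π p)).source := mem_extChartAt_source _
  obtain ⟨s, hs3, hs0, hse⟩ := hπ.exists_section hξ hg hp hx
  have hlam := (hasFDerivAt_lam hξ hg p v).1
  -- Differentiability of `l` has to be proved, since the derivative takes the default value zero
  -- otherwise; it holds because `l` in the chart is λ composed with a local section.
  have h1 : DifferentiableAt ℝ (fun z => l ((chartC 3 (π p)).symm z)) (chartC 3 (π p) (π p)) := by
    refine DifferentiableAt.congr_of_eventuallyEq (DifferentiableAt.comp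
      (g := fun y => lam g ξ ((chartC 4 p).symm y)) (f := s) _ (by rw [hs0]; exact hlam)
      (hs3.differentiableAt (by norm_num))) ?_
    filter_upwards [hse] with z hz
    rw [← hz.2.1]
    exact hl _ hz.1
  have h2 : MDifferentiableAt 𝓘(ℝ, EuclideanSpace ℝ (Fin 3)) 𝓘(ℝ, ℝ) l (π p) := by
    have h3 := h1.mdifferentiableAt.comp (π p)
      ((contMDiffAt_chart hx).mdifferentiableAt (by norm_num))
    refine h3.congr_of_eventuallyEq ?_
    filter_upwards [(isOpen_extChartAt_source (π p)).mem_nhds hx] with q hq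
    exact (congrArg l ((chartC 3 (π p)).left_inv hq)).symm
  have h4 : mfderiv 𝓘(ℝ, EuclideanSpace ℝ (Fin 3)) 𝓘(ℝ, ℝ) l (π p)
      = fderiv ℝ (fun z => l ((chartC 3 (π p)).symm z)) (chartC 3 (π p) (π p)) := by
    rw [h2.mfderiv]
    simp only [writtenInExtChartAt, modelWithCornersSelf_coe, Set.range_id,
      fderivWithin_univ]
    rfl
  have h5 : (mvfderiv 𝓘(ℝ, EuclideanSpace ℝ (Fin 3)) l (π p) : Coords 3 →L[ℝ] ℝ)
      = fderiv ℝ (fun z => l ((chartC 3 (π p)).symm z)) (chartC 3 (π p) (π p)) := by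
    rw [← h4]
    rfl
  have e : inCharts 4 3 p (π p) π (coord p) = chartC 3 (π p) (π p) := by
    simp only [inCharts, symm_coord (n := 4) p]
  have hφ := (hπ.contDiffAt_inCharts hξ hg hp hx).differentiableAt (by norm_num)
  have h6 : HasFDerivAt (fun y => l ((chartC 3 (π p)).symm (inCharts 4 3 p (π p) π y))) _
      (coord p) := HasFDerivAt.comp (g := fun z => l ((chartC 3 (π p)).symm z)) (coord p)
        (by rw [e]; exact h1.hasFDerivAt) hφ.hasFDerivAt
  have h7 := h6.unique (hlam.hasFDerivAt.congr_of_eventuallyEq (by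
    filter_upwards [hπ.eventually_good hξ hg hp hx] with y hy
    refine (congrArg l ((chartC 3 (π p)).left_inv hy.2.2)).trans ?_
    exact hl _ hy.2.1))
  rw [← h7, h5, ContinuousLinearMap.comp_apply, hπ.fderiv_inCharts_center hξ hg hp]
  rfl

theorem IsTrajectoryManifold.sigmaN_dprojC (hπ : IsTrajectoryManifold g ξ π)
    (hl : Corr₀ g ξ π l (lam g ξ)) (hω : Corr₁ g ξ π ω (twist g η ξ))
    (hp : p ∈ timelikeRegion g ξ) (v : Coords 4) :
    (sigmaN l ω (π p) : Coords 3 →L[ℝ] ℂ) (dprojC π p v) = ernstForm g η ξ p v := by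
  rw [KillingSpacetime.ernstForm_eq hξ hg, ← hπ.mvfderiv_lam hξ hg hl hp, ← corr₁_iff.1 hω p hp]
  rfl

theorem IsTrajectoryManifold.differentiableAt_sigmaN (hπ : IsTrajectoryManifold g ξ π)
    (hη : IsVolumeForm g η)
    (hl : Corr₀ g ξ π l (lam g ξ)) (hω : Corr₁ g ξ π ω (twist g η ξ)) (x : N) :
    DifferentiableAt ℝ (pull1 (sigmaN l ω) x) (coord x) := by
  obtain ⟨p, hp, rfl⟩ := hπ.surjective x
  obtain ⟨s, hs3, hs0, hse⟩ := hπ.exists_section hξ hg hp (mem_extChartAt_source (π p))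
  have hD : DifferentiableAt ℝ (fderiv ℝ s) (coord (π p)) :=
    differentiableAt_fderiv (hs3.of_le (by norm_num))
  have hσ : DifferentiableAt ℝ (fun z => pull1 (ernstForm g η ξ) p (s z)) (coord (π p)) := by
    refine DifferentiableAt.comp (g := pull1 (ernstForm g η ξ) p) (f := s) _ ?_
      (hs3.differentiableAt (by norm_num))
    have e : s (coord (π p)) = coord p := hs0
    rw [e]
    exact differentiableAt_ernstForm hη hξ hg p
  refine (hσ.clm_comp hD).congr_of_eventuallyEq ?_
  filter_upwards [hse] with z hz
  refine ContinuousLinearMap.ext fun w => ?_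
  have h1 := hπ.sigmaN_dprojC hξ hg hl hω hz.1 (dchart p (s z) (fderiv ℝ s z w))
  rw [hz.2.2, hz.2.1] at h1
  exact h1

end Sections

/-! ### The Hessian of the Ernst potential on the space of orbits -/

section Hessian

open Filter

variable {M : Type*} [TopologicalSpace M] [ChartedSpace (EuclideanSpace ℝ (Fin 4)) M]
  [IsManifold 𝓘(ℝ, EuclideanSpace ℝ (Fin 4)) 3 M]
  {g : BilinField 4 M} {η : (p : M) → Tan 4 p [⋀^Fin 4]→ₗ[ℝ] ℝ} {ξ : (p : M) → Tan 4 p} {p : M}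
  {N : Type*} [TopologicalSpace N] [ChartedSpace (EuclideanSpace ℝ (Fin 3)) N]
  [IsManifold 𝓘(ℝ, EuclideanSpace ℝ (Fin 3)) 3 N] {π : M → N}
  {l : N → ℝ} {ω : (x : N) → Tan 3 x →L[ℝ] ℝ} {γ : BilinField 3 N}
  {e : Fin 4 → Coords 4} {r : ℝ}

/-- Replacing partial by covariant derivatives in the Koszul expression, all connection terms but
one cancel. So the connection of `B` differs from that of `g` by a tensor built from `∇B`. -/
theorem chris1_eq_nablaForm₂ (hg : IsLorentzMetric g)
    {B : M → Coords 4 →L[ℝ] Coords 4 →L[ℝ] ℝ} (hB : ∀ p u v, B p u v = B p v u)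
    (p : M) (u v w : Coords 4) :
    chris1 (pull2 B p) (coord p) u v w = B p (conn g p (coord p) u v) w
      + (1 / 2) * (nablaForm₂ g B p u v w + nablaForm₂ g B p v u w - nablaForm₂ g B p w u v) := by
  have hs := hg.isMetric.conn_symm (coord_mem_target (n := 4) p)
  simp only [chris1, nablaForm₂, nabla2, pull2_center]
  rw [hs v u, hs w u, hs w v, hB p v (conn g p (coord p) u w), hB p u (conn g p (coord p) v w)]
  ring

variable (hη : IsVolumeForm g η) (hξ : IsKilling g ξ) (hg : IsLorentzMetric g)

include hη hξ hg

/-- The Hessian of the Ernst potential on the manifold of trajectories. -/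
theorem IsTrajectoryManifold.exists_nablaForm_sigmaN (hπ : IsTrajectoryManifold g ξ π)
    (hl : Corr₀ g ξ π l (lam g ξ)) (hω : Corr₁ g ξ π ω (twist g η ξ))
    (hγ : Corr₂ g ξ π γ (gammaMetric g ξ)) (hp : p ∈ timelikeRegion g ξ) (u v : Coords 4) :
    ∃ X : Coords 4,
      (∀ w, gammaForm g ξ p X w = (1 / 2) * (nablaForm₂ g (gammaForm g ξ) p u v w
        + nablaForm₂ g (gammaForm g ξ) p v u w - nablaForm₂ g (gammaForm g ξ) p w u v)) ∧
      nablaForm γ (sigmaN l ω) (π p) (dprojC π p u) (dprojC π p v)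
        = nablaForm g (ernstForm g η ξ) p u v - ernstForm g η ξ p X := by
  have hγm := hπ.isMetric hξ hg hγ
  have hγ' := corr₂_iff.1 hγ
  have hx : π p ∈ (chartC 3 (π p)).source := mem_extChartAt_source _
  have hy := coord_mem_target (n := 4) p
  set φ := inCharts 4 3 p (π p) π with hφdef
  have hφ0 : φ (coord p) = coord (π p) := by
    simp only [hφdef, inCharts, symm_coord (n := 4) p]
    rfl
  have hφ : ContDiffAt ℝ 2 φ (coord p) :=
    (hπ.contDiffAt_inCharts hξ hg hp hx).of_le (by norm_num)
  have hA : ∀ w, fderiv ℝ φ (coord p) w = dprojC π p w := hπ.fderiv_inCharts_center hξ hg hp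
  have hgood := hπ.eventually_good hξ hg hp hx
  have h1 : ∀ᶠ z in 𝓝 (coord p), pull1 (ernstForm g η ξ) p z
      = (pull1 (sigmaN l ω) (π p) (φ z)).comp (fderiv ℝ φ z) := by
    filter_upwards [hgood] with z hz
    ext w
    have h := hπ.sigmaN_dprojC hξ hg hl hω hz.2.1 (dchart p z w)
    rw [hπ.dprojC_dchart hξ hg hz.1 hz.2.1 hz.2.2] at h
    refine h.symm.trans ?_
    exact congrArg (fun q => (sigmaN l ω q : Coords 3 →L[ℝ] ℂ)
      (dchart (π p) (φ z) (fderiv ℝ φ z w))) ((chartC 3 (π p)).left_inv hz.2.2).symm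
  have h2 : ∀ᶠ z in 𝓝 (coord p), ∀ v w, pull2 (gammaForm g ξ) p z v w
      = pull2 γ (π p) (φ z) (fderiv ℝ φ z v) (fderiv ℝ φ z w) := by
    filter_upwards [hgood] with z hz v w
    have h := hγ' _ hz.2.1 (dchart p z v) (dchart p z w)
    rw [hπ.dprojC_dchart hξ hg hz.1 hz.2.1 hz.2.2, hπ.dprojC_dchart hξ hg hz.1 hz.2.1 hz.2.2] at h
    refine h.symm.trans ?_
    exact congrArg (fun q => bil γ q (dchart (π p) (φ z) (fderiv ℝ φ z v))
      (dchart (π p) (φ z) (fderiv ℝ φ z w))) ((chartC 3 (π p)).left_inv hz.2.2).symm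
  have hσd : DifferentiableAt ℝ (pull1 (sigmaN l ω) (π p)) (φ (coord p)) := by
    rw [hφ0]
    exact hπ.differentiableAt_sigmaN hξ hg hη hl hω (π p)
  have hyN : φ (coord p) ∈ (chartC 3 (π p)).target := by
    rw [hφ0]
    exact coord_mem_target (n := 3) (π p)
  have h3 := fderiv_pullback_one hφ hσd h1 u v
  have hγd : DifferentiableAt ℝ (pull2 (gammaForm g ξ) p) (coord p) :=
    (contDiffAt_gammaForm hξ hg p hy).differentiableAt (by norm_num)
  have h4 := chris1_pullback hφ (hγm.differentiableAt hyN) hγd (hγm.pull_symm _ _) h2 u v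
  have hσ0 : ∀ w, pull1 (sigmaN l ω) (π p) (coord (π p)) (dprojC π p w)
      = ernstForm g η ξ p w := by
    intro w
    have h := hπ.sigmaN_dprojC hξ hg hl hω hp w
    have h' : pull1 (sigmaN l ω) (π p) (coord (π p)) = (sigmaN l ω (π p) : Coords 3 →L[ℝ] ℂ) :=
      pull1_center (sigmaN l ω) (π p)
    rw [h']
    exact h
  rw [hφ0, hA, hA] at h3
  simp only [hφ0, hA] at h4
  -- Here `W` is what `Dφ` would give on a lifted connection; a lift `w'` of it minus the connection
  -- of `g` is the difference vector `X`. It is defined only modulo ξ, since γ is degenerate, but σ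
  -- vanishes on ξ.
  set W := conn γ (π p) (coord (π p)) (dprojC π p u) (dprojC π p v)
    + fderiv ℝ (fderiv ℝ φ) (coord p) u v with hW
  obtain ⟨w', hw'⟩ := hπ.dprojC_surjective hp W
  refine ⟨w' - conn g p (coord p) u v, fun w => ?_, ?_⟩
  · have h5 := chris1_eq_nablaForm₂ hg (fun p => gammaForm_symm (ξ := ξ) hg p) p u v w
    have h6 : gammaForm g ξ p w' w = chris1 (pull2 (gammaForm g ξ) p) (coord p) u v w := by
      rw [h4, ← hγm.isConn (coord_mem_target (n := 3) (π p)), ← add_apply, ← map_add, ← hW, ← hw',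
        ← hγ' p hp, bil_center]
    rw [map_sub, sub_apply, h6, h5]
    ring
  · have h7 : nablaForm γ (sigmaN l ω) (π p) (dprojC π p u) (dprojC π p v)
        = fderiv ℝ (pull1 (sigmaN l ω) (π p)) (coord (π p)) (dprojC π p u) (dprojC π p v)
          - pull1 (sigmaN l ω) (π p) (coord (π p))
            (conn γ (π p) (coord (π p)) (dprojC π p u) (dprojC π p v)) := rfl
    have h8 : nablaForm g (ernstForm g η ξ) p u v
        = fderiv ℝ (pull1 (ernstForm g η ξ) p) (coord p) u v
          - pull1 (ernstForm g η ξ) p (coord p) (conn g p (coord p) u v) := rfl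
    rw [h7, h8, h3, map_sub, ← hσ0 w', hw', hW, map_add, pull1_center]
    ring

/-- Since `σ(e 0) = 0`, only the spatial components of the difference vector matter. They are `λ⁻¹`
times `connShiftF`, and the claim becomes `hessian_frame`. -/
theorem IsAdaptedFrame.nablaForm_sigmaN (h : IsAdaptedFrame g ξ p e r)
    (hπ : IsTrajectoryManifold g ξ π)
    (hl : Corr₀ g ξ π l (lam g ξ)) (hω : Corr₁ g ξ π ω (twist g η ξ))
    (hγ : Corr₂ g ξ π γ (gammaMetric g ξ)) (hp : p ∈ timelikeRegion g ξ) (b a : Fin 4) :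
    nablaForm γ (sigmaN l ω) (π p) (dprojC π p (e b)) (dprojC π p (e a))
      = yF mink (frameVol ((η p e : ℝ) : ℂ)) (timeVec r) (tr3 (frameC e) (Pc g ξ p)) b a
        - (1 / 2) * formSq g η ξ p * (mink b a + ((r : ℂ) ^ 2)⁻¹ * timeVec (-r) b * timeVec (-r) a)
        - 1 / (2 * (r : ℂ) ^ 2) * ernstForm g η ξ p (e b) * ernstForm g η ξ p (e a) := by
  obtain ⟨X, hX, hN⟩ := hπ.exists_nablaForm_sigmaN hη hξ hg hl hω hγ hp (e b) (e a)
  have hr : r ≠ 0 := ne_of_gt h.pos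
  have hlam := h.sq_eq
  have ho : ∀ a b, bil g p (e a) (e b) = if a = b then (if a = 0 then -1 else 1) else 0 :=
    h.orthonormal
  have hfl : ∀ a, flatC g ξ p (e a) = if a = 0 then - r else 0 := h.flat_frame
  have hF : tr2 (frameC e) (Fc g ξ p) = fun i j => ((kF g ξ p (e i) (e j) : ℝ) : ℂ) :=
    Fc_frame hξ hg p
  have hdl : ∀ a, 2 * kF g ξ p (vecC ξ p) (e a) = 2 * r * kF g ξ p (e 0) (e a) := by
    intro a
    rw [h.vec_eq, map_smul, smul_apply, smul_eq_mul]
    ring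
  have hσ : tr1 (frameC e) (ernst g η ξ p) = fun i => ernstForm g η ξ p (e i) :=
    funext fun i => tr1_ernst p e i
  have hσ0 : ernstForm g η ξ p (e 0) = 0 := by
    have h1 := ernstForm_vecC hη hξ hg hp
    rw [h.vec_eq, map_smul] at h1
    exact (smul_eq_zero.1 h1).resolve_left hr
  set dl : Fin 4 → ℂ := fun a => ((2 * kF g ξ p (vecC ξ p) (e a) : ℝ) : ℂ) with hdldef
  -- A spatial frame vector is orthogonal to ξ, so `γ(X, e_i) = r² g(X, e_i)`; the right side of
  -- `hX` is evaluated with `nabla2_gammaForm`.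
  have hXi : ∀ i : Fin 4, i ≠ 0 → ((bil g p (e i) X : ℝ) : ℂ)
      = ((r : ℂ) ^ 2)⁻¹ * connShiftF dl (tr2 (frameC e) (Fc g ξ p)) (timeVec (-r)) b a i := by
    intro i hi
    have h1 := hX (e i)
    rw [gammaForm_apply, hfl i, if_neg hi, mul_zero, add_zero, ← hlam,
      nabla2_gammaForm hξ hg, nabla2_gammaForm hξ hg, nabla2_gammaForm hξ hg] at h1
    have h2 : bil g p (e i) X = bil g p X (e i) := hg.symm p _ _
    have h3 := hξ.kF_anti hg p (e a) (e b)
    have h4 := hξ.kF_anti hg p (e i) (e a)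
    have h5 := hξ.kF_anti hg p (e i) (e b)
    have h6 : r ^ 2 * bil g p (e i) X
        = (1 / 2) * (2 * kF g ξ p (vecC ξ p) (e b) * bil g p (e a) (e i)
          + 2 * kF g ξ p (vecC ξ p) (e a) * bil g p (e b) (e i)
          - 2 * kF g ξ p (vecC ξ p) (e i) * bil g p (e b) (e a))
          + kF g ξ p (e b) (e i) * flatC g ξ p (e a)
          + kF g ξ p (e a) (e i) * flatC g ξ p (e b) := by
      rw [h2, h1, h3, h4, h5]
      ring
    have h7 : ∀ a, timeVec (-r) a = ((flatC g ξ p (e a) : ℝ) : ℂ) := by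
      intro a
      rw [hfl, timeVec]
      split_ifs <;> simp
    have h8 : ∀ a b, mink a b = ((bil g p (e a) (e b) : ℝ) : ℂ) := by
      intro a b
      rw [ho, ← minkR_cast, minkR]
    rw [eq_inv_mul_iff_mul_eq₀ (pow_ne_zero 2 (by exact_mod_cast hr)), connShiftF, hF, h7, h7,
      h8, h8, h8]
    have h9 := congrArg Complex.ofReal h6
    push_cast at h9
    simp only [hdldef]
    push_cast
    linear_combination h9
  have hEX : ernstForm g η ξ p X = ((r : ℂ) ^ 2)⁻¹ *
      (ernstForm g η ξ p (e 1) * connShiftF dl (tr2 (frameC e) (Fc g ξ p)) (timeVec (-r)) b a 1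
      + ernstForm g η ξ p (e 2) * connShiftF dl (tr2 (frameC e) (Fc g ξ p)) (timeVec (-r)) b a 2
      + ernstForm g η ξ p (e 3)
        * connShiftF dl (tr2 (frameC e) (Fc g ξ p)) (timeVec (-r)) b a 3) := by
    conv_lhs => rw [vec_orthonormal h.orthonormal X]
    rw [Fin.sum_univ_four]
    simp only [map_add, map_smul, hσ0, smul_zero, Complex.real_smul]
    simp only [show (1 : Fin 4) ≠ 0 by decide, show (2 : Fin 4) ≠ 0 by decide,
      show (3 : Fin 4) ≠ 0 by decide, if_false, one_mul]
    rw [hXi 1 (by decide), hXi 2 (by decide), hXi 3 (by decide)]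
    ring
  have hfin := hessian_frame (r := (r : ℂ)) (ε := ((η p e : ℝ) : ℂ)) (h.vol_sq hη)
    (by exact_mod_cast hr) (hξ.frame_anti hg p e) (tr3 (frameC e) (Pc g ξ p))
    (h.ernst_frame (η := η)) (dl := dl) (by
      intro a
      rw [hF, hdldef]
      simp only [hdl]
      push_cast
      ring) b a
  rw [hσ] at hfin
  rw [hN, h.nablaForm_ernstForm hη hξ hg, hEX, h.formSq_frame]
  exact hfin

omit hη hξ hg in
-- The arguments are exchanged because `Ẑ_{ij} = D_j σ_i` has the derivative index last, whereas
-- `nablaForm` has it first.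
theorem counterpart₂_zHat (hσ : DifferentiableAt ℝ (pull1 (sigmaN l ω) (π p)) (coord (π p)))
    (a b : Fin 4) : counterpart₂ π (zHat γ l ω) p a b
      = nablaForm γ (sigmaN l ω) (π p) (dprojC π p (stdVec 4 b)) (dprojC π p (stdVec 4 a)) := by
  rw [apply_eq_sum (nablaForm γ (sigmaN l ω) (π p)) (dprojC π p (stdVec 4 b)), sum_apply,
    counterpart₂, Finset.sum_comm]
  refine Finset.sum_congr rfl fun j _ => ?_
  rw [smul_apply, apply_eq_sum _ (dprojC π p (stdVec 4 a)), Finset.smul_sum]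
  refine Finset.sum_congr rfl fun i _ => ?_
  rw [Complex.real_smul, Complex.real_smul, zHat, covDeriv_eq hσ]
  change _ * ((dprojC π p (stdVec 4 a) i : ℝ) : ℂ) * ((dprojC π p (stdVec 4 b) j : ℝ) : ℂ) = _
  rw [mul_assoc, mul_comm]
  rw [mul_comm ((dprojC π p (stdVec 4 a) i : ℝ) : ℂ), mul_assoc]
  rfl

omit hη hξ hg in
theorem tr2_complexBilin (B : Coords 4 →L[ℝ] Coords 4 →L[ℝ] ℂ) (i j : Fin 4) :
    tr2 (frameC e) (fun a b => B (stdVec 4 a) (stdVec 4 b)) i j = B (e i) (e j) := by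
  rw [apply_eq_sum B (e i)]
  simp only [sum_apply, smul_apply]
  have h : ∀ a, B (stdVec 4 a) (e j) = ∑ b, (e j b : ℂ) * B (stdVec 4 a) (stdVec 4 b) := fun a => by
    rw [apply_eq_sum _ (e j)]
    rfl
  simp only [h, Complex.real_smul, tr2, frameC, Finset.mul_sum, mul_assoc]

omit hη in
theorem IsAdaptedFrame.projMetric_frame (h : IsAdaptedFrame g ξ p e r) (i j : Fin 4) :
    tr2 (frameC e) (fun a b => (projMetric g ξ p a b : ℂ)) i j
      = mink i j + ((r : ℂ) ^ 2)⁻¹ * timeVec (-r) i * timeVec (-r) j := by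
  have e1 := tr2_bilin (e := e) (bil g p
    + (lam g ξ p)⁻¹ • (flatC g ξ p).smulRight (flatC g ξ p)) i j
  have ho : bil g p (e i) (e j) = if i = j then (if i = 0 then -1 else 1) else 0 :=
    h.orthonormal i j
  have hfl : ∀ a, flatC g ξ p (e a) = if a = 0 then - r else 0 := h.flat_frame
  have e2 : ∀ u v : Coords 4, (bil g p + (lam g ξ p)⁻¹ • (flatC g ξ p).smulRight (flatC g ξ p)) u v
      = bil g p u v + (lam g ξ p)⁻¹ * flatC g ξ p u * flatC g ξ p v := by
    intro u v
    simp [mul_assoc]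
  have e3 : ∀ a, ((flatC g ξ p (e a) : ℝ) : ℂ) = timeVec (-r) a := by
    intro a
    rw [hfl, timeVec]
    split_ifs <;> simp
  simp only [e2] at e1
  refine e1.trans ?_
  push_cast
  rw [e3, e3, ← h.sq_eq, ho, ← minkR_cast, minkR]
  push_cast
  rfl

/-- The counterpart of the Hessian of the Ernst potential. -/
theorem counterpart₂_zHat_eq (hvac : ∀ (p : M) (a b : Fin 4), ricci g p a b = 0)
    (hπ : IsTrajectoryManifold g ξ π)
    (hl : Corr₀ g ξ π l (lam g ξ)) (hω : Corr₁ g ξ π ω (twist g η ξ))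
    (hγ : Corr₂ g ξ π γ (gammaMetric g ξ)) (hp : p ∈ timelikeRegion g ξ) (a b : Fin 4) :
    counterpart₂ π (zHat γ l ω) p a b
      = tensorY g η ξ p a b - (1 / 2) * formSq g η ξ p * (projMetric g ξ p a b : ℂ)
        - 1 / (2 * (lam g ξ p : ℂ)) * ernst g η ξ p a * ernst g η ξ p b := by
  obtain ⟨e, r, h⟩ := exists_isAdaptedFrame hg hp
  rw [counterpart₂_zHat (hπ.differentiableAt_sigmaN hξ hg hη hl hω (π p))]
  have key : (fun b a => nablaForm γ (sigmaN l ω) (π p) (dprojC π p (stdVec 4 b))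
        (dprojC π p (stdVec 4 a)))
      = fun b a => tensorY g η ξ p b a - (1 / 2) * formSq g η ξ p * (projMetric g ξ p b a : ℂ)
        - 1 / (2 * (lam g ξ p : ℂ)) * ernst g η ξ p b * ernst g η ξ p a := by
    refine tr2_injective h.det_ne_zero ?_
    funext i j
    have e1 := tr2_complexBilin (e := e) ((nablaForm γ (sigmaN l ω) (π p)).bilinearComp
      (dprojC π p) (dprojC π p)) i j
    refine e1.trans ((h.nablaForm_sigmaN hη hξ hg hπ hl hω hγ hp i j).trans ?_)
    have e2 : tr2 (frameC e) (fun b a => tensorY g η ξ p b a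
          - (1 / 2) * formSq g η ξ p * (projMetric g ξ p b a : ℂ)
          - 1 / (2 * (lam g ξ p : ℂ)) * ernst g η ξ p b * ernst g η ξ p a) i j
        = tr2 (frameC e) (tensorY g η ξ p) i j
          - (1 / 2) * formSq g η ξ p
            * tr2 (frameC e) (fun a b => (projMetric g ξ p a b : ℂ)) i j
          - 1 / (2 * (lam g ξ p : ℂ)) * tr1 (frameC e) (ernst g η ξ p) i
            * tr1 (frameC e) (ernst g η ξ p) j := by
      simp only [tr2, tr1, mul_sub, Finset.sum_sub_distrib, Finset.mul_sum, Finset.sum_mul]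
      congr 1
      · congr 1
        exact Finset.sum_congr rfl fun _ _ => Finset.sum_congr rfl fun _ _ => by ring
      · rw [Finset.sum_comm]
        exact Finset.sum_congr rfl fun _ _ => Finset.sum_congr rfl fun _ _ => by ring
    rw [e2, h.tensorY_frame hvac, h.projMetric_frame hξ hg, tr1_ernst, tr1_ernst, ← h.sq_eq]
    push_cast
    rfl
  refine (congrFun (congrFun key b) a).trans ?_
  -- The formula was obtained with the derivative index first; symmetry of `Y` and `h` permits the
  -- exchange.
  rw [tensorY_symm hη hξ hg hvac hp, projMetric_symm hg]
  ring

end Hessian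

/-! ### The Jacobian of the projection and the inverse quotient metric -/

section SimonTensor

variable {M : Type*} [TopologicalSpace M] [ChartedSpace (EuclideanSpace ℝ (Fin 4)) M]
  [IsManifold 𝓘(ℝ, EuclideanSpace ℝ (Fin 4)) 3 M]
  {g : BilinField 4 M} {η : (p : M) → Tan 4 p [⋀^Fin 4]→ₗ[ℝ] ℝ} {ξ : (p : M) → Tan 4 p} {p : M}
  {N : Type*} [TopologicalSpace N] [ChartedSpace (EuclideanSpace ℝ (Fin 3)) N]
  [IsManifold 𝓘(ℝ, EuclideanSpace ℝ (Fin 3)) 3 N] {π : M → N}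
  {l : N → ℝ} {ω : (x : N) → Tan 3 x →L[ℝ] ℝ} {γ : BilinField 3 N}

/-- The Jacobian matrix of `π`. -/
def jacMat (π : M → N) (p : M) : Matrix (Fin 3) (Fin 4) ℝ := Matrix.of (jac π p)

theorem dprojC_apply (π : M → N) (p : M) (v : Coords 4) (i : Fin 3) :
    dprojC π p v i = ∑ a, jac π p i a * v a := by
  have h := congrArg (fun w : Coords 3 => w i) (apply_eq_sum (dprojC π p) v)
  refine h.trans ?_
  simp only [PiLp.smul_apply, WithLp.ofLp_sum, Finset.sum_apply, smul_eq_mul]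
  exact Finset.sum_congr rfl fun a _ => mul_comm _ _

theorem exists_jacMat_mul_eq_one (hs : Function.Surjective (dprojC π p)) :
    ∃ R : Matrix (Fin 4) (Fin 3) ℝ, jacMat π p * R = 1 := by
  obtain ⟨R, hR⟩ := exists_rightInverse hs
  refine ⟨Matrix.of fun a i => R (stdVec 3 i) a, ?_⟩
  ext i j
  rw [Matrix.mul_apply, Matrix.one_apply]
  have h := dprojC_apply π p (R (stdVec 3 j)) i
  rw [hR, stdVec_apply] at h
  exact h.symm

variable (hξ : IsKilling g ξ) (hg : IsLorentzMetric g)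

include hξ hg

theorem jacMat_transpose_mul (hγ : Corr₂ g ξ π γ (gammaMetric g ξ))
    (hp : p ∈ timelikeRegion g ξ) :
    (jacMat π p).transpose * gdn γ (π p) * jacMat π p = Matrix.of (gammaMetric g ξ p) := by
  ext a b
  have h : bil γ (π p) (dprojC π p (stdVec 4 a)) (dprojC π p (stdVec 4 b))
      = gammaMetric g ξ p a b := hγ p hp a b
  rw [Matrix.of_apply, ← h, apply_eq_sum (bil γ (π p)), sum_apply]
  simp only [Matrix.mul_apply, Finset.sum_mul]
  rw [Finset.sum_comm]
  refine Finset.sum_congr rfl fun i _ => ?_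
  rw [smul_apply, apply_eq_sum (bil γ (π p) (stdVec 3 i)), Finset.smul_sum]
  refine Finset.sum_congr rfl fun j _ => ?_
  change jac π p i a * bil γ (π p) (stdVec 3 i) (stdVec 3 j) * jac π p j b
    = jac π p i a * (jac π p j b * bil γ (π p) (stdVec 3 i) (stdVec 3 j))
  ring

/-- With one index raised γ is `λ 1 + ξ ⊗ ξ_α`, and the Jacobian annihilates ξ. -/
theorem IsTrajectoryManifold.jacMat_mul_gup_mul_gammaMetric (hπ : IsTrajectoryManifold g ξ π)
    (hp : p ∈ timelikeRegion g ξ) :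
    jacMat π p * gup g p * Matrix.of (gammaMetric g ξ p) = lam g ξ p • jacMat π p := by
  have h1 : Matrix.of (gammaMetric g ξ p)
      = lam g ξ p • gdn g p + Matrix.vecMulVec (xiDn g ξ p) (xiDn g ξ p) := by
    ext a b
    rfl
  have h2 : (gup g p).mulVec (xiDn g ξ p) = comp (ξ p) := funext fun a => gup_xiDn hg p a
  have h3 : (jacMat π p).mulVec (comp (ξ p)) = 0 := by
    funext i
    have h4 := congrArg (fun w : Coords 3 => w i) (hπ.dprojC_vecC hξ hg hp)
    exact (dprojC_apply π p (vecC ξ p) i).symm.trans h4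
  rw [h1, Matrix.mul_add, Matrix.mul_assoc, Matrix.mul_assoc, Matrix.mul_smul, gup_mul_gdn hg,
    Matrix.mul_smul, Matrix.mul_one, Matrix.mul_vecMulVec, Matrix.mul_vecMulVec, h2, h3,
    Matrix.zero_vecMulVec, add_zero]

/-- The inverse metric on the manifold of trajectories. -/
theorem IsTrajectoryManifold.gup_eq (hπ : IsTrajectoryManifold g ξ π)
    (hγ : Corr₂ g ξ π γ (gammaMetric g ξ)) (hp : p ∈ timelikeRegion g ξ) (i j : Fin 3) :
    gup γ (π p) i j = (lam g ξ p)⁻¹ * ∑ a, ∑ b, gup g p a b * jac π p i a * jac π p j b := by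
  have hl : lam g ξ p ≠ 0 := ne_of_gt hp
  obtain ⟨R, hR⟩ := exists_jacMat_mul_eq_one (hπ.dprojC_surjective hp)
  set J := jacMat π p
  have h1 : J * gup g p * J.transpose * gdn γ (π p) = lam g ξ p • (1 : Matrix (Fin 3) (Fin 3) ℝ) := by
    have h2 : J * gup g p * J.transpose * gdn γ (π p) * J = lam g ξ p • J := by
      rw [← hπ.jacMat_mul_gup_mul_gammaMetric hξ hg hp, ← jacMat_transpose_mul hξ hg hγ hp]
      simp only [Matrix.mul_assoc, J]
    -- The Jacobian has a right inverse because π is a submersion, so it can be cancelled on the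
    -- right; this exhibits the inverse of the quotient metric.
    have h3 := congrArg (fun A => A * R) h2
    simpa only [Matrix.mul_assoc, Matrix.smul_mul, hR, Matrix.mul_one] using h3
  have h4 : gup γ (π p) = (lam g ξ p)⁻¹ • (J * gup g p * J.transpose) := by
    refine Matrix.inv_eq_left_inv ?_
    rw [Matrix.smul_mul, h1, smul_smul, inv_mul_cancel₀ hl, one_smul]
  rw [h4, Matrix.smul_apply, smul_eq_mul]
  congr 1
  simp only [Matrix.mul_apply, Finset.sum_mul]
  rw [Finset.sum_comm]
  refine Finset.sum_congr rfl fun a _ => Finset.sum_congr rfl fun b _ => ?_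
  change jac π p i a * gup g p a b * jac π p j b = _
  ring

end SimonTensor

/-! ### Contractions and pull-back of components -/

section Counterparts

/-- Components of the pull-back of a one-form. -/
def pb1 (J : Fin 3 → Fin 4 → ℂ) (w : Fin 3 → ℂ) (a : Fin 4) : ℂ := ∑ i, w i * J i a

/-- Components of the pull-back of a rank-two tensor. -/
def pb2 (J : Fin 3 → Fin 4 → ℂ) (T : Fin 3 → Fin 3 → ℂ) (a b : Fin 4) : ℂ :=
  ∑ i, ∑ j, T i j * J i a * J j b

theorem pb2_eq (J : Fin 3 → Fin 4 → ℂ) (T : Fin 3 → Fin 3 → ℂ) (a b : Fin 4) :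
    pb2 J T a b = ∑ i, pb1 J (T i) b * J i a := by
  simp only [pb2, pb1, Finset.sum_mul]
  exact Finset.sum_congr rfl fun i _ => Finset.sum_congr rfl fun j _ => by ring

theorem sum_pb2 {J : Fin 3 → Fin 4 → ℂ} {G : Fin 3 → Fin 3 → ℂ} {H : Fin 4 → Fin 4 → ℂ} {k : ℂ}
    (hG : ∀ i j, G i j = k * ∑ a, ∑ b, H a b * J i a * J j b) (T : Fin 3 → Fin 3 → ℂ) :
    ∑ i, ∑ j, G i j * T i j = k * ∑ a, ∑ b, H a b * pb2 J T a b := by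
  have h1 : ∀ i j, G i j * T i j = ∑ a, ∑ b, k * (H a b * (T i j * J i a * J j b)) := by
    intro i j
    rw [hG]
    simp only [Finset.mul_sum, Finset.sum_mul]
    exact Finset.sum_congr rfl fun a _ => Finset.sum_congr rfl fun b _ => by ring
  simp only [h1, pb2, Finset.mul_sum]
  rw [Finset.sum_congr rfl fun i _ => Finset.sum_comm, Finset.sum_comm]
  refine Finset.sum_congr rfl fun a _ => ?_
  rw [Finset.sum_congr rfl fun i _ => Finset.sum_comm, Finset.sum_comm]

theorem sum_pb2_contr {J : Fin 3 → Fin 4 → ℂ} {G : Fin 3 → Fin 3 → ℂ} {H : Fin 4 → Fin 4 → ℂ}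
    {k : ℂ} (hG : ∀ i j, G i j = k * ∑ a, ∑ b, H a b * J i a * J j b) (w : Fin 3 → ℂ)
    (T : Fin 3 → Fin 3 → ℂ) (c : Fin 4) :
    pb1 J (fun m => ∑ i, ∑ j, G i j * (w j * T i m)) c
      = k * ∑ a, ∑ b, H a b * pb1 J w b * pb2 J T a c := by
  have h := sum_pb2 hG (fun i j => w j * pb1 J (T i) c)
  have h1 : ∀ a b, pb2 J (fun i j => w j * pb1 J (T i) c) a b = pb1 J w b * pb2 J T a c := by
    intro a b
    rw [pb2_eq J T, Finset.mul_sum]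
    simp only [pb2, pb1, Finset.sum_mul]
    refine Finset.sum_congr rfl fun i _ => ?_
    rw [Finset.sum_congr rfl fun j _ => by rw [Finset.mul_sum, Finset.sum_mul, Finset.sum_mul]]
    refine Finset.sum_congr rfl fun j _ => ?_
    rw [Finset.mul_sum]
    exact Finset.sum_congr rfl fun m _ => by ring
  simp only [h1, ← mul_assoc] at h
  simp only [← mul_assoc] at h ⊢
  rw [← h]
  simp only [pb1, Finset.sum_mul, Finset.mul_sum]
  rw [Finset.sum_comm]
  refine Finset.sum_congr rfl fun i _ => ?_
  rw [Finset.sum_comm]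
  exact Finset.sum_congr rfl fun j _ => Finset.sum_congr rfl fun m _ => by ring

/-- The pull-back of a tensor that has the structure of Simon's tensor. -/
theorem pullback_simon (J : Fin 3 → Fin 4 → ℂ) (w u : Fin 3 → ℂ) (Z G : Fin 3 → Fin 3 → ℂ)
    (a b c : Fin 4) :
    ∑ i, ∑ j, ∑ k, (w k * Z i j - w j * Z i k - (u k * G j i - u j * G k i))
        * J i a * J j b * J k c
      = pb1 J w c * pb2 J Z a b - pb1 J w b * pb2 J Z a c
        - (pb1 J u c * pb2 J G b a - pb1 J u b * pb2 J G c a) := by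
  simp only [pb1, pb2, Fin.sum_univ_three]
  ring

end Counterparts

/-! ### The spacetime counterpart of Simon's tensor -/

section SimonPullback

variable {M : Type*} [TopologicalSpace M] [ChartedSpace (EuclideanSpace ℝ (Fin 4)) M]
  [IsManifold 𝓘(ℝ, EuclideanSpace ℝ (Fin 4)) 3 M]
  {g : BilinField 4 M} {η : (p : M) → Tan 4 p [⋀^Fin 4]→ₗ[ℝ] ℝ} {ξ : (p : M) → Tan 4 p} {p : M}
  {N : Type*} [TopologicalSpace N] [ChartedSpace (EuclideanSpace ℝ (Fin 3)) N]
  [IsManifold 𝓘(ℝ, EuclideanSpace ℝ (Fin 3)) 3 N] {π : M → N}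
  {l : N → ℝ} {ω : (x : N) → Tan 3 x →L[ℝ] ℝ} {γ : BilinField 3 N}

theorem simon_eq (x : N) (i j k : Fin 3) :
    simon γ l ω x i j k
      = sigmaN l ω x (frame x k) * zHat γ l ω x i j - sigmaN l ω x (frame x j) * zHat γ l ω x i k
        - (simonU γ l ω x k * (gdn γ x j i : ℂ) - simonU γ l ω x j * (gdn γ x k i : ℂ)) := by
  rw [simon, sigmaD, zHat, zHat]
  ring

/-- In this form `u` is half the bracket `Z σ_k − σ^m Z_{mk}` of the map `U`, formed with the
inverse of γ and `Z = Ẑ`. -/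
theorem simonU_eq (x : N) (k : Fin 3) :
    simonU γ l ω x k
      = (1 / 2) * ((∑ i, ∑ j, (gup γ x i j : ℂ) * zHat γ l ω x i j) * sigmaN l ω x (frame x k)
        - ∑ i, ∑ j, (gup γ x i j : ℂ) * (sigmaN l ω x (frame x j) * zHat γ l ω x i k)) := by
  simp only [simonU, Finset.sum_mul, ← Finset.sum_sub_distrib, Finset.mul_sum]
  refine Finset.sum_congr rfl fun i _ => Finset.sum_congr rfl fun j _ => ?_
  rw [sigmaD, zHat, zHat]
  ring

variable (hη : IsVolumeForm g η) (hξ : IsKilling g ξ) (hg : IsLorentzMetric g)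

include hη hξ hg

/-- The counterpart of Simon's tensor. -/
theorem counterpart₃_simon_eq (hvac : ∀ (p : M) (a b : Fin 4), ricci g p a b = 0)
    (hπ : IsTrajectoryManifold g ξ π)
    (hl : Corr₀ g ξ π l (lam g ξ)) (hω : Corr₁ g ξ π ω (twist g η ξ))
    (hγ : Corr₂ g ξ π γ (gammaMetric g ξ)) (hp : p ∈ timelikeRegion g ξ) (a b c : Fin 4) :
    counterpart₃ π (simon γ l ω) p a b c = spacetimeSimon g η ξ p a b c := by
  have hlam : (lam g ξ p : ℂ) ≠ 0 := by exact_mod_cast ne_of_gt hp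
  set J : Fin 3 → Fin 4 → ℂ := fun i a => (jac π p i a : ℂ) with hJ
  set Z : Fin 4 → Fin 4 → ℂ := fun a b => tensorY g η ξ p a b + singularPart g η ξ p a b with hZdef
  set w : Fin 3 → ℂ := fun k => sigmaN l ω (π p) (frame (π p) k) with hwdef
  have hZ : pb2 J (zHat γ l ω (π p)) = Z := by
    funext a b
    refine (counterpart₂_zHat_eq hη hξ hg hvac hπ hl hω hγ hp a b).trans ?_
    simp only [hZdef, singularPart]
    ring
  have hw : pb1 J w = ernst g η ξ p := by
    funext a
    rw [← ernstForm_stdVec, ← hπ.sigmaN_dprojC hξ hg hl hω hp]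
    refine Eq.trans ?_ (apply_eq_sum (sigmaN l ω (π p) : Coords 3 →L[ℝ] ℂ) _).symm
    refine Finset.sum_congr rfl fun i _ => ?_
    rw [Complex.real_smul, mul_comm]
    rfl
  have hG : pb2 J (fun i j => (gdn γ (π p) i j : ℂ)) = fun a b => (gammaMetric g ξ p a b : ℂ) := by
    funext a b
    have h := congrFun (congrFun (jacMat_transpose_mul hξ hg hγ hp) a) b
    rw [Matrix.of_apply] at h
    rw [← h]
    simp only [Matrix.mul_apply, Finset.sum_mul, Matrix.transpose_apply, jacMat, Matrix.of_apply]
    rw [Finset.sum_comm, pb2]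
    push_cast
    exact Finset.sum_congr rfl fun i _ => Finset.sum_congr rfl fun j _ => by rw [hJ]; ring
  have hup : ∀ i j, (gup γ (π p) i j : ℂ)
      = (lam g ξ p : ℂ)⁻¹ * ∑ a, ∑ b, (gup g p a b : ℂ) * J i a * J j b := by
    intro i j
    rw [hπ.gup_eq hξ hg hγ hp]
    push_cast
    rfl
  have hu : pb1 J (simonU γ l ω (π p)) = fun c => (1 / 2) * (lam g ξ p : ℂ)⁻¹
      * (trace g p Z * ernst g η ξ p c - sigmaContr g η ξ p Z c) := by
    funext c
    have h1 := sum_pb2 hup (zHat γ l ω (π p))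
    have h2 := sum_pb2_contr hup w (zHat γ l ω (π p)) c
    rw [hZ] at h1 h2
    rw [hw] at h2
    have h3 : pb1 J (simonU γ l ω (π p)) c
        = (1 / 2) * ((∑ i, ∑ j, (gup γ (π p) i j : ℂ) * zHat γ l ω (π p) i j) * pb1 J w c
          - pb1 J (fun m => ∑ i, ∑ j, (gup γ (π p) i j : ℂ)
            * (w j * zHat γ l ω (π p) i m)) c) := by
      simp only [pb1, simonU_eq, Finset.mul_sum, mul_sub, sub_mul, Finset.sum_sub_distrib]
      congr 1
      · exact Finset.sum_congr rfl fun _ _ => by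
          simp only [Finset.sum_mul, Finset.mul_sum, mul_assoc, hwdef]
      · exact Finset.sum_congr rfl fun _ _ => by
          simp only [Finset.sum_mul, Finset.mul_sum, mul_assoc, hwdef]
    rw [h3, h1, h2, hw, trace, sigmaContr]
    ring
  -- The powers of λ compensate: the inverse quotient metric in `u` gives `λ⁻¹`, and the factor γ
  -- that multiplies `u` is `λ h`. What results is the map `U` on spacetime.
  have hS : counterpart₃ π (simon γ l ω) p a b c = mapU g η ξ p Z a b c := by
    rw [counterpart₃]
    simp only [simon_eq]
    refine (pullback_simon J w (simonU γ l ω (π p)) (zHat γ l ω (π p))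
      (fun i j => (gdn γ (π p) i j : ℂ)) a b c).trans ?_
    rw [hw, hZ, hu, hG, mapU, projMetric_symm hg p a b, projMetric_symm hg p a c]
    simp only [gammaMetric_eq_lam_mul hη hξ hg hp]
    push_cast
    field_simp
    ring
  rw [hS, hZdef, mapU_singularPart_aux hη hξ hg hp, mapU_tensorY hη hξ hg hvac hp]

end SimonPullback

end KillingSpacetime

end

theorem lemma3
    {M : Type*} [TopologicalSpace M] [T2Space M] [ParacompactSpace M] [ConnectedSpace M]
    [ChartedSpace (EuclideanSpace ℝ (Fin 4)) M] [IsManifold 𝓘(ℝ, EuclideanSpace ℝ (Fin 4)) 3 M]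
    (g : BilinField 4 M) (hg : IsLorentzMetric g)
    (η : (p : M) → Tan 4 p [⋀^Fin 4]→ₗ[ℝ] ℝ) (hη : IsVolumeForm g η)
    (hvac : ∀ (p : M) (a b : Fin 4), ricci g p a b = 0)
    (ξ : (p : M) → Tan 4 p) (hξ : IsKilling g ξ) :
    -- the singular part lies in the kernel of `U`, and `U(Y)` is the spacetime Simon tensor
    (∀ p ∈ timelikeRegion g ξ,
      SymOrth ξ p (fun a b => (projMetric g ξ p a b : ℂ)) ∧
      SymOrth ξ p (fun a b => ernst g η ξ p a * ernst g η ξ p b) ∧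
      SymOrth ξ p (singularPart g η ξ p) ∧
      SymOrth ξ p (tensorY g η ξ p) ∧
      trace g p (tensorY g η ξ p) = 0 ∧
      (∀ Z : Fin 4 → Fin 4 → ℂ, SymOrth ξ p Z → ∀ s₁ s₂ : ℂ,
        mapU g η ξ p (fun a b => Z a b + s₁ * (projMetric g ξ p a b : ℂ)
          + s₂ * ernst g η ξ p a * ernst g η ξ p b) = mapU g η ξ p Z) ∧
      mapU g η ξ p (singularPart g η ξ p) = 0 ∧
      mapU g η ξ p (fun a b => tensorY g η ξ p a b + singularPart g η ξ p a b)
        = mapU g η ξ p (tensorY g η ξ p) ∧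
      mapU g η ξ p (tensorY g η ξ p) = spacetimeSimon g η ξ p) ∧
    -- the spacetime Simon tensor is regular on the whole spacetime
    IsContinuousTensor₃ (spacetimeSimon g η ξ) ∧
    -- the counterparts of `Ẑ` and of Simon's tensor on the manifold of trajectories
    ∀ {N : Type*} [TopologicalSpace N] [ChartedSpace (EuclideanSpace ℝ (Fin 3)) N]
      [IsManifold 𝓘(ℝ, EuclideanSpace ℝ (Fin 3)) 3 N] (π : M → N),
      IsTrajectoryManifold g ξ π →
      (∃! l : N → ℝ, Corr₀ g ξ π l (lam g ξ)) ∧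
      (∃! ω : (x : N) → Tan 3 x →L[ℝ] ℝ, Corr₁ g ξ π ω (twist g η ξ)) ∧
      (∃! γ : BilinField 3 N, Corr₂ g ξ π γ (gammaMetric g ξ)) ∧
      ∀ (l : N → ℝ) (ω : (x : N) → Tan 3 x →L[ℝ] ℝ) (γ : BilinField 3 N),
        Corr₀ g ξ π l (lam g ξ) → Corr₁ g ξ π ω (twist g η ξ) →
        Corr₂ g ξ π γ (gammaMetric g ξ) →
        ∀ p ∈ timelikeRegion g ξ,
          (∀ a b, counterpart₂ π (zHat γ l ω) p a b
            = tensorY g η ξ p a b - (1 / 2) * formSq g η ξ p * (projMetric g ξ p a b : ℂ)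
              - 1 / (2 * (lam g ξ p : ℂ)) * ernst g η ξ p a * ernst g η ξ p b) ∧
          ∀ a b c, counterpart₃ π (simon γ l ω) p a b c = spacetimeSimon g η ξ p a b c := by
  refine ⟨fun p hp => ⟨symOrth_projMetric hη hξ hg hp, symOrth_ernst hη hξ hg hp,
    symOrth_singularPart hη hξ hg hp,
    ⟨tensorY_symm hη hξ hg hvac hp, tensorY_orth hη hξ hg hvac hp⟩,
    tensorY_trace hη hξ hg hvac hp, fun Z _ s₁ s₂ => mapU_add hη hξ hg hp Z s₁ s₂,
    mapU_singularPart hη hξ hg hp, mapU_singularPart_aux hη hξ hg hp _,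
    mapU_tensorY hη hξ hg hvac hp⟩,
    isContinuousTensor₃_spacetimeSimon hη hξ hg hvac, ?_⟩
  intro N _ _ _ π hπ
  exact ⟨hπ.existsUnique_corr₀ hξ hg, hπ.existsUnique_corr₁ hξ hg hη hvac,
    hπ.existsUnique_corr₂ hξ hg, fun l ω γ hl hω hγ p hp =>
      ⟨counterpart₂_zHat_eq hη hξ hg hvac hπ hl hω hγ hp,
        counterpart₃_simon_eq hη hξ hg hvac hπ hl hω hγ hp⟩⟩
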